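/- Notation, for functions on $\mathbb{R}^3$. Put $$|||v|||=\sup_{R>0}\Big(\frac1R\int_{|x|\le R}|v|^2dx\Big)^{1/2},\qquad N(f)=\sum_{j\in\mathbb{Z}}\Big(2^{j+1}\int_{2^{j-1}\le|x|\le 2^j}|f|^2dx\Big)^{1/2}.$$ For $A:\mathbb{R}^3\to\mathbb{R}^3$ with $A_j\in L^2_{loc}$ let $\nabla_A=\nabla+iA$, let $H^1_A(\mathbb{R}^3)$ be the space of $u\in L^2$ with $(\partial_j+iA_j)u\in L^2$ for $j=1,2,3$, and let $|\nabla_A^{\perp}u|^2=|\nabla_Au|^2-\big|\tfrac{x}{|x|}\cdot\nabla_Au\big|^2$. The magnetic field is the matrix $B_{kj}=\partial_{x_j}A_k-\partial_{x_k}A_j$ (in the sense of distributions on $\mathbb{R}^3\setminus\{0\}$, assumed to be a locally integrable function there), and its tangential component is $(B_\tau)_j=\sum_k\frac{x_k}{|x|}B_{kj}$. For real $V_1$, $(\partial_rV_1)_-$ is the negative part of the distributional radial derivative $\partial_rV_1$ on $\mathbb{R}^3\setminus\{0\}$, assumed to be a function. Theorem. Let $r_0\ge1$ and $\mu,c,\alpha>0$.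 There are $\lambda_1>0$ and $C>0$, depending only on $r_0,\mu,c,\alpha$, such that the following holds. Let $A_j\in L^2_{loc}(\mathbb{R}^3)$ and let $V_1,V_2$ be real measurable functions on $\mathbb{R}^3$ such that, for almost every $x$, $$\frac{|V_1|}{|x|}+(\partial_rV_1)_-+|B_\tau|+|V_2|\le\frac{c}{|x|^{1+\mu}}\quad\text{if }|x|\ge r_0,$$ $$V_1=(\partial_rV_1)_-=0,\qquad |V_2|\le\frac{c}{|x|^{2-\alpha}},\qquad |B_\tau|\le\frac{c}{|x|^{2-\alpha}}\quad\text{if }|x|\le r_0 .$$ Let $\lambda\ge\lambda_1$, let $\varepsilon>0$, let $f$ be measurable with $N(f)<\infty$, and let $u\in H^1_A(\mathbb{R}^3)$ be a solution (in the sense of distributions) of $$(\nabla+iA)^2u+V_1u+V_2u+\lambda u+i\varepsilon u=f\quad\text{in }\mathbb{R}^3.$$ Then $$\lambda|||u|||^2+|||\nabla_Au|||^2+\int_{\mathbb{R}^3}\frac{|\nabla_A^{\perp}u|^2}{|x|}dx+\sup_{R>0}\frac1{R^2}\int_{|x|=R}|u|^2d\sigma_R\le C(1+\varepsilon)\,N(f)^2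 .$$ In particular $C$ does not depend on $\varepsilon$, $\lambda$, $f$ or $u$. -/

import Mathlib

open MeasureTheory Set
open scoped ENNReal

noncomputable section

namespace MagneticHelmholtz

/-- Three-dimensional Euclidean space. -/
abbrev E3 : Type := EuclideanSpace ℝ (Fin 3)

/-- The space `ℂ³` with its Euclidean norm, where magnetic gradients take their values. -/
abbrev C3 : Type := EuclideanSpace ℂ (Fin 3)

/-- The partial derivative `∂φ/∂x_j` of a differentiable function. -/
def partialD {F : Type*} [NormedAddCommGroup F] [NormedSpace ℝ F]
    (j : Fin 3) (φ : E3 → F) (x : E3) : F :=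
  fderiv ℝ φ x (EuclideanSpace.single j (1 : ℝ))

/-- Test functions on `ℝ³`: smooth and compactly supported. -/
structure IsTest {F : Type*} [NormedAddCommGroup F] [NormedSpace ℝ F] (φ : E3 → F) : Prop where
  smooth : ContDiff ℝ ((⊤ : ℕ∞) : WithTop ℕ∞) φ
  compact : HasCompactSupport φ

/-! ### The potentials -/

/-- `A ∈ L²_loc(ℝ³; ℝ³)`. -/
structure MemL2loc (A : E3 → E3) : Prop where
  aesm : AEStronglyMeasurable A volume
  locInt : LocallyIntegrable (fun x => ‖A x‖ ^ 2) volume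

/-- The matrix field `B` is the magnetic field of `A`, that is
`B_{kj} = ∂A_k/∂x_j - ∂A_j/∂x_k` in the sense of distributions on `ℝ³ ∖ {0}`
(the point at which singularities are allowed). -/
structure IsMagneticField (A : E3 → E3) (B : E3 → Matrix (Fin 3) (Fin 3) ℝ) : Prop where
  locInt : ∀ k j, LocallyIntegrableOn (fun x => B x k j) {(0 : E3)}ᶜ volume
  weak : ∀ k j, ∀ φ : E3 → ℝ, IsTest φ → (0 : E3) ∉ tsupport φ →
    ∫ x, B x k j * φ x = ∫ x, (A x j * partialD k φ x - A x k * partialD j φ x)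

/-- The tangential (trapping) component of `B`: `(B_τ)_j = ∑_k (x_k / |x|) B_{kj}`. -/
def tangentialField (B : E3 → Matrix (Fin 3) (Fin 3) ℝ) (x : E3) : E3 :=
  WithLp.toLp 2 (fun j => ∑ k, x k / ‖x‖ * B x k j)

/-- The divergence of the vector field `φ(x) x/|x|`; the distribution `∂_r V` acts on `φ` by
`⟨∂_r V, φ⟩ = - ∫ V div(φ x/|x|)`. -/
def radialDiv (φ : E3 → ℝ) (x : E3) : ℝ :=
  ∑ j, partialD j (fun y => φ y * (y j / ‖y‖)) x

/-- The distributional radial derivative `∂_r V` on `ℝ³ ∖ {0}` has negative part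
`(∂_r V)_- ≤ q`: the distribution `∂_r V + q` is nonnegative, so that it is a positive measure
and `∂_r V` is a signed measure whose negative part has a density that is at most `q`. -/
def RadialDerivNegPartLE (V q : E3 → ℝ) : Prop :=
  ∀ φ : E3 → ℝ, IsTest φ → (0 : E3) ∉ tsupport φ → (∀ x, 0 ≤ φ x) →
    0 ≤ -(∫ x, V x * radialDiv φ x) + ∫ x, q x * φ x

/-- The assumptions on the potentials; `q` is the (bound of the) negative part `(∂_r V₁)_-`. -/
structure Admissible (r₀ μ c α : ℝ) (A : E3 → E3) (B : E3 → Matrix (Fin 3) (Fin 3) ℝ)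
    (V₁ V₂ q : E3 → ℝ) : Prop where
  memL2loc : MemL2loc A
  field : IsMagneticField A B
  aesm_V₁ : AEStronglyMeasurable V₁ volume
  aesm_V₂ : AEStronglyMeasurable V₂ volume
  aesm_q : AEStronglyMeasurable q volume
  q_nonneg : ∀ x, 0 ≤ q x
  negPart : RadialDerivNegPartLE V₁ q
  far : ∀ᵐ x : E3, r₀ ≤ ‖x‖ →
    |V₁ x| / ‖x‖ + q x + ‖tangentialField B x‖ + |V₂ x| ≤ c / ‖x‖ ^ (1 + μ)
  near_V₁ : ∀ᵐ x : E3, ‖x‖ ≤ r₀ → V₁ x = 0 ∧ q x = 0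
  near_V₂ : ∀ᵐ x : E3, ‖x‖ ≤ r₀ → |V₂ x| ≤ c / ‖x‖ ^ (2 - α)
  near_B : ∀ᵐ x : E3, ‖x‖ ≤ r₀ → ‖tangentialField B x‖ ≤ c / ‖x‖ ^ (2 - α)

/-! ### The magnetic Sobolev space and the equation -/

/-- `u ∈ H¹_A(ℝ³)` with magnetic gradient `g = ∇_A u = (∇ + iA)u`: `u` and `g` are square
integrable and `∂_j u + i A_j u = g_j` in the sense of distributions on `ℝ³`. -/
structure IsH1A (A : E3 → E3) (u : E3 → ℂ) (g : E3 → C3) : Prop where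
  memLp : MemLp u 2 volume
  memLp_grad : MemLp g 2 volume
  weak : ∀ j, ∀ φ : E3 → ℂ, IsTest φ →
    ∫ x, g x j * φ x =
      ∫ x, (-(u x * partialD j φ x) + Complex.I * (A x j : ℂ) * u x * φ x)

/-- The function `u`, with magnetic gradient `g = ∇_A u`, solves
`(∇ + iA)² u + V₁ u + V₂ u + λ u + iε u = f` in the sense of distributions on `ℝ³`. -/
def SolvesHelmholtz (A : E3 → E3) (V₁ V₂ : E3 → ℝ) (lam ε : ℝ) (f u : E3 → ℂ)
    (g : E3 → C3) : Prop :=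
  ∀ φ : E3 → ℂ, IsTest φ →
    ∫ x, (-(∑ j, g x j * (partialD j φ x - Complex.I * (A x j : ℂ) * φ x))
        + ((V₁ x : ℂ) + (V₂ x : ℂ) + (lam : ℂ) + Complex.I * (ε : ℂ)) * u x * φ x)
      = ∫ x, f x * φ x

/-! ### The norms, with values in `[0, ∞]` -/

/-- The Morrey–Campanato norm `|||v||| = sup_{R>0} ((1/R) ∫_{|x| ≤ R} |v|²)^{1/2}`. -/
def morreyNorm {F : Type*} [NormedAddCommGroup F] (v : E3 → F) : ℝ≥0∞ :=
  ⨆ (R : ℝ) (_ : 0 < R),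
    ((∫⁻ x in {x : E3 | ‖x‖ ≤ R}, ‖v x‖ₑ ^ 2) / ENNReal.ofReal R) ^ (1 / 2 : ℝ)

/-- The dyadic shell `C(j) = {2^{j-1} ≤ |x| ≤ 2^j}`. -/
def shell (j : ℤ) : Set E3 := {x | (2 : ℝ) ^ (j - 1) ≤ ‖x‖ ∧ ‖x‖ ≤ (2 : ℝ) ^ j}

/-- The dual norm `N(f) = ∑_{j ∈ ℤ} (2^{j+1} ∫_{C(j)} |f|²)^{1/2}`. -/
def dualNorm (f : E3 → ℂ) : ℝ≥0∞ :=
  ∑' j : ℤ, (ENNReal.ofReal ((2 : ℝ) ^ (j + 1)) * ∫⁻ x in shell j, ‖f x‖ₑ ^ 2) ^ (1 / 2 : ℝ)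

/-- The squared length of the tangential part of the gradient,
`|∇_A^⊥ u|² = |∇_A u|² - |(x/|x|) · ∇_A u|²`, for `g = ∇_A u`. -/
def tangentialSq (g : E3 → C3) (x : E3) : ℝ :=
  ‖g x‖ ^ 2 - ‖∑ j, ((x j / ‖x‖ : ℝ) : ℂ) * g x j‖ ^ 2

/-- `∫ |∇_A^⊥ u|² / |x|`. -/
def tangentialEnergy (g : E3 → C3) : ℝ≥0∞ :=
  ∫⁻ x, ENNReal.ofReal (tangentialSq g x / ‖x‖)

/-- The surface integral `∫_{|x| = R} |u|² dσ_R = R² ∫_{S²} |u(Rω)|² dσ(ω)`. -/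
def sphereIntegral (u : E3 → ℂ) (R : ℝ) : ℝ≥0∞ :=
  ENNReal.ofReal (R ^ 2) *
    ∫⁻ ω : Metric.sphere (0 : E3) 1, ‖u (R • (ω : E3))‖ₑ ^ 2 ∂((volume : Measure E3).toSphere)

/-- `sup_{R>0} R⁻² ∫_{|x| = R} |u|² dσ_R`. A function `u ∈ H¹_A` is only given almost everywhere,
and for almost every `R` the surface integral does not depend on the representative and is that of
the trace. The integral of the trace is continuous in `R`, so the supremum over all `R > 0` of the
integrals of the traces is the essential supremum taken here. -/
def sphereSup (u : E3 → ℂ) : ℝ≥0∞ :=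
  essSup (fun R : ℝ => sphereIntegral u R / ENNReal.ofReal (R ^ 2)) (volume.restrict (Ioi 0))

end MagneticHelmholtz

end

open MagneticHelmholtz

namespace MagneticHelmholtz
noncomputable section

open Filter Topology
open scoped NNReal ComplexConjugate Interval Pointwise
open Complex (I norm_real normSq abs_re_le_norm re_ofReal_mul normSq_eq_norm_sq conj_ofReal
  measurable_ofReal continuous_ofReal conj_re mul_re mul_im real_smul norm_I normSq_apply ofRealCLM
  reCLM conj_im sub_re add_re ofReal_zero ofReal_re ofReal_im)
open Real (norm_of_nonneg norm_eq_abs rpow_le_rpow_of_exponent_le rpow_le_rpow_of_exponent_ge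
  sq_sqrt sqrt_nonneg sqrt_eq_rpow rpow_two)
open ENNReal (ofReal ofReal_mul ofReal_ne_top ofReal_le_ofReal rpow_le_rpow ofReal_pow ofReal_ofNat
  toReal_nonneg mul_ne_top rpow_mul ofReal_toReal mul_lt_top ofReal_add toReal_mono ofReal_lt_top
  div_ne_top toReal_ofReal)
open RCLike (norm_conj re_to_complex)
open Finset (sum_congr mul_sum aestronglyMeasurable_fun_sum)
open intervalIntegral (integral_congr mul_integral_comp_mul_right intervalIntegral_eq_integral_uIoc
  integral_mono_on integral_eq_sub_of_hasDerivAt integral_add_adjacent_intervals)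
open ContinuousLinearMap (le_opNorm lsmul lsmul_apply precompL_apply)
open EuclideanSpace (norm_sq_eq)
open PiLp (norm_apply_le)

variable {𝕜 F : Type*} [RCLike 𝕜] [NormedAddCommGroup F] {A β : E3 → E3} {V U q : E3 → ℝ}
  {u f : E3 → ℂ} {g : E3 → C3} {v : E3 → F} {w φ κ : ℝ → ℝ} {m M s C lam ε : ℝ} {L : ℝ≥0}

local notation "AESM" f:max => AEStronglyMeasurable f
local notation "C∞" => ((⊤ : ℕ∞) : WithTop ℕ∞)

/-! ### Measurability shorthands -/

section
variable {X Y : Type*} [MeasurableSpace X] {μ : Measure X} [TopologicalSpace Y]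
  [TopologicalSpace.PseudoMetrizableSpace Y] {f : X → Y}

/-! The estimate is a Morawetz (virial) estimate: formally the equation is paired with φ(|x|)(x·∇_A
u + u) for a nonincreasing radial multiplier φ. The errors caused by the potentials are small at
high frequency and are absorbed.

Since A is only in L²_loc, x·∇_A u need not be an admissible test function. It is replaced by
difference quotients of the transported dilations `covDil`, that is, u(sx) multiplied by exp(i ∫_1^s
x·A(τx) dτ), the parallel transport along the ray. The gradient of this phase is sA(sx) - A(x) plus
the flux of x·B along the ray (`phase_weak`). Hence ∇_A of a transported dilation is a rotated copy
of s(∇_A u)(sx), plus a term with the flux times u(sx) (`IsH1A.covDil`), and only the tangential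
field enters. The quotients converge weakly to x·∇_A u (`tendsto_covDil_quotient`). Symmetrizing
between s and 1/s moves the whole difference in the gradient pairing onto φ (`gradPair_sub`), so no
second derivatives of u are needed. The outcome is `SolvesHelmholtz.virial`.

Adding the equation tested with φu, the one-sided bound on ∂_r V₁ tested with |x|φ|u|², and a radial
integration by parts that removes λ from the right-hand side gives
`SolvesHelmholtz.morawetz_compact`. Hardy's inequality gives u/|x| in L², so the cutoffs can be
removed: `SolvesHelmholtz.morawetz`.

The multiplier is `mult b c`, an average over R in (b, c) of min(1/R, 1/|x|). With it the Morawetz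
form is a sum of nonnegative terms that control (|∇_A u|² + λ|u|²)/c for |x| < b, the tangential
energy for |x| > c, and the mean of |u|²/|x|² over the shell between
(`SolvesHelmholtz.lower_bound`). Varying b and c reaches balls of every radius, the whole tangential
energy and, by shrinking shells, almost every sphere.

The right-hand side is `errTot`. The potentials have a majorant w slightly better than |x|^(-2) at
the origin and than |x|^(-1) at infinity. Since |u| is at most min(|x|, λ^(-1/2)) times the root of
the local energy density, w|u| gains a factor λ^(-θ/2) in front of a weight whose integrals are
controlled by averages over balls; for λ ≥ λ₁ this is absorbed. The source is handled by dyadic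
duality. The remaining term ε∫|u||∇_A u| is bounded through the energy identity: ε∫|u|² ≤ ∫|f||u|,
and ∫|∇_A u|² is at most a multiple of λ∫|u|² + ∫|f||u|. The pairing of f with u carries a factor
λ^(-1/2), so λ cancels, while the ε left under the root produces the factor 1 + ε (`absorption`). -/

lemma _root_.Continuous.aesm [TopologicalSpace X] [SecondCountableTopologyEither X Y]
    [OpensMeasurableSpace X] (h : Continuous f) : AEStronglyMeasurable f μ :=
  h.aestronglyMeasurable

lemma _root_.AEMeasurable.aesm [SecondCountableTopology Y] [MeasurableSpace Y] [BorelSpace Y]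
    (h : AEMeasurable f μ) : AEStronglyMeasurable f μ := h.aestronglyMeasurable

lemma _root_.Measurable.aesm [SecondCountableTopology Y] [MeasurableSpace Y] [BorelSpace Y]
    (h : Measurable f) : AEStronglyMeasurable f μ := h.aemeasurable.aesm

lemma _root_.MeasureTheory.LocallyIntegrable.aesm (h : LocallyIntegrable v) : AESM v :=
  h.aestronglyMeasurable

lemma _root_.MeasureTheory.Integrable.aesm (h : Integrable v) : AESM v := h.1

end

/-! ### Mollification and its convergence in L^p -/

section Mollifier
open Convolution ContinuousLinearMap

variable [NormedSpace ℝ F]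

/-- A standard sequence of bump functions shrinking to the origin. -/
def bump (n : ℕ) : ContDiffBump (0 : E3) where
  rIn := 1 / (2 * ((n : ℝ) + 1))
  rOut := 1 / ((n : ℝ) + 1)
  rIn_pos := by positivity
  rIn_lt_rOut := by
    apply one_div_lt_one_div_of_lt <;> [positivity; linarith [(Nat.cast_nonneg n : (0 : ℝ) ≤ n)] ]

/-- The mollification of a function at scale `1 / (n + 1)`. -/
def moll (n : ℕ) (v : E3 → F) : E3 → F := (bump n).normed volume ⋆[lsmul ℝ ℝ, volume] v

lemma bump_rOut (n : ℕ) : (bump n).rOut = 1 / ((n : ℝ) + 1) := rfl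

lemma tendsto_bump_rOut : Tendsto (fun n => (bump n).rOut) atTop (𝓝 0) :=
  tendsto_one_div_add_atTop_nhds_zero_nat

lemma moll_apply (n : ℕ) (v : E3 → F) (x : E3) :
    moll n v x = ∫ t, (bump n).normed volume t • v (x - t) := rfl

lemma moll_apply_swap (n : ℕ) (v : E3 → F) (x : E3) :
    moll n v x = ∫ t, (bump n).normed volume (x - t) • v t := by
  rw [moll, convolution_eq_swap]; rfl

lemma moll_ae_tendsto [CompleteSpace F] (hv : LocallyIntegrable v) :
    ∀ᵐ x, Tendsto (fun n => moll n v x) atTop (𝓝 (v x)) := by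
  apply ContDiffBump.ae_convolution_tendsto_right_of_locallyIntegrable (K := 2)
    tendsto_bump_rOut _ hv
  filter_upwards with n
  -- The outer radius is exactly twice the inner one, which is the bounded ratio K = 2 that almost
  -- everywhere convergence requires.
  simp only [bump]; apply le_of_eq; field_simp

lemma moll_contDiff [CompleteSpace F] (n : ℕ) (hv : LocallyIntegrable v) :
    ContDiff ℝ C∞ (moll n v) :=
  (bump n).hasCompactSupport_normed.contDiff_convolution_left _ ((bump n).contDiff_normed) hv

lemma moll_zero_of {n : ℕ} {x : E3} (h : ∀ y, dist y x < 1 / ((n : ℝ) + 1) → v y = 0) :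
    moll n v x = 0 := by
  rw [moll_apply]; apply integral_eq_zero_of_ae; filter_upwards with t
  by_cases ht : t ∈ Metric.ball 0 (bump n).rOut
  · rw [h (x - t), smul_zero]; · rfl
    rw [bump_rOut] at ht; simpa [dist_eq_norm] using ht
  · have : (bump n).normed volume t = 0 := by
      rw [← Function.notMem_support, ContDiffBump.support_normed_eq]; exact ht
    simp [this]

lemma moll_norm_le {n : ℕ} {K : ℝ} (hK : ∀ x, ‖v x‖ ≤ K) (x : E3) : ‖moll n v x‖ ≤ K := by
  rw [moll_apply]
  have h1 : Integrable (fun t => (bump n).normed volume t * K) :=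
    ((bump n).integrable_normed).mul_const K
  calc ‖∫ t, (bump n).normed volume t • v (x - t)‖
      ≤ ∫ t, (bump n).normed volume t * K := by
        apply norm_integral_le_of_norm_le h1
        filter_upwards with t
        rw [norm_smul, norm_of_nonneg ((bump n).nonneg_normed t)]
        exact mul_le_mul_of_nonneg_left (hK _) ((bump n).nonneg_normed t)
    _ = K := by rw [integral_mul_const, (bump n).integral_normed, one_mul]

lemma moll_nonneg {n : ℕ} {v : E3 → ℝ} (hv : ∀ x, 0 ≤ v x) (x : E3) : 0 ≤ moll n v x := by
  rw [moll_apply]; exact integral_nonneg fun t => mul_nonneg ((bump n).nonneg_normed t) (hv _)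

lemma measurable_bump (n : ℕ) : Measurable ((bump n).normed volume) :=
  ((bump n).continuous_normed).measurable

/-- Young's inequality for a mollification. -/
lemma eLpNorm_moll_le {p : ℝ} (hp : 1 ≤ p) (n : ℕ) (hv : AESM v) :
    eLpNorm (moll n v) (ofReal p) volume ≤ eLpNorm v (ofReal p) volume := by
  have hp0 : 0 < p := by linarith
  set w : E3 → ℝ≥0∞ := fun t => ofReal ((bump n).normed volume t) with hw
  have hwm := (measurable_bump n).ennreal_ofReal
  have hw1 : ∫⁻ t, w t = 1 := by
    rw [hw, ← ofReal_integral_eq_lintegral_ofReal (bump n).integrable_normed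
      (ae_of_all _ fun t => (bump n).nonneg_normed t), (bump n).integral_normed,
      ENNReal.ofReal_one]
  have key : ∀ x, ‖moll n v x‖ₑ ^ p ≤ ∫⁻ t, w t * ‖v (x - t)‖ₑ ^ p := by
    intro x
    have hvx : AESM (fun t => v (x - t)) :=
      hv.comp_quasiMeasurePreserving (quasiMeasurePreserving_sub_left_of_right_invariant volume x)
    have h1 : ‖moll n v x‖ₑ ≤ ∫⁻ t, w t * ‖v (x - t)‖ₑ := by
      rw [moll_apply]
      refine (enorm_integral_le_lintegral_enorm _).trans (le_of_eq ?_)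
      refine lintegral_congr fun t => ?_
      rw [enorm_smul, hw, Real.enorm_of_nonneg ((bump n).nonneg_normed t)]
    -- The bump is a probability density, so Jensen's inequality, in the form that L^p norms
    -- increase with p on a probability space, bounds the p-th power of the average by the average
    -- of p-th powers. Tonelli and translation invariance finish.
    let μ := volume.withDensity w
    have : IsProbabilityMeasure μ := ⟨by rw [withDensity_apply _ MeasurableSet.univ]; simpa using hw1⟩
    have hac : μ ≪ volume := withDensity_absolutelyContinuous _ _
    have h2 : eLpNorm (fun t => v (x - t)) 1 μ ≤ eLpNorm (fun t => v (x - t)) (ofReal p) μ :=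
      eLpNorm_le_eLpNorm_of_exponent_le (by rw [← ENNReal.ofReal_one]; exact ofReal_le_ofReal hp)
        (hvx.mono_ac hac)
    have h3 : ∫⁻ t, ‖v (x - t)‖ₑ ∂μ = ∫⁻ t, w t * ‖v (x - t)‖ₑ := by
      rw [lintegral_withDensity_eq_lintegral_mul₀ hwm.aemeasurable hvx.enorm]; rfl
    have h4 : ∫⁻ t, ‖v (x - t)‖ₑ ^ p ∂μ = ∫⁻ t, w t * ‖v (x - t)‖ₑ ^ p := by
      rw [lintegral_withDensity_eq_lintegral_mul₀ hwm.aemeasurable (hvx.enorm.pow_const _)]; rfl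
    rw [eLpNorm_one_eq_lintegral_enorm, h3, eLpNorm_eq_lintegral_rpow_enorm_toReal (by simpa using hp0)
      ofReal_ne_top, toReal_ofReal hp0.le, h4] at h2
    calc ‖moll n v x‖ₑ ^ p ≤ (∫⁻ t, w t * ‖v (x - t)‖ₑ) ^ p := rpow_le_rpow h1 hp0.le
      _ ≤ ((∫⁻ t, w t * ‖v (x - t)‖ₑ ^ p) ^ (1 / p)) ^ p := rpow_le_rpow h2 hp0.le
      _ = _ := by rw [← rpow_mul, one_div_mul_cancel hp0.ne', ENNReal.rpow_one]
  rw [eLpNorm_eq_lintegral_rpow_enorm_toReal (by simpa using hp0) ofReal_ne_top,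
    eLpNorm_eq_lintegral_rpow_enorm_toReal (by simpa using hp0) ofReal_ne_top,
    toReal_ofReal hp0.le]
  apply rpow_le_rpow _ (by positivity)
  have hjoint : AEMeasurable (fun z : E3 × E3 => w z.2 * ‖v (z.1 - z.2)‖ₑ ^ p)
      (volume.prod volume) := by
    apply AEMeasurable.mul (hwm.comp measurable_snd).aemeasurable
    apply AEMeasurable.pow_const
    exact (hv.comp_quasiMeasurePreserving (quasiMeasurePreserving_sub volume volume)).enorm
  calc ∫⁻ x, ‖moll n v x‖ₑ ^ p ≤ ∫⁻ x, ∫⁻ t, w t * ‖v (x - t)‖ₑ ^ p := lintegral_mono key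
    _ = ∫⁻ t, ∫⁻ x, w t * ‖v (x - t)‖ₑ ^ p := lintegral_lintegral_swap hjoint
    _ = ∫⁻ t, w t * ∫⁻ x, ‖v x‖ₑ ^ p := by
        refine lintegral_congr fun t => ?_
        rw [lintegral_const_mul' _ _ ofReal_ne_top,
          lintegral_sub_right_eq_self (fun x => ‖v x‖ₑ ^ p) t]
    _ = _ := by rw [lintegral_mul_const _ hwm, hw1, one_mul]

lemma locInt_of_memLp {p : ℝ} (hp : 1 ≤ p) (hv : MemLp v (ofReal p) volume) : LocallyIntegrable v :=
  hv.locallyIntegrable (by rw [← ENNReal.ofReal_one]; exact ofReal_le_ofReal hp)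

lemma convolutionExistsAt_moll (n : ℕ) (hv : LocallyIntegrable v) (x : E3) :
    ConvolutionExistsAt ((bump n).normed volume) v x (lsmul ℝ ℝ) volume :=
  ((bump n).hasCompactSupport_normed).convolutionExists_left _ ((bump n).continuous_normed) hv x

lemma moll_sub (n : ℕ) {w : E3 → F} (hv : LocallyIntegrable v) (hw : LocallyIntegrable w) :
    moll n (v - w) = moll n v - moll n w := by
  ext x; simp only [moll_apply, Pi.sub_apply, smul_sub]
  exact integral_sub (convolutionExistsAt_moll n hv x) (convolutionExistsAt_moll n hw x)

/-- Mollifications converge in `L^p`. -/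
lemma moll_tendsto_eLpNorm [CompleteSpace F] {p : ℝ} (hp : 1 ≤ p) (hv : MemLp v (ofReal p) volume) :
    Tendsto (fun n => eLpNorm (moll n v - v) (ofReal p) volume) atTop (𝓝 0) := by
  have hp1 : 1 ≤ ofReal p := by rw [← ENNReal.ofReal_one]; exact ofReal_le_ofReal hp
  rw [ENNReal.tendsto_atTop_zero]; intro ε hε
  by_cases hεt : ε = ∞
  · exact ⟨0, fun n _ => by simp [hεt]⟩
  have hε3 : ε / 3 ≠ 0 := by simp [hε.ne']
  obtain ⟨w, hwc, hwv, hwcont, hwp⟩ := hv.exists_hasCompactSupport_eLpNorm_sub_le ofReal_ne_top hε3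
  have hvl := locInt_of_memLp hp hv
  have hwl := locInt_of_memLp hp hwp
  -- the continuous part
  let K := Metric.cthickening 1 (tsupport w)
  have hK : IsCompact K := hwc.cthickening
  have hmem : volume K ≠ ∞ := hK.measure_lt_top.ne
  have huc := hwc.uniformContinuous_of_continuous hwcont
  set m : ℝ≥0∞ := (volume K) ^ (1 / p) with hm
  have hmt : m ≠ ∞ := ENNReal.rpow_ne_top_of_nonneg (by positivity) hmem
  -- For large n the mollification of w differs from w by at most δ, and only on K, so the L^p
  -- distance is at most δ times the p-th root of the volume of K. The choice of δ makes this at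
  -- most ε/3; a null K needs no smallness.
  obtain ⟨δ, hδ, hδ2⟩ : ∃ δ, 0 < δ ∧ ofReal δ * m ≤ ε / 3 := by
    by_cases hm0 : m = 0
    · exact ⟨1, one_pos, by simp [hm0]⟩
    refine ⟨(ε / 3 / m).toReal, ?_, ?_⟩
    · apply ENNReal.toReal_pos
      · simp [hε.ne', hmt]
      · exact div_ne_top (div_ne_top hεt (by norm_num)) hm0
    · rw [ofReal_toReal (div_ne_top (div_ne_top hεt (by norm_num)) hm0),
        ENNReal.div_mul_cancel hm0 hmt]
  obtain ⟨η, hη, hη2⟩ := Metric.uniformContinuous_iff.1 huc δ hδ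
  obtain ⟨n0, hn0⟩ := eventually_atTop.1 (tendsto_bump_rOut.eventually (gt_mem_nhds hη))
  refine ⟨n0, fun n hn => ?_⟩
  have h1 : eLpNorm (moll n w - w) (ofReal p) volume ≤ ε / 3 := by
    have hb : ∀ x, ‖(moll n w - w) x‖ ≤ δ := by
      intro x; rw [Pi.sub_apply, ← dist_eq_norm]
      apply ContDiffBump.dist_normed_convolution_le hwcont.aesm
      intro y hy; exact (hη2 (lt_trans (Metric.mem_ball.1 hy) (hn0 n hn))).le
    have hz : ∀ x ∉ K, (moll n w - w) x = 0 := by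
      intro x hx
      have hxs : ∀ y, dist y x ≤ 1 → w y = 0 := by
        intro y hy; by_contra hne
        exact hx (Metric.mem_cthickening_of_dist_le x y 1 _
          (subset_tsupport w (Function.mem_support.2 hne)) (by rwa [dist_comm]))
      have h10 : 1 / ((n : ℝ) + 1) ≤ 1 := by rw [div_le_one (by positivity)]; linarith
      rw [Pi.sub_apply, moll_zero_of (fun y hy => hxs y (hy.le.trans h10)), hxs x (by simp), sub_zero]
    have hind : moll n w - w = K.indicator (moll n w - w) := by
      ext x
      by_cases hx : x ∈ K
      · simp [hx]
      · simp only [hx, not_false_eq_true, indicator_of_notMem]; exact hz x hx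
    rw [hind, eLpNorm_indicator_eq_eLpNorm_restrict hK.measurableSet]
    refine (eLpNorm_le_of_ae_bound (ae_of_all _ hb)).trans ?_
    rw [Measure.restrict_apply_univ, toReal_ofReal (by linarith), mul_comm, ← one_div]; exact hδ2
  have h2 := (eLpNorm_moll_le hp n (hv.1.sub hwp.1)).trans hwv
  have hmeas : AESM (moll n (v - w)) := (moll_contDiff n (hvl.sub hwl)).continuous.aesm
  have hmeas2 := (moll_contDiff n hwl).continuous.aesm.sub hwp.1
  -- The first and last terms are small by Young's inequality and the choice of w, the middle one by
  -- uniform continuity.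
  have hdec : moll n v - v = moll n (v - w) + ((moll n w - w) - (v - w)) := by
    rw [moll_sub n hvl hwl]; abel
  rw [hdec]
  calc _ ≤ ε / 3 + (ε / 3 + ε / 3) := by
        refine (eLpNorm_add_le hmeas (hmeas2.sub (hv.1.sub hwp.1)) hp1).trans ?_
        refine add_le_add h2 ((eLpNorm_sub_le hmeas2 (hv.1.sub hwp.1) hp1).trans ?_)
        exact add_le_add h1 hwv
    _ = ε := by rw [← add_assoc, ENNReal.add_thirds]

end Mollifier

open scoped Convolution

/-! ### Test functions and their derivatives -/

lemma IsTest.continuous {φ : E3 → 𝕜} (h : IsTest φ) : Continuous φ := h.smooth.continuous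

lemma IsTest.contDiff_one {φ : E3 → 𝕜} (h : IsTest φ) : ContDiff ℝ 1 φ :=
  h.smooth.of_le (by exact_mod_cast le_top)

lemma IsTest.differentiable {φ : E3 → 𝕜} (h : IsTest φ) : Differentiable ℝ φ :=
  h.contDiff_one.differentiable one_ne_zero

lemma IsTest.partialD {φ : E3 → 𝕜} (h : IsTest φ) (j : Fin 3) : IsTest (partialD j φ) := by
  refine ⟨?_, ?_⟩
  · exact (h.smooth.fderiv_right (m := C∞) (by simp)).clm_apply contDiff_const
  · exact h.compact.fderiv_apply (𝕜 := ℝ) _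

lemma IsTest.mul {φ ψ : E3 → 𝕜} (h : IsTest φ) (h' : ContDiff ℝ C∞ ψ) :
    IsTest (fun x => ψ x * φ x) := ⟨h'.mul h.smooth, h.compact.mul_left⟩

lemma IsTest.bounded {φ : E3 → 𝕜} (h : IsTest φ) : ∃ K, ∀ x, ‖φ x‖ ≤ K :=
  h.compact.exists_bound_of_continuous h.continuous

lemma IsTest.conj {φ : E3 → ℂ} (h : IsTest φ) : IsTest (fun x => starRingEnd ℂ (φ x)) :=
  ⟨Complex.conjCLE.contDiff.comp h.smooth, h.compact.comp_left (by simp)⟩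

lemma IsTest.re {φ : E3 → ℂ} (h : IsTest φ) : IsTest (fun x => (φ x).re) :=
  ⟨reCLM.contDiff.comp h.smooth, h.compact.comp_left (by simp)⟩

lemma IsTest.im {φ : E3 → ℂ} (h : IsTest φ) : IsTest (fun x => (φ x).im) :=
  ⟨Complex.imCLM.contDiff.comp h.smooth, h.compact.comp_left (by simp)⟩

lemma partialD_conj {φ : E3 → ℂ} (h : Differentiable ℝ φ) (j : Fin 3) (x : E3) :
    partialD j (fun x => starRingEnd ℂ (φ x)) x = starRingEnd ℂ (partialD j φ x) := by
  unfold partialD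
  erw [(Complex.conjCLE.toContinuousLinearMap.hasFDerivAt.comp x (h x).hasFDerivAt).fderiv]; rfl

lemma partialD_ofReal {φ : E3 → ℝ} (h : Differentiable ℝ φ) (j : Fin 3) (x : E3) :
    partialD j (fun x => (φ x : ℂ)) x = ((partialD j φ x : ℝ) : ℂ) := by
  unfold partialD; erw [(ofRealCLM.hasFDerivAt.comp x (h x).hasFDerivAt).fderiv]; rfl

lemma partialD_re {φ : E3 → ℂ} (h : Differentiable ℝ φ) (j : Fin 3) (x : E3) :
    partialD j (fun x => (φ x).re) x = (partialD j φ x).re := by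
  unfold partialD; erw [(reCLM.hasFDerivAt.comp x (h x).hasFDerivAt).fderiv]; rfl

lemma partialD_im {φ : E3 → ℂ} (h : Differentiable ℝ φ) (j : Fin 3) (x : E3) :
    partialD j (fun x => (φ x).im) x = (partialD j φ x).im := by
  unfold partialD; erw [(Complex.imCLM.hasFDerivAt.comp x (h x).hasFDerivAt).fderiv]; rfl

lemma partialD_mul {φ ψ : E3 → 𝕜} {x : E3} (h : DifferentiableAt ℝ φ x)
    (h' : DifferentiableAt ℝ ψ x) (j : Fin 3) :
    partialD j (fun x => φ x * ψ x) x = φ x * partialD j ψ x + partialD j φ x * ψ x := by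
  unfold partialD; rw [show (fun x => φ x * ψ x) = φ * ψ from rfl, fderiv_mul h h']; simp [mul_comm]

lemma zero_of_tsupp {φ : E3 → 𝕜} {x : E3} (hx : x ∉ tsupport φ) : φ x = 0 :=
  image_eq_zero_of_notMem_tsupport hx

lemma partialD_zero_of {φ : E3 → 𝕜} {x : E3} (j : Fin 3) (hx : x ∉ tsupport φ) :
    partialD j φ x = 0 := by
  have : fderiv ℝ φ x = 0 := by
    by_contra h; exact hx (support_fderiv_subset ℝ (Function.mem_support.2 h))
  simp [partialD, this]

/-! ### Local square integrability and L² pairings -/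

/-- Locally square integrable functions. -/
def L2loc (v : E3 → F) : Prop := ∀ K : Set E3, IsCompact K → MemLp (K.indicator v) 2

lemma _root_.MeasureTheory.MemLp.l2loc (h : MemLp v 2) : L2loc v :=
  fun _ hK => h.indicator hK.measurableSet

lemma l2loc_of_bounded (hm : AESM v) (hC : ∀ x, ‖v x‖ ≤ C) : L2loc v := by
  intro K hK; rw [memLp_indicator_iff_restrict hK.measurableSet]
  have : IsFiniteMeasure (volume.restrict K) := ⟨by simpa using hK.measure_lt_top⟩
  exact MemLp.of_bound hm.restrict C (ae_of_all _ hC)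

lemma L2loc.aesm (h : L2loc v) : AESM v := by
  have h2 : (⋃ n : ℕ, Metric.closedBall (0 : E3) n) = univ := Metric.iUnion_closedBall_nat 0
  rw [← Measure.restrict_univ (μ := (volume : Measure E3)), ← h2, aestronglyMeasurable_iUnion_iff]
  intro n
  have := (h _ (isCompact_closedBall 0 n)).1
  rwa [aestronglyMeasurable_indicator_iff measurableSet_closedBall] at this

lemma L2loc.memLp_mul_bounded {v : E3 → ℂ} (h : L2loc v) {w : E3 → ℂ} (hw : AESM w)
    (hC : ∀ x, ‖w x‖ ≤ C) {K : Set E3} (hK : IsCompact K) (hwK : ∀ x ∉ K, w x = 0) :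
    MemLp (fun x => v x * w x) 2 := by
  have h1 : (fun x => v x * w x) = fun x => K.indicator v x * w x := by
    ext x; by_cases hx : x ∈ K <;> simp [hx, hwK]
  rw [h1]
  refine ((h K hK).norm.const_mul C).mono ((h K hK).1.mul hw) (ae_of_all _ fun x => ?_)
  rw [norm_mul, mul_comm]
  exact (mul_le_mul_of_nonneg_right (hC x) (norm_nonneg _)).trans (le_abs_self _)

lemma int_mul {v w : E3 → 𝕜} (hv : MemLp v 2) (hw : MemLp w 2) :
    Integrable (fun x => v x * w x) := hv.integrable_mul hw

lemma locInt_iff : LocallyIntegrable v ↔ ∀ K, IsCompact K → IntegrableOn v K :=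
  ⟨fun h _ hK => h.integrableOn_isCompact hK, fun h => locallyIntegrable_iff.2 fun K hK => h K hK⟩

lemma L2loc.locallyIntegrable (h : L2loc v) : LocallyIntegrable v := by
  rw [locInt_iff]; intro K hK
  have h1 := h K hK
  rw [memLp_indicator_iff_restrict hK.measurableSet] at h1
  have : IsFiniteMeasure (volume.restrict K) := ⟨by simpa using hK.measure_lt_top⟩
  exact h1.integrable (by norm_num)

lemma L2loc.mul {v w : E3 → ℂ} (hv : L2loc v) (hw : L2loc w) :
    LocallyIntegrable (fun x => v x * w x) := by
  rw [locInt_iff]; intro K hK; rw [← integrable_indicator_iff hK.measurableSet]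
  have h1 : K.indicator (fun x => v x * w x) = fun x => K.indicator v x * K.indicator w x := by
    ext x; by_cases hx : x ∈ K <;> simp [hx]
  rw [h1]; exact (hv K hK).integrable_mul (hw K hK)

lemma _root_.MeasureTheory.LocallyIntegrable.mul_bounded {v w : E3 → 𝕜} (hv : LocallyIntegrable v)
    (hw : AESM w) (hC : ∀ x, ‖w x‖ ≤ C) : LocallyIntegrable (fun x => v x * w x) := by
  rw [locInt_iff] at *; intro K hK; exact (hv K hK).mul_bdd hw.restrict (ae_of_all _ hC)

lemma _root_.MeasureTheory.LocallyIntegrable.int_mul_compact {v w : E3 → 𝕜}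
    (hv : LocallyIntegrable v) (hw : AESM w) (hC : ∀ x, ‖w x‖ ≤ C) {K : Set E3} (hK : IsCompact K)
    (hwK : ∀ x ∉ K, w x = 0) : Integrable (fun x => v x * w x) := by
  have h1 : (fun x => v x * w x) = K.indicator (fun x => v x * w x) := by
    ext x; by_cases hx : x ∈ K <;> simp [hx, hwK]
  rw [h1, integrable_indicator_iff hK.measurableSet]
  exact (hv.mul_bounded hw hC).integrableOn_isCompact hK

lemma _root_.MeasureTheory.LocallyIntegrable.int_mul_test {v φ : E3 → 𝕜} (hv : LocallyIntegrable v)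
    (hφ : IsTest φ) : Integrable (fun x => v x * φ x) := by
  obtain ⟨C, hC⟩ := hφ.bounded
  exact hv.int_mul_compact hφ.continuous.aesm hC hφ.compact fun x hx => zero_of_tsupp hx

lemma _root_.MeasureTheory.MemLp.int_sq (h : MemLp v 2) : Integrable fun x => ‖v x‖ ^ 2 :=
  (memLp_two_iff_integrable_sq_norm h.1).1 h

lemma int_congr [NormedSpace ℝ F] {α : Type*} [MeasurableSpace α] {μ : Measure α} {f g : α → F}
    (h : ∀ x, f x = g x) : ∫ x, f x ∂μ = ∫ x, g x ∂μ := by simp only [h]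

/-- Pairing with a square integrable function is continuous in `L²`. -/
lemma enorm_int_mul_le {k z : E3 → 𝕜} (hk : AESM k) (hz : AESM z) :
    ‖∫ x, k x * z x‖ₑ ≤ eLpNorm k 2 volume * eLpNorm z 2 volume := by
  refine (enorm_integral_le_lintegral_enorm _).trans ?_
  have h3 : ∫⁻ x, ‖k x * z x‖ₑ = eLpNorm (k • z) 1 volume := by
    rw [eLpNorm_one_eq_lintegral_enorm]; exact lintegral_congr fun x => by simp
  rw [h3]; exact eLpNorm_smul_le_mul_eLpNorm hz hk

lemma tendsto_int_mul {ι : Type*} {l : Filter ι} {k : E3 → 𝕜} {Z : ι → E3 → 𝕜} {z : E3 → 𝕜}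
    (hk : MemLp k 2) (hZ : ∀ n, MemLp (Z n) 2) (hz : MemLp z 2)
    (h : Tendsto (fun n => eLpNorm (Z n - z) 2 volume) l (𝓝 0)) :
    Tendsto (fun n => ∫ x, k x * Z n x) l (𝓝 (∫ x, k x * z x)) := by
  rw [tendsto_iff_edist_tendsto_0]
  have h2 : Tendsto (fun n => eLpNorm k 2 volume * eLpNorm (Z n - z) 2 volume) l (𝓝 0) := by
    simpa using ENNReal.Tendsto.const_mul h (Or.inr hk.2.ne)
  refine tendsto_of_tendsto_of_tendsto_of_le_of_le tendsto_const_nhds h2 (fun _ => bot_le) fun n => ?_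
  rw [edist_eq_enorm_sub, ← integral_sub (int_mul hk (hZ n)) (int_mul hk hz)]; simp_rw [← mul_sub]
  exact enorm_int_mul_le hk.1 ((hZ n).1.sub hz.1)

/-! ### Weak derivatives: mollification, product rule, chain rule -/

/-- `D` is the weak partial derivative `∂v/∂x_j` on `ℝ³`. -/
structure WDeriv (j : Fin 3) (v D : E3 → 𝕜) : Prop where
  left : LocallyIntegrable v
  right : LocallyIntegrable D
  weak : ∀ φ : E3 → 𝕜, IsTest φ → ∫ x, D x * φ x = -∫ x, v x * partialD j φ x

lemma isTest_bump (n : ℕ) (x : E3) :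
    IsTest (fun y => (((bump n).normed volume (x - y) : ℝ) : 𝕜)) := by
  have h1 : ContDiff ℝ C∞ (fun y => (bump n).normed volume (x - y)) :=
    (bump n).contDiff_normed.comp (contDiff_const.sub contDiff_id)
  refine ⟨(RCLike.ofRealCLM (K := 𝕜)).contDiff.comp h1, ?_⟩
  have h2 : HasCompactSupport (fun y => (bump n).normed volume (x - y)) :=
    (bump n).hasCompactSupport_normed.comp_homeomorph (Homeomorph.subLeft x)
  exact h2.comp_left (by simp)

lemma partialD_bump (n : ℕ) (x y : E3) (j : Fin 3) :
    partialD j (fun y => (((bump n).normed volume (x - y) : ℝ) : 𝕜)) y =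
      -((partialD j ((bump n).normed volume) (x - y) : ℝ) : 𝕜) := by
  have hd : Differentiable ℝ ((bump n).normed (volume : Measure E3)) :=
    ((bump n).contDiff_normed).differentiable one_ne_zero
  have h1 := (hd (x - y)).hasFDerivAt.comp y ((hasFDerivAt_id y).const_sub x)
  unfold partialD; erw [((RCLike.ofRealCLM).hasFDerivAt.comp y h1).fderiv]; simp

/-- The weak derivative commutes with mollification. -/
lemma WDeriv.partialD_moll {j : Fin 3} {v D : E3 → 𝕜} (h : WDeriv j v D) (n : ℕ) (x : E3) :
    partialD j (moll n v) x = moll n D x := by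
  have h1 : fderiv ℝ (moll n v) x =
      (fderiv ℝ ((bump n).normed volume) ⋆[(lsmul ℝ ℝ).precompL E3, volume] v) x :=
    ((bump n).hasCompactSupport_normed.hasFDerivAt_convolution_left _
      ((bump n).contDiff_normed) h.left x).fderiv
  have hex : ConvolutionExistsAt (fderiv ℝ ((bump n).normed volume)) v x
      ((lsmul ℝ ℝ).precompL E3) volume :=
    ((bump n).hasCompactSupport_normed.fderiv (𝕜 := ℝ)).convolutionExists_left _
      (((bump n).contDiff_normed).continuous_fderiv one_ne_zero) h.left x
  unfold partialD
  rw [h1, convolution_eq_swap, ContinuousLinearMap.integral_apply hex.integrable_swap,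
    moll_apply_swap]
  -- The reflected bump y ↦ ρ(x - y) is the test function. Differentiating it in y produces a sign
  -- that cancels the one in the definition of a weak derivative.
  have h2 := h.weak _ (isTest_bump n x)
  simp_rw [partialD_bump] at h2; simp only [mul_neg, integral_neg, neg_neg] at h2
  have h3 : ∀ t, (bump n).normed volume (x - t) • D t =
      D t * (((bump n).normed volume (x - t) : ℝ) : 𝕜) := by
    intro t; rw [RCLike.real_smul_eq_coe_mul, mul_comm]
  simp_rw [h3, h2]
  refine int_congr fun t => ?_
  simp; rw [RCLike.real_smul_eq_coe_mul, mul_comm]; rfl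

lemma isTest_moll (n : ℕ) {v : E3 → 𝕜} (hv : LocallyIntegrable v) {K : Set E3} (hK : IsCompact K)
    (hvK : ∀ x ∉ K, v x = 0) : IsTest (moll n v) := by
  refine ⟨moll_contDiff n hv, ?_⟩
  refine HasCompactSupport.intro (K := Metric.cthickening 1 K) hK.cthickening fun x hx => ?_
  refine moll_zero_of fun y hy => hvK y fun hyK => hx ?_
  refine Metric.mem_cthickening_of_dist_le x y 1 _ hyK ?_
  rw [dist_comm]
  refine hy.le.trans ?_
  rw [div_le_one (by positivity)]; linarith

lemma moll_zero_cthick (n : ℕ) {v : E3 → 𝕜} {K : Set E3} (hvK : ∀ x ∉ K, v x = 0) {x : E3}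
    (hx : x ∉ Metric.cthickening 1 K) : moll n v x = 0 := by
  refine moll_zero_of fun y hy => hvK y fun hyK => hx ?_
  refine Metric.mem_cthickening_of_dist_le x y 1 _ hyK ?_
  rw [dist_comm]
  refine hy.le.trans ?_
  rw [div_le_one (by positivity)]; linarith

lemma moll_tendsto_L2 {v : E3 → 𝕜} (hv : MemLp v 2) :
    Tendsto (fun n => eLpNorm (moll n v - v) 2 volume) atTop (𝓝 0) := by
  simpa using moll_tendsto_eLpNorm (p := 2) (by norm_num) (v := v) (by simpa using hv)

lemma moll_memLp_two {v : E3 → 𝕜} (hv : MemLp v 2) (n : ℕ) : MemLp (moll n v) 2 := by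
  refine ⟨(moll_contDiff n hv.l2loc.locallyIntegrable).continuous.aesm, ?_⟩
  have := eLpNorm_moll_le (p := 2) (by norm_num) n hv.1
  simp at this; exact this.trans_lt hv.2

lemma moll_tendsto_L1 {v : E3 → 𝕜} (hv : Integrable v) :
    Tendsto (fun n => eLpNorm (moll n v - v) 1 volume) atTop (𝓝 0) := by
  simpa using moll_tendsto_eLpNorm le_rfl (v := v) (by simpa [memLp_one_iff_integrable] using hv)

lemma int_moll {v : E3 → 𝕜} (hv : Integrable v) (n : ℕ) : Integrable (moll n v) :=
  ((bump n).integrable_normed).integrable_convolution _ hv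

/-- The product with a smooth function. -/
lemma WDeriv.smooth_mul {j : Fin 3} {v D ψ : E3 → 𝕜} (h : WDeriv j v D) (hψ : ContDiff ℝ C∞ ψ) :
    WDeriv j (fun x => ψ x * v x) (fun x => partialD j ψ x * v x + ψ x * D x) := by
  have hψ1 : ContDiff ℝ 1 ψ := hψ.of_le (by exact_mod_cast le_top)
  have hpc : Continuous (partialD j ψ) := (hψ1.continuous_fderiv one_ne_zero).clm_apply continuous_const
  have hl : ∀ {w c : E3 → 𝕜}, LocallyIntegrable w → Continuous c →
      LocallyIntegrable (fun x => c x * w x) := by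
    intro w c hw hc; simpa [smul_eq_mul] using hw.continuous_smul hc
  refine ⟨hl h.left hψ.continuous, (hl h.left hpc).add (hl h.right hψ.continuous), ?_⟩
  intro φ hφ
  have h1 := h.weak _ (hφ.mul hψ)
  have h2 : ∀ x, partialD j (fun x => ψ x * φ x) x = ψ x * partialD j φ x + partialD j ψ x * φ x :=
    fun x => partialD_mul ((hψ1.differentiable one_ne_zero) x) (hφ.differentiable x) j
  simp_rw [h2] at h1
  have i1 := (hl h.left hpc).int_mul_test hφ
  have e1 : ∫ x, D x * (ψ x * φ x) = ∫ x, (ψ x * D x) * φ x := int_congr fun x => by ring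
  have e2 : ∫ x, v x * (ψ x * partialD j φ x + partialD j ψ x * φ x) =
      (∫ x, (ψ x * v x) * partialD j φ x) + ∫ x, (partialD j ψ x * v x) * φ x := by
    rw [← integral_add ((hl h.left hψ.continuous).int_mul_test (hφ.partialD j)) i1]
    exact int_congr fun x => by ring
  rw [e1, e2] at h1; simp_rw [add_mul]
  rw [integral_add i1 ((hl h.right hψ.continuous).int_mul_test hφ), h1]; ring

lemma int_of_compact {v : E3 → 𝕜} (hv : LocallyIntegrable v) {K : Set E3} (hK : IsCompact K)
    (hvK : ∀ x ∉ K, v x = 0) : Integrable v := by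
  have h1 : v = K.indicator v := by ext x; by_cases hx : x ∈ K <;> simp [hx, hvK]
  rw [h1, integrable_indicator_iff hK.measurableSet]; exact hv.integrableOn_isCompact hK

/-- The product rule for a bounded factor with locally square integrable derivative and a locally
square integrable factor. -/
lemma WDeriv.mul {j : Fin 3} {v D w Dw : E3 → ℂ} (h1 : WDeriv j v D) (hC : ∀ x, ‖v x‖ ≤ C)
    (hD : L2loc D) (h2 : WDeriv j w Dw) (hw : L2loc w) :
    WDeriv j (fun x => v x * w x) (fun x => D x * w x + v x * Dw x) := by
  have hvm := h1.left.aesm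
  have lvw : LocallyIntegrable (fun x => v x * w x) := by
    simpa [mul_comm] using h2.left.mul_bounded hvm hC
  have lDw := hD.mul hw
  have lvDw : LocallyIntegrable (fun x => v x * Dw x) := by
    simpa [mul_comm] using h2.right.mul_bounded hvm hC
  refine ⟨lvw, lDw.add lvDw, fun φ hφ => ?_⟩
  obtain ⟨Cφ, hCφ⟩ := hφ.bounded
  obtain ⟨Cd, hCd⟩ := (hφ.partialD j).bounded
  have hC0 := (norm_nonneg _).trans (hC 0)
  -- The product φv is not smooth, so the weak derivative of w is tested with its mollifications.
  -- `Dw` is only locally integrable, so that side converges by boundedness of v and dominated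
  -- convergence; the other side pairs w in L² with an L² limit.
  set ζ : E3 → ℂ := fun x => φ x * v x with hζ
  set Z : E3 → ℂ := fun x => partialD j φ x * v x + φ x * D x with hZ
  have hζZ : WDeriv j ζ Z := h1.smooth_mul hφ.smooth
  set K := tsupport φ with hKdef
  have hK := hφ.compact
  have hζK : ∀ x ∉ K, ζ x = 0 := fun x hx => by simp [hζ, zero_of_tsupp hx]
  have hZK : ∀ x ∉ K, Z x = 0 := fun x hx => by simp [hZ, zero_of_tsupp hx, partialD_zero_of j hx]
  have hζb : ∀ x, ‖ζ x‖ ≤ Cφ * C := fun x => by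
    rw [hζ, norm_mul]
    exact mul_le_mul (hCφ x) (hC x) (norm_nonneg _) ((norm_nonneg _).trans (hCφ x))
  have hZ2 : MemLp Z 2 := by
    refine MemLp.add ?_ ?_
    · have := (l2loc_of_bounded hvm hC).memLp_mul_bounded
        (hφ.partialD j).continuous.aesm hCd hK (fun x hx => partialD_zero_of j hx)
      simpa [mul_comm] using this
    · have := hD.memLp_mul_bounded hφ.continuous.aesm hCφ hK (fun x hx => zero_of_tsupp hx)
      simpa [mul_comm] using this
  set K1 := Metric.cthickening 1 K with hK1def
  have hK1 : IsCompact K1 := hK.cthickening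
  -- All mollifications live in the 1-thickening `K1` of the support, so w may be cut off there and
  -- becomes an L² function.
  have key : ∀ n, ∫ x, Dw x * moll n ζ x = -∫ x, K1.indicator w x * moll n Z x := by
    intro n; rw [h2.weak _ (isTest_moll n hζZ.left hK hζK)]; congr 1
    refine int_congr fun x => ?_
    simp only [hζZ.partialD_moll]
    by_cases hx : x ∈ K1
    · simp [hx]
    · simp [hx, moll_zero_cthick n hZK hx]
  have lim1 : Tendsto (fun n => ∫ x, Dw x * moll n ζ x) atTop (𝓝 (∫ x, Dw x * ζ x)) := by
    refine tendsto_integral_of_dominated_convergence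
      (fun x => K1.indicator (fun x => ‖Dw x‖ * (Cφ * C)) x) ?_ ?_ ?_ ?_
    · exact fun n => h2.right.aesm.mul (moll_contDiff n hζZ.left).continuous.aesm
    · rw [integrable_indicator_iff hK1.measurableSet]
      exact ((h2.right.integrableOn_isCompact hK1).norm).mul_const _
    · refine fun n => ae_of_all _ fun x => ?_
      by_cases hx : x ∈ K1
      · simp only [hx, indicator_of_mem, norm_mul]
        exact mul_le_mul_of_nonneg_left (moll_norm_le hζb x) (norm_nonneg _)
      · simp [hx, moll_zero_cthick n hζK hx]
    · filter_upwards [moll_ae_tendsto hζZ.left] with x hx using hx.const_mul _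
  have lim2 := tendsto_int_mul (hw K1 hK1) (moll_memLp_two hZ2) hZ2 (moll_tendsto_L2 hZ2)
  have e := tendsto_nhds_unique lim1 (by simp_rw [key]; exact lim2.neg)
  have hKK1 : K ⊆ K1 := Metric.self_subset_cthickening K
  have i1 := lDw.int_mul_test hφ
  have e1 : ∫ x, Dw x * ζ x = ∫ x, (v x * Dw x) * φ x := int_congr fun x => by simp only [hζ]; ring
  have e2 : ∫ x, K1.indicator w x * Z x =
      (∫ x, (v x * w x) * partialD j φ x) + ∫ x, (D x * w x) * φ x := by
    rw [← integral_add (lvw.int_mul_test (hφ.partialD j)) i1]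
    refine int_congr fun x => ?_
    by_cases hx : x ∈ K
    · simp only [hKK1 hx, indicator_of_mem, hZ]; ring
    · simp [hZK x hx, zero_of_tsupp hx, partialD_zero_of j hx]
  rw [e1, e2] at e; simp_rw [add_mul]; rw [integral_add i1 (lvDw.int_mul_test hφ), e]; ring

lemma tendsto_int_mul_one {Z : ℕ → E3 → 𝕜} {z φ : E3 → 𝕜} (hZ : ∀ n, Integrable (Z n))
    (hz : Integrable z) (h : Tendsto (fun n => eLpNorm (Z n - z) 1 volume) atTop (𝓝 0))
    (hφ : AESM φ) (hC : ∀ᵐ x, ‖φ x‖ ≤ C) :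
    Tendsto (fun n => ∫ x, Z n x * φ x) atTop (𝓝 (∫ x, z x * φ x)) := by
  apply tendsto_integral_of_L1 _ (hz.mul_bdd hφ hC).aesm
  · exact Eventually.of_forall fun n => (hZ n).mul_bdd hφ hC
  · have h2 : Tendsto (fun n => eLpNorm (Z n - z) 1 volume * ofReal C) atTop (𝓝 0) := by
      simpa using ENNReal.Tendsto.mul_const h (Or.inr ofReal_ne_top)
    refine tendsto_of_tendsto_of_tendsto_of_le_of_le tendsto_const_nhds h2 (fun _ => bot_le) fun n => ?_
    rw [eLpNorm_one_eq_lintegral_enorm, ← lintegral_mul_const' _ _ ofReal_ne_top]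
    refine lintegral_mono_ae ?_
    filter_upwards [hC] with x hx
    rw [← sub_mul, enorm_mul, Pi.sub_apply]; gcongr; rw [← ofReal_norm]; exact ofReal_le_ofReal hx

/-- The chain rule for weak derivatives. -/
lemma WDeriv.comp {j : Fin 3} {v D : E3 → ℂ} (h : WDeriv j v D) (hv : Integrable v)
    (hD : Integrable D) {Φ : ℂ → ℂ} (hΦ : ContDiff ℝ 1 Φ) (hC : ∀ z, ‖fderiv ℝ Φ z‖ ≤ C) :
    WDeriv j (fun x => Φ (v x)) (fun x => fderiv ℝ Φ (v x) (D x)) := by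
  have hC0 := (norm_nonneg _).trans (hC 0)
  have hΦd := hΦ.differentiable one_ne_zero
  have hlip : ∀ a b, ‖Φ a - Φ b‖ ≤ C * ‖a - b‖ := fun a b =>
    convex_univ.norm_image_sub_le_of_norm_fderiv_le
      (fun x _ => hΦd x) (fun x _ => hC x) (mem_univ b) (mem_univ a)
  have hcf := hΦ.continuous_fderiv one_ne_zero
  have hvm := hv.aesm
  have hm2 : ∀ {a b : E3 → ℂ}, AESM a → AESM b → AESM (fun x => fderiv ℝ Φ (a x) (b x)) := by
    intro a b ha hb
    exact isBoundedBilinearMap_apply.continuous.comp_aestronglyMeasurable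
      ((hcf.comp_aestronglyMeasurable ha).prodMk hb)
  have lΦ : LocallyIntegrable (fun x => Φ (v x)) := by
    have h0 : LocallyIntegrable (fun x => ‖Φ 0‖ + C * ‖v x‖) :=
      (locallyIntegrable_const _).add (hv.norm.const_mul C).locallyIntegrable
    refine h0.mono (hΦ.continuous.comp_aestronglyMeasurable hvm) (ae_of_all _ fun x => ?_)
    have := hlip (v x) 0
    rw [sub_zero] at this; rw [norm_of_nonneg (by positivity)]
    calc ‖Φ (v x)‖ = ‖Φ 0 + (Φ (v x) - Φ 0)‖ := by congr 1; ring
      _ ≤ ‖Φ 0‖ + ‖Φ (v x) - Φ 0‖ := norm_add_le _ _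
      _ ≤ _ := by gcongr
  have iD : Integrable (fun x => fderiv ℝ Φ (v x) (D x)) := by
    refine (hD.norm.const_mul C).mono' (hm2 hvm hD.aesm) (ae_of_all _ fun x => ?_)
    exact (le_opNorm _ _).trans (mul_le_mul_of_nonneg_right (hC _) (norm_nonneg _))
  refine ⟨lΦ, iD.locallyIntegrable, fun φ hφ => ?_⟩
  obtain ⟨Cφ, hCφ⟩ := hφ.bounded
  obtain ⟨Cd, hCd⟩ := (hφ.partialD j).bounded
  have smn : ∀ n, ContDiff ℝ 1 (moll n v) := fun n =>
    (moll_contDiff n h.left).of_le (by exact_mod_cast le_top)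
  have dn : ∀ n, Differentiable ℝ (moll n v) := fun n => (smn n).differentiable one_ne_zero
  have fd : ∀ n x, fderiv ℝ (fun y => Φ (moll n v y)) x (EuclideanSpace.single j 1) =
      fderiv ℝ Φ (moll n v x) (moll n D x) := by
    intro n x
    have h2 := h.partialD_moll n x
    unfold partialD at h2; erw [((hΦd (moll n v x)).hasFDerivAt.comp x (dn n x).hasFDerivAt).fderiv]
    rw [ContinuousLinearMap.comp_apply, h2]
  have key : ∀ n, ∫ x, fderiv ℝ Φ (moll n v x) (moll n D x) * φ x =
      -∫ x, Φ (moll n v x) * partialD j φ x := by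
    intro n
    have cΦ := hΦ.continuous.comp (smn n).continuous
    have cf := (hcf.comp (smn n).continuous).clm_apply (moll_contDiff n h.right).continuous
    have := integral_mul_fderiv_eq_neg_fderiv_mul_of_integrable (μ := (volume : Measure E3))
      (f := fun y => Φ (moll n v y)) (g := φ)
      (v := EuclideanSpace.single j 1) ?_ ?_ ?_ ?_ ?_
    · simp_rw [fd] at this; rw [neg_eq_iff_eq_neg.symm] at this; exact this.symm
    · simp_rw [fd]; exact (cf.mul hφ.continuous).integrable_of_hasCompactSupport hφ.compact.mul_left
    · exact (cΦ.mul (hφ.partialD j).continuous).integrable_of_hasCompactSupport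
        (hφ.partialD j).compact.mul_left
    · exact (cΦ.mul hφ.continuous).integrable_of_hasCompactSupport hφ.compact.mul_left
    · exact fun x _ => (hΦd _).comp x (dn n x)
    · exact fun x _ => hφ.differentiable x
  have lim2 : Tendsto (fun n => ∫ x, Φ (moll n v x) * partialD j φ x) atTop
      (𝓝 (∫ x, Φ (v x) * partialD j φ x)) := by
    have l1 : Tendsto (fun n => ∫ x, ‖moll n v x - v x‖ * ‖partialD j φ x‖) atTop (𝓝 0) := by
      have a1 := tendsto_int_mul_one (Z := fun n x => ‖moll n v x - v x‖) (z := fun _ => 0)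
        (fun n => ((int_moll hv n).sub hv).norm) (integrable_zero _ _ _) ?_
        (hφ.partialD j).continuous.norm.aesm (ae_of_all _ fun x => by simpa using hCd x)
      · simpa using a1
      · refine (moll_tendsto_L1 hv).congr fun n => ?_
        rw [eLpNorm_one_eq_lintegral_enorm, eLpNorm_one_eq_lintegral_enorm]; simp
    rw [tendsto_iff_norm_sub_tendsto_zero]
    have l2 := l1.const_mul C
    rw [mul_zero] at l2
    refine squeeze_zero (fun _ => norm_nonneg _) (fun n => ?_) l2
    have i1 : Integrable (fun x => Φ (moll n v x) * partialD j φ x) :=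
      ((hΦ.continuous.comp (smn n).continuous).mul
        (hφ.partialD j).continuous).integrable_of_hasCompactSupport (hφ.partialD j).compact.mul_left
    rw [← integral_sub i1 (lΦ.int_mul_test (hφ.partialD j)), ← integral_const_mul]
    refine norm_integral_le_of_norm_le ?_ (ae_of_all _ fun x => ?_)
    · exact ((((int_moll hv n).sub hv).norm).mul_bdd (hφ.partialD j).continuous.norm.aesm
        (ae_of_all _ fun x => by simpa using hCd x)).const_mul C
    · rw [← sub_mul, norm_mul, ← mul_assoc]
      exact mul_le_mul_of_nonneg_right (hlip _ _) (norm_nonneg _)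
  have lim1 : Tendsto (fun n => ∫ x, fderiv ℝ Φ (moll n v x) (moll n D x) * φ x) atTop
      (𝓝 (∫ x, fderiv ℝ Φ (v x) (D x) * φ x)) := by
    -- Two limits are separated. With `D` fixed, only the argument of the derivative of Φ is
    -- mollified and dominated convergence applies; the replacement of `moll n D` by `D` costs at
    -- most the L¹ distance, because the derivative of Φ is bounded.
    have b : Tendsto (fun n => ∫ x, fderiv ℝ Φ (moll n v x) (D x) * φ x) atTop
        (𝓝 (∫ x, fderiv ℝ Φ (v x) (D x) * φ x)) := by
      refine tendsto_integral_of_dominated_convergence (fun x => C * ‖D x‖ * Cφ) ?_ ?_ ?_ ?_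
      · exact fun n => (hm2 (smn n).continuous.aesm hD.aesm).mul hφ.continuous.aesm
      · exact (hD.norm.const_mul C).mul_const _
      · refine fun n => ae_of_all _ fun x => ?_
        rw [norm_mul]
        exact mul_le_mul ((le_opNorm _ _).trans
          (mul_le_mul_of_nonneg_right (hC _) (norm_nonneg _))) (hCφ x) (norm_nonneg _) (by positivity)
      · filter_upwards [moll_ae_tendsto h.left] with x hx
        exact ((((ContinuousLinearMap.apply ℝ ℂ (D x)).continuous.comp hcf).tendsto _).comp hx).mul_const _
    have l1 : Tendsto (fun n => ∫ x, ‖moll n D x - D x‖ * ‖φ x‖) atTop (𝓝 0) := by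
      have a1 := tendsto_int_mul_one (Z := fun n x => ‖moll n D x - D x‖) (z := fun _ => 0)
        (fun n => ((int_moll hD n).sub hD).norm) (integrable_zero _ _ _) ?_
        hφ.continuous.norm.aesm
        (ae_of_all _ fun x => by simpa using hCφ x)
      · simpa using a1
      · refine (moll_tendsto_L1 hD).congr fun n => ?_
        rw [eLpNorm_one_eq_lintegral_enorm, eLpNorm_one_eq_lintegral_enorm]; simp
    have c : Tendsto (fun n => (∫ x, fderiv ℝ Φ (moll n v x) (moll n D x) * φ x) -
        ∫ x, fderiv ℝ Φ (moll n v x) (D x) * φ x) atTop (𝓝 0) := by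
      rw [tendsto_zero_iff_norm_tendsto_zero]
      have l2 := l1.const_mul C
      rw [mul_zero] at l2
      refine squeeze_zero (fun _ => norm_nonneg _) (fun n => ?_) l2
      have bd : ∀ {b : E3 → ℂ}, Integrable b →
          Integrable (fun x => fderiv ℝ Φ (moll n v x) (b x) * φ x) := by
        intro b hb
        have : Integrable (fun x => fderiv ℝ Φ (moll n v x) (b x)) := by
          refine (hb.norm.const_mul C).mono' (hm2 (smn n).continuous.aesm hb.aesm)
            (ae_of_all _ fun x => ?_)
          exact (le_opNorm _ _).trans (mul_le_mul_of_nonneg_right (hC _) (norm_nonneg _))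
        exact this.locallyIntegrable.int_mul_test hφ
      rw [← integral_sub (bd (int_moll hD n)) (bd hD), ← integral_const_mul]
      refine norm_integral_le_of_norm_le ?_ (ae_of_all _ fun x => ?_)
      · exact ((((int_moll hD n).sub hD).norm).mul_bdd hφ.continuous.norm.aesm
          (ae_of_all _ fun x => by simpa using hCφ x)).const_mul C
      · rw [← sub_mul, ← map_sub, norm_mul, ← mul_assoc]
        exact mul_le_mul_of_nonneg_right ((le_opNorm _ _).trans
          (mul_le_mul_of_nonneg_right (hC _) (norm_nonneg _))) (norm_nonneg _)
    simpa using c.add b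
  exact tendsto_nhds_unique lim1 (by simp_rw [key]; exact lim2.neg)


/-! ### Radial Lipschitz functions -/

lemma hasFDerivAt_norm_of_ne {x : E3} (hx : x ≠ 0) :
    HasFDerivAt (fun y : E3 => ‖y‖) (‖x‖⁻¹ • innerSL ℝ x) x := by
  have hn := norm_ne_zero_iff.2 hx
  have h2 := ((hasStrictFDerivAt_norm_sq x).hasFDerivAt).sqrt (by positivity)
  have h3 : (fun y : E3 => √(‖y‖ ^ 2)) = fun y => ‖y‖ := by
    ext y; exact Real.sqrt_sq (norm_nonneg y)
  rw [h3, Real.sqrt_sq (norm_nonneg x)] at h2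
  have h4 : ‖x‖⁻¹ • innerSL ℝ x = (1 / (2 * ‖x‖)) • 2 • innerSL ℝ x := by
    rw [two_smul, ← two_smul ℝ, smul_smul]; congr 1; field_simp
  rw [h4]; exact h2

lemma inner_single (x : E3) (j : Fin 3) : inner ℝ x (EuclideanSpace.single j (1 : ℝ)) = x j := by
  simp [EuclideanSpace.inner_single_right]

lemma ae_ne_zero : ∀ᵐ x : E3, x ≠ 0 := by simp [ae_iff, measure_singleton]

/-- Along the ray s ↦ (s/|x|)x the composite is φ itself for s near |x|. -/
lemma differentiableAt_of_comp_norm {x : E3} (hx : x ≠ 0)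
    (h : DifferentiableAt ℝ (fun y : E3 => φ ‖y‖) x) : DifferentiableAt ℝ φ ‖x‖ := by
  have hn := norm_pos_iff.2 hx
  have h1 : DifferentiableAt ℝ (fun s => (s / ‖x‖) • x) ‖x‖ := by fun_prop
  have h0 : (‖x‖ / ‖x‖) • x = x := by rw [div_self hn.ne', one_smul]
  have h2 : DifferentiableAt ℝ (fun s => φ ‖(s / ‖x‖) • x‖) ‖x‖ := by
    have h' : DifferentiableAt ℝ (fun y => φ ‖y‖) ((‖x‖ / ‖x‖) • x) := by rwa [h0]
    exact DifferentiableAt.comp (g := fun y => φ ‖y‖) ‖x‖ h' h1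
  refine h2.congr_of_eventuallyEq ?_
  filter_upwards [lt_mem_nhds hn] with s hs
  congr 1; rw [norm_smul, norm_of_nonneg (by positivity), div_mul_cancel₀ _ hn.ne']

/-- Rademacher's theorem is applied to the composite on ℝ³ and then restricted to rays; this avoids
pulling back null sets of radii. -/
lemma ae_diff_norm {K : ℝ≥0} (hφ : LipschitzWith K φ) : ∀ᵐ x : E3, DifferentiableAt ℝ φ ‖x‖ := by
  have h1 : LipschitzWith K (fun x : E3 => φ ‖x‖) := by
    simpa [Function.comp_def] using hφ.comp lipschitzWith_one_norm
  filter_upwards [h1.ae_differentiableAt, ae_ne_zero] with x hx hx0 using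
    differentiableAt_of_comp_norm hx0 hx

lemma partialD_norm_comp {x : E3} (hx : x ≠ 0) (h : DifferentiableAt ℝ φ ‖x‖) (j : Fin 3) :
    partialD j (fun y => φ ‖y‖) x = deriv φ ‖x‖ * (x j / ‖x‖) := by
  unfold partialD; erw [(h.hasDerivAt.comp_hasFDerivAt x (hasFDerivAt_norm_of_ne hx)).fderiv]
  simp only [_root_.smul_apply, innerSL_apply_apply, inner_single, smul_eq_mul]; ring

lemma norm_coord_div_le (x : E3) (j : Fin 3) : ‖x j / ‖x‖‖ ≤ 1 := by
  rw [norm_div, norm_norm]; exact div_le_one_of_le₀ (norm_apply_le x j) (norm_nonneg x)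

lemma exists_bound_radial (hκ : LipschitzWith L κ) (h0 : ∀ r ∉ Icc m M, κ r = 0) :
    ∃ C, ∀ r, ‖κ r‖ ≤ C :=
  (HasCompactSupport.intro isCompact_Icc h0).exists_bound_of_continuous hκ.continuous

lemma meas_coord (j : Fin 3) : Measurable (fun x : E3 => x j) := by fun_prop

lemma measurable_radial_deriv (φ : ℝ → ℝ) (j : Fin 3) :
    Measurable (fun x : E3 => deriv φ ‖x‖ * (x j / ‖x‖)) :=
  ((measurable_deriv φ).comp measurable_norm).mul ((meas_coord j).div measurable_norm)

lemma norm_radial_deriv_le {K : ℝ≥0} (hφ : LipschitzWith K φ) (x : E3) (j : Fin 3) :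
    ‖deriv φ ‖x‖ * (x j / ‖x‖)‖ ≤ K := by
  rw [norm_mul]
  calc _ ≤ (K : ℝ) * 1 := mul_le_mul (norm_deriv_le_of_lipschitz hφ) (norm_coord_div_le x j)
        (norm_nonneg _) K.2
    _ = K := mul_one _

lemma lineDeriv_neg_test {ψ : E3 → ℝ} (h : IsTest ψ) (x : E3) (j : Fin 3) :
    lineDeriv ℝ ψ x (-(EuclideanSpace.single j (1 : ℝ))) = -partialD j ψ x := by
  rw [(h.differentiable x).lineDeriv_eq_fderiv, map_neg]; rfl

lemma WDeriv.ofReal {j : Fin 3} {v D : E3 → ℝ} (h : WDeriv j v D) :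
    WDeriv j (fun x => (v x : ℂ)) (fun x => (D x : ℂ)) := by
  have l1 : LocallyIntegrable (fun x => (v x : ℂ)) := fun x => (h.left x).imp fun _ hs => ⟨hs.1, hs.2.ofReal⟩
  have l2 : LocallyIntegrable (fun x => (D x : ℂ)) := fun x => (h.right x).imp fun _ hs => ⟨hs.1, hs.2.ofReal⟩
  refine ⟨l1, l2, fun ψ hψ => ?_⟩
  have i1 := l2.int_mul_test hψ
  have i2 := l1.int_mul_test (hψ.partialD j)
  apply Complex.ext
  · rw [Complex.neg_re]
    have e1 := integral_re i1
    have e2 := integral_re i2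
    simp at e1 e2; rw [← e1, ← e2]
    have := h.weak _ hψ.re
    simp_rw [partialD_re hψ.differentiable] at this; simpa [mul_re] using this
  · rw [Complex.neg_im]
    have e1 := integral_im i1
    have e2 := integral_im i2
    simp at e1 e2; rw [← e1, ← e2]
    have := h.weak _ hψ.im
    simp_rw [partialD_im hψ.differentiable] at this; simpa [mul_im] using this

/-- Two Lipschitz functions, one of compact support, can be integrated by parts with their almost
everywhere line derivatives. At almost every x the chain rule identifies the line derivative of the
radial function. -/
lemma wderiv_radial {K : ℝ≥0} (hφ : LipschitzWith K φ) (j : Fin 3) :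
    WDeriv j (fun x : E3 => (φ ‖x‖ : ℂ)) (fun x => ((deriv φ ‖x‖ * (x j / ‖x‖) : ℝ) : ℂ)) := by
  have hcr : Continuous (fun x : E3 => φ ‖x‖) := hφ.continuous.comp continuous_norm
  have hlipn : LipschitzWith K (fun x : E3 => φ ‖x‖) := by
    simpa [Function.comp_def] using hφ.comp lipschitzWith_one_norm
  have hlr := (l2loc_of_bounded (measurable_radial_deriv φ j).aesm
      (norm_radial_deriv_le hφ · j)).locallyIntegrable
  suffices real : ∀ ψ : E3 → ℝ, IsTest ψ →
      ∫ x, (deriv φ ‖x‖ * (x j / ‖x‖)) * ψ x = -∫ x, φ ‖x‖ * partialD j ψ x from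
    WDeriv.ofReal ⟨hcr.locallyIntegrable, hlr, real⟩
  intro ψ hψ
  obtain ⟨D, hD⟩ := ContDiff.lipschitzWith_of_hasCompactSupport hψ.compact hψ.smooth (by simp)
  have h := LipschitzWith.integral_lineDeriv_mul_eq (μ := (volume : Measure E3)) hlipn hD hψ.compact
    (EuclideanSpace.single j 1)
  simp_rw [lineDeriv_neg_test hψ] at h; rw [← integral_neg]
  refine Eq.trans ?_ (h.trans ?_)
  · refine integral_congr_ae ?_
    filter_upwards [ae_diff_norm hφ, ae_ne_zero] with x hx hx0
    have hd : DifferentiableAt ℝ (fun y => φ ‖y‖) x :=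
      DifferentiableAt.comp x hx (hasFDerivAt_norm_of_ne hx0).differentiableAt
    rw [hd.lineDeriv_eq_fderiv, ← partialD_norm_comp hx0 hx j]; rfl
  · exact int_congr fun x => by ring

/-! ### Membership in the magnetic Sobolev space -/

lemma memLp_C3 {G : E3 → C3} (h : ∀ j, MemLp (fun x => G x j) 2) : MemLp G 2 := by
  have hm : AESM G := by
    have h1 := (aemeasurable_pi_lambda _ fun j => (h j).1.aemeasurable).aesm
    exact (PiLp.continuous_toLp 2 (fun _ : Fin 3 => ℂ)).comp_aestronglyMeasurable h1
  have hs : MemLp (fun x => ∑ j, ‖G x j‖) 2 := memLp_finsetSum _ fun j _ => (h j).norm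
  refine hs.mono hm (ae_of_all _ fun x => ?_)
  rw [norm_of_nonneg (Finset.sum_nonneg fun _ _ => norm_nonneg _), EuclideanSpace.norm_eq]
  refine Real.sqrt_le_iff.2 ⟨Finset.sum_nonneg fun _ _ => norm_nonneg _, ?_⟩
  exact Finset.sum_sq_le_sq_sum_of_nonneg fun _ _ => norm_nonneg _

lemma memLp_comp {G : E3 → C3} (h : MemLp G 2) (j : Fin 3) : MemLp (fun x => G x j) 2 := by
  refine h.mono ?_ (ae_of_all _ fun x => norm_apply_le (G x) j)
  have : Continuous (fun y : C3 => y j) := by fun_prop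
  exact this.comp_aestronglyMeasurable h.1

lemma MemL2loc.l2loc (h : MemL2loc A) : L2loc A := by
  intro K hK
  rw [memLp_indicator_iff_restrict hK.measurableSet,
    memLp_two_iff_integrable_sq_norm h.aesm.restrict]
  exact h.locInt.integrableOn_isCompact hK

lemma MemL2loc.component (h : MemL2loc A) (j : Fin 3) : L2loc (fun x => (A x j : ℂ)) := by
  intro K hK
  have h1 := h.l2loc K hK
  rw [memLp_indicator_iff_restrict hK.measurableSet] at h1 ⊢
  have : Continuous (fun y : E3 => (y j : ℂ)) := by fun_prop
  refine h1.mono (this.comp_aestronglyMeasurable h1.1) (ae_of_all _ fun x => ?_)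
  rw [norm_real]; exact norm_apply_le (A x) j

/-- The term Au is locally integrable as a product of L²_loc functions, so the single integral in
the definition of H¹_A may be split, and ∇u = ∇_A u - iAu becomes an ordinary weak gradient to which
the calculus of `WDeriv` applies. -/
lemma wderiv_iff_weak (hA : MemL2loc A) (hu : MemLp u 2) (hg : MemLp g 2) (j : Fin 3) :
    WDeriv j u (fun x => g x j - I * A x j * u x) ↔ ∀ φ : E3 → ℂ, IsTest φ →
      ∫ x, g x j * φ x = ∫ x, (-(u x * partialD j φ x) + I * A x j * u x * φ x) := by
  have lu := hu.l2loc.locallyIntegrable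
  have lg := (memLp_comp hg j).l2loc.locallyIntegrable
  have lA : LocallyIntegrable (fun x => I * A x j * u x) := by
    simpa [Pi.smul_def, smul_eq_mul, mul_assoc] using ((hA.component j).mul hu.l2loc).smul I
  have e : ∀ φ : E3 → ℂ, IsTest φ → ((∫ x, (g x j - I * A x j * u x) * φ x =
      -∫ x, u x * partialD j φ x) ↔
      ∫ x, g x j * φ x = ∫ x, (-(u x * partialD j φ x) + I * A x j * u x * φ x)) := fun φ hφ => by
    have i2 := lA.int_mul_test hφ
    have e := integral_add (lu.int_mul_test (hφ.partialD j)).neg i2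
    simp only [Pi.neg_apply, integral_neg] at e
    simp_rw [e, sub_mul]; rw [integral_sub (lg.int_mul_test hφ) i2, sub_eq_iff_eq_add]
  exact ⟨fun h φ hφ => (e φ hφ).1 (h.weak φ hφ), fun h => ⟨lu, lg.sub lA, fun φ hφ => (e φ hφ).2 (h φ hφ)⟩⟩

lemma IsH1A.wderiv (hA : MemL2loc A) (h : IsH1A A u g) (j : Fin 3) :
    WDeriv j u (fun x => g x j - I * A x j * u x) :=
  (wderiv_iff_weak hA h.memLp h.memLp_grad j).2 (h.weak j)

lemma isH1A_of_wderiv (hu : MemLp u 2) (hg : MemLp g 2) (hA : MemL2loc A)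
    (h : ∀ j, WDeriv j u (fun x => g x j - I * A x j * u x)) : IsH1A A u g :=
  ⟨hu, hg, fun j => (wderiv_iff_weak hA hu hg j).1 (h j)⟩

/-- Multiplication of a function in `H¹_A` by a bounded function. -/
lemma IsH1A.mul (hA : MemL2loc A) (h : IsH1A A u g) {v : E3 → ℂ} {D : Fin 3 → E3 → ℂ}
    (hv : ∀ j, WDeriv j v (D j)) (hC : ∀ x, ‖v x‖ ≤ C) (hD : ∀ j, L2loc (D j)) {G : E3 → C3}
    (hG : MemLp G 2) (hGeq : ∀ j x, G x j = D j x * u x + v x * g x j) :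
    IsH1A A (fun x => v x * u x) G := by
  refine isH1A_of_wderiv ?_ hG hA fun j => ?_
  · refine (h.memLp.norm.const_mul C).mono (((hv 0).left.aesm).mul h.memLp.1) (ae_of_all _ fun x => ?_)
    rw [norm_mul]; exact (mul_le_mul_of_nonneg_right (hC x) (norm_nonneg _)).trans (le_abs_self _)
  · convert (hv j).mul hC (hD j) (h.wderiv hA j) h.memLp.l2loc using 1
    ext x; rw [hGeq]; ring

/-! ### An equivariant truncation -/

/-- A smooth bounded truncation of the identity of `ℂ` that commutes with rotations. -/
def trunc (n : ℕ) (z : ℂ) : ℂ := ((1 + normSq z / (n + 1))⁻¹ : ℝ) * z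

/-- The real derivative of `trunc`. -/
def truncD (n : ℕ) (z ζ : ℂ) : ℂ := ((1 + normSq z / (n + 1))⁻¹ : ℝ) * ζ -
    ((2 * (starRingEnd ℂ z * ζ).re / (n + 1)) * ((1 + normSq z / (n + 1))⁻¹) ^ 2 : ℝ) * z

lemma trunc_den_pos (n : ℕ) (z : ℂ) : 0 < 1 + normSq z / (n + 1) := by
  have := Complex.normSq_nonneg z
  positivity

lemma contDiff_normSq : ContDiff ℝ C∞ normSq := by
  have : (normSq : ℂ → ℝ) = fun z => reCLM z * reCLM z + Complex.imCLM z * Complex.imCLM z := by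
    ext z; simp [normSq_apply]
  rw [this]; fun_prop

lemma contDiff_trunc (n : ℕ) : ContDiff ℝ 1 (trunc n) := by
  unfold trunc
  have h1 : ContDiff ℝ 1 (fun z => (1 + normSq z / (n + 1))⁻¹) := by
    refine ContDiff.inv ?_ fun z => (trunc_den_pos n z).ne'
    exact contDiff_const.add ((contDiff_normSq.of_le (by exact_mod_cast le_top)).div_const _)
  exact (ofRealCLM.contDiff.comp h1).mul contDiff_id

lemma fderiv_trunc (n : ℕ) (z ζ : ℂ) : fderiv ℝ (trunc n) z ζ = truncD n z ζ := by
  -- The map is differentiable only over ℝ, so its derivative in the direction ζ is computed along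
  -- the real line z + tζ.
  have hline : HasDerivAt (fun t : ℝ => z + t * ζ) ζ 0 := by
    have h1 : HasDerivAt (fun t : ℝ => (t : ℂ)) 1 0 := ofRealCLM.hasDerivAt
    simpa using (h1.mul_const ζ).const_add z
  have h1 : HasDerivAt (fun t : ℝ => trunc n (z + t * ζ)) (fderiv ℝ (trunc n) z ζ) 0 := by
    have hd' : HasFDerivAt (trunc n) (fderiv ℝ (trunc n) z) (z + (0 : ℂ) * ζ) := by
      simpa using (((contDiff_trunc n).differentiable one_ne_zero) z).hasFDerivAt
    exact hd'.comp_hasDerivAt 0 hline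
  have hq : HasDerivAt (fun t : ℝ => normSq (z + t * ζ)) (2 * (starRingEnd ℂ z * ζ).re) 0 := by
    have : (fun t : ℝ => normSq (z + t * ζ)) =
        fun t => (z.re + t * ζ.re) * (z.re + t * ζ.re) + (z.im + t * ζ.im) * (z.im + t * ζ.im) := by
      ext t; simp [normSq_apply]
    rw [this]
    have e : ∀ a b : ℝ, HasDerivAt (fun t => a + t * b) b 0 := fun a b => by
      simpa using ((hasDerivAt_id 0).mul_const b).const_add a
    convert! ((e z.re ζ.re).mul (e z.re ζ.re)).add ((e z.im ζ.im).mul (e z.im ζ.im)) using 1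
    simp; ring
  have hinv : HasDerivAt (fun t : ℝ => (1 + normSq (z + t * ζ) / (n + 1))⁻¹)
      (-(2 * (starRingEnd ℂ z * ζ).re / (n + 1)) / (1 + normSq z / (n + 1)) ^ 2) 0 := by
    have := ((hq.div_const (n + 1)).const_add 1).inv (by simpa using (trunc_den_pos n z).ne')
    simp only [ofReal_zero, zero_mul, add_zero] at this; exact this
  rw [h1.unique (hinv.ofReal_comp.mul hline), truncD]; simp; field_simp; ring

/-- Infinitesimal rotation equivariance. It makes the term iAv transform like v, so that ∇_A of the
truncation of v is `truncD` applied to ∇_A v, without any leftover containing A. -/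
lemma truncD_I_mul (n : ℕ) (z : ℂ) (a : ℝ) : truncD n z (I * a * z) = I * a * trunc n z := by
  have : (starRingEnd ℂ z * (I * a * z)).re = 0 := by simp; ring
  rw [truncD, this, trunc]; push_cast; ring

lemma norm_trunc_le (n : ℕ) (z : ℂ) : ‖trunc n z‖ ≤ ‖z‖ := by
  have hp := trunc_den_pos n z
  rw [trunc, norm_mul, norm_real, norm_of_nonneg (by positivity)]
  refine mul_le_of_le_one_left (norm_nonneg _) (inv_le_one_of_one_le₀ ?_)
  have : 0 ≤ normSq z / (n + 1) := div_nonneg (Complex.normSq_nonneg z) (by positivity)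
  linarith

lemma norm_trunc_le_const (n : ℕ) (z : ℂ) : ‖trunc n z‖ ≤ n + 1 := by
  have hp := trunc_den_pos n z
  rw [trunc, norm_mul, norm_real, norm_of_nonneg (by positivity),
    inv_mul_le_iff₀ hp, normSq_eq_norm_sq]
  have : (1 + ‖z‖ ^ 2 / (n + 1)) * (n + 1) = (n + 1) + ‖z‖ ^ 2 := by field_simp
  rw [this]; nlinarith [(Nat.cast_nonneg n : 0 ≤ n)]

/-- The constant is 1 + 2, one for each term of `truncD`. It is independent of n, which provides the
majorant when the truncation is removed. -/
lemma norm_truncD_le (n : ℕ) (z ζ : ℂ) : ‖truncD n z ζ‖ ≤ 3 * ‖ζ‖ := by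
  have hp := trunc_den_pos n z
  set m := (1 + normSq z / (n + 1))⁻¹ with hm
  have hm0 : 0 < m := by positivity
  have hn0 : (0 : ℝ) < n + 1 := by positivity
  have hmm : m * (1 + ‖z‖ ^ 2 / (n + 1)) = 1 := by
    rw [hm, normSq_eq_norm_sq] at *; exact inv_mul_cancel₀ hp.ne'
  have hm1 : m ≤ 1 := by
    have : 0 ≤ m * (‖z‖ ^ 2 / (n + 1)) := by positivity
    nlinarith
  have hm2 : m * (‖z‖ ^ 2 / (n + 1)) ≤ 1 := by nlinarith
  have hre : |(starRingEnd ℂ z * ζ).re| ≤ ‖z‖ * ‖ζ‖ := by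
    refine (abs_re_le_norm _).trans ?_
    rw [norm_mul, norm_conj]
  rw [truncD, ← hm]
  refine (norm_sub_le _ _).trans ?_
  rw [norm_mul, norm_mul, norm_real, norm_real, norm_of_nonneg hm0.le, norm_mul,
    norm_of_nonneg (by positivity : 0 ≤ m ^ 2), norm_div, norm_mul,
    norm_of_nonneg hn0.le, norm_eq_abs, norm_eq_abs, abs_of_pos (by norm_num : (0 : ℝ) < 2)]
  have a1 : m * ‖ζ‖ ≤ ‖ζ‖ := mul_le_of_le_one_left (norm_nonneg _) hm1
  have a2 : 2 * |(starRingEnd ℂ z * ζ).re| / (n + 1) * m ^ 2 * ‖z‖ ≤ 2 * ‖ζ‖ := by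
    calc _ ≤ 2 * (‖z‖ * ‖ζ‖) / (n + 1) * m ^ 2 * ‖z‖ := by gcongr
      _ = 2 * ‖ζ‖ * (m * (m * (‖z‖ ^ 2 / (n + 1)))) := by ring
      _ ≤ 2 * ‖ζ‖ * (1 * 1) := by gcongr
      _ = _ := by ring
  linarith

lemma trunc_tendsto (z : ℂ) : Tendsto (fun n => trunc n z) atTop (𝓝 z) := by
  have h0 : Tendsto (fun n : ℕ => normSq z / (n + 1)) atTop (𝓝 0) := by
    simpa [div_eq_mul_inv, mul_comm] using
      (tendsto_one_div_add_atTop_nhds_zero_nat).const_mul (normSq z)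
  have h1 : Tendsto (fun n : ℕ => (1 + normSq z / (n + 1))⁻¹) atTop (𝓝 1) := by
    simpa using (h0.const_add 1).inv₀ (by norm_num)
  simpa [trunc] using ((continuous_ofReal.tendsto _).comp h1).mul_const z

lemma truncD_tendsto (z ζ : ℂ) : Tendsto (fun n => truncD n z ζ) atTop (𝓝 ζ) := by
  have hi : Tendsto (fun n : ℕ => 1 / ((n : ℝ) + 1)) atTop (𝓝 0) :=
    tendsto_one_div_add_atTop_nhds_zero_nat
  have h0 : Tendsto (fun n : ℕ => normSq z / (n + 1)) atTop (𝓝 0) := by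
    simpa [div_eq_mul_inv, mul_comm] using hi.const_mul (normSq z)
  have h1 : Tendsto (fun n : ℕ => (1 + normSq z / (n + 1))⁻¹) atTop (𝓝 1) := by
    simpa using (h0.const_add 1).inv₀ (by norm_num)
  have h3 : Tendsto (fun n : ℕ => (2 * (starRingEnd ℂ z * ζ).re / (n + 1)) *
      ((1 + normSq z / (n + 1))⁻¹) ^ 2) atTop (𝓝 0) := by
    have a : Tendsto (fun n : ℕ => 2 * (starRingEnd ℂ z * ζ).re / (n + 1)) atTop (𝓝 0) := by
      simpa [div_eq_mul_inv, mul_comm] using hi.const_mul (2 * (starRingEnd ℂ z * ζ).re)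
    simpa using a.mul (h1.pow 2)
  have := (((continuous_ofReal.tendsto _).comp h1).mul_const ζ).sub
    (((continuous_ofReal.tendsto _).comp h3).mul_const z)
  simpa [truncD, Function.comp_def] using this


/-! ### Density of test functions among functions supported in annuli -/

/-- The function vanishes outside the annulus `m ≤ |x| ≤ M`. -/
def SuppAnn (m M : ℝ) (v : E3 → F) : Prop := ∀ x, ‖x‖ < m ∨ M < ‖x‖ → v x = 0

/-- The closed annulus. -/
def ann (m M : ℝ) : Set E3 := {x | m ≤ ‖x‖ ∧ ‖x‖ ≤ M}

lemma isClosed_ann (m M : ℝ) : IsClosed (ann m M) :=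
  (isClosed_le continuous_const continuous_norm).inter (isClosed_le continuous_norm continuous_const)

lemma compact_ann (m M : ℝ) : IsCompact (ann m M) :=
  (isCompact_closedBall 0 M).of_isClosed_subset (isClosed_ann m M) fun x hx => by simpa using hx.2

lemma measSet_ann (m M : ℝ) : MeasurableSet (ann m M) := (isClosed_ann m M).measurableSet

lemma SuppAnn.eq_zero (h : SuppAnn m M v) {x : E3} (hx : x ∉ ann m M) : v x = 0 := by
  apply h
  by_contra hc; push Not at hc; exact hx hc

lemma SuppAnn.of_notMem (h : ∀ x ∉ ann m M, v x = 0) : SuppAnn m M v := by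
  intro x hx; apply h; rintro ⟨h1, h2⟩; rcases hx with h | h <;> linarith

lemma memLp_conj {Z : E3 → ℂ} (h : MemLp Z 2) : MemLp (fun x => conj (Z x)) 2 :=
  h.mono (Complex.continuous_conj.comp_aestronglyMeasurable h.1) (ae_of_all _ fun x => by simp)

lemma tendsto_int_mul_conj {k : E3 → ℂ} {Z : ℕ → E3 → ℂ} {z : E3 → ℂ} (hk : MemLp k 2)
    (hZ : ∀ n, MemLp (Z n) 2) (hz : MemLp z 2)
    (h : Tendsto (fun n => eLpNorm (Z n - z) 2 volume) atTop (𝓝 0)) :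
    Tendsto (fun n => ∫ x, k x * conj (Z n x)) atTop (𝓝 (∫ x, k x * conj (z x))) := by
  refine tendsto_int_mul hk (fun n => memLp_conj (hZ n)) (memLp_conj hz) ?_
  refine h.congr fun n => eLpNorm_congr_norm_ae (ae_of_all _ fun x => ?_)
  simp only [Pi.sub_apply, ← map_sub, norm_conj]

lemma memLp_mul_bdd {k w : E3 → ℂ} (hk : MemLp k 2) (hw : AESM w) (hC : ∀ x, ‖w x‖ ≤ C) :
    MemLp (fun x => k x * w x) 2 := by
  refine (hk.norm.const_mul C).mono (hk.1.mul hw) (ae_of_all _ fun x => ?_)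
  rw [norm_mul, mul_comm]
  exact (mul_le_mul_of_nonneg_right (hC x) (norm_nonneg _)).trans (le_abs_self _)

lemma integral_pairing_split {k0 v : E3 → ℂ} {k G : E3 → C3} (hk0 : MemLp k0 2) (hk : MemLp k 2)
    (hv : MemLp v 2) (hG : MemLp G 2) :
    ∫ x, ((∑ j, k x j * conj (G x j)) + k0 x * conj (v x)) =
      (∑ j, ∫ x, k x j * conj (G x j)) + ∫ x, k0 x * conj (v x) := by
  rw [integral_add, integral_finsetSum]
  · exact fun j _ => int_mul (memLp_comp hk j) (memLp_conj (memLp_comp hG j))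
  · exact integrable_finsetSum _ fun j _ => int_mul (memLp_comp hk j) (memLp_conj (memLp_comp hG j))
  · exact int_mul hk0 (memLp_conj hv)

/-- The bump radius is at most 1 and eventually below m/2; this is the origin of the enlarged
annulus with radii m/2 and M + 1 used from here on. -/
lemma suppAnn_moll [NormedSpace ℝ F] (hm : 0 < m) (h : SuppAnn m M v) :
    ∀ᶠ n : ℕ in atTop, SuppAnn (m / 2) (M + 1) (moll n v) := by
  have h1 : ∀ᶠ n : ℕ in atTop, 1 / (n + 1) < m / 2 :=
    (tendsto_one_div_add_atTop_nhds_zero_nat).eventually (gt_mem_nhds (by linarith))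
  filter_upwards [h1] with n hn x hx
  refine moll_zero_of fun y hy => h y ?_
  have h10 : 1 / ((n : ℝ) + 1) ≤ 1 := by rw [div_le_one (by positivity)]; linarith
  have hd : |‖y‖ - ‖x‖| ≤ dist y x := by rw [dist_eq_norm]; exact abs_norm_sub_norm_le y x
  have := abs_le.1 hd
  rcases hx with hx | hx
  · left; linarith
  · right; linarith

/-- Mollify v. The plain gradient converges in L². The term A times the mollification is handled by
dominated convergence, and for this v must be bounded, since A is only locally square integrable. -/
lemma density_bounded (hA : MemL2loc A) {k0 : E3 → ℂ} {k : E3 → C3} (hk0 : MemLp k0 2)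
    (hk : MemLp k 2) (hm : 0 < m)
    (H : ∀ φ : E3 → ℂ, IsTest φ → SuppAnn (m / 2) (M + 1) φ → ∫ x, ((∑ j, k x j * conj (partialD j φ x + I * A x j * φ x)) + k0 x * conj (φ x)) = 0)
    {v : E3 → ℂ} {G : E3 → C3} (hv : IsH1A A v G) (hvs : SuppAnn m M v) (hC : ∀ x, ‖v x‖ ≤ C) :
    ∫ x, ((∑ j, k x j * conj (G x j)) + k0 x * conj (v x)) = 0 := by
  have hvl := hv.memLp.l2loc.locallyIntegrable
  set K := ann m M
  have hK := compact_ann m M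
  set K1 := Metric.cthickening 1 K with hK1def
  have hK1 : IsCompact K1 := hK.cthickening
  have hvK : ∀ x ∉ K, v x = 0 := fun x hx => hvs.eq_zero hx
  set D : Fin 3 → E3 → ℂ := fun j x => G x j - I * A x j * v x with hDdef
  have hAv : ∀ j, MemLp (fun x => I * A x j * v x) 2 := by
    intro j
    simpa [mul_assoc] using ((hA.component j).memLp_mul_bounded hv.memLp.1 hC hK hvK).const_mul I
  have hD2 : ∀ j, MemLp (D j) 2 := fun j => (memLp_comp hv.memLp_grad j).sub (hAv j)
  have hwd : ∀ j, WDeriv j v (D j) := fun j => hv.wderiv hA j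
  have hmn : ∀ n, ∀ x, ‖moll n v x‖ ≤ C := fun n x => moll_norm_le hC x
  have hmz : ∀ n, ∀ x ∉ K1, moll n v x = 0 := fun n x hx => moll_zero_cthick n hvK hx
  have hmm : ∀ n, AESM (moll n v) := fun n => (moll_contDiff n hvl).continuous.aesm
  have hAn : ∀ n j, MemLp (fun x => I * A x j * moll n v x) 2 := by
    intro n j
    simpa [mul_assoc] using ((hA.component j).memLp_mul_bounded (hmm n) (hmn n) hK1 (hmz n)).const_mul I
  let Gn : ℕ → E3 → C3 := fun n x => WithLp.toLp 2 fun j => moll n (D j) x + I * A x j * moll n v x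
  have hGn : ∀ n, MemLp (Gn n) 2 :=
    fun n => memLp_C3 fun j => (moll_memLp_two (hD2 j) n).add (hAn n j)
  have hvn := moll_memLp_two hv.memLp
  have key : ∀ᶠ n in atTop,
      (∑ j, ∫ x, k x j * conj (Gn n x j)) + ∫ x, k0 x * conj (moll n v x) = 0 := by
    filter_upwards [suppAnn_moll hm hvs] with n hn
    rw [← integral_pairing_split hk0 hk (hvn n) (hGn n)]
    have := H _ (isTest_moll n hvl hK hvK) hn
    simp_rw [(hwd _).partialD_moll] at this; exact this
  have lim0 := tendsto_int_mul_conj hk0 hvn hv.memLp (moll_tendsto_L2 hv.memLp)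
  have limj : ∀ j, Tendsto (fun n => ∫ x, k x j * conj (Gn n x j)) atTop
      (𝓝 (∫ x, k x j * conj (G x j))) := by
    intro j
    have hkj := memLp_comp hk j
    have l1 := tendsto_int_mul_conj hkj (moll_memLp_two (hD2 j)) (hD2 j) (moll_tendsto_L2 (hD2 j))
    have l2 : Tendsto (fun n => ∫ x, k x j * conj (I * A x j * moll n v x)) atTop
        (𝓝 (∫ x, k x j * conj (I * A x j * v x))) := by
      refine tendsto_integral_of_dominated_convergence
        (fun x => ‖k x j‖ * ‖K1.indicator (fun x => (A x j : ℂ)) x‖ * C) ?_ ?_ ?_ ?_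
      · exact fun n => hkj.1.mul (memLp_conj (hAn n j)).1
      · exact (int_mul hkj.norm ((hA.component j) K1 hK1).norm).mul_const C
      · refine fun n => ae_of_all _ fun x => ?_
        by_cases hx : x ∈ K1
        · simp only [hx, indicator_of_mem, norm_mul, norm_conj, norm_I, one_mul, mul_assoc]
          exact mul_le_mul_of_nonneg_left (mul_le_mul_of_nonneg_left (hmn n x) (norm_nonneg _))
            (norm_nonneg _)
        · simp [hmz n x hx, hx]
      · filter_upwards [moll_ae_tendsto hvl] with x hx
        exact (((Complex.continuous_conj.tendsto _).comp (hx.const_mul _)).const_mul _)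
    have l3 := l1.add l2
    have e : (∫ x, k x j * conj (D j x)) + ∫ x, k x j * conj (I * A x j * v x) =
        ∫ x, k x j * conj (G x j) := by
      rw [← integral_add (int_mul hkj (memLp_conj (hD2 j))) (int_mul hkj (memLp_conj (hAv j)))]
      refine int_congr fun x => ?_
      simp only [hDdef, map_sub]; ring
    rw [e] at l3
    refine l3.congr fun n => ?_
    rw [← integral_add (int_mul hkj (memLp_conj (moll_memLp_two (hD2 j) n)))
        (int_mul hkj (memLp_conj (hAn n j)))]
    refine int_congr fun x => ?_
    simp only [Gn, map_add]; ring
  have lim := (tendsto_finsetSum Finset.univ fun j _ => limj j).add lim0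
  rw [integral_pairing_split hk0 hk hv.memLp hv.memLp_grad]
  exact tendsto_nhds_unique_of_eventuallyEq lim tendsto_const_nhds key

/-- A relation that holds for all test functions supported in an annulus extends to all functions
of `H¹_A` supported in a smaller annulus. -/
lemma density (hA : MemL2loc A) {k0 : E3 → ℂ} {k : E3 → C3} (hk0 : MemLp k0 2) (hk : MemLp k 2)
    (hm : 0 < m)
    (H : ∀ φ : E3 → ℂ, IsTest φ → SuppAnn (m / 2) (M + 1) φ → ∫ x, ((∑ j, k x j * conj (partialD j φ x + I * A x j * φ x)) + k0 x * conj (φ x)) = 0)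
    {v : E3 → ℂ} {G : E3 → C3} (hv : IsH1A A v G) (hvs : SuppAnn m M v) (hGs : SuppAnn m M G) :
    ∫ x, ((∑ j, k x j * conj (G x j)) + k0 x * conj (v x)) = 0 := by
  have hK := compact_ann m M
  have hvi := int_of_compact hv.memLp.l2loc.locallyIntegrable hK fun x hx => hvs.eq_zero hx
  have hwd : ∀ j, WDeriv j v (fun x => G x j - I * A x j * v x) := fun j => hv.wderiv hA j
  have hDi : ∀ j, Integrable (fun x => G x j - I * A x j * v x) :=
    fun j => int_of_compact (hwd j).right hK fun x hx => by simp [hvs.eq_zero hx, hGs.eq_zero hx]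
  let Gn : ℕ → E3 → C3 := fun n x => WithLp.toLp 2 fun j => truncD n (v x) (G x j)
  have htm : ∀ n {a : E3 → ℂ}, AESM a → AESM (fun x => truncD n (v x) (a x)) := by
    intro n a ha; simp_rw [← fderiv_trunc]
    exact isBoundedBilinearMap_apply.continuous.comp_aestronglyMeasurable
      ((((contDiff_trunc n).continuous_fderiv one_ne_zero).comp_aestronglyMeasurable
        hv.memLp.1).prodMk ha)
  have hGn : ∀ n, MemLp (Gn n) 2 := fun n => memLp_C3 fun j => by
    have hGj := memLp_comp hv.memLp_grad j
    refine (hGj.norm.const_mul 3).mono (htm n hGj.1) (ae_of_all _ fun x => ?_)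
    exact (norm_truncD_le n _ _).trans (le_abs_self _)
  have hvn : ∀ n, MemLp (fun x => trunc n (v x)) 2 := fun n =>
    hv.memLp.mono ((contDiff_trunc n).continuous.comp_aestronglyMeasurable hv.memLp.1)
      (ae_of_all _ fun x => norm_trunc_le n _)
  have hH : ∀ n, IsH1A A (fun x => trunc n (v x)) (Gn n) := by
    intro n
    refine isH1A_of_wderiv (hvn n) (hGn n) hA fun j => ?_
    -- The chain rule acts on the plain gradient, which is only integrable; `truncD_I_mul` converts
    -- the result into a statement about the magnetic gradient, which is in L².
    convert (hwd j).comp hvi (hDi j) (contDiff_trunc n) (C := 3) ?_ using 1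
    · ext x; rw [map_sub, fderiv_trunc, fderiv_trunc, truncD_I_mul]
    · intro z
      refine ContinuousLinearMap.opNorm_le_bound _ (by norm_num) fun ζ => ?_
      rw [fderiv_trunc]; exact norm_truncD_le n z ζ
  have key : ∀ n, ∫ x, ((∑ j, k x j * conj (Gn n x j)) + k0 x * conj (trunc n (v x))) = 0 := by
    intro n
    refine density_bounded hA hk0 hk hm H (hH n) ?_ fun x => norm_trunc_le_const n _
    exact fun x hx => by simp [hvs x hx, trunc]
  have lim : Tendsto (fun n => ∫ x, ((∑ j, k x j * conj (Gn n x j)) +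
      k0 x * conj (trunc n (v x)))) atTop
      (𝓝 (∫ x, ((∑ j, k x j * conj (G x j)) + k0 x * conj (v x)))) := by
    refine tendsto_integral_of_dominated_convergence
      (fun x => (∑ j, ‖k x j‖ * (3 * ‖G x j‖)) + ‖k0 x‖ * ‖v x‖) ?_ ?_ ?_ ?_
    · intro n
      refine AEStronglyMeasurable.add ?_ (hk0.1.mul (memLp_conj (hvn n)).1)
      exact aestronglyMeasurable_fun_sum _ fun j _ =>
        (memLp_comp hk j).1.mul (memLp_conj (memLp_comp (hGn n) j)).1
    · refine Integrable.add (integrable_finsetSum _ fun j _ => ?_) (int_mul hk0.norm hv.memLp.norm)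
      exact int_mul (memLp_comp hk j).norm ((memLp_comp hv.memLp_grad j).norm.const_mul 3)
    · refine fun n => ae_of_all _ fun x => (norm_add_le _ _).trans (add_le_add ?_ ?_)
      · refine (norm_sum_le _ _).trans (Finset.sum_le_sum fun j _ => ?_)
        rw [norm_mul, norm_conj]
        exact mul_le_mul_of_nonneg_left (norm_truncD_le n _ _) (norm_nonneg _)
      · rw [norm_mul, norm_conj]
        exact mul_le_mul_of_nonneg_left (norm_trunc_le n _) (norm_nonneg _)
    · refine ae_of_all _ fun x => Tendsto.add (tendsto_finsetSum _ fun j _ => ?_) ?_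
      · exact ((Complex.continuous_conj.tendsto _).comp (truncD_tendsto _ _)).const_mul _
      · exact ((Complex.continuous_conj.tendsto _).comp (trunc_tendsto _)).const_mul _
  simp_rw [key] at lim; exact (tendsto_nhds_unique lim tendsto_const_nhds)

/-- Integration by parts for covariant derivatives. -/
lemma IsH1A.integral_mul_conj (hA : MemL2loc A) (h : IsH1A A u g) (hm : 0 < m) {v : E3 → ℂ}
    {G : E3 → C3} (hv : IsH1A A v G) (hvs : SuppAnn m M v) (hGs : SuppAnn m M G) (j : Fin 3) :
    ∫ x, g x j * conj (v x) = -∫ x, u x * conj (G x j) := by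
  have hgj := memLp_comp h.memLp_grad j
  -- Placing u in slot j and `g x j` in the zero-order slot turns the integration by parts formula
  -- into a vanishing relation of the type covered by `density`.
  let k : E3 → C3 := fun x => WithLp.toLp 2 fun i => if i = j then u x else 0
  have hk : MemLp k 2 := memLp_C3 fun i => by
    by_cases hi : i = j
    · simpa [k, hi] using h.memLp
    · simp [k, hi]
  have hsum : ∀ (x : E3) (c : Fin 3 → ℂ), ∑ i, k x i * c i = u x * c j := by intro x c; simp [k]
  have := density hA hgj hk hm ?_ hv hvs hGs
  · simp_rw [hsum] at this
    rw [integral_add (int_mul h.memLp (memLp_conj (memLp_comp hv.memLp_grad j)))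
      (int_mul hgj (memLp_conj hv.memLp))] at this
    exact eq_neg_of_add_eq_zero_right this
  · intro φ hφ _; simp_rw [hsum]
    have h1 := h.weak j _ hφ.conj
    simp_rw [partialD_conj hφ.differentiable] at h1
    have lA : LocallyIntegrable (fun x => I * A x j * u x) := by
      simpa [Pi.smul_def, smul_eq_mul, mul_assoc] using ((hA.component j).mul h.memLp.l2loc).smul I
    have i3 := (h.memLp.l2loc.locallyIntegrable).int_mul_test (hφ.partialD j).conj
    have e : ∀ x, u x * conj (partialD j φ x + I * A x j * φ x) + g x j * conj (φ x) =
        g x j * conj (φ x) - (-(u x * conj (partialD j φ x)) + I * A x j * u x * conj (φ x)) := by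
      intro x; simp; ring
    simp_rw [e]
    refine (integral_sub ((hgj.l2loc.locallyIntegrable).int_mul_test hφ.conj) (i3.neg.add (lA.int_mul_test hφ.conj))).trans ?_
    rw [h1]; exact sub_self _

/-- The equation tested with a function of `H¹_A` supported in an annulus. -/
lemma SolvesHelmholtz.test (hA : MemL2loc A) (h : IsH1A A u g)
    (hs : SolvesHelmholtz A V U lam ε f u g) (hm : 0 < m)
    (hV : MemLp ((ann (m / 2) (M + 1)).indicator fun x => ((V x : ℂ) + U x + lam + I * ε) * u x) 2)
    (hf : MemLp ((ann (m / 2) (M + 1)).indicator f) 2) {v : E3 → ℂ} {G : E3 → C3} (hv : IsH1A A v G)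
    (hvs : SuppAnn m M v) (hGs : SuppAnn m M G) :
    ∫ x, ∑ j, g x j * conj (G x j) = (∫ x, ((V x : ℂ) + U x + lam + I * ε) * u x * conj (v x)) -
        ∫ x, f x * conj (v x) := by
  set a := ann (m / 2) (M + 1) with ha
  -- `density` asks for coefficients in L² on all of ℝ³. Cutting them off outside the enlarged
  -- annulus changes nothing, because every test function involved is supported there.
  set k1 : E3 → ℂ := a.indicator fun x => ((V x) + U x + lam + I * ε) * u x with hk1
  set k2 : E3 → ℂ := a.indicator f with hk2
  have sub : ∀ {w : E3 → ℂ}, SuppAnn (m / 2) (M + 1) w → ∀ x,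
      k1 x * conj (w x) = ((V x) + U x + lam + I * ε) * u x *
        conj (w x) ∧ k2 x * conj (w x) = f x * conj (w x) := by
    intro w hw x
    by_cases hx : x ∈ a
    · simp [hk1, hk2, hx]
    · simp [hw.eq_zero hx]
  have hvs' : SuppAnn (m / 2) (M + 1) v := fun x hx => hvs x (by
    rcases hx with hx | hx
    · left; linarith
    · right; linarith)
  have key := density hA (hf.sub hV) h.memLp_grad hm ?_ hv hvs hGs
  · rw [integral_pairing_split (hf.sub hV) h.memLp_grad hv.memLp hv.memLp_grad,
      ← integral_finsetSum _ fun j _ => int_mul (memLp_comp h.memLp_grad j)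
        (memLp_conj (memLp_comp hv.memLp_grad j))] at key
    have e : ∫ x, (k2 - k1) x * conj (v x) = (∫ x, f x * conj (v x)) - ∫ x, ((V x) + U x + lam +
          I * ε) * u x * conj (v x) := by
      simp_rw [← (sub hvs' _).1, ← (sub hvs' _).2, Pi.sub_apply, sub_mul]
      exact integral_sub (int_mul hf (memLp_conj hv.memLp)) (int_mul hV (memLp_conj hv.memLp))
    rw [e] at key; linear_combination key
  · intro φ hφ hφs
    have h1 := hs _ hφ.conj
    simp_rw [partialD_conj hφ.differentiable] at h1
    obtain ⟨C, hC⟩ := hφ.bounded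
    have hφ2 : MemLp φ 2 := (hφ.continuous.memLp_of_hasCompactSupport hφ.compact)
    have hdφ2 : ∀ j, MemLp (partialD j φ) 2 := fun j =>
      ((hφ.partialD j).continuous.memLp_of_hasCompactSupport (hφ.partialD j).compact)
    have hAφ : ∀ j, MemLp (fun x => I * A x j * φ x) 2 := by
      intro j
      have := ((hA.component j).memLp_mul_bounded hφ.continuous.aesm hC hφ.compact
        (fun x hx => zero_of_tsupp hx)).const_mul I
      simpa [mul_assoc] using this
    have ig : Integrable (fun x => ∑ j, g x j * conj (partialD j φ x +
        I * A x j * φ x)) := integrable_finsetSum _ fun j _ =>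
      int_mul (memLp_comp h.memLp_grad j) (memLp_conj ((hdφ2 j).add (hAφ j)))
    have i1 := int_mul hV (memLp_conj hφ2)
    have i2 := int_mul hf (memLp_conj hφ2)
    simp_rw [← (sub hφs _).1, ← (sub hφs _).2] at h1
    have e : ∀ x, -∑ j, g x j * (conj (partialD j φ x) - I * A x j * conj (φ x)) =
        -∑ j, g x j * conj (partialD j φ x + I * A x j * φ x) := by
      intro x; congr 1
      refine sum_congr rfl fun j _ => ?_
      simp only [map_add, map_mul, Complex.conj_I, conj_ofReal]; ring
    simp_rw [e] at h1
    have i0 : Integrable (fun x => -∑ j, g x j * conj (partialD j φ x + I * A x j * φ x)) := ig.neg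
    rw [integral_add i0 i1, integral_neg] at h1
    have e2 : ∀ x, (k2 - k1) x * conj (φ x) = k2 x * conj (φ x) - k1 x * conj (φ x) := by
      intro x; rw [Pi.sub_apply, sub_mul]
    simp_rw [e2]
    refine (integral_add ig (i2.sub i1)).trans ?_
    refine (congrArg _ (integral_sub i2 i1)).trans ?_
    linear_combination -h1


/-! ### Dilations and integrability jointly in the factor and the point -/

/-- The range of dilation factors. -/
abbrev dil : Set ℝ := Icc (1 / 2) 2

lemma dil_pos (h : s ∈ dil) : 0 < s := lt_of_lt_of_le (by norm_num) h.1

/-- The measure on the range of dilation factors. -/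
def dilMeas : Measure ℝ := volume.restrict (Icc (1 / 2) 2)

local notation "dilVol" => Measure.prod dilMeas volume

instance : IsFiniteMeasure dilMeas := by unfold dilMeas; infer_instance

lemma ae_dilMeas : ∀ᵐ τ ∂dilMeas, τ ∈ dil := ae_restrict_mem measurableSet_Icc

lemma uIoc_subset_dil {s s' : ℝ} (hs : s ∈ dil) (hs' : s' ∈ dil) : Ι s s' ⊆ Icc (1 / 2) 2 := by
  intro τ hτ; rw [uIoc, mem_Ioc] at hτ
  exact ⟨(le_min hs.1 hs'.1).trans hτ.1.le, hτ.2.trans (max_le hs.2 hs'.2)⟩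

lemma one_mem_dil : (1 : ℝ) ∈ dil := by constructor <;> norm_num

lemma restrict_uIoc_le {s s' : ℝ} (hs : s ∈ dil) (hs' : s' ∈ dil) :
    volume.restrict (Ι s s') ≤ dilMeas :=
  Measure.restrict_mono (uIoc_subset_dil hs hs') le_rfl

lemma prod_restrict_uIoc_le {s s' : ℝ} (hs : s ∈ dil) (hs' : s' ∈ dil) :
    (volume.restrict (Ι s s')).prod (volume : Measure E3) ≤ dilVol :=
  Measure.prod_mono (restrict_uIoc_le hs hs') le_rfl

lemma finrank_E3 : Module.finrank ℝ E3 = 3 := by simp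

lemma integral_dil [NormedSpace ℝ F] (f : E3 → F) (hs : 0 < s) :
    ∫ x, f (s • x) = (s ^ 3)⁻¹ • ∫ x, f x := by
  rw [Measure.integral_comp_smul_of_nonneg volume f s (hR := hs.le), finrank_E3]

lemma integral_dil_inv [NormedSpace ℝ F] (f : E3 → F) (hs : 0 < s) :
    ∫ x, f (s⁻¹ • x) = s ^ 3 • ∫ x, f x := by
  rw [integral_dil f (inv_pos.2 hs), inv_pow, inv_inv]

lemma qmp_dil (hs : 0 < s) : Measure.QuasiMeasurePreserving (fun x : E3 => s • x) volume volume :=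
  Measure.quasiMeasurePreserving_smul volume hs.ne'

lemma qmp_dil_prod :
    Measure.QuasiMeasurePreserving (fun z : ℝ × E3 => z.1 • z.2) dilVol volume := by
  refine QuasiMeasurePreserving.prod_of_right (by fun_prop) ?_
  filter_upwards [ae_dilMeas] with τ hτ
  exact qmp_dil (dil_pos hτ)

lemma aesm_dil {f : E3 → F} (hf : AESM f) :
    AEStronglyMeasurable (fun z : ℝ × E3 => f (z.1 • z.2)) dilVol :=
  hf.comp_quasiMeasurePreserving qmp_dil_prod

lemma eLpNorm_dil {f : E3 → F} (hf : AESM f) (hs : 0 < s) :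
    eLpNorm (fun x => f (s • x)) 2 volume = ofReal ((s ^ 3)⁻¹) ^ (1 / 2 : ℝ) *
      eLpNorm f 2 volume := by
  have hm : Measure.map (fun x : E3 => s • x) volume = ofReal ((s ^ 3)⁻¹) • volume := by
    rw [Measure.map_addHaar_smul volume hs.ne', finrank_E3, abs_of_pos (by positivity)]
  have h1 : AEStronglyMeasurable f (Measure.map (fun x => s • x) volume) := by
    rw [hm]; exact hf.mono_ac Measure.smul_absolutelyContinuous
  have := eLpNorm_map_measure (p := 2) h1 (measurable_const_smul s).aemeasurable
  rw [show (fun x => f (s • x)) = f ∘ (fun x => s • x) from rfl, ← this, hm,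
    eLpNorm_smul_measure_of_ne_top (by norm_num)]
  simp

lemma memLp_dil {f : E3 → F} (hf : MemLp f 2) (hs : 0 < s) : MemLp (fun x => f (s • x)) 2 := by
  refine ⟨hf.1.comp_quasiMeasurePreserving (qmp_dil hs), ?_⟩
  rw [eLpNorm_dil hf.1 hs]
  exact mul_lt_top (ENNReal.rpow_lt_top_of_nonneg (by norm_num) ofReal_ne_top) hf.2

lemma eLpNorm_dil_le {f : E3 → F} (hf : AESM f) (hs : s ∈ dil) :
    eLpNorm (fun x => f (s • x)) 2 volume ≤ 8 * eLpNorm f 2 volume := by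
  have hs0 := dil_pos hs
  rw [eLpNorm_dil hf hs0]; gcongr
  have h1 : ofReal ((s ^ 3)⁻¹) ≤ 8 := by
    rw [← ofReal_ofNat 8]
    refine ofReal_le_ofReal ?_
    rw [inv_le_comm₀ (by positivity) (by norm_num)]
    have := pow_le_pow_left₀ (by norm_num) hs.1 3
    linarith
  -- The root of 8 would suffice; it is enlarged to 8 to keep the constant free of radicals.
  calc _ ≤ 8 ^ (1 / 2) := rpow_le_rpow h1 (by norm_num)
    _ ≤ 8 ^ 1 := ENNReal.rpow_le_rpow_of_exponent_le (by norm_num) (by norm_num)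
    _ = 8 := ENNReal.rpow_one _

lemma integrable_dil_prod {f : E3 → F} (hf : Integrable f) :
    Integrable (fun z : ℝ × E3 => f (z.1 • z.2)) dilVol := by
  rw [integrable_prod_iff (aesm_dil hf.1)]
  refine ⟨?_, ?_⟩
  · filter_upwards [ae_dilMeas] with τ hτ
    exact hf.comp_smul (dil_pos hτ).ne'
  · have h1 : (fun τ => (τ ^ 3)⁻¹ * ∫ x, ‖f x‖) =ᵐ[dilMeas] fun τ => ∫ x, ‖f (τ • x)‖ := by
      filter_upwards [ae_dilMeas] with τ hτ
      rw [integral_dil (fun x => ‖f x‖) (dil_pos hτ), smul_eq_mul]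
    refine Integrable.congr ?_ h1
    refine Integrable.mul_const ?_ _
    refine ContinuousOn.integrableOn_compact isCompact_Icc ?_
    refine (continuousOn_pow 3).inv₀ fun τ hτ => ?_
    exact (pow_pos (dil_pos hτ) 3).ne'

/-- Integrability on all annuli around the origin. -/
def AnnInt (f : E3 → F) : Prop := ∀ m M : ℝ, 0 < m → IntegrableOn f (ann m M)

lemma dil_mem_ann {τ : ℝ} {x : E3} (hτ : τ ∈ dil) (hm : 0 < m) (hx : x ∈ ann m M) :
    τ • x ∈ ann (m / 2) (2 * M) := by
  have h0 := dil_pos hτ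
  have hn := norm_nonneg x
  constructor
  · rw [norm_smul, norm_of_nonneg h0.le]; nlinarith [hx.1, hτ.1]
  · rw [norm_smul, norm_of_nonneg h0.le]; nlinarith [hx.2, hτ.2]

/-- Integrability of a dilated function against a bounded kernel supported in an annulus. -/
lemma AnnInt.integrable_dil {f : E3 → 𝕜} (hf : AnnInt f) (hm : 0 < m) {ψ : ℝ × E3 → 𝕜}
    (hψ : AEStronglyMeasurable ψ dilVol) (hC : ∀ τ ∈ dil, ∀ x, ‖ψ (τ, x)‖ ≤ C)
    (h0 : ∀ τ ∈ dil, ∀ x ∉ ann m M, ψ (τ, x) = 0) :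
    Integrable (fun z : ℝ × E3 => f (z.1 • z.2) * ψ z) dilVol := by
  have h1 : Integrable ((ann (m / 2) (2 * M)).indicator f) :=
    (integrable_indicator_iff (measSet_ann _ _)).2 (hf _ _ (by linarith))
  have hae : ∀ᵐ z ∂(dilMeas.prod (volume : Measure E3)), z.1 ∈ dil :=
    Measure.quasiMeasurePreserving_fst.ae ae_dilMeas
  have h2 := (integrable_dil_prod h1).mul_bdd hψ (by
    filter_upwards [hae] with z hz using hC z.1 hz z.2)
  refine h2.congr ?_
  filter_upwards [hae] with z hz
  by_cases hx : z.2 ∈ ann m M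
  · simp only [dil_mem_ann hz hm hx, indicator_of_mem]
  · rw [h0 z.1 hz z.2 hx, mul_zero, mul_zero]

lemma AnnInt.integrable_snd {f : E3 → 𝕜} (hf : AnnInt f) (hm : 0 < m) {ψ : ℝ × E3 → 𝕜}
    (hψ : AEStronglyMeasurable ψ dilVol) (hC : ∀ τ ∈ dil, ∀ x, ‖ψ (τ, x)‖ ≤ C)
    (h0 : ∀ τ ∈ dil, ∀ x ∉ ann m M, ψ (τ, x) = 0) :
    Integrable (fun z : ℝ × E3 => f z.2 * ψ z) dilVol := by
  have h1 : Integrable ((ann m M).indicator f) :=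
    (integrable_indicator_iff (measSet_ann _ _)).2 (hf _ _ hm)
  have hae : ∀ᵐ z ∂(dilMeas.prod (volume : Measure E3)), z.1 ∈ dil :=
    Measure.quasiMeasurePreserving_fst.ae ae_dilMeas
  have h2 := (h1.comp_snd dilMeas).mul_bdd hψ (by
    filter_upwards [hae] with z hz using hC z.1 hz z.2)
  refine h2.congr ?_
  filter_upwards [hae] with z hz
  by_cases hx : z.2 ∈ ann m M
  · simp only [hx, indicator_of_mem]
  · rw [h0 z.1 hz z.2 hx, mul_zero, mul_zero]

lemma _root_.MeasureTheory.LocallyIntegrable.annInt {f : E3 → F} (hf : LocallyIntegrable f) :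
    AnnInt f :=
  fun m M _ => hf.integrableOn_isCompact (compact_ann m M)

lemma annInt_of_bounded {f : E3 → F} (hf : AESM f)
    (h : ∀ m M : ℝ, 0 < m → ∃ C, ∀ x ∈ ann m M, ‖f x‖ ≤ C) : AnnInt f := by
  intro m M hm
  obtain ⟨C, hC⟩ := h m M hm
  have : IsFiniteMeasure ((volume : Measure E3).restrict (ann m M)) :=
    ⟨by simpa using (compact_ann m M).measure_lt_top⟩
  exact Integrable.of_bound hf.restrict C ((ae_restrict_iff' (measSet_ann _ _)).2 (ae_of_all _ hC))

lemma tsupport_subset_ann {φ : E3 → ℝ} (hφ : IsTest φ) (h0 : (0 : E3) ∉ tsupport φ) :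
    ∃ m M : ℝ, 0 < m ∧ tsupport φ ⊆ ann m M := by
  obtain ⟨m, hm, hm2⟩ := Metric.isOpen_iff.1 (isClosed_tsupport φ).isOpen_compl 0 h0
  obtain ⟨M, hM⟩ := hφ.compact.isBounded.subset_closedBall 0
  refine ⟨m, M, hm, fun x hx => ⟨?_, by simpa using hM hx⟩⟩
  by_contra hc; exact hm2 (by simpa using hc : x ∈ Metric.ball 0 m) hx

/-! ### Phase, flux, and the gradient of the phase -/

/-- The phase of parallel transport along the ray through `x`, from `x` to `s • x`. -/
def phase (A : E3 → E3) (s : ℝ) (x : E3) : ℝ := ∫ τ in (1 : ℝ)..s, ∑ k, x k * A (τ • x) k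

/-- The flux of the magnetic field through the sector swept by the segment from `x` to `s • x`. -/
def flux (β : E3 → E3) (s : ℝ) (x : E3) (j : Fin 3) : ℝ := ∫ τ in (1 : ℝ)..s, β (τ • x) j

/-- `β = (x · B)` is the contraction of the magnetic field of `A` with the position vector, in the
weak sense. -/
structure RadialFlux (A β : E3 → E3) : Prop where
  meas : Measurable β
  bound : ∀ m M : ℝ, 0 < m → ∃ C, ∀ x ∈ ann m M, ‖β x‖ ≤ C
  orth : ∀ x, ∑ j, x j * β x j = 0
  weak : ∀ j, ∀ φ : E3 → ℝ, IsTest φ → (0 : E3) ∉ tsupport φ →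
    ∫ x, β x j * φ x = ∫ x, (A x j * (2 * φ x + ∑ k, x k * partialD k φ x) -
      (∑ k, x k * A x k) * partialD j φ x)

lemma MemL2loc.comp_real (h : MemL2loc A) (j : Fin 3) : L2loc (fun x => A x j) := by
  intro K hK
  have h1 := h.l2loc K hK
  rw [memLp_indicator_iff_restrict hK.measurableSet] at h1 ⊢
  have : Continuous (fun y : E3 => y j) := by fun_prop
  exact h1.mono (this.comp_aestronglyMeasurable h1.1) (ae_of_all _ fun x => norm_apply_le (A x) j)

lemma L2loc.dil {v : E3 → 𝕜} (hv : L2loc v) {τ : ℝ} (hτ : 0 < τ) : L2loc (fun x => v (τ • x)) := by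
  intro K hK
  refine (memLp_dil (hv (τ • K) (hK.smul τ)) hτ).congr_norm ?_ (ae_of_all _ fun x => ?_)
  · refine AEStronglyMeasurable.indicator ?_ hK.measurableSet
    exact hv.aesm.comp_quasiMeasurePreserving (qmp_dil hτ)
  · by_cases hx : x ∈ K
    · simp [hx, smul_mem_smul_set hx]
    · have : τ • x ∉ τ • K := by rwa [smul_mem_smul_set_iff₀ hτ.ne']
      simp [hx, this]

lemma RadialFlux.annInt (h : RadialFlux A β) (j : Fin 3) : AnnInt (fun x => β x j) := by
  refine annInt_of_bounded ((meas_coord j).comp h.meas).aesm fun m M hm => ?_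
  obtain ⟨C, hC⟩ := h.bound m M hm
  exact ⟨C, fun x hx => (norm_apply_le (β x) j).trans (hC x hx)⟩

lemma IsTest.dil {φ : E3 → ℝ} (h : IsTest φ) (hs : s ≠ 0) : IsTest (fun x => φ (s • x)) :=
  ⟨h.smooth.comp (contDiff_const_smul s), h.compact.comp_smul hs⟩

lemma partialD_dil [NormedSpace ℝ F] {φ : E3 → F} (s : ℝ) (x : E3)
    (h : DifferentiableAt ℝ φ (s • x)) (j : Fin 3) :
    partialD j (fun y => φ (s • y)) x = s • partialD j φ (s • x) := by
  have h1 : HasFDerivAt (fun y => s • y) (s • ContinuousLinearMap.id ℝ E3) x :=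
    (hasFDerivAt_id x).const_smul s
  unfold partialD; erw [(h.hasFDerivAt.comp x h1).fderiv]; simp

lemma zero_notMem_tsupport_dil {φ : E3 → ℝ} (h0 : (0 : E3) ∉ tsupport φ) :
    (0 : E3) ∉ tsupport (fun x => φ (s • x)) := by
  intro h
  have := tsupport_comp_subset_preimage φ (by fun_prop) h
  simp at this; exact h0 this

lemma sum_coord_partialD [NormedSpace ℝ F] (φ : E3 → F) (x : E3) :
    ∑ k, x k • partialD k φ x = fderiv ℝ φ x x := by
  unfold partialD; simp_rw [← map_smul]; rw [← map_sum]; congr 1; ext i; simp [Pi.single_apply]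

/-- The weak relation is tested with φ(x/τ). The operator x·∇ commutes with dilations, so all powers
of τ balance. -/
lemma RadialFlux.weak_dil (h : RadialFlux A β) {φ : E3 → ℝ} (hφ : IsTest φ)
    (h0 : (0 : E3) ∉ tsupport φ) {τ : ℝ} (hτ : 0 < τ) (j : Fin 3) :
    ∫ x, β (τ • x) j * φ x = ∫ x, (A (τ • x) j * (2 * φ x + fderiv ℝ φ x x) -
      (∑ k, x k * A (τ • x) k) * partialD j φ x) := by
  have e2 := integral_dil (fun y => (A y j * (2 * φ (τ⁻¹ • y) +
    ∑ k, y k * partialD k (fun x => φ (τ⁻¹ • x)) y) -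
      (∑ k, y k * A y k) * partialD j (fun x => φ (τ⁻¹ • x)) y)) hτ
  rw [← h.weak j _ (hφ.dil (inv_pos.2 hτ).ne') (zero_notMem_tsupport_dil h0), ← integral_dil (fun y => β y j * φ (τ⁻¹ • y)) hτ] at e2
  have hs : ∀ x : E3, τ⁻¹ • τ • x = x := fun x => inv_smul_smul₀ hτ.ne' x
  simp only [hs] at e2; rw [← e2]
  refine int_congr fun x => ?_
  have hp : ∀ k, partialD k (fun x => φ (τ⁻¹ • x)) (τ • x) = τ⁻¹ * partialD k φ x := by
    intro k; rw [partialD_dil _ _ (hφ.differentiable _), hs, smul_eq_mul]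
  simp only [hp, ← sum_coord_partialD, PiLp.smul_apply, smul_eq_mul]
  have s1 : ∑ k, τ * x k * (τ⁻¹ * partialD k φ x) = ∑ k, x k * partialD k φ x :=
    sum_congr rfl fun k _ => by field_simp
  have s2 : (∑ k, τ * x k * A (τ • x) k) * (τ⁻¹ * partialD j φ x) =
      (∑ k, x k * A (τ • x) k) * partialD j φ x := by
    simp_rw [mul_assoc, ← mul_sum]; field_simp
  rw [s1, s2]

/-- The combination 2φ + x·∇φ occurring in the weak form of the flux is thus an exact derivative in
the dilation factor. -/
lemma hasDerivAt_dil {φ : E3 → ℝ} (hφ : IsTest φ) (y : E3) {τ : ℝ} (hτ : 0 < τ) :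
    HasDerivAt (fun τ : ℝ => (τ ^ 2)⁻¹ * φ (τ⁻¹ • y))
      (-((τ ^ 3)⁻¹ * (2 * φ (τ⁻¹ • y) + fderiv ℝ φ (τ⁻¹ • y) (τ⁻¹ • y)))) τ := by
  have h1 := (hasDerivAt_inv hτ.ne').smul_const y
  have h3 : HasDerivAt (fun τ => (τ ^ 2)⁻¹) (-(2 * τ) / (τ ^ 2) ^ 2) τ := by
    have := (hasDerivAt_pow 2 τ).inv (pow_ne_zero 2 hτ.ne')
    simp at this; exact this
  refine (h3.mul ((hφ.differentiable (τ⁻¹ • y)).hasFDerivAt.comp_hasDerivAt τ h1)).congr_deriv ?_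
  simp; field_simp; ring

lemma inv_mem_dil {τ : ℝ} (hτ : τ ∈ dil) : τ⁻¹ ∈ dil := by
  have h0 := dil_pos hτ
  constructor
  · rw [le_inv_comm₀ (by norm_num) h0]; norm_num; exact hτ.2
  · rw [inv_le_comm₀ h0 (by norm_num)]; norm_num; linarith [hτ.1]

lemma dil_inv_notMem_ann {τ : ℝ} {x : E3} (hτ : τ ∈ dil) (hm : 0 < m)
    (hx : x ∉ ann (m / 2) (2 * M)) : τ⁻¹ • x ∉ ann m M := by
  intro h
  have := dil_mem_ann hτ hm h
  rw [smul_inv_smul₀ (dil_pos hτ).ne'] at this; exact hx this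

/-- The dilated one-forms `s A(s x)` differ from `A` by the gradient of the phase and the flux. -/
lemma phase_weak (hA : MemL2loc A) (h : RadialFlux A β) {φ : E3 → ℝ} (hφ : IsTest φ)
    (h0 : (0 : E3) ∉ tsupport φ) (hs : s ∈ dil) (j : Fin 3) :
    ∫ x, (s * A (s • x) j - A x j + flux β s x j) * φ x = -∫ x, phase A s x * partialD j φ x := by
  obtain ⟨m, M, hm, hmM⟩ := tsupport_subset_ann hφ h0
  have hs0 := dil_pos hs
  obtain ⟨Cφ, hCφ⟩ := hφ.bounded
  obtain ⟨Cd, hCd⟩ := (hφ.partialD j).bounded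
  -- Formally d/dτ [τA_j(τx)] = ∂_j[x·A(τx)] - β_j(τx), which is integrated over τ from 1 to s. In
  -- weak form the left side becomes the pairing of A_j(τx) with `E`, since no derivative of A is
  -- available.
  set E : E3 → ℝ := fun x => 2 * φ x + fderiv ℝ φ x x with hE
  have hEc : Continuous E := by
    refine (continuous_const.mul hφ.continuous).add ?_
    exact (hφ.contDiff_one.continuous_fderiv one_ne_zero).clm_apply continuous_id
  have hE0 : ∀ x ∉ ann m M, E x = 0 := by
    intro x hx
    have hx' : x ∉ tsupport φ := fun h => hx (hmM h)
    have : fderiv ℝ φ x = 0 := by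
      by_contra h; exact hx' (support_fderiv_subset ℝ (Function.mem_support.2 h))
    simp [hE, zero_of_tsupp hx', this]
  obtain ⟨CE, hCE⟩ : ∃ C, ∀ x, ‖E x‖ ≤ C :=
    (HasCompactSupport.intro (compact_ann m M) hE0).exists_bound_of_continuous hEc
  have hφ0 : ∀ x ∉ ann m M, φ x = 0 := fun x hx => zero_of_tsupp fun h => hx (hmM h)
  have hd0 : ∀ x ∉ ann m M, partialD j φ x = 0 := fun x hx => partialD_zero_of j fun h => hx (hmM h)
  have hAj := (hA.comp_real j).locallyIntegrable.annInt
  have hle := prod_restrict_uIoc_le one_mem_dil hs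
  have cm : ∀ {c : E3 → ℝ}, Continuous c → AEStronglyMeasurable (fun z : ℝ × E3 => c z.2) dilVol :=
    fun hc => (hc.comp continuous_snd).aesm
  have I1 := (h.annInt j).integrable_dil hm (cm hφ.continuous) (fun _ _ x => hCφ x)
      (fun _ _ x hx => hφ0 x hx)
  have I2 := hAj.integrable_dil hm (cm hEc) (fun _ _ x => hCE x) (fun _ _ x hx => hE0 x hx)
  have I3 : Integrable (fun z : ℝ × E3 => (∑ k, z.2 k * A (z.1 • z.2) k) * partialD j φ z.2)
      dilVol := by
    simp_rw [Finset.sum_mul]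
    refine integrable_finsetSum _ fun k _ => ?_
    have hc : Continuous (fun x => x k * partialD j φ x) :=
      (by fun_prop : Continuous fun x => x k).mul (hφ.partialD j).continuous
    have hc0 : ∀ x ∉ ann m M, x k * partialD j φ x = 0 := fun x hx => by rw [hd0 x hx, mul_zero]
    obtain ⟨C, hC⟩ : ∃ C, ∀ x, ‖x k * partialD j φ x‖ ≤ C :=
      (HasCompactSupport.intro (compact_ann m M) hc0).exists_bound_of_continuous hc
    refine (((hA.comp_real k).locallyIntegrable.annInt).integrable_dil hm (cm hc) (fun _ _ x => hC x)
      (fun _ _ x hx => hc0 x hx)).congr (ae_of_all _ fun z => ?_)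
    simp only; ring
  have key : ∀ τ ∈ Ι 1 s, ∫ x, β (τ • x) j * φ x =
      (∫ x, A (τ • x) j * E x) - ∫ x, (∑ k, x k * A (τ • x) k) * partialD j φ x := by
    intro τ hτ
    have hτ0 := dil_pos (uIoc_subset_dil one_mem_dil hs hτ)
    rw [h.weak_dil hφ h0 hτ0 j]
    refine integral_sub ?_ ?_
    · exact (((hA.comp_real j).dil hτ0).locallyIntegrable).int_mul_compact
        hEc.aesm hCE (compact_ann m M) hE0
    · have hsl : ∀ k : Fin 3, LocallyIntegrable (fun x => A (τ • x) k) :=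
        fun k => ((hA.comp_real k).dil hτ0).locallyIntegrable
      have : LocallyIntegrable (fun x => ∑ k, x k * A (τ • x) k) := by
        refine locallyIntegrable_finsetSum _ fun k _ => ?_
        have := (hsl k).continuous_smul (g := fun x => x k) (by fun_prop)
        simpa using this
      exact this.int_mul_test (hφ.partialD j)
  -- integrate over the dilation factor
  have int : ∫ τ in 1..s, ∫ x, β (τ • x) j * φ x = (∫ τ in 1..s, ∫ x, A (τ • x) j * E x) -
        ∫ τ in 1..s, ∫ x, (∑ k, x k * A (τ • x) k) * partialD j φ x := by
    rw [← intervalIntegral.integral_sub]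
    · refine intervalIntegral.integral_congr_ae (ae_of_all _ fun τ hτ => key τ hτ)
    · rw [intervalIntegrable_iff]; exact (I2.mono_measure hle).integral_prod_left
    · rw [intervalIntegrable_iff]; exact (I3.mono_measure hle).integral_prod_left
  rw [intervalIntegral_integral_swap (I1.mono_measure hle), intervalIntegral_integral_swap
      (f := fun τ x => (∑ k, x k * A (τ • x) k) * partialD j φ x) (I3.mono_measure hle)] at int
  simp_rw [intervalIntegral.integral_mul_const] at int
  change ∫ x, flux β s x j * φ x = _ - ∫ x, phase A s x * partialD j φ x at int
  -- the remaining term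
  have rem : ∫ τ in 1..s, ∫ x, A (τ • x) j * E x =
      -∫ y, A y j * ((s ^ 2)⁻¹ * φ (s⁻¹ • y) - φ y) := by
    have e1 : ∀ τ ∈ Ι 1 s, ∫ x, A (τ • x) j * E x = ∫ y, A y j * ((τ ^ 3)⁻¹ * E (τ⁻¹ • y)) := by
      intro τ hτ
      have hτ0 := dil_pos (uIoc_subset_dil one_mem_dil hs hτ)
      have := integral_dil (fun y => A y j * E (τ⁻¹ • y)) hτ0
      simp only [inv_smul_smul₀ hτ0.ne'] at this; rw [this, smul_eq_mul, ← integral_const_mul]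
      exact int_congr fun y => by ring
    rw [intervalIntegral.integral_congr_ae (ae_of_all _ fun τ hτ => e1 τ hτ)]
    have hmE : AEStronglyMeasurable (fun z : ℝ × E3 => (z.1 ^ 3)⁻¹ * E (z.1⁻¹ • z.2)) dilVol := by
      refine Measurable.aesm ?_
      refine ((measurable_fst.pow_const 3).inv).mul (hEc.measurable.comp ?_)
      exact measurable_fst.inv.smul measurable_snd
    have hCE0 := (norm_nonneg _).trans (hCE 0)
    have I4 : Integrable (fun z : ℝ × E3 => A z.2 j * ((z.1 ^ 3)⁻¹ * E (z.1⁻¹ • z.2))) dilVol := by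
      refine hAj.integrable_snd (m := m / 2) (M := 2 * M) (by linarith) hmE (C := 8 * CE) ?_ ?_
      · intro τ hτ x
        have hτ0 := dil_pos hτ
        rw [norm_mul, norm_inv, norm_pow, norm_of_nonneg hτ0.le]
        refine mul_le_mul ?_ (hCE _) (norm_nonneg _) (by norm_num)
        rw [inv_le_comm₀ (by positivity) (by norm_num)]
        have := pow_le_pow_left₀ (by norm_num) hτ.1 3
        linarith
      · intro τ hτ x hx; rw [hE0 _ (dil_inv_notMem_ann hτ hm hx), mul_zero]
    rw [intervalIntegral_integral_swap
      (f := fun τ y => A y j * ((τ ^ 3)⁻¹ * E (τ⁻¹ • y))) (I4.mono_measure hle), ← integral_neg]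
    refine int_congr fun y => ?_
    rw [intervalIntegral.integral_const_mul, ← mul_neg]; congr 1
    have hpos : ∀ τ ∈ uIcc 1 s, 0 < τ := by
      intro τ hτ; exact lt_of_lt_of_le (lt_min one_pos hs0) hτ.1
    -- After the substitution y = τx the factor τ sits on the smooth test function only, and the
    -- fundamental theorem of calculus applies there.
    have ftc := integral_eq_sub_of_hasDerivAt
     
      (f' := fun τ => -((τ ^ 3)⁻¹ * E (τ⁻¹ • y)))
      (fun τ hτ => hasDerivAt_dil hφ y (hpos τ hτ)) ?_
    · simp at ftc; rw [← ftc, neg_neg]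
    · refine ContinuousOn.intervalIntegrable ?_
      refine ContinuousOn.neg (ContinuousOn.mul ?_ (hEc.comp_continuousOn ?_))
      · exact (continuousOn_pow 3).inv₀ fun τ hτ => (pow_pos (hpos τ hτ) 3).ne'
      · exact (continuousOn_inv₀.mono fun τ hτ => (hpos τ hτ).ne').smul continuousOn_const
  rw [rem] at int
  -- assemble
  have iA := (hA.comp_real j).locallyIntegrable.int_mul_test hφ
  have iA2 := (hA.comp_real j).locallyIntegrable.int_mul_test (hφ.dil (inv_pos.2 hs0).ne')
  have iA3 : Integrable (fun x => s * A (s • x) j * φ x) := by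
    refine ((iA2.comp_smul hs0.ne').const_mul s).congr (ae_of_all _ fun x => ?_)
    simp only [inv_smul_smul₀ hs0.ne']; ring
  have iflux : Integrable (fun x => flux β s x j * φ x) := by
    have := (I1.mono_measure hle).integral_prod_right
    by_cases h1s : 1 ≤ s
    · refine this.congr (ae_of_all _ fun x => ?_)
      simp only [flux, intervalIntegral.integral_of_le h1s, uIoc_of_le h1s]; rw [integral_mul_const]
    · refine this.neg.congr (ae_of_all _ fun x => ?_)
      simp only [flux, intervalIntegral.integral_of_ge (le_of_not_ge h1s),
        uIoc_of_ge (le_of_not_ge h1s), Pi.neg_apply]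
      rw [integral_mul_const, neg_mul]
  have e4 : ∫ y, A y j * ((s ^ 2)⁻¹ * φ (s⁻¹ • y) - φ y) =
      (∫ x, s * A (s • x) j * φ x) - ∫ x, A x j * φ x := by
    have := integral_dil (fun y => A y j * φ (s⁻¹ • y)) hs0
    simp only [inv_smul_smul₀ hs0.ne'] at this
    have e5 : ∫ x, s * A (s • x) j * φ x = ∫ y, (s ^ 2)⁻¹ * (A y j * φ (s⁻¹ • y)) := by
      simp_rw [mul_assoc]
      rw [integral_const_mul, this, integral_const_mul, smul_eq_mul, ← mul_assoc]; congr 1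
      field_simp
    rw [e5, ← integral_sub (iA2.const_mul _) iA]; exact int_congr fun y => by ring
  rw [e4] at int
  have e6 : ∫ x, (s * A (s • x) j - A x j + flux β s x j) * φ x =
      ((∫ x, s * A (s • x) j * φ x) - ∫ x, A x j * φ x) + ∫ x, flux β s x j * φ x := by
    rw [← integral_sub iA3 iA]
    refine Eq.trans (int_congr (fun x => ?_)) (integral_add (iA3.sub iA) iflux)
    ring
  rw [e6, int]; ring


/-! ### Continuity of dilations and of the phase in the dilation factor -/

lemma tendsto_dil_of_continuous {f : E3 → F} (hf : Continuous f) (hc : HasCompactSupport f) :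
    Tendsto (fun τ : ℝ => eLpNorm (fun x => f (τ • x) - f x) 2 volume) (𝓝 1) (𝓝 0) := by
  obtain ⟨M, hM⟩ := hc.isBounded.subset_closedBall 0
  have hf0 : ∀ x, M < ‖x‖ → f x = 0 := by
    intro x hx; by_contra h
    have := hM (subset_tsupport f (Function.mem_support.2 h))
    rw [mem_closedBall_zero_iff] at this; linarith
  set K : Set E3 := Metric.closedBall 0 (2 * |M|) with hK
  have hKc : IsCompact K := isCompact_closedBall _ _
  obtain ⟨C, hC⟩ := hc.exists_bound_of_continuous hf
  have hfm : AESM f := hf.aesm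
  have h0 : Tendsto (fun τ : ℝ => ∫⁻ x, ‖f (τ • x) - f x‖ₑ ^ (2 : ℝ)) (𝓝 1) (𝓝 (∫⁻ _ : E3, 0)) := by
    refine tendsto_lintegral_filter_of_dominated_convergence
      (K.indicator fun _ => (ofReal (2 * C)) ^ (2 : ℝ)) ?_ ?_ ?_ ?_
    · exact Eventually.of_forall fun τ => (((hf.comp (continuous_const_smul τ)).sub
        hf).enorm.measurable).pow_const _
    · have : ∀ᶠ τ : ℝ in 𝓝 1, τ ∈ dil := Icc_mem_nhds (by norm_num) (by norm_num)
      filter_upwards [this] with τ hτ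
      refine ae_of_all _ fun x => ?_
      by_cases hx : x ∈ K
      · rw [indicator_of_mem hx]
        refine rpow_le_rpow ?_ (by norm_num)
        rw [← ofReal_norm]
        refine ofReal_le_ofReal ((norm_sub_le _ _).trans ?_)
        linarith [hC (τ • x), hC x]
      · have hx' : 2 * |M| < ‖x‖ := by simpa [hK] using hx
        have h1 := le_abs_self M
        have h2 := abs_nonneg M
        rw [hf0 x (by linarith), hf0 (τ • x)]
        · simp
        · rw [norm_smul, norm_of_nonneg (by linarith [hτ.1])]; nlinarith [hτ.1]
    · rw [lintegral_indicator hKc.measurableSet, setLIntegral_const]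
      exact mul_ne_top (ENNReal.rpow_ne_top_of_nonneg (by norm_num) ofReal_ne_top)
        hKc.measure_lt_top.ne
    · refine ae_of_all _ fun x => ?_
      have h1 : Continuous fun τ : ℝ => ‖f (τ • x) - f x‖ₑ ^ (2 : ℝ) :=
        ENNReal.continuous_rpow_const.comp
          ((hf.comp (continuous_id.smul continuous_const)).sub continuous_const).enorm
      simpa using h1.tendsto 1
  simp only [lintegral_zero] at h0
  have h1 : ∀ τ : ℝ, eLpNorm (fun x => f (τ • x) - f x) 2 volume =
      (∫⁻ x, ‖f (τ • x) - f x‖ₑ ^ (2 : ℝ)) ^ (1 / 2 : ℝ) := by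
    intro τ; rw [eLpNorm_eq_lintegral_rpow_enorm_toReal (by norm_num) (by norm_num)]; simp
  simp_rw [h1]
  have := (ENNReal.continuous_rpow_const (y := (1 / 2))).tendsto 0
  rw [ENNReal.zero_rpow_of_pos (by norm_num)] at this; exact this.comp h0

/-- Dilations act continuously on `L²`. -/
lemma tendsto_dil [NormedSpace ℝ F] {f : E3 → F} (hf : MemLp f 2) :
    Tendsto (fun τ : ℝ => eLpNorm (fun x => f (τ • x) - f x) 2 volume) (𝓝 1) (𝓝 0) := by
  rw [ENNReal.tendsto_nhds_zero]; intro ε hε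
  -- The three pieces cost 8, 1 and 1 units, the 8 coming from the bound for dilations; 20 leaves
  -- room.
  have hε' : ε / 20 ≠ 0 := (ENNReal.div_pos hε.ne' (by norm_num)).ne'
  obtain ⟨h, hc, hle, hcont, hm⟩ := hf.exists_hasCompactSupport_eLpNorm_sub_le (by norm_num) hε'
  have hcon := (ENNReal.tendsto_nhds_zero.1 (tendsto_dil_of_continuous hcont hc)) (ε / 20)
    (pos_iff_ne_zero.2 hε')
  have hnb : ∀ᶠ τ : ℝ in 𝓝 1, τ ∈ dil := Icc_mem_nhds (by norm_num) (by norm_num)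
  filter_upwards [hcon, hnb] with τ h1 hτ
  have hτ0 := dil_pos hτ
  have hd' := (eLpNorm_dil_le (hf.sub hm).1 hτ).trans (mul_le_mul_right hle _)
  have hsplit : (fun x => f (τ • x) - f x) =
      (fun x => (f - h) (τ • x)) + ((fun x => h (τ • x) - h x) - (f - h)) := by
    funext x; simp only [Pi.add_apply, Pi.sub_apply]; abel
  rw [hsplit]
  have hm2 := (memLp_dil hm hτ0).sub hm
  calc _ ≤ eLpNorm (fun x => (f - h) (τ • x)) 2 volume +
        eLpNorm ((fun x => h (τ • x) - h x) - (f - h)) 2 volume :=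
      eLpNorm_add_le (memLp_dil (hf.sub hm) hτ0).1 (hm2.sub (hf.sub hm)).1 (by norm_num)
    _ ≤ 8 * (ε / 20) + (eLpNorm (fun x => h (τ • x) - h x) 2 volume + eLpNorm (f - h) 2 volume) := by
      gcongr
      exact eLpNorm_sub_le hm2.1 (hf.sub hm).1 (by norm_num)
    _ ≤ 8 * (ε / 20) + (ε / 20 + ε / 20) := by gcongr
    _ = 10 * (ε / 20) := by ring
    _ ≤ 20 * (ε / 20) := by gcongr; norm_num
    _ = ε := ENNReal.mul_div_cancel (by norm_num) (by norm_num)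

/-- Minkowski's inequality for integrals over the dilation factor. -/
lemma eLpNorm_intervalIntegral_le {F : ℝ × E3 → ℝ} {a b : ℝ} (ha : a ∈ dil) (hb : b ∈ dil)
    (hF : AEStronglyMeasurable F dilVol) {K : ℝ≥0∞}
    (hK : ∀ τ ∈ Ι a b, eLpNorm (fun x => F (τ, x)) 2 volume ≤ K) :
    eLpNorm (fun x => ∫ τ in a..b, F (τ, x)) 2 volume ≤ ofReal |b - a| * K := by
  -- Cauchy–Schwarz in τ followed by Tonelli already yields the factor |b - a| with a bound that is
  -- uniform in τ.
  have hμ : ∀ G : ℝ → ℝ≥0∞, AEMeasurable G (volume.restrict (Ι a b)) →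
      (∫⁻ τ in Ι a b, G τ) ^ (2 : ℝ) ≤ ofReal |b - a| * ∫⁻ τ in Ι a b, G τ ^ (2 : ℝ) := by
    intro G hG
    have h := ENNReal.lintegral_mul_le_Lp_mul_Lq (volume.restrict (Ι a b)) Real.HolderConjugate.two_two
      (aemeasurable_const (b := 1)) hG
    simp only [Pi.mul_apply, one_mul, ENNReal.one_rpow, lintegral_one, Measure.restrict_apply_univ,
      Real.volume_uIoc] at h
    calc _ ≤ (ofReal |b - a| ^ (1 / 2) * (∫⁻ τ in Ι a b, G τ ^ 2) ^ (1 / 2)) ^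
          2 := rpow_le_rpow h (by norm_num)
      _ = _ := by
        rw [ENNReal.mul_rpow_of_nonneg _ _ (by norm_num), ← rpow_mul, ← rpow_mul]; norm_num
  have hF' := hF.mono_measure (prod_restrict_uIoc_le ha hb)
  have hn : ∀ f : E3 → ℝ, eLpNorm f 2 volume = (∫⁻ x, ‖f x‖ₑ ^ (2 : ℝ)) ^ (1 / 2 : ℝ) := by
    intro f; rw [eLpNorm_eq_lintegral_rpow_enorm_toReal (by norm_num) (by norm_num)]; simp
  have hn2 : ∀ f : E3 → ℝ, ∫⁻ x, ‖f x‖ₑ ^ (2 : ℝ) = eLpNorm f 2 volume ^ (2 : ℝ) := by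
    intro f; rw [hn, ← rpow_mul]; norm_num
  have hae : ∀ᵐ x : E3, AEMeasurable (fun τ => ‖F (τ, x)‖ₑ) (volume.restrict (Ι a b)) := by
    filter_upwards [hF'.prodMk_right] with x hx using hx.enorm
  have main : ∫⁻ x, ‖∫ τ in a..b, F (τ, x)‖ₑ ^ (2 : ℝ) ≤ (ofReal |b - a| * K) ^ (2 : ℝ) := by
    calc ∫⁻ x, ‖∫ τ in a..b, F (τ, x)‖ₑ ^ (2 : ℝ)
        ≤ ∫⁻ x, ofReal |b - a| * ∫⁻ τ in Ι a b, ‖F (τ, x)‖ₑ ^ (2 : ℝ) := by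
          refine lintegral_mono_ae ?_
          filter_upwards [hae] with x hx
          refine le_trans (rpow_le_rpow ?_ (by norm_num)) (hμ _ hx)
          rw [← ofReal_norm, intervalIntegral.norm_intervalIntegral_eq, ofReal_norm]
          exact enorm_integral_le_lintegral_enorm _
      _ = ofReal |b - a| * ∫⁻ τ in Ι a b, ∫⁻ x, ‖F (τ, x)‖ₑ ^ (2 : ℝ) := by
          rw [lintegral_const_mul' _ _ ofReal_ne_top,
            lintegral_lintegral_swap (f := fun τ x => ‖F (τ, x)‖ₑ ^ 2)]
          exact hF'.enorm.pow_const _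
      _ ≤ ofReal |b - a| * ∫⁻ _ in Ι a b, K ^ (2 : ℝ) := by
          refine mul_le_mul_right (setLIntegral_mono measurable_const fun τ hτ => ?_) _
          rw [hn2]; exact rpow_le_rpow (hK τ hτ) (by norm_num)
      _ = _ := by
          rw [setLIntegral_const, Real.volume_uIoc, ENNReal.mul_rpow_of_nonneg _ _ (by norm_num),
            show 2 = ((2 : ℕ) : ℝ) by norm_num, ENNReal.rpow_natCast, ENNReal.rpow_natCast]
          ring
  rw [hn]
  calc _ ≤ ((ofReal |b - a| * K) ^ 2) ^ (1 / 2) :=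
        rpow_le_rpow main (by norm_num)
    _ = _ := by rw [← rpow_mul]; norm_num

/-- The radial component `x · A(τ x)`. -/
def rpot (A : E3 → E3) (z : ℝ × E3) : ℝ := ∑ k, z.2 k * A (z.1 • z.2) k

lemma phase_eq (s : ℝ) (x : E3) : phase A s x = ∫ τ in (1 : ℝ)..s, rpot A (τ, x) := rfl

lemma aesm_rpot (hA : MemL2loc A) : AEStronglyMeasurable (rpot A) dilVol := by
  refine aestronglyMeasurable_fun_sum _ fun k _ => ?_
  exact ((meas_coord k).comp measurable_snd).aesm.mul (aesm_dil (hA.comp_real k).aesm)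

lemma aesm_phase (hA : MemL2loc A) (hs : s ∈ dil) : AESM (phase A s) := by
  have h := (aesm_rpot hA).mono_measure (prod_restrict_uIoc_le one_mem_dil hs)
  have : phase A s = fun x => (if 1 ≤ s then 1 else -1 : ℝ) • ∫ τ in Ι 1 s, rpot A (τ, x) := by
    funext x
    rw [phase_eq, intervalIntegral_eq_integral_uIoc]
  rw [this]; exact h.prod_swap.integral_prod_right'.const_smul (if 1 ≤ s then 1 else -1 : ℝ)

lemma measurableSet_ann_prod (m M : ℝ) : MeasurableSet {z : ℝ × E3 | z.2 ∈ ann m M} :=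
  (measSet_ann m M).preimage measurable_snd

lemma indicator_rpot_le (hA : MemL2loc A) (hm : 0 < m) :
    ∃ K : ℝ≥0∞, K ≠ ∞ ∧ ∀ τ ∈ dil,
      eLpNorm (fun x => (ann m M).indicator (fun x => rpot A (τ, x)) x) 2 volume ≤ K := by
  have hF : ∀ k, MemLp ((ann (m / 2) (2 * M)).indicator fun x => A x k) 2 := fun k =>
    hA.comp_real k _ (compact_ann _ _)
  refine ⟨∑ k : Fin 3, ofReal M *
    (8 * eLpNorm ((ann (m / 2) (2 * M)).indicator fun x => A x k) 2 volume), ?_, ?_⟩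
  · exact ENNReal.sum_ne_top.2 fun k _ => mul_ne_top ofReal_ne_top
      (mul_ne_top (by norm_num) (hF k).2.ne)
  · intro τ hτ
    have e : (fun x => (ann m M).indicator (fun x => rpot A (τ, x)) x) =
        ∑ k, fun x => (ann m M).indicator (fun x => x k * A (τ • x) k) x := by
      funext x
      rw [Finset.sum_apply]
      by_cases hx : x ∈ ann m M
      · simp only [indicator_of_mem hx, rpot]
      · simp [indicator_of_notMem hx]
    rw [e]
    have hmeas : ∀ k, AEStronglyMeasurable
        (fun x => (ann m M).indicator (fun x => x k * A (τ • x) k) x) volume := fun k =>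
      (((meas_coord k).aesm).mul
        ((hA.comp_real k).dil (dil_pos hτ)).aesm).indicator (measSet_ann _ _)
    refine (eLpNorm_sum_le (fun k _ => hmeas k) (by norm_num)).trans
      (Finset.sum_le_sum fun k _ => ?_)
    refine le_trans ?_ (mul_le_mul_right (eLpNorm_dil_le (hF k).1 hτ) _)
    refine le_of_le_of_eq (eLpNorm_le_nnreal_smul_eLpNorm_of_ae_le_mul (c := M.toNNReal)
      (g := fun x => (ann (m / 2) (2 * M)).indicator (fun x => A x k) (τ • x))
      (ae_of_all _ fun x => ?_) 2) ?_
    · by_cases hx : x ∈ ann m M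
      · rw [indicator_of_mem hx, indicator_of_mem (dil_mem_ann hτ hm hx), nnnorm_mul]
        refine mul_le_mul_left ?_ _
        rw [← NNReal.coe_le_coe, coe_nnnorm]
        exact ((norm_apply_le x k).trans hx.2).trans (Real.le_coe_toNNReal M)
      · rw [indicator_of_notMem hx]; simp
    · rfl

/-- On an individual ray A need not be integrable, but x·A(τx) is bounded in L² of the annulus
uniformly in τ, so the integral over τ is again in L². -/
lemma memLp_phase (hA : MemL2loc A) (hs : s ∈ dil) (hm : 0 < m) :
    MemLp ((ann m M).indicator (phase A s)) 2 := by
  obtain ⟨K, hK, h⟩ := indicator_rpot_le hA hm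
  refine ⟨(aesm_phase hA hs).indicator (measSet_ann _ _), ?_⟩
  have e : (ann m M).indicator (phase A s) = fun x => ∫ τ in 1..s,
      ({z : ℝ × E3 | z.2 ∈ ann m M}.indicator (rpot A)) (τ, x) := by
    funext x
    by_cases hx : x ∈ ann m M
    · rw [indicator_of_mem hx, phase_eq]
      refine integral_congr fun τ _ => ?_
      simp [indicator, hx]
    · rw [indicator_of_notMem hx]; simp [indicator, hx]
  rw [e]
  refine (eLpNorm_intervalIntegral_le one_mem_dil hs
    ((aesm_rpot hA).indicator (measurableSet_ann_prod m M))
    fun τ hτ => ?_).trans_lt (mul_lt_top ofReal_lt_top hK.lt_top)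
  exact h τ (uIoc_subset_dil one_mem_dil hs hτ)

lemma tendsto_rpot (hA : MemL2loc A) (hm : 0 < m) :
    Tendsto (fun τ : ℝ => eLpNorm (fun x => (ann m M).indicator
      (fun x => rpot A (τ, x) - rpot A (1, x)) x) 2 volume) (𝓝 1) (𝓝 0) := by
  have hF : ∀ k, MemLp ((ann (m / 2) (2 * M)).indicator fun x => A x k) 2 := fun k =>
    hA.comp_real k _ (compact_ann _ _)
  have hlim : Tendsto (fun τ : ℝ => ∑ k : Fin 3, ofReal M *
      eLpNorm (fun x => (ann (m / 2) (2 * M)).indicator (fun x => A x k) (τ • x) -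
        (ann (m / 2) (2 * M)).indicator (fun x => A x k) x) 2 volume) (𝓝 1) (𝓝 0) := by
    have := tendsto_finsetSum (Finset.univ : Finset (Fin 3)) fun k _ =>
      ENNReal.Tendsto.const_mul (a := ofReal M) (tendsto_dil (hF k)) (Or.inr ofReal_ne_top)
    simpa using this
  refine tendsto_of_tendsto_of_tendsto_of_le_of_le' tendsto_const_nhds hlim
    (Eventually.of_forall fun _ => zero_le) ?_
  have hnb : ∀ᶠ τ : ℝ in 𝓝 1, τ ∈ dil := Icc_mem_nhds (by norm_num) (by norm_num)
  filter_upwards [hnb] with τ hτ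
  have e : (fun x => (ann m M).indicator (fun x => rpot A (τ, x) - rpot A (1, x)) x) =
      ∑ k, fun x => (ann m M).indicator (fun x => x k * (A (τ • x) k - A x k)) x := by
    funext x
    rw [Finset.sum_apply]
    by_cases hx : x ∈ ann m M
    · simp only [indicator_of_mem hx, rpot, one_smul, mul_sub, Finset.sum_sub_distrib]
    · simp [indicator_of_notMem hx]
  rw [e]
  have hmeas : ∀ k, AEStronglyMeasurable
      (fun x => (ann m M).indicator (fun x => x k * (A (τ • x) k - A x k)) x) volume := fun k =>
    (((meas_coord k).aesm).mul (((hA.comp_real k).dil (dil_pos hτ)).aesm.sub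
        (hA.comp_real k).aesm)).indicator (measSet_ann _ _)
  refine (eLpNorm_sum_le (fun k _ => hmeas k) (by norm_num)).trans (Finset.sum_le_sum fun k _ => ?_)
  refine le_of_le_of_eq (eLpNorm_le_nnreal_smul_eLpNorm_of_ae_le_mul (c := M.toNNReal)
    (g := fun x => (ann (m / 2) (2 * M)).indicator (fun x => A x k) (τ • x) -
        (ann (m / 2) (2 * M)).indicator (fun x => A x k) x) (ae_of_all _ fun x => ?_) 2) ?_
  · by_cases hx : x ∈ ann m M
    · have hx1 := dil_mem_ann one_mem_dil hm hx
      rw [one_smul] at hx1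
      rw [indicator_of_mem hx, indicator_of_mem (dil_mem_ann hτ hm hx), indicator_of_mem hx1,
        nnnorm_mul]
      refine mul_le_mul_left ?_ _
      rw [← NNReal.coe_le_coe, coe_nnnorm]
      exact ((norm_apply_le x k).trans hx.2).trans (Real.le_coe_toNNReal M)
    · rw [indicator_of_notMem hx]; simp
  · rfl

/-- Fubini on each annulus of a countable exhaustion. On almost every ray the phase is then a
genuine, continuous integral in s. -/
lemma ae_intervalIntegrable_rpot (hA : MemL2loc A) :
    ∀ᵐ x : E3, IntegrableOn (fun τ => rpot A (τ, x)) (Icc (1 / 2) 2) := by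
  have key : ∀ n : ℕ, ∀ᵐ x : E3, x ∈ ann (1 / (n + 1)) n →
      IntegrableOn (fun τ => rpot A (τ, x)) (Icc (1 / 2) 2) := by
    intro n
    have hm : 0 < 1 / ((n : ℝ) + 1) := by positivity
    have hint : Integrable (fun z : ℝ × E3 => ∑ k, A (z.1 • z.2) k *
        ((ann (1 / (n + 1)) n).indicator (fun x => x k) z.2)) dilVol := by
      refine integrable_finsetSum _ fun k _ => ?_
      refine (hA.comp_real k).locallyIntegrable.annInt.integrable_dil hm (M := n) (C := n)
        (ψ := fun z => (ann (1 / (n + 1)) n).indicator (fun x => x k) z.2) ?_ ?_ ?_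
      · exact (((meas_coord k).indicator (measSet_ann _ _)).comp measurable_snd).aesm
      · intro τ _ x
        by_cases hx : x ∈ ann (1 / (n + 1)) n
        · simp only [indicator_of_mem hx]; exact (norm_apply_le x k).trans hx.2
        · simp only [indicator_of_notMem hx, norm_zero, Nat.cast_nonneg]
      · intro τ _ x hx; simp only [indicator_of_notMem hx]
    filter_upwards [hint.prod_left_ae] with x hx hxa
    refine Integrable.congr hx (ae_of_all _ fun τ => ?_)
    simp only [rpot, indicator_of_mem hxa]; exact sum_congr rfl fun k _ => mul_comm _ _
  filter_upwards [ae_all_iff.2 key, ae_ne_zero] with x hx hx0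
  obtain ⟨n1, hn1⟩ := exists_nat_one_div_lt (norm_pos_iff.2 hx0)
  obtain ⟨n2, hn2⟩ := exists_nat_ge ‖x‖
  refine hx (max n1 n2) ⟨?_, ?_⟩
  · refine le_trans ?_ hn1.le
    apply one_div_le_one_div_of_le (by positivity)
    gcongr
    exact le_max_left _ _
  · push_cast; exact hn2.trans (le_max_right _ _)

lemma tendsto_phase_zero (hA : MemL2loc A) :
    ∀ᵐ x : E3, Tendsto (fun s => phase A s x) (𝓝 1) (𝓝 0) := by
  filter_upwards [ae_intervalIntegrable_rpot hA] with x hx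
  have h2 : IntegrableOn (fun τ => rpot A (τ, x)) (uIcc (1 / 2) 2) := by
    rwa [uIcc_of_le (by norm_num)]
  have h1 := intervalIntegral.continuousOn_primitive_interval' (b₁ := 1 / 2) (b₂ := 2)
    ((intervalIntegrable_iff_integrableOn_Icc_of_le (by norm_num)).2 hx)
    (by rw [uIcc_of_le (by norm_num)]; exact one_mem_dil)
  rw [uIcc_of_le (by norm_num)] at h1
  have h3 := (h1.continuousAt (Icc_mem_nhds (by norm_num) (by norm_num)) : ContinuousAt _ (1 : ℝ))
  simpa [phase_eq] using h3.tendsto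

/-- Transport from x to ss'x passes through s'x. This cocycle identity is the group law of the
transported dilations. -/
lemma phase_comp (s s' : ℝ) (x : E3) (h1 : IntervalIntegrable (fun τ => rpot A (τ, x)) volume 1 s')
    (h2 : IntervalIntegrable (fun τ => rpot A (τ, x)) volume s' (s * s')) :
    phase A (s * s') x = phase A s' x + phase A s (s' • x) := by
  have e : ∀ τ, rpot A (τ, s' • x) = s' * rpot A (τ * s', x) := by
    intro τ; simp only [rpot, PiLp.smul_apply, smul_eq_mul, smul_smul, mul_sum, mul_assoc]
  rw [phase_eq, phase_eq, phase_eq]; simp_rw [e]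
  rw [intervalIntegral.integral_const_mul, mul_integral_comp_mul_right
    (f := fun τ => rpot A (τ, x)), one_mul, integral_add_adjacent_intervals h1 h2]

/-- Transport in the reverse direction. Only a substitution and an orientation are involved, so no
integrability on the ray is needed. -/
lemma phase_inv (hs : 0 < s) (y : E3) : phase A s (s⁻¹ • y) = -phase A s⁻¹ y := by
  have e : ∀ τ, rpot A (τ, s⁻¹ • y) = s⁻¹ * rpot A (τ * s⁻¹, y) := by
    intro τ; simp only [rpot, PiLp.smul_apply, smul_eq_mul, smul_smul, mul_sum, mul_assoc]
  rw [phase_eq, phase_eq]; simp_rw [e]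
  rw [intervalIntegral.integral_const_mul, mul_integral_comp_mul_right
    (f := fun τ => rpot A (τ, y)), one_mul, mul_inv_cancel₀ hs.ne',
    intervalIntegral.integral_symm]

/-- The quotient minus x·A(x) is the mean over τ between 1 and s of x·A(τx) - x·A(x), whose L² norm
on the annulus is small by continuity of dilations. So the derivative of the phase at s = 1 exists
in L² on annuli. -/
lemma tendsto_phase_quotient (hA : MemL2loc A) (hm : 0 < m) :
    Tendsto (fun s : ℝ => eLpNorm (fun x => (ann m M).indicator
      (fun x => (s - 1)⁻¹ * phase A s x - rpot A (1, x)) x) 2 volume) (𝓝[≠] 1) (𝓝 0) := by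
  rw [ENNReal.tendsto_nhds_zero]; intro ε hε
  obtain ⟨δ, hδ, hδ2⟩ := Metric.eventually_nhds_iff.1
    (ENNReal.tendsto_nhds_zero.1 (tendsto_rpot hA hm) ε hε)
  have hnb : ∀ᶠ τ : ℝ in 𝓝[≠] 1, τ ∈ dil :=
    nhdsWithin_le_nhds (Icc_mem_nhds (by norm_num) (by norm_num))
  have hnb2 : ∀ᶠ τ : ℝ in 𝓝[≠] 1, dist τ 1 < δ := nhdsWithin_le_nhds (Metric.ball_mem_nhds _ hδ)
  filter_upwards [hnb, hnb2, self_mem_nhdsWithin] with s hs hs2 hs1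
  have hs1' := sub_ne_zero.2 hs1
  have hmA : AEStronglyMeasurable (fun z : ℝ × E3 => rpot A (1, z.2)) dilVol := by
    have h : AESM (fun x => rpot A (1, x)) := by
      refine aestronglyMeasurable_fun_sum _ fun k _ => ?_
      simp; exact (meas_coord k).aesm.mul (hA.comp_real k).aesm
    exact h.comp_snd
  have e : (fun x => (ann m M).indicator
      (fun x => (s - 1)⁻¹ * phase A s x - rpot A (1, x)) x) =ᵐ[volume]
      fun x => (s - 1)⁻¹ • ∫ τ in 1..s, ({z : ℝ × E3 | z.2 ∈ ann m M}.indicator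
        (fun z => rpot A z - rpot A (1, z.2))) (τ, x) := by
    filter_upwards [ae_intervalIntegrable_rpot hA] with x hxi
    by_cases hx : x ∈ ann m M
    · have h1 : ∀ τ, ({z : ℝ × E3 | z.2 ∈ ann m M}.indicator
        (fun z => rpot A z - rpot A (1, z.2))) (τ, x) =
          rpot A (τ, x) - rpot A (1, x) := fun τ => by simp [indicator, hx]
      simp_rw [h1]
      rw [indicator_of_mem hx, intervalIntegral.integral_sub, intervalIntegral.integral_const,
        phase_eq, smul_eq_mul, smul_eq_mul, mul_sub, ← mul_assoc, inv_mul_cancel₀ hs1', one_mul]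
      · rw [intervalIntegrable_iff]; exact hxi.mono_set (uIoc_subset_dil one_mem_dil hs)
      · exact intervalIntegrable_const
    · rw [indicator_of_notMem hx]; simp [indicator, hx]
  rw [eLpNorm_congr_ae e]
  refine (eLpNorm_const_smul_le (c := (s - 1)⁻¹)).trans ?_
  have hb := eLpNorm_intervalIntegral_le one_mem_dil hs
    (((aesm_rpot hA).sub hmA).indicator (measurableSet_ann_prod m M)) (K := ε)
    (fun τ hτ => ?_)
  · refine (mul_le_mul_right hb _).trans ?_
    rw [← mul_assoc, ← ofReal_norm, ← ofReal_mul (norm_nonneg _), norm_eq_abs, abs_inv,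
      inv_mul_cancel₀ (abs_ne_zero.2 hs1'), ENNReal.ofReal_one, one_mul]
  · refine hδ2 (lt_of_le_of_lt ?_ hs2)
    rw [Real.dist_eq, Real.dist_eq]; rcases le_total 1 s with h | h
    · rw [uIoc_of_le h] at hτ; rw [abs_of_nonneg (by linarith [hτ.1]), abs_of_nonneg (by linarith)]
      linarith [hτ.2]
    · rw [uIoc_of_ge h] at hτ; rw [abs_of_nonpos (by linarith [hτ.2]), abs_of_nonpos (by linarith)]
      linarith [hτ.1]


/-! ### Transported dilations of functions in H¹_A -/

/-- A smooth cutoff equal to one on the annulus `m ≤ |x| ≤ M`. -/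
def annCut (m M : ℝ) (x : E3) : ℝ := Real.smoothTransition ((4 * ‖x‖ ^ 2 / m ^ 2 - 1) / 3) *
    Real.smoothTransition ((4 - ‖x‖ ^ 2 / M ^ 2) / 3)

lemma contDiff_annCut (m M : ℝ) : ContDiff ℝ C∞ (annCut m M) := by
  unfold annCut
  have h : ContDiff ℝ C∞ fun x : E3 => ‖x‖ ^ 2 := contDiff_norm_sq ℝ
  refine ContDiff.mul ?_ ?_
  · exact Real.smoothTransition.contDiff.comp
      ((((contDiff_const.mul h).div_const _).sub contDiff_const).div_const _)
  · exact Real.smoothTransition.contDiff.comp ((contDiff_const.sub (h.div_const _)).div_const _)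

lemma annCut_eq_one (hm : 0 < m) {x : E3} (hx : x ∈ ann m M) : annCut m M x = 1 := by
  have hM := hm.trans_le (hx.1.trans hx.2)
  have h1 : 1 ≤ ‖x‖ ^ 2 / m ^ 2 := by
    rw [le_div_iff₀ (by positivity), one_mul]; exact pow_le_pow_left₀ hm.le hx.1 2
  have h2 : ‖x‖ ^ 2 / M ^ 2 ≤ 1 := by
    rw [div_le_one (by positivity)]; exact pow_le_pow_left₀ (norm_nonneg x) hx.2 2
  rw [annCut, Real.smoothTransition.one_of_one_le, Real.smoothTransition.one_of_one_le, one_mul]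
  · linarith
  · rw [mul_div_assoc]; linarith

lemma annCut_eq_zero (hm : 0 < m) (hM : 0 < M) {x : E3} (hx : x ∉ ann (m / 2) (2 * M)) :
    annCut m M x = 0 := by
  by_cases h : m / 2 ≤ ‖x‖
  · have h2 : 2 * M < ‖x‖ := by by_contra hc; exact hx ⟨h, not_lt.1 hc⟩
    rw [annCut, Real.smoothTransition.zero_of_nonpos (x := (4 - ‖x‖ ^ 2 / M ^ 2) / 3), mul_zero]
    have : 4 ≤ ‖x‖ ^ 2 / M ^ 2 := by rw [le_div_iff₀ (by positivity)]; nlinarith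
    linarith
  · rw [annCut, Real.smoothTransition.zero_of_nonpos, zero_mul]
    have : 4 * ‖x‖ ^ 2 / m ^ 2 ≤ 1 := by
      rw [div_le_one (by positivity)]; nlinarith [norm_nonneg x, not_le.1 h]
    linarith

lemma isTest_annCut (hm : 0 < m) (hM : 0 < M) : IsTest (annCut m M) := ⟨contDiff_annCut m M,
    HasCompactSupport.intro (compact_ann (m / 2) (2 * M)) fun _ hx => annCut_eq_zero hm hM hx⟩

lemma zero_notMem_tsupport_of_ann (hm : 0 < m) {φ : E3 → F} (h : ∀ x ∉ ann m M, φ x = 0) :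
    (0 : E3) ∉ tsupport φ := by
  intro h0
  have : tsupport φ ⊆ ann m M := by
    refine closure_minimal (fun x hx => ?_) (isClosed_ann m M)
    by_contra hc; exact hx (h x hc)
  have := (this h0).1
  rw [norm_zero] at this; linarith

lemma partialD_annCut (hm : 0 < m) {x : E3} (hx : x ∈ ann m M) (j : Fin 3) :
    partialD j (annCut (m / 2) (2 * M)) x = 0 := by
  have hx0 := hm.trans_le hx.1
  have : annCut (m / 2) (2 * M) =ᶠ[𝓝 x] fun _ => 1 := by
    have h1 : ∀ᶠ y : E3 in 𝓝 x, ‖y‖ ∈ Ioo (m / 2) (2 * M) :=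
      continuous_norm.continuousAt (Ioo_mem_nhds (by linarith [hx.1]) (by linarith [hx.2]))
    filter_upwards [h1] with y hy
    exact annCut_eq_one (by linarith) ⟨hy.1.le, hy.2.le⟩
  rw [partialD, this.fderiv_eq]; simp

lemma L2loc.of_le_mul {G : Type*} [NormedAddCommGroup G] {w : E3 → G} (hw : L2loc w) (hv : AESM v)
    (h : ∀ x, ‖v x‖ ≤ C * ‖w x‖) : L2loc v := by
  intro K hK
  refine MemLp.of_le_mul (c := C) (hw K hK) (hv.indicator hK.measurableSet) (ae_of_all _ fun x => ?_)
  by_cases hx : x ∈ K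
  · simpa [hx] using h x
  · simp [hx]

lemma L2loc.add {w : E3 → F} (hv : L2loc v) (hw : L2loc w) : L2loc (fun x => v x + w x) := by
  intro K hK
  refine ((hv K hK).add (hw K hK)).ae_eq (ae_of_all _ fun x => ?_)
  by_cases hx : x ∈ K <;> simp [hx]

lemma WDeriv.congr {j : Fin 3} {v D v' D' : E3 → 𝕜} (h : WDeriv j v D) (hv : ∀ x, v x = v' x)
    (hD : ∀ x, D x = D' x) : WDeriv j v' D' := by
  rwa [← (funext hv : v = v'), ← (funext hD : D = D')]

lemma IsTest.dil_complex {φ : E3 → ℂ} (h : IsTest φ) (hs : s ≠ 0) : IsTest (fun x => φ (s • x)) :=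
  ⟨h.smooth.comp (contDiff_const_smul s), h.compact.comp_smul hs⟩

lemma locallyIntegrable_dil (h : LocallyIntegrable v) (hs : 0 < s) :
    LocallyIntegrable (fun x => v (s • x)) := by
  rw [locInt_iff] at h ⊢; intro K hK
  have h1 := (integrable_indicator_iff (hK.smul s).measurableSet).2 (h (s • K) (hK.smul s))
  refine (integrable_indicator_iff hK.measurableSet).1 ((h1.comp_smul hs.ne').congr
    (ae_of_all _ fun x => ?_))
  by_cases hx : x ∈ K
  · simp [hx, smul_mem_smul_set hx]
  · have : s • x ∉ s • K := by rwa [smul_mem_smul_set_iff₀ hs.ne']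
    simp [hx, this]

lemma WDeriv.dil {j : Fin 3} {v D : E3 → ℂ} (h : WDeriv j v D) (hs : 0 < s) :
    WDeriv j (fun x => v (s • x)) (fun x => s * D (s • x)) := by
  refine ⟨locallyIntegrable_dil h.left hs, (locallyIntegrable_dil h.right hs).smul s, ?_⟩
  intro φ hφ
  have e1 := integral_dil (fun y => D y * φ (s⁻¹ • y)) hs
  have e2 := integral_dil (fun y => v y * partialD j (fun x => φ (s⁻¹ • x)) y) hs
  have hp : ∀ x, partialD j (fun x => φ (s⁻¹ • x)) (s • x) = (s⁻¹ : ℂ) * partialD j φ x := by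
    intro x
    rw [partialD_dil _ _ (hφ.differentiable _), inv_smul_smul₀ hs.ne', real_smul,
      Complex.ofReal_inv]
  simp only [inv_smul_smul₀ hs.ne', hp] at e1 e2
  rw [h.weak _ (hφ.dil_complex (inv_pos.2 hs).ne'), smul_neg, ← e2, ← integral_neg] at e1
  simp_rw [mul_assoc]; rw [integral_const_mul, e1, ← integral_const_mul, ← integral_neg]
  refine int_congr fun x => ?_
  have : (s : ℂ) ≠ 0 := by exact_mod_cast hs.ne'
  field_simp

lemma norm_flux_le (h : RadialFlux A β) (hm : 0 < m) :
    ∃ C, 0 ≤ C ∧ ∀ s ∈ dil, ∀ x ∈ ann m M, ∀ j, ‖flux β s x j‖ ≤ C := by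
  obtain ⟨C, hC⟩ := h.bound (m / 2) (2 * M) (by linarith)
  refine ⟨|C| * 1, by positivity, fun s hs x hx j => ?_⟩
  refine (intervalIntegral.norm_integral_le_of_norm_le_const (C := |C|) fun τ hτ => ?_).trans ?_
  · exact (norm_apply_le _ _).trans ((hC _ (dil_mem_ann
      (uIoc_subset_dil one_mem_dil hs hτ) hm hx)).trans (le_abs_self C))
  · refine mul_le_mul_of_nonneg_left ?_ (abs_nonneg C)
    rw [abs_le]; constructor <;> linarith [hs.1, hs.2]

lemma measurable_flux (h : RadialFlux A β) (s : ℝ) (j : Fin 3) :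
    Measurable (fun x => flux β s x j) := by
  have h1 : Measurable (fun z : ℝ × E3 => β (z.1 • z.2) j) :=
    (meas_coord j).comp (h.meas.comp (measurable_fst.smul measurable_snd))
  have : (fun x => flux β s x j) = fun x => (if 1 ≤ s then 1 else -1 : ℝ) •
      ∫ τ in Ι 1 s, β (τ • x) j := by
    funext x
    rw [flux, intervalIntegral_eq_integral_uIoc]
  rw [this]
  have h2 : Measurable fun x => ∫ τ in Ι 1 s, β (τ • x) j :=
    (h1.comp measurable_swap).stronglyMeasurable.integral_prod_right'.measurable
  exact h2.const_smul (if 1 ≤ s then 1 else -1 : ℝ)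

/-- The gradient of the phase is known only away from the origin. The cutoff turns `phase_weak` into
a statement on all of ℝ³, with function and gradient in L²_loc. -/
lemma wderiv_cutoff_phase (hA : MemL2loc A) (h : RadialFlux A β) (hs : s ∈ dil) (hm : 0 < m)
    (hM : 0 < M) (j : Fin 3) :
    WDeriv j (fun x => annCut m M x * phase A s x) (fun x => partialD j (annCut m M) x *
      phase A s x + annCut m M x * (s * A (s • x) j - A x j + flux β s x j)) ∧
    L2loc (fun x => annCut m M x * phase A s x) ∧
    L2loc (fun x => partialD j (annCut m M) x *
      phase A s x + annCut m M x * (s * A (s • x) j - A x j + flux β s x j)) := by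
  have hχ := isTest_annCut hm hM
  have hχ0 : ∀ x ∉ ann (m / 2) (2 * M), annCut m M x = 0 := fun x hx => annCut_eq_zero hm hM hx
  have hts : tsupport (annCut m M) ⊆ ann (m / 2) (2 * M) := by
    refine closure_minimal (fun x hx => ?_) (isClosed_ann _ _)
    by_contra hc; exact hx (hχ0 x hc)
  have hm2 : 0 < m / 2 := by linarith
  have mulb : ∀ {w : E3 → ℝ} {ψ : E3 → ℝ}, MemLp ((ann (m / 2) (2 * M)).indicator w) 2 → IsTest ψ →
      (∀ x ∉ ann (m / 2) (2 * M), ψ x = 0) → MemLp (fun x => ψ x * w x) 2 := by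
    intro w ψ hw hψ h0
    obtain ⟨C, hC⟩ := hψ.bounded
    have e : (fun x => ψ x * w x) = fun x => ψ x * (ann (m / 2) (2 * M)).indicator w x := by
      funext x
      by_cases hx : x ∈ ann (m / 2) (2 * M)
      · rw [indicator_of_mem hx]
      · rw [h0 x hx, zero_mul, zero_mul]
    rw [e]
    refine MemLp.of_le_mul (c := C) hw (hψ.continuous.aesm.mul hw.1) (ae_of_all _ fun x => ?_)
    rw [norm_mul]; exact mul_le_mul_of_nonneg_right (hC x) (norm_nonneg _)
  have hd0 : ∀ x ∉ ann (m / 2) (2 * M), partialD j (annCut m M) x = 0 := fun x hx =>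
    partialD_zero_of j fun hc => hx (hts hc)
  have m1 := mulb (memLp_phase hA hs hm2) hχ hχ0
  have m2 := mulb (memLp_phase hA hs hm2) (hχ.partialD j) hd0
  have m3 : MemLp (fun x => annCut m M x * (s * A (s • x) j - A x j + flux β s x j)) 2 := by
    refine mulb ?_ hχ hχ0
    have a1 := ((hA.comp_real j).dil (dil_pos hs)) _ (compact_ann (m / 2) (2 * M))
    have a2 := (hA.comp_real j) _ (compact_ann (m / 2) (2 * M))
    obtain ⟨C, -, hC⟩ := norm_flux_le h hm2
    have a3 : MemLp ((ann (m / 2) (2 * M)).indicator fun x => flux β s x j) 2 := by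
      rw [memLp_indicator_iff_restrict (measSet_ann _ _)]
      have : IsFiniteMeasure ((volume : Measure E3).restrict (ann (m / 2) (2 * M))) :=
        ⟨by simpa using (compact_ann (m / 2) (2 * M)).measure_lt_top⟩
      exact MemLp.of_bound (measurable_flux h s j).aesm C
        ((ae_restrict_iff' (measSet_ann _ _)).2 (ae_of_all _ fun x hx => hC s hs x hx j))
    refine (((a1.const_mul s).sub a2).add a3).ae_eq (ae_of_all _ fun x => ?_)
    by_cases hx : x ∈ ann (m / 2) (2 * M)
    · simp only [Pi.add_apply, Pi.sub_apply, indicator_of_mem hx]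
    · simp [indicator_of_notMem hx]
  refine ⟨⟨m1.l2loc.locallyIntegrable, (m2.add m3).l2loc.locallyIntegrable, ?_⟩, m1.l2loc,
    (m2.add m3).l2loc⟩
  intro φ hφ
  have hz : 0 ∉ tsupport (fun x => annCut m M x * φ x) :=
    zero_notMem_tsupport_of_ann hm2 fun x hx => by rw [hχ0 x hx, zero_mul]
  have key := phase_weak hA h (hφ.mul (contDiff_annCut m M)) hz hs j
  have ep : ∀ x, partialD j (fun x => annCut m M x * φ x) x =
      annCut m M x * partialD j φ x + partialD j (annCut m M) x * φ x := fun x =>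
    partialD_mul (hχ.differentiable x) (hφ.differentiable x) j
  simp_rw [ep] at key
  have i2 := m2.l2loc.locallyIntegrable.int_mul_test hφ
  have i3 := m3.l2loc.locallyIntegrable.int_mul_test hφ
  have i1 := m1.l2loc.locallyIntegrable.int_mul_test (hφ.partialD j)
  have e1 : ∫ x, phase A s x * (annCut m M x * partialD j φ x +
      partialD j (annCut m M) x * φ x) = (∫ x, annCut m M x * phase A s x * partialD j φ x) +
      ∫ x, partialD j (annCut m M) x * phase A s x * φ x :=
    Eq.trans (int_congr (fun x => by ring)) (integral_add i1 i2)
  have e2 : ∫ x, (partialD j (annCut m M) x * phase A s x +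
      annCut m M x * (s * A (s • x) j - A x j + flux β s x j)) * φ x =
      (∫ x, partialD j (annCut m M) x * phase A s x * φ x) +
      ∫ x, annCut m M x * (s * A (s • x) j - A x j + flux β s x j) * φ x :=
    Eq.trans (int_congr (fun x => by ring)) (integral_add i2 i3)
  have e3 : ∫ x, annCut m M x * (s * A (s • x) j - A x j + flux β s x j) * φ x =
      ∫ x, (s * A (s • x) j - A x j + flux β s x j) * (annCut m M x * φ x) :=
    int_congr fun x => by ring
  rw [e2, e3, key, e1]; ring

/-- The unimodular map `z ↦ exp (i Re z)`. -/
def expRe (z : ℂ) : ℂ := Complex.exp (I * (z.re : ℂ))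

lemma hasFDerivAt_expRe (z : ℂ) :
    HasFDerivAt expRe ((Complex.exp (I * (z.re : ℂ)) * I) •
      (ofRealCLM.comp reCLM)) z := by
  have h1 : HasFDerivAt (fun z => z.re) (ofRealCLM.comp reCLM) z :=
    (ofRealCLM.comp reCLM).hasFDerivAt
  have h2 := (h1.const_mul I).cexp
  rwa [smul_smul] at h2

lemma norm_expRe (z : ℂ) : ‖expRe z‖ = 1 := by rw [expRe, mul_comm, Complex.norm_exp_ofReal_mul_I]

lemma contDiff_expRe : ContDiff ℝ 1 expRe := by
  unfold expRe; exact (contDiff_const.mul (ofRealCLM.contDiff.comp reCLM.contDiff)).cexp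

lemma norm_fderiv_expRe_le (z : ℂ) : ‖fderiv ℝ expRe z‖ ≤ 1 := by
  rw [(hasFDerivAt_expRe z).fderiv]
  refine ContinuousLinearMap.opNorm_le_bound _ zero_le_one fun w => ?_
  have := norm_expRe z
  rw [expRe] at this; simp; exact abs_re_le_norm w

/-- The phase factor of parallel transport. -/
def expPh (A : E3 → E3) (s : ℝ) (x : E3) : ℂ := Complex.exp (I * phase A s x)

lemma norm_expPh (s : ℝ) (x : E3) : ‖expPh A s x‖ = 1 := by
  rw [expPh, mul_comm, Complex.norm_exp_ofReal_mul_I]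

lemma aesm_expPh (hA : MemL2loc A) (hs : s ∈ dil) : AESM (expPh A s) := by
  have : Continuous fun t : ℝ => Complex.exp (I * t) := by fun_prop
  exact this.comp_aestronglyMeasurable (aesm_phase hA hs)

lemma deriv_zero_of (h0 : ∀ r ∉ Icc m M, φ r = 0) {r : ℝ} (hr : r ∉ Icc m M) : deriv φ r = 0 := by
  have : φ =ᶠ[𝓝 r] fun _ => 0 := by
    filter_upwards [isClosed_Icc.isOpen_compl.mem_nhds hr] with y hy using h0 y hy
  rw [this.deriv_eq, deriv_const]

/-- The weak gradient of a radial cutoff times the phase factor. -/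
lemma wderiv_radial_expPh (hA : MemL2loc A) (h : RadialFlux A β) (hs : s ∈ dil)
    (hφ : LipschitzWith L φ) (hm : 0 < m) (h0 : ∀ r ∉ Icc m M, φ r = 0) (j : Fin 3) :
    WDeriv j (fun x => φ ‖x‖ * expPh A s x)
      (fun x => ((deriv φ ‖x‖ * (x j / ‖x‖) : ℝ) : ℂ) * expPh A s x +
        (φ ‖x‖ : ℂ) * (I * ((s * A (s • x) j - A x j + flux β s x j : ℝ) : ℂ) * expPh A s x)) ∧
    L2loc (fun x => ((deriv φ ‖x‖ * (x j / ‖x‖) : ℝ) : ℂ) * expPh A s x +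
        (φ ‖x‖ : ℂ) * (I * ((s * A (s • x) j - A x j + flux β s x j : ℝ) : ℂ) * expPh A s x)) := by
  -- Enlarging M makes the annulus nonempty, hence M' positive, as the cutoff requires.
  obtain ⟨M', hM', h0'⟩ : ∃ M', m ≤ M' ∧ ∀ r, r ∉ Icc m M' → φ r = 0 :=
    ⟨max m M, le_max_left _ _, fun r hr => h0 r fun h => hr ⟨h.1, h.2.trans (le_max_right _ _)⟩⟩
  have hM0 := hm.trans_le hM'
  obtain ⟨w, wl, wl'⟩ := wderiv_cutoff_phase hA h hs (m := m / 2) (M := 2 * M') (by linarith)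
    (by linarith) j
  set χ := annCut (m / 2) (2 * M') with hχ
  set Dz : E3 → ℝ := fun x => partialD j χ x * phase A s x +
    χ x * (s * A (s • x) j - A x j + flux β s x j) with hDz
  have hχt := isTest_annCut (m := m / 2) (M := 2 * M') (by linarith) (by linarith)
  have iz : Integrable (fun x => ((χ x * phase A s x : ℝ) : ℂ)) := by
    have hz : ∀ x ∉ tsupport (annCut (m / 2) (2 * M')), χ x * phase A s x = 0 := fun x hx => by
      rw [hχ, zero_of_tsupp hx, zero_mul]
    exact (int_of_compact wl.locallyIntegrable hχt.compact hz).ofReal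
  have iD : Integrable (fun x => (Dz x : ℂ)) := by
    have hz : ∀ x ∉ tsupport (annCut (m / 2) (2 * M')), Dz x = 0 := fun x hx => by
      simp only [hDz, hχ, zero_of_tsupp hx, partialD_zero_of j hx, zero_mul, zero_add]
    exact (int_of_compact wl'.locallyIntegrable hχt.compact hz).ofReal
  -- Exponentiating through the real part gives a map of ℂ with bounded derivative, so the chain
  -- rule applies to the real phase. The cutoff equals one near the support of φ and disappears
  -- after multiplication by φ.
  have we := w.ofReal.comp iz iD contDiff_expRe norm_fderiv_expRe_le
  obtain ⟨C, hC⟩ := exists_bound_radial hφ h0'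
  have hCx : ∀ x : E3, ‖(φ ‖x‖ : ℂ)‖ ≤ C := fun x => by rw [norm_real]; exact hC _
  have hbd : ∀ x : E3, ‖((deriv φ ‖x‖ * (x j / ‖x‖) : ℝ) : ℂ)‖ ≤ L := fun x => by
    rw [norm_real]; exact norm_radial_deriv_le hφ x j
  have hmd : AESM (fun x : E3 => ((deriv φ ‖x‖ * (x j / ‖x‖) : ℝ) : ℂ)) :=
    (measurable_ofReal.comp (measurable_radial_deriv φ j)).aesm
  have hwm := l2loc_of_bounded (contDiff_expRe.continuous.comp_aestronglyMeasurable iz.1)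
      fun x => (norm_expRe _).le
  have hone : ∀ x, ‖x‖ ∈ Icc m M' → χ x = 1 := fun x hx =>
    annCut_eq_one (by linarith) ⟨by linarith [hx.1], by linarith [hx.2]⟩
  have ev : ∀ x, φ ‖x‖ * expRe ((χ x * phase A s x : ℝ) : ℂ) = (φ ‖x‖) * expPh A s x := by
    intro x
    by_cases hx : ‖x‖ ∈ Icc m M'
    · rw [hone x hx, one_mul, expRe, ofReal_re, expPh]
    · rw [h0' _ hx, ofReal_zero, zero_mul, zero_mul]
  have eD : ∀ x, ((deriv φ ‖x‖ * (x j / ‖x‖) : ℝ) : ℂ) * expRe ((χ x * phase A s x : ℝ) : ℂ) +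
      (φ ‖x‖) * (fderiv ℝ expRe ((χ x * phase A s x : ℝ) : ℂ) (Dz x)) =
      ((deriv φ ‖x‖ * (x j / ‖x‖) : ℝ) : ℂ) * expPh A s x +
        (φ ‖x‖) * (I * ((s * A (s • x) j - A x j + flux β s x j : ℝ) : ℂ) * expPh A s x) := by
    intro x
    by_cases hx : ‖x‖ ∈ Icc m M'
    · have hd : partialD j χ x = 0 := partialD_annCut hm hx j
      rw [(hasFDerivAt_expRe _).fderiv]
      simp only [hDz, hone x hx, hd, expRe, expPh, ofReal_re, one_mul, zero_mul, zero_add,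
        smul_apply, ContinuousLinearMap.comp_apply, Complex.ofRealCLM_apply, Complex.reCLM_apply,
        smul_eq_mul]
      ring
    · rw [h0' _ hx, deriv_zero_of h0' hx]; simp
  refine ⟨((wderiv_radial hφ j).mul hCx (l2loc_of_bounded hmd hbd) we hwm).congr ev eD, ?_⟩
  have e2 : L2loc (fun x => ((deriv φ ‖x‖ * (x j / ‖x‖) : ℝ) : ℂ) *
      expRe ((χ x * phase A s x : ℝ) : ℂ)) := by
    refine l2loc_of_bounded (hmd.mul hwm.aesm) (C := L) fun x => ?_
    rw [norm_mul, norm_expRe, mul_one]; exact hbd x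
  have e3 : L2loc (fun x => φ ‖x‖ * (fderiv ℝ expRe ((χ x * phase A s x : ℝ) : ℂ) (Dz x))) := by
    refine wl'.of_le_mul (C := C) (((continuous_ofReal.comp (hφ.continuous.comp
      continuous_norm)).aesm).mul we.right.aesm) fun x => ?_
    rw [norm_mul]
    refine mul_le_mul (hCx x) ?_ (norm_nonneg _) ((norm_nonneg _).trans (hCx x))
    refine (le_opNorm _ _).trans ?_
    rw [norm_real]; exact mul_le_of_le_one_left (norm_nonneg _) (norm_fderiv_expRe_le _)
  rw [← funext eD]; exact e2.add e3

/-- The dilation of `u` by `s`, parallel transported along rays. -/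
def covDil (A : E3 → E3) (s : ℝ) (u : E3 → ℂ) (x : E3) : ℂ := expPh A s x * u (s • x)

/-- The magnetic gradient of `covDil`. -/
def covDilGrad (A β : E3 → E3) (s : ℝ) (u : E3 → ℂ) (g : E3 → C3) (x : E3) (j : Fin 3) : ℂ :=
  expPh A s x * (s * g (s • x) j + I * flux β s x j * u (s • x))

/-- The phase factor contributes i(sA(sx) - A(x) + flux) and u(sx) contributes s∇_A u(sx) -
isA(sx)u(sx). The terms with A(sx) cancel and -iA(x) is absorbed into ∇_A. What is left is the flux,
which is bounded on annuli although A need not be. The radial factor keeps away from the origin,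
where no control of the flux is assumed. -/
lemma IsH1A.covDil (hA : MemL2loc A) (hβ : RadialFlux A β) (h : IsH1A A u g) (hs : s ∈ dil)
    (hφ : LipschitzWith L φ) (hm : 0 < m) (h0 : ∀ r ∉ Icc m M, φ r = 0) :
    IsH1A A (fun x => φ ‖x‖ * covDil A s u x) (fun x => WithLp.toLp 2 fun j =>
      ((deriv φ ‖x‖ * (x j / ‖x‖) : ℝ) : ℂ) * MagneticHelmholtz.covDil A s u x +
        (φ ‖x‖ : ℂ) * covDilGrad A β s u g x j) := by
  have hs0 : 0 < s := dil_pos hs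
  obtain ⟨C, hC⟩ := exists_bound_radial hφ h0
  have hC0 : 0 ≤ C := (norm_nonneg _).trans (hC 0)
  have hCx : ∀ x : E3, ‖(φ ‖x‖ : ℂ) * expPh A s x‖ ≤ C := fun x => by
    rw [norm_mul, norm_expPh, mul_one, norm_real]; exact hC _
  have hpm := aesm_expPh hA hs
  have hφm : AESM (fun x : E3 => (φ ‖x‖ : ℂ)) :=
    (continuous_ofReal.comp (hφ.continuous.comp continuous_norm)).aesm
  have hus := memLp_dil h.memLp hs0
  obtain ⟨Cf, hCf0, hCf⟩ := norm_flux_le hβ (M := M) hm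
  refine isH1A_of_wderiv ?_ (memLp_C3 fun j => ?_) hA fun j => ?_
  · refine (memLp_mul_bdd hus (hφm.mul hpm) hCx).ae_eq (ae_of_all _ fun x => ?_)
    simp only [MagneticHelmholtz.covDil, Pi.mul_apply]; ring
  · have hgs := memLp_comp (memLp_dil h.memLp_grad hs0) j
    have hmd : AESM (fun x : E3 => ((deriv φ ‖x‖ * (x j / ‖x‖) : ℝ) : ℂ)) :=
      (measurable_ofReal.comp (measurable_radial_deriv φ j)).aesm
    have hfm : AESM (fun x : E3 => I * flux β s x j) :=
      ((measurable_ofReal.comp (measurable_flux hβ s j)).const_mul _).aesm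
    have h1 := memLp_mul_bdd hus (hmd.mul hpm) (C := L) fun x => by
      rw [Pi.mul_apply, norm_mul, norm_expPh, mul_one, norm_real]; exact norm_radial_deriv_le hφ x j
    have h2 := memLp_mul_bdd hus ((hφm.mul hpm).mul hfm) (C := C * Cf) fun x => by
      by_cases hx : x ∈ ann m M
      · simp only [Pi.mul_apply, norm_mul (_ * _) (_ * _)]
        refine mul_le_mul (hCx x) ?_ (norm_nonneg _) hC0
        rw [norm_mul, norm_I, one_mul, norm_real]; exact hCf s hs x hx j
      · have : φ ‖x‖ = 0 := h0 _ hx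
        simp only [Pi.mul_apply, this, ofReal_zero, zero_mul, norm_zero]; exact mul_nonneg hC0 hCf0
    have h3 := memLp_mul_bdd hgs ((hφm.mul hpm).mul_const (s : ℂ)) (C := C * s) fun x => by
      simp only [Pi.mul_apply, norm_mul (_ * _) _, norm_real, norm_of_nonneg hs0.le]
      exact mul_le_mul_of_nonneg_right (hCx x) hs0.le
    refine ((h1.add h2).add h3).ae_eq (ae_of_all _ fun x => ?_)
    simp only [MagneticHelmholtz.covDil, covDilGrad, Pi.mul_apply, Pi.add_apply]; ring
  · obtain ⟨w, wl⟩ := wderiv_radial_expPh hA hβ hs hφ hm h0 j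
    refine (w.mul hCx wl ((h.wderiv hA j).dil hs0) hus.l2loc).congr (fun x => ?_) fun x => ?_
    · simp only [MagneticHelmholtz.covDil]; ring
    · simp only [MagneticHelmholtz.covDil, covDilGrad]; push_cast; ring


/-! ### The Euler operator as generator of the transported dilations -/

/-- The function `θ ↦ exp (-iθ)`. -/
def expNeg (θ : ℝ) : ℂ := Complex.exp (I * ((-θ : ℝ) : ℂ))

lemma norm_expNeg (θ : ℝ) : ‖expNeg θ‖ = 1 := by
  rw [expNeg, mul_comm, Complex.norm_exp_ofReal_mul_I]

lemma expNeg_zero : expNeg 0 = 1 := by simp [expNeg]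

lemma continuous_expNeg : Continuous expNeg := by unfold expNeg; fun_prop

lemma hasDerivAt_expNeg (θ : ℝ) : HasDerivAt expNeg (expNeg θ * -I) θ := by
  have h1 : HasDerivAt (fun θ => I * ((-θ : ℝ) : ℂ)) (I * ((-1 : ℝ) : ℂ)) θ :=
    ((hasDerivAt_neg θ).ofReal_comp).const_mul _
  refine h1.cexp.congr_deriv ?_
  simp [expNeg]

/-- The difference quotient of `expNeg` at the origin. -/
def expSlope (θ : ℝ) : ℂ := dslope expNeg 0 θ

/-- Factoring out θ leaves a bounded continuous function of θ. The phase itself, known to have L²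
difference quotients, then appears linearly. -/
lemma expNeg_sub_one (θ : ℝ) : expNeg θ - 1 = (θ : ℂ) * expSlope θ := by
  have := sub_smul_dslope expNeg 0 θ
  rw [sub_zero, expNeg_zero, real_smul] at this; exact this.symm

lemma expSlope_zero : expSlope 0 = -I := by
  rw [expSlope, dslope_same, (hasDerivAt_expNeg 0).deriv, expNeg_zero, one_mul]

lemma norm_expSlope_le (θ : ℝ) : ‖expSlope θ‖ ≤ 1 := by
  rcases eq_or_ne θ 0 with rfl | h
  · rw [expSlope_zero, norm_neg, norm_I]
  · have h1 : ‖expNeg θ - 1‖ ≤ ‖-θ‖ := Real.norm_exp_I_mul_ofReal_sub_one_le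
    rw [expNeg_sub_one, norm_mul, norm_real, norm_neg] at h1
    exact le_of_mul_le_mul_left (by rwa [mul_one]) (norm_pos_iff.2 h)

lemma continuous_expSlope : Continuous expSlope := by
  rw [← continuousOn_univ]
  refine (continuousOn_dslope univ_mem).2 ⟨continuous_expNeg.continuousOn, ?_⟩
  exact (hasDerivAt_expNeg 0).differentiableAt

/-- The Euler operator `x · ∇_A`, in terms of the magnetic gradient. -/
def euler (g : E3 → C3) (x : E3) : ℂ := ∑ j, x j * g x j

local notation "crossRe" g:max u:max x:max => Complex.re (euler g x * conj (u x))

lemma IsTest.coord_mul {ζ : E3 → ℂ} (hζ : IsTest ζ) (j : Fin 3) : IsTest (fun x => x j * ζ x) := by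
  refine hζ.mul (ψ := fun x => (x j : ℂ)) ?_
  have h1 : ContDiff ℝ C∞ (fun x : E3 => x j) := by fun_prop
  exact ofRealCLM.contDiff.comp h1

lemma partialD_coord_mul {ζ : E3 → ℂ} (hζ : IsTest ζ) (j : Fin 3) (x : E3) :
    partialD j (fun x => x j * ζ x) x = (x j : ℂ) * partialD j ζ x + ζ x := by
  have h1 : HasFDerivAt (fun x => (x j)) (ofRealCLM.comp (EuclideanSpace.proj j : E3 →L[ℝ] ℝ)) x :=
    (ofRealCLM.comp (EuclideanSpace.proj j : E3 →L[ℝ] ℝ)).hasFDerivAt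
  rw [partialD_mul h1.differentiableAt (hζ.differentiable x)]; congr 1; rw [partialD, h1.fderiv]
  simp

/-- The transpose of x·∇_A; the 3 is the divergence of x. The right-hand side is what
differentiation of a dilated test function with its phase produces. -/
lemma IsH1A.integral_euler (hA : MemL2loc A) {v : E3 → ℂ} {G : E3 → C3} (h : IsH1A A v G)
    {ζ : E3 → ℂ} (hζ : IsTest ζ) :
    ∫ x, euler G x * ζ x = -∫ x, v x * (3 * ζ x + fderiv ℝ ζ x x -
      I * (rpot A (1, x) : ℂ) * ζ x) := by
  have iL : ∀ j, Integrable (fun x => G x j * (x j * ζ x)) := fun j =>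
    (memLp_comp h.memLp_grad j).l2loc.locallyIntegrable.int_mul_test (hζ.coord_mul j)
  have i1 : ∀ j, Integrable (fun x => v x * partialD j (fun x => x j * ζ x) x) :=
    fun j => h.memLp.l2loc.locallyIntegrable.int_mul_test ((hζ.coord_mul j).partialD j)
  have i2 : ∀ j, Integrable (fun x => I * A x j * v x * (x j * ζ x)) := by
    intro j
    have := (((hA.component j).mul h.memLp.l2loc).int_mul_test (hζ.coord_mul j)).const_mul I
    exact this.congr (ae_of_all _ fun x => by ring)
  have e1 : ∫ x, euler G x * ζ x = ∑ j, ∫ x, G x j * (x j * ζ x) := by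
    rw [← integral_finsetSum _ fun j _ => iL j]
    refine int_congr fun x => ?_
    simp only [euler, Finset.sum_mul]; exact sum_congr rfl fun j _ => by ring
  rw [e1]; simp_rw [h.weak _ _ (hζ.coord_mul _)]
  refine (integral_finsetSum (f := fun j x => -(v x * partialD j (fun x => x j * ζ x) x) +
    I * A x j * v x * (x j * ζ x)) _
    fun j _ => ((i1 j).neg.add (i2 j))).symm.trans ?_
  rw [← integral_neg]
  refine int_congr fun x => ?_
  simp only [partialD_coord_mul hζ, rpot, one_smul, ← sum_coord_partialD, real_smul,
    Fin.sum_univ_three]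
  push_cast; ring

lemma hasDerivAt_dil_test {ζ : E3 → ℂ} (hζ : IsTest ζ) (y : E3) (σ : ℝ) :
    HasDerivAt (fun σ : ℝ => (σ : ℂ) ^ 3 * ζ (σ • y))
      ((3 * (σ : ℂ) ^ 2) * ζ (σ • y) + (σ : ℂ) ^ 3 * fderiv ℝ ζ (σ • y) y) σ := by
  have h1 : HasDerivAt (fun σ => σ • y) y σ := by simpa using (hasDerivAt_id σ).smul_const y
  have h3 : HasDerivAt (fun σ : ℝ => (σ : ℂ) ^ 3) (3 * σ ^ 2) σ := by
    exact ((hasDerivAt_id σ).ofReal_comp.pow 3).congr_deriv (by simp)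
  exact h3.mul ((hζ.differentiable (σ • y)).hasFDerivAt.comp_hasDerivAt σ h1)

lemma dil_test_lipschitz {ζ : E3 → ℂ} (hζ : IsTest ζ) (hm : 0 < m) (h0 : ∀ x ∉ ann m M, ζ x = 0) :
    ∃ C, ∀ σ ∈ dil, ∀ y, ‖(σ : ℂ) ^ 3 * ζ (σ • y) - ζ y‖ ≤
        C * |σ - 1| * (ann (m / 2) (2 * M)).indicator (fun _ => (1 : ℝ)) y := by
  obtain ⟨C1, hC1⟩ := hζ.bounded
  obtain ⟨C2, hC2⟩ := (hζ.compact.fderiv ℝ).exists_bound_of_continuous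
    (hζ.contDiff_one.continuous_fderiv one_ne_zero)
  refine ⟨12 * C1 + 8 * (C2 * (2 * M)), fun σ hσ y => ?_⟩
  by_cases hy : y ∈ ann (m / 2) (2 * M)
  · rw [indicator_of_mem hy, mul_one]
    have := (convex_Icc (1 / 2) 2).norm_image_sub_le_of_norm_hasDerivWithin_le
     
      (C := 12 * C1 + 8 * (C2 * (2 * M)))
      (fun σ _ => (hasDerivAt_dil_test hζ y σ).hasDerivWithinAt) (fun σ hσ => ?_) one_mem_dil hσ
    · simpa using this
    · have hσ0 : 0 ≤ σ := by linarith [hσ.1]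
      have hn : ‖(σ : ℂ)‖ = σ := by rw [norm_real, norm_of_nonneg hσ0]
      refine (norm_add_le _ _).trans (add_le_add ?_ ?_)
      · rw [norm_mul, norm_mul, norm_pow, hn]
        refine mul_le_mul ?_ (hC1 _) (norm_nonneg _) (by norm_num)
        simp; nlinarith [hσ.2]
      · rw [norm_mul, norm_pow, hn]
        refine mul_le_mul ?_ ?_ (norm_nonneg _) (by norm_num)
        · have := pow_le_pow_left₀ hσ0 hσ.2 3
          norm_num at this ⊢; exact this
        · refine (le_opNorm _ _).trans ?_
          exact mul_le_mul (hC2 _) hy.2 (norm_nonneg _) ((norm_nonneg _).trans (hC2 0))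
  · have h2 : ζ y = 0 := by
      refine h0 y fun h => hy ?_
      have := dil_mem_ann one_mem_dil hm h
      rwa [one_smul] at this
    have h3 : ζ (σ • y) = 0 := by
      refine h0 _ fun h => hy ?_
      have := dil_mem_ann (inv_mem_dil hσ) hm h
      rwa [inv_smul_smul₀ (by linarith [hσ.1] : σ ≠ 0)] at this
    rw [indicator_of_notMem hy, h2, h3]; simp

/-- Here the dilation acts on the smooth ζ while v stays in place, so v need not be differentiable.
The quotient splits into a part in which the test function is differenced, treated by dominated
convergence, and a part in which the phase is differenced, treated by the L² convergence of phase
quotients. -/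
lemma hasDerivAt_phase_pairing (hA : MemL2loc A) {v : E3 → ℂ} (hv : MemLp v 2) {ζ : E3 → ℂ}
    (hζ : IsTest ζ) (hm : 0 < m) (h0 : ∀ x ∉ ann m M, ζ x = 0) :
    HasDerivAt (fun σ : ℝ => ∫ y, v y * (expNeg (phase A σ y) * ((σ : ℂ) ^ 3 * ζ (σ • y))))
      (∫ x, v x * (3 * ζ x + fderiv ℝ ζ x x - I * (rpot A (1, x) : ℂ) * ζ x)) 1 := by
  obtain ⟨C, hC⟩ := dil_test_lipschitz hζ hm h0
  obtain ⟨Cζ, hCζ⟩ := hζ.bounded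
  have hm2 : 0 < m / 2 := by linarith
  have hnb : ∀ᶠ τ : ℝ in 𝓝[≠] 1, τ ∈ dil :=
    nhdsWithin_le_nhds (Icc_mem_nhds (by norm_num) (by norm_num))
  have hvl := hv.l2loc.locallyIntegrable
  have hem : ∀ σ ∈ dil, AESM (fun y => expNeg (phase A σ y)) :=
    fun σ hσ => continuous_expNeg.comp_aestronglyMeasurable (aesm_phase hA hσ)
  have hζc : ∀ σ : ℝ, Continuous fun y => (σ : ℂ) ^ 3 * ζ (σ • y) := fun σ =>
    continuous_const.mul (hζ.continuous.comp (continuous_const_smul σ))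
  have hvζ := memLp_mul_bdd hv hζ.continuous.aesm hCζ
  have hvζ0 : ∀ y ∉ ann m M, v y * ζ y = 0 := fun y hy => by rw [h0 y hy, mul_zero]
  set T1 : ℝ → E3 → ℂ := fun σ y => v y * (expNeg (phase A σ y) *
    (((σ - 1)⁻¹ : ℝ) * ((σ : ℂ) ^ 3 * ζ (σ • y) - ζ y))) with hT1
  set T2 : ℝ → E3 → ℂ := fun σ y => (v y * ζ y * expSlope (phase A σ y)) *
    (((σ - 1)⁻¹ * phase A σ y : ℝ) : ℂ) with hT2
  set B : E3 → ℝ := fun y => ‖v y‖ * (C * (ann (m / 2) (2 * M)).indicator (fun _ => (1 : ℝ)) y)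
    with hB
  have hBi : Integrable B := by
    have h1 : Integrable ((ann (m / 2) (2 * M)).indicator fun y => C * ‖v y‖) :=
      (integrable_indicator_iff (measSet_ann _ _)).2
        ((hvl.integrableOn_isCompact (compact_ann _ _)).norm.const_mul C)
    refine h1.congr (ae_of_all _ fun y => ?_)
    by_cases hy : y ∈ ann (m / 2) (2 * M)
    · simp only [hB, indicator_of_mem hy]; ring
    · simp only [hB, indicator_of_notMem hy]; ring
  have hT1m : ∀ σ ∈ dil, AESM (T1 σ) := fun σ hσ =>
    hv.1.mul ((hem σ hσ).mul (((hζc σ).sub hζ.continuous).aesm.const_mul _))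
  have hT1b : ∀ σ ∈ dil, σ ≠ 1 → ∀ y, ‖T1 σ y‖ ≤ B y := by
    intro σ hσ h1 y; rw [hT1, hB]
    simp only [norm_mul, norm_expNeg, one_mul, norm_real, norm_eq_abs, abs_inv]
    refine mul_le_mul_of_nonneg_left ?_ (norm_nonneg _)
    rw [inv_mul_le_iff₀ (abs_pos.2 (sub_ne_zero.2 h1))]
    refine (hC σ hσ y).trans (le_of_eq (by ring))
  have hT1i : ∀ σ ∈ dil, σ ≠ 1 → Integrable (T1 σ) := fun σ hσ h1 =>
    hBi.mono' (hT1m σ hσ) (ae_of_all _ (hT1b σ hσ h1))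
  have hph : ∀ σ ∈ dil, MemLp (fun y => (((σ - 1)⁻¹ * (ann m M).indicator
      (phase A σ) y : ℝ) : ℂ)) 2 := fun σ hσ =>
    ((memLp_phase hA hσ hm).const_mul _).ofReal
  have hQ : ∀ σ ∈ dil, MemLp (fun y => v y * ζ y * expSlope (phase A σ y)) 2 := fun σ hσ =>
    memLp_mul_bdd hvζ (continuous_expSlope.comp_aestronglyMeasurable
      (aesm_phase hA hσ)) fun y => norm_expSlope_le _
  have hT2e : ∀ σ, T2 σ = fun y => (v y * ζ y * expSlope (phase A σ y)) *
      (((σ - 1)⁻¹ * (ann m M).indicator (phase A σ) y : ℝ) : ℂ) := by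
    intro σ; funext y
    by_cases hy : y ∈ ann m M
    · rw [indicator_of_mem hy]
    · rw [hT2]; simp only [hvζ0 y hy, zero_mul]
  have hT2i : ∀ σ ∈ dil, Integrable (T2 σ) := fun σ hσ => by
    rw [hT2e]; exact int_mul (hQ σ hσ) (hph σ hσ)
  -- the first limit
  have lim1 : Tendsto (fun σ => ∫ y, T1 σ y) (𝓝[≠] 1)
      (𝓝 (∫ y, v y * (3 * ζ y + fderiv ℝ ζ y y))) := by
    refine tendsto_integral_filter_of_dominated_convergence B ?_ ?_ hBi ?_
    · filter_upwards [hnb] with σ hσ using hT1m σ hσ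
    · filter_upwards [hnb, self_mem_nhdsWithin] with σ hσ h1 using ae_of_all _ (hT1b σ hσ h1)
    · filter_upwards [tendsto_phase_zero hA] with y hy
      have e1 : Tendsto (fun σ => expNeg (phase A σ y)) (𝓝[≠] 1) (𝓝 1) := by
        have := (continuous_expNeg.tendsto 0).comp (hy.mono_left (nhdsWithin_le_nhds (s := {1}ᶜ)))
        rwa [expNeg_zero] at this
      have e2 : Tendsto (fun σ : ℝ => (((σ - 1)⁻¹ : ℝ) : ℂ) * ((σ : ℂ) ^ 3 * ζ (σ • y) - ζ y))
          (𝓝[≠] 1) (𝓝 (3 * ζ y + fderiv ℝ ζ y y)) := by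
        have := hasDerivAt_iff_tendsto_slope.1 (hasDerivAt_dil_test hζ y 1)
        simp at this
        refine this.congr fun σ => ?_
        simp [slope_def_module]
      simpa only [one_mul] using (tendsto_const_nhds).mul (e1.mul e2)
  -- the second limit
  have hR : MemLp ((ann m M).indicator fun y => rpot A (1, y)) 2 := by
    have : ∀ k : Fin 3, L2loc (fun x : E3 => A x k) := hA.comp_real
    obtain ⟨K, hK, h⟩ := indicator_rpot_le hA hm
    refine ⟨AEStronglyMeasurable.indicator ?_ (measSet_ann _ _),
      (h 1 one_mem_dil).trans_lt hK.lt_top⟩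
    refine aestronglyMeasurable_fun_sum _ fun k _ => ?_
    simp; exact (meas_coord k).aesm.mul (this k).aesm
  have lim2 : Tendsto (fun σ => ∫ y, T2 σ y) (𝓝[≠] 1)
      (𝓝 (∫ y, v y * ζ y * -I * ((ann m M).indicator (fun y => rpot A (1, y)) y : ℝ))) := by
    -- The phase quotient is first replaced by its L² limit by Cauchy–Schwarz; the slope factor is
    -- bounded by 1 throughout.
    have s1 : Tendsto (fun σ => ∫ y, (v y * ζ y * expSlope (phase A σ y)) *
        (((σ - 1)⁻¹ * (ann m M).indicator (phase A σ) y -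
          (ann m M).indicator (fun y => rpot A (1, y)) y : ℝ) : ℂ)) (𝓝[≠] 1) (𝓝 0) := by
      rw [tendsto_zero_iff_enorm_tendsto_zero]
      have l2 := ENNReal.Tendsto.const_mul (tendsto_phase_quotient hA (M := M) hm) (Or.inr hvζ.2.ne)
      rw [mul_zero] at l2
      refine tendsto_of_tendsto_of_tendsto_of_le_of_le' tendsto_const_nhds l2
        (Eventually.of_forall fun _ => zero_le) ?_
      filter_upwards [hnb] with σ hσ
      refine (enorm_int_mul_le (hQ σ hσ).1 ?_).trans (mul_le_mul' ?_ ?_)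
      · have := (hph σ hσ).1.sub hR.ofReal.1
        refine this.congr (ae_of_all _ fun y => ?_)
        simp
      · refine eLpNorm_mono fun y => ?_
        rw [norm_mul]; exact mul_le_of_le_one_right (norm_nonneg _) (norm_expSlope_le _)
      · refine eLpNorm_mono fun y => ?_
        rw [norm_real]
        by_cases hy : y ∈ ann m M
        · simp only [indicator_of_mem hy]; exact le_rfl
        · simp [indicator_of_notMem hy]
    have s2 : Tendsto (fun σ => ∫ y, (v y * ζ y * expSlope (phase A σ y)) *
        ((ann m M).indicator (fun y => rpot A (1, y)) y : ℝ)) (𝓝[≠] 1)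
        (𝓝 (∫ y, v y * ζ y * -I * ((ann m M).indicator (fun y => rpot A (1, y)) y : ℝ))) := by
      refine tendsto_integral_filter_of_dominated_convergence (fun y => ‖v y * ζ y *
        ((ann m M).indicator (fun y => rpot A (1, y)) y : ℝ)‖) ?_ ?_
        (int_mul hvζ hR.ofReal).norm ?_
      · filter_upwards [hnb] with σ hσ using (hQ σ hσ).1.mul hR.ofReal.1
      · refine Eventually.of_forall fun σ => ae_of_all _ fun y => ?_
        rw [norm_mul, norm_mul (v y * ζ y), norm_mul (v y * ζ y)]
        refine mul_le_mul_of_nonneg_right ?_ (norm_nonneg _)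
        exact mul_le_of_le_one_right (norm_nonneg _) (norm_expSlope_le _)
      · filter_upwards [tendsto_phase_zero hA] with y hy
        have e1 : Tendsto (fun σ => expSlope (phase A σ y)) (𝓝[≠] 1) (𝓝 (-I)) := by
          have := (continuous_expSlope.tendsto 0).comp
            (hy.mono_left (nhdsWithin_le_nhds (s := {1}ᶜ)))
          rwa [expSlope_zero] at this
        exact (tendsto_const_nhds.mul e1).mul tendsto_const_nhds
    have s3 := s1.add s2
    rw [zero_add] at s3
    refine s3.congr' ?_
    filter_upwards [hnb] with σ hσ
    rw [hT2e, ← integral_add]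
    · refine int_congr fun y => ?_
      push_cast; ring
    · have := int_mul (hQ σ hσ) ((hph σ hσ).sub hR.ofReal)
      refine this.congr (ae_of_all _ fun y => ?_)
      simp
    · exact int_mul (hQ σ hσ) hR.ofReal
  -- conclusion
  rw [hasDerivAt_iff_tendsto_slope]
  have iV1 : Integrable (fun y => v y * (3 * ζ y + fderiv ℝ ζ y y)) := by
    have hc : Continuous fun y => 3 * ζ y + fderiv ℝ ζ y y :=
      (continuous_const.mul hζ.continuous).add
        ((hζ.contDiff_one.continuous_fderiv one_ne_zero).clm_apply continuous_id)
    have hz : ∀ x ∉ tsupport ζ, 3 * ζ x + fderiv ℝ ζ x x = 0 := fun x hx => by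
      have : fderiv ℝ ζ x = 0 := by
        by_contra h; exact hx (support_fderiv_subset ℝ (Function.mem_support.2 h))
      rw [zero_of_tsupp hx, this]; simp
    obtain ⟨K, hK⟩ := (HasCompactSupport.intro hζ.compact hz).exists_bound_of_continuous hc
    exact hvl.int_mul_compact hc.aesm hK hζ.compact hz
  have iV2 : Integrable (fun y => v y * ζ y * -I *
      ((ann m M).indicator (fun y => rpot A (1, y)) y : ℝ)) :=
    ((int_mul hvζ hR.ofReal).const_mul (-I)).congr
      (ae_of_all _ fun y => by simp only [RCLike.ofReal_eq_complex_ofReal]; ring)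
  have elim : ∫ x, v x * (3 * ζ x + fderiv ℝ ζ x x - I * (rpot A (1, x) : ℂ) * ζ x) =
      (∫ y, v y * (3 * ζ y + fderiv ℝ ζ y y)) + ∫ y, v y * ζ y * -I *
      ((ann m M).indicator (fun y => rpot A (1, y)) y : ℝ) := by
    rw [← integral_add iV1 iV2]
    refine int_congr fun y => ?_
    by_cases hy : y ∈ ann m M
    · simp only [indicator_of_mem hy]; ring
    · simp only [indicator_of_notMem hy, h0 y hy, ofReal_zero]; ring
  rw [elim]
  refine (lim1.add lim2).congr' ?_
  filter_upwards [hnb, self_mem_nhdsWithin] with σ hσ h1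
  have hs1 : (((σ - 1)⁻¹ : ℝ) : ℂ) * ((σ : ℂ) - 1) = 1 := by
    have : (σ : ℂ) - 1 ≠ 0 := by
      rw [← Complex.ofReal_one, ← Complex.ofReal_sub]
      exact Complex.ofReal_ne_zero.2 (sub_ne_zero.2 h1)
    push_cast; exact inv_mul_cancel₀ this
  have iσ : ∀ τ ∈ dil, Integrable (fun y => v y * (expNeg (phase A τ y) *
      ((τ : ℂ) ^ 3 * ζ (τ • y)))) := by
    intro τ hτ
    refine hvl.int_mul_compact ((hem τ hτ).mul (hζc τ).aesm)
      (C := ‖(τ : ℂ) ^ 3‖ * Cζ) (fun y => ?_) (compact_ann (m / 2) (2 * M)) fun y hy => ?_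
    · rw [norm_mul, norm_expNeg, one_mul, norm_mul]
      exact mul_le_mul_of_nonneg_left (hCζ _) (norm_nonneg _)
    · have h3 : ζ (τ • y) = 0 := by
        refine h0 _ fun h => hy ?_
        have := dil_mem_ann (inv_mem_dil hτ) hm h
        rwa [inv_smul_smul₀ (by linarith [hτ.1] : τ ≠ 0)] at this
      rw [h3, mul_zero, mul_zero]
  rw [slope_def_module, ← integral_sub (iσ σ hσ) (iσ 1 one_mem_dil), real_smul,
    ← integral_const_mul, ← integral_add (hT1i σ hσ h1) (hT2i σ hσ)]
  refine int_congr fun y => ?_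
  have hp1 : phase A 1 y = 0 := by simp [phase_eq]
  simp only [hT1, hT2, hp1, expNeg_zero, one_smul, Complex.ofReal_one, one_pow, one_mul,
    Complex.ofReal_mul]
  -- With the phase denoted θ: e^(-iθ)σ³ζ(σy) - ζ(y) = e^(-iθ)(σ³ζ(σy) - ζ(y)) + (e^(-iθ) - 1)ζ(y).
  linear_combination (-(v y * ζ y * (((σ - 1)⁻¹ : ℝ) : ℂ))) * (expNeg_sub_one (phase A σ y))

/-- The transported dilations are generated by the Euler operator. -/
lemma hasDerivAt_covDil_pairing_one (hA : MemL2loc A) {v : E3 → ℂ} {G : E3 → C3} (h : IsH1A A v G)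
    {ζ : E3 → ℂ} (hζ : IsTest ζ) (hm : 0 < m) (h0 : ∀ x ∉ ann m M, ζ x = 0) :
    HasDerivAt (fun s => ∫ x, covDil A s v x * ζ x) (∫ x, euler G x * ζ x) 1 := by
  set P : ℝ → ℂ := fun σ => ∫ y, v y * (expNeg (phase A σ y) * (σ ^ 3 * ζ (σ • y))) with hP
  have hP' := hasDerivAt_phase_pairing hA h.memLp hζ hm h0
  have hinv : HasDerivAt (fun s : ℝ => s⁻¹) (-1) 1 := by
    simpa using hasDerivAt_inv (one_ne_zero (α := ℝ))
  have hP'' : HasDerivAt P (∫ x, v x * (3 * ζ x + fderiv ℝ ζ x x -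
      I * (rpot A (1, x) : ℂ) * ζ x)) 1⁻¹ := by rwa [inv_one]
  -- Changing variables turns dilation of v by s into dilation of the test function by 1/s, whose
  -- derivative -1 supplies the sign of the transpose.
  have hcomp := hP''.scomp 1 hinv
  rw [h.integral_euler hA hζ]; rw [neg_one_smul] at hcomp
  refine hcomp.congr_of_eventuallyEq ?_
  filter_upwards [eventually_gt_nhds (zero_lt_one (α := ℝ))] with s hs
  have e := integral_dil (fun y => expPh A s (s⁻¹ • y) * v y * ζ (s⁻¹ • y)) hs
  simp only [inv_smul_smul₀ hs.ne'] at e; simp only [covDil, hP, Function.comp]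
  rw [e, real_smul, ← integral_const_mul]
  refine int_congr fun y => ?_
  simp only [expPh, phase_inv hs, expNeg]; push_cast; ring


/-! ### Weak convergence of the difference quotients -/

/-- The piecewise linear cutoff that is one on `[a, b]` and vanishes outside `[a / 2, 2 b]`. -/
def trap (a b r : ℝ) : ℝ := max 0 (min 1 (min (2 * r / a - 1) (2 - r / b)))

lemma trap_nonneg (a b r : ℝ) : 0 ≤ trap a b r := le_max_left _ _

lemma trap_le_one (a b r : ℝ) : trap a b r ≤ 1 := max_le zero_le_one (min_le_left _ _)

lemma trap_eq_one {a b r : ℝ} (ha : 0 < a) (hr : r ∈ Icc a b) : trap a b r = 1 := by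
  have h1 : 1 ≤ 2 * r / a - 1 := by
    have : 2 ≤ 2 * r / a := by rw [le_div_iff₀ ha]; linarith [hr.1]
    linarith
  have h2 : 1 ≤ 2 - r / b := by
    have : r / b ≤ 1 := by rw [div_le_one (ha.trans_le (hr.1.trans hr.2))]; exact hr.2
    linarith
  rw [trap, min_eq_left (le_min h1 h2), max_eq_right zero_le_one]

lemma trap_eq_zero {a b r : ℝ} (ha : 0 < a) (hb : 0 < b) (hr : r ∉ Icc (a / 2) (2 * b)) :
    trap a b r = 0 := by
  refine max_eq_left ((min_le_right _ _).trans ?_)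
  by_cases h : a / 2 ≤ r
  · refine (min_le_right _ _).trans ?_
    have h3 : 2 * b < r := by by_contra hc; exact hr ⟨h, not_lt.1 hc⟩
    have : 2 ≤ r / b := by rw [le_div_iff₀ hb]; exact h3.le
    linarith
  · refine (min_le_left _ _).trans ?_
    have : 2 * r / a ≤ 1 := by rw [div_le_one ha]; linarith
    linarith

lemma lipschitzWith_affine (p q : ℝ) : LipschitzWith ‖p‖₊ (fun r : ℝ => p * r + q) :=
  LipschitzWith.of_dist_le_mul fun r s => by
    rw [Real.dist_eq, Real.dist_eq, coe_nnnorm, norm_eq_abs, ← abs_mul]; exact le_of_eq (by ring_nf)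

lemma lipschitzWith_trap (a b : ℝ) : ∃ L : ℝ≥0, LipschitzWith L (trap a b) := by
  have h3 := (((lipschitzWith_affine (2 / a) (-1)).min (lipschitzWith_affine (-b⁻¹) 2)).const_min 1).const_max 0
  have e : trap a b = fun x => max 0 (min 1 (min (2 / a * x + -1) (-b⁻¹ * x + 2))) := by
    funext r
    rw [trap, show 2 * r / a - 1 = 2 / a * r + -1 by ring, show 2 - r / b = -b⁻¹ * r + 2 by ring]
  rw [e]; exact ⟨_, h3⟩

/-- The flux is orthogonal to the ray, since x·β = 0. Hence the Euler operator does not see the flux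
term in the gradient of a transported dilation. -/
lemma euler_flux (hβ : RadialFlux A β) (hs : s ∈ dil) (x : E3) : ∑ j, x j * flux β s x j = 0 := by
  rcases eq_or_ne x 0 with rfl | hx
  · simp
  have hint : ∀ j, IntervalIntegrable (fun τ => x j * β (τ • x) j) volume 1 s := by
    intro j
    refine IntervalIntegrable.const_mul ?_ _
    obtain ⟨C, hC⟩ := hβ.bound (‖x‖ / 2) (2 * ‖x‖) (half_pos (norm_pos_iff.2 hx))
    rw [intervalIntegrable_iff]
    have hm : Measurable fun τ : ℝ => β (τ • x) j :=
      (meas_coord j).comp (hβ.meas.comp (measurable_id.smul_const x))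
    refine Measure.integrableOn_of_bounded (M := C) (by simp) hm.aesm ?_
    refine (ae_restrict_iff' measurableSet_uIoc).2 (ae_of_all _ fun τ hτ => ?_)
    exact (norm_apply_le _ _).trans (hC _ (dil_mem_ann (uIoc_subset_dil one_mem_dil hs hτ)
      (norm_pos_iff.2 hx) ⟨le_rfl, le_rfl⟩))
  simp only [flux, ← intervalIntegral.integral_const_mul]
  rw [← intervalIntegral.integral_finsetSum fun j _ => hint j]
  have : ∀ τ ∈ uIcc 1 s, ∑ j, x j * β (τ • x) j = 0 := by
    intro τ hτ
    have h := hβ.orth (τ • x)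
    simp only [PiLp.smul_apply, smul_eq_mul, mul_assoc, ← mul_sum] at h
    exact (mul_eq_zero.1 h).resolve_left (lt_of_lt_of_le (lt_min one_pos (by linarith [hs.1])) hτ.1).ne'
  rw [integral_congr this]; simp

lemma memLp_covDil (hA : MemL2loc A) (hu : MemLp u 2) (hs : s ∈ dil) : MemLp (covDil A s u) 2 := by
  have := memLp_mul_bdd (memLp_dil hu (dil_pos hs)) (aesm_expPh hA hs) fun x => (norm_expPh s x).le
  exact this.ae_eq (ae_of_all _ fun x => mul_comm _ _)

/-- By the group law the dilation by t is the dilation by t/s of the one by s, so the derivative at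
s reduces to the derivative at 1 for the already dilated function; t ↦ t/s accounts for the scalar.
A trapezoidal factor, equal to one near all relevant dilates of the support of ζ, brings the dilated
function into H¹_A. -/
lemma hasDerivAt_covDil_pairing (hA : MemL2loc A) (hβ : RadialFlux A β) (h : IsH1A A u g)
    {ζ : E3 → ℂ} (hζ : IsTest ζ) (hm : 0 < m) (hM : 0 < M) (h0 : ∀ x ∉ ann m M, ζ x = 0)
    (hs : s ∈ Ioo (1 / 2 : ℝ) 2) :
    HasDerivAt (fun s => ∫ x, covDil A s u x * ζ x)
      ((s⁻¹ : ℝ) • ∫ x, expPh A s x * euler g (s • x) * ζ x) s := by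
  have hs' : s ∈ dil := ⟨hs.1.le, hs.2.le⟩
  have hs0 := dil_pos hs'
  obtain ⟨L, hL⟩ := lipschitzWith_trap (m / 2) (2 * M)
  have htr0 : ∀ r, r ∉ Icc (m / 2 / 2) (2 * (2 * M)) → trap (m / 2) (2 * M) r = 0 := fun r hr =>
    trap_eq_zero (by linarith) (by linarith) hr
  have hd := hasDerivAt_covDil_pairing_one hA (h.covDil hA hβ hs' hL (by linarith) htr0) hζ hm h0
  have e1 : ∫ x, euler (fun x => WithLp.toLp 2 fun j =>
      ((deriv (trap (m / 2) (2 * M)) ‖x‖ * (x j / ‖x‖) : ℝ) : ℂ) * covDil A s u x +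
        ((trap (m / 2) (2 * M) ‖x‖ : ℝ) : ℂ) * covDilGrad A β s u g x j) x * ζ x =
      ∫ x, expPh A s x * euler g (s • x) * ζ x := by
    refine int_congr fun x => ?_
    by_cases hx : x ∈ ann m M
    · have h1 : deriv (trap (m / 2) (2 * M)) ‖x‖ = 0 := by
        have : trap (m / 2) (2 * M) =ᶠ[𝓝 ‖x‖] fun _ => 1 := by
          filter_upwards [Ioo_mem_nhds (a := m / 2) (b := 2 * M) (by linarith [hx.1])
            (by linarith [hx.2])] with r hr
          exact trap_eq_one (by linarith) ⟨hr.1.le, hr.2.le⟩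
        rw [this.deriv_eq, deriv_const]
      have h2 : trap (m / 2) (2 * M) ‖x‖ = 1 :=
        trap_eq_one (by linarith) ⟨by linarith [hx.1], by linarith [hx.2]⟩
      simp only [h1, h2, zero_mul, ofReal_zero, zero_add, Complex.ofReal_one, one_mul, euler,
        covDilGrad, PiLp.smul_apply, smul_eq_mul, Complex.ofReal_mul]
      congr 1
      have hf := congrArg (fun t : ℝ => (t : ℂ)) (euler_flux hβ hs' x)
      simp only [Fin.sum_univ_three, Complex.ofReal_add, Complex.ofReal_mul, ofReal_zero] at hf ⊢
      linear_combination (expPh A s x * I * u (s • x)) * hf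
    · simp only [h0 x hx, mul_zero]
  rw [e1] at hd
  have hdiv : HasDerivAt (fun t : ℝ => t / s) s⁻¹ s := by simpa using (hasDerivAt_id s).div_const s
  have hd' : HasDerivAt (fun s' => ∫ x, covDil A s' (fun x =>
      ((trap (m / 2) (2 * M) ‖x‖ : ℝ) : ℂ) * covDil A s u x) x * ζ x)
      (∫ x, expPh A s x * euler g (s • x) * ζ x) (s / s) := by rwa [div_self hs0.ne']
  refine (HasDerivAt.scomp (h := fun t => t / s) s hd' hdiv).congr_of_eventuallyEq ?_
  have n2 : ∀ᶠ t in 𝓝 s, t / s ∈ dil := by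
    refine hdiv.continuousAt (Icc_mem_nhds ?_ ?_) <;> rw [div_self hs0.ne'] <;> norm_num
  filter_upwards [Icc_mem_nhds hs.1 hs.2, n2] with t ht hts
  simp
  refine integral_congr_ae ?_
  filter_upwards [ae_intervalIntegrable_rpot hA] with x hxi
  by_cases hx : x ∈ ann m M
  · have h2 := trap_eq_one (by linarith) (dil_mem_ann hts hm hx)
    have i1 := intervalIntegrable_iff.2 (hxi.mono_set (uIoc_subset_dil one_mem_dil hts))
    have hst : s * (t / s) = t := by field_simp
    have i2 : IntervalIntegrable (fun τ => rpot A (τ, x)) volume (t / s) (s * (t / s)) := by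
      rw [hst]; exact intervalIntegrable_iff.2 (hxi.mono_set (uIoc_subset_dil hts ht))
    have hp := phase_comp s (t / s) x i1 i2
    rw [hst] at hp; simp only [covDil, expPh, h2, hp, smul_smul, hst]
    rw [Complex.ofReal_add, mul_add, Complex.exp_add]; push_cast; ring
  · simp only [h0 x hx, mul_zero]

/-- The `L²` norm as a real number. -/
def l2n (f : E3 → F) : ℝ := (eLpNorm f 2 volume).toReal

lemma norm_integral_mul_le {k z : E3 → ℂ} (hk : MemLp k 2) (hz : MemLp z 2) :
    ‖∫ x, k x * z x‖ ≤ l2n k * l2n z := by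
  have := toReal_mono (mul_ne_top hk.2.ne hz.2.ne) (enorm_int_mul_le hk.1 hz.1)
  rwa [toReal_enorm, ENNReal.toReal_mul] at this

lemma memLp_euler (hg : MemLp g 2) (m M : ℝ) : MemLp ((ann m M).indicator (euler g)) 2 := by
  have : (ann m M).indicator (euler g) = fun x => ∑ j, g x j *
      (((ann m M).indicator (fun x => x j) x : ℝ) : ℂ) := by
    funext x
    by_cases hx : x ∈ ann m M
    · simp only [indicator_of_mem hx, euler, mul_comm]
    · simp only [indicator_of_notMem hx, ofReal_zero, mul_zero, Finset.sum_const_zero]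
  rw [this]
  refine memLp_finsetSum _ fun j _ => memLp_mul_bdd (memLp_comp hg j) ?_ (C := |M|) fun x => ?_
  · exact (measurable_ofReal.comp ((meas_coord j).indicator (measSet_ann _ _))).aesm
  · rw [norm_real]
    by_cases hx : x ∈ ann m M
    · rw [indicator_of_mem hx]; exact (norm_apply_le x j).trans (hx.2.trans (le_abs_self M))
    · rw [indicator_of_notMem hx, norm_zero]; exact abs_nonneg M

/-- Mean value inequality in s. The factor 16 is 2·8, from 1/s ≤ 2 and the L² bound of a dilation.
Only the L² norm of ζ enters, which allows an extension to test functions without smoothness. -/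
lemma covDil_pairing_lipschitz_test (hA : MemL2loc A) (hβ : RadialFlux A β) (h : IsH1A A u g)
    {ζ : E3 → ℂ} (hζ : IsTest ζ) (hm : 0 < m) (hM : 0 < M) (h0 : ∀ x ∉ ann m M, ζ x = 0)
    (hs : s ∈ Ioo (1 / 2 : ℝ) 2) :
    ‖∫ x, (covDil A s u x - u x) * ζ x‖ ≤
      16 * l2n ((ann (m / 2) (2 * M)).indicator (euler g)) * l2n ζ * |s - 1| := by
  have hζ2 : MemLp ζ 2 := hζ.continuous.memLp_of_hasCompactSupport hζ.compact
  have hE := memLp_euler h.memLp_grad (m / 2) (2 * M)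
  have key := (convex_Ioo (1 / 2) 2).norm_image_sub_le_of_norm_hasDerivWithin_le
   
    (C := 16 * l2n ((ann (m / 2) (2 * M)).indicator (euler g)) * l2n ζ)
    (fun s hs => (hasDerivAt_covDil_pairing hA hβ h hζ hm hM h0 hs).hasDerivWithinAt)
    (fun s hs => ?_) (x := 1) ⟨by norm_num, by norm_num⟩ hs
  · have h1 : ∀ x, covDil A 1 u x = u x := fun x => by simp [covDil, expPh, phase_eq]
    simp only [h1, norm_eq_abs] at key
    rw [← integral_sub (int_mul (memLp_covDil hA h.memLp ⟨hs.1.le, hs.2.le⟩) hζ2)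
      (int_mul h.memLp hζ2)] at key
    simpa only [sub_mul] using key
  · have hs' : s ∈ dil := ⟨hs.1.le, hs.2.le⟩
    have hs0 := dil_pos hs'
    have e1 : ∫ x, expPh A s x * euler g (s • x) * ζ x =
        ∫ x, ((ann (m / 2) (2 * M)).indicator (euler g) (s • x) * expPh A s x) * ζ x := by
      refine int_congr fun x => ?_
      by_cases hx : x ∈ ann m M
      · simp only [indicator_of_mem (dil_mem_ann hs' hm hx)]; ring
      · simp only [h0 x hx, mul_zero]
    have m1 := memLp_mul_bdd (memLp_dil hE hs0) (aesm_expPh hA hs') fun x => (norm_expPh s x).le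
    have m2 : l2n (fun x => (ann (m / 2) (2 * M)).indicator (euler g) (s • x) * expPh A s x) ≤
        8 * l2n ((ann (m / 2) (2 * M)).indicator (euler g)) := by
      have b1 : eLpNorm (fun x => (ann (m / 2) (2 * M)).indicator (euler g) (s • x) *
          expPh A s x) 2 volume ≤ 8 * eLpNorm ((ann (m / 2) (2 * M)).indicator (euler g)) 2
            volume := by
        refine le_trans (eLpNorm_mono fun x => ?_) (eLpNorm_dil_le hE.1 hs')
        rw [norm_mul, norm_expPh, mul_one]
      have := toReal_mono (mul_ne_top (by norm_num) hE.2.ne) b1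
      rwa [ENNReal.toReal_mul] at this
    rw [norm_smul, norm_of_nonneg (inv_nonneg.2 hs0.le), e1]
    have hi : s⁻¹ ≤ 2 := by rw [inv_le_comm₀ hs0 (by norm_num)]; linarith [hs.1]
    have hz0 : 0 ≤ l2n ζ := toReal_nonneg
    calc _ ≤ 2 * (8 * l2n ((ann (m / 2) (2 * M)).indicator (euler g)) * l2n ζ) := by
          refine mul_le_mul hi ((norm_integral_mul_le m1 hζ2).trans ?_) (norm_nonneg _) (by norm_num)
          exact mul_le_mul_of_nonneg_right m2 hz0
      _ = _ := by ring

lemma eLpNorm_moll_two_le {v : E3 → ℂ} (hv : AESM v) (n : ℕ) :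
    eLpNorm (moll n v) 2 volume ≤ eLpNorm v 2 volume := by
  simpa using eLpNorm_moll_le (p := 2) (by norm_num) n hv

/-- Mollifying k does not increase its L² norm, so the bound for test functions passes to the limit,
on a slightly larger annulus. -/
lemma covDil_pairing_lipschitz (hA : MemL2loc A) (hβ : RadialFlux A β) (h : IsH1A A u g)
    {k : E3 → ℂ} (hk : MemLp k 2) (hm : 0 < m) (hM : 0 < M) (h0 : SuppAnn m M k)
    (hs : s ∈ Ioo (1 / 2 : ℝ) 2) :
    ‖∫ x, (covDil A s u x - u x) * k x‖ ≤
      16 * l2n ((ann (m / 2 / 2) (2 * (M + 1))).indicator (euler g)) * l2n k * |s - 1| := by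
  have hd := (memLp_covDil hA h.memLp ⟨hs.1.le, hs.2.le⟩).sub h.memLp
  have lim := (tendsto_int_mul hd (fun n => moll_memLp_two hk n) hk (moll_tendsto_L2 hk)).norm
  refine le_of_tendsto lim ?_
  filter_upwards [suppAnn_moll hm h0] with n hn
  have ht := isTest_moll n hk.l2loc.locallyIntegrable (compact_ann m M) fun x hx => h0.eq_zero hx
  refine (covDil_pairing_lipschitz_test hA hβ h ht (by linarith) (by linarith)
    (fun x hx => hn.eq_zero hx) hs).trans ?_
  refine mul_le_mul_of_nonneg_right (mul_le_mul_of_nonneg_left ?_ ?_) (abs_nonneg _)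
  · exact toReal_mono hk.2.ne (eLpNorm_moll_two_le hk.1 n)
  · exact mul_nonneg (by norm_num) toReal_nonneg

/-- Interchange of two limits under an approximation error that is uniform in the parameter. -/
lemma tendsto_of_approx {ι : Type*} {l : Filter ι} {F : ι → ℂ} {Fn : ℕ → ι → ℂ} {b : ℂ} {bn : ℕ → ℂ}
    {δ : ℕ → ℝ} (h1 : ∀ᶠ n in atTop, Tendsto (Fn n) l (𝓝 (bn n))) (h2 : Tendsto bn atTop (𝓝 b))
    (h3 : Tendsto δ atTop (𝓝 0)) (h4 : ∀ᶠ n in atTop, ∀ᶠ i in l, ‖F i - Fn n i‖ ≤ δ n) :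
    Tendsto F l (𝓝 b) := by
  rw [Metric.tendsto_nhds]; intro ε hε
  have e2 := (Metric.tendsto_nhds.1 h2) (ε / 3) (by linarith)
  have e3 := (Metric.tendsto_nhds.1 h3) (ε / 3) (by linarith)
  obtain ⟨n, n1, n2, n3, n4⟩ := (h1.and (e2.and (e3.and h4))).exists
  filter_upwards [(Metric.tendsto_nhds.1 n1) (ε / 3) (by linarith), n4] with i i1 i2
  rw [Real.dist_eq, sub_zero] at n3
  calc dist (F i) b ≤ dist (F i) (Fn n i) + dist (Fn n i) (bn n) + dist (bn n) b :=
        dist_triangle4 _ _ _ _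
    _ < ε := by rw [dist_eq_norm (F i)]; linarith [le_abs_self (δ n)]

/-- The difference quotients of the transported dilations converge weakly to `x · ∇_A u`. -/
lemma tendsto_covDil_quotient (hA : MemL2loc A) (hβ : RadialFlux A β) (h : IsH1A A u g) {k : E3 → ℂ}
    (hk : MemLp k 2) (hm : 0 < m) (hM : 0 < M) (h0 : SuppAnn m M k) :
    Tendsto (fun s : ℝ => (((s - 1)⁻¹ : ℝ) : ℂ) * ∫ x, (covDil A s u x - u x) * k x) (𝓝[≠] 1)
      (𝓝 (∫ x, euler g x * k x)) := by
  have hm2 : 0 < m / 2 := by linarith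
  have hnb : ∀ᶠ τ : ℝ in 𝓝[≠] 1, τ ∈ Ioo (1 / 2) 2 :=
    nhdsWithin_le_nhds (Ioo_mem_nhds (by norm_num) (by norm_num))
  have ht : ∀ n, IsTest (moll n k) := fun n =>
    isTest_moll n hk.l2loc.locallyIntegrable (compact_ann m M) fun x hx => h0.eq_zero hx
  have hsub : ∀ x ∉ ann (m / 2) (M + 1), k x = 0 := fun x hx =>
    h0.eq_zero fun hc => hx ⟨by linarith [hc.1], by linarith [hc.2]⟩
  set E' := l2n ((ann (m / 2 / 2 / 2) (2 * (M + 1 + 1))).indicator (euler g)) with hE'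
  -- The quotients with k mollified converge by differentiability. The error from mollification is
  -- uniform in s by the Lipschitz bound, with the L² distance of k and its mollification as factor.
  refine tendsto_of_approx
    (Fn := fun n s => (((s - 1)⁻¹ : ℝ) : ℂ) * ∫ x, (covDil A s u x - u x) * moll n k x)
    (bn := fun n => ∫ x, (ann (m / 2) (M + 1)).indicator (euler g) x * moll n k x)
    (δ := fun n => 16 * E' * l2n (moll n k - k)) ?_ ?_ ?_ ?_
  · filter_upwards [suppAnn_moll hm h0] with n hn
    have hd := hasDerivAt_covDil_pairing_one hA h (ht n) hm2 (fun x hx => hn.eq_zero hx)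
    have e : ∫ x, (ann (m / 2) (M + 1)).indicator (euler g) x * moll n k x =
        ∫ x, euler g x * moll n k x := by
      refine int_congr fun x => ?_
      by_cases hx : x ∈ ann (m / 2) (M + 1)
      · simp only [indicator_of_mem hx]
      · simp only [hn.eq_zero hx, mul_zero]
    rw [e]
    refine (hasDerivAt_iff_tendsto_slope.1 hd).congr' ?_
    filter_upwards [hnb] with s hs
    have h1 : ∀ x, covDil A 1 u x = u x := fun x => by simp [covDil, expPh, phase_eq]
    rw [slope_def_module, real_smul]; simp only [h1]
    rw [← integral_sub (int_mul (memLp_covDil hA h.memLp ⟨hs.1.le, hs.2.le⟩)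
      (moll_memLp_two hk n)) (int_mul h.memLp (moll_memLp_two hk n))]
    simp only [sub_mul]
  · have := tendsto_int_mul (memLp_euler h.memLp_grad (m / 2) (M + 1)) (fun n => moll_memLp_two hk n) hk
      (moll_tendsto_L2 hk)
    have e : ∫ x, (ann (m / 2) (M + 1)).indicator (euler g) x * k x = ∫ x, euler g x * k x := by
      refine int_congr fun x => ?_
      by_cases hx : x ∈ ann (m / 2) (M + 1)
      · simp only [indicator_of_mem hx]
      · simp only [hsub x hx, mul_zero]
    rwa [e] at this
  · have := (ENNReal.continuousAt_toReal ENNReal.zero_ne_top).tendsto.comp (moll_tendsto_L2 hk)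
    simpa [l2n, Function.comp_def] using this.const_mul (16 * E')
  · filter_upwards [suppAnn_moll hm h0] with n hn
    filter_upwards [hnb, self_mem_nhdsWithin] with s hs hs1
    have hd := (memLp_covDil hA h.memLp ⟨hs.1.le, hs.2.le⟩).sub h.memLp
    have hsup : SuppAnn (m / 2) (M + 1) (moll n k - k) := SuppAnn.of_notMem fun x hx => by
      rw [Pi.sub_apply, hn.eq_zero hx, hsub x hx, sub_zero]
    have hb := covDil_pairing_lipschitz hA hβ h ((moll_memLp_two hk n).sub hk) hm2 (by linarith) hsup hs
    rw [← mul_sub, norm_mul, norm_real, norm_eq_abs, abs_inv,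
      inv_mul_le_iff₀ (abs_pos.2 (sub_ne_zero.2 hs1)), norm_sub_rev]
    have e : (∫ x, (covDil A s u x - u x) * moll n k x) - ∫ x, (covDil A s u x - u x) * k x =
        ∫ x, (covDil A s u x - u x) * (moll n k - k) x := by
      refine (integral_sub (int_mul hd (moll_memLp_two hk n))
        (int_mul hd hk)).symm.trans (int_congr (fun x => ?_))
      simp; ring
    rw [e, mul_comm]; exact hb


/-! ### Symmetrized quotients of the gradient pairing -/

lemma tendsto_inv_punctured : Tendsto (fun s : ℝ => s⁻¹) (𝓝[≠] 1) (𝓝[≠] 1) := by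
  refine tendsto_nhdsWithin_iff.2 ⟨?_, ?_⟩
  · have : ContinuousAt (fun s : ℝ => s⁻¹) 1 := continuousAt_inv₀ one_ne_zero
    have := this.tendsto
    rw [inv_one] at this; exact this.mono_left nhdsWithin_le_nhds
  · filter_upwards [self_mem_nhdsWithin] with s hs
    exact fun h => hs (inv_injective (by simpa using h))

/-- Since 1/s - 1 = -(s - 1)/s, the quotient at 1/s, rescaled by 1/s, tends to the same limit; the
symmetric quotient is the mean of the two. -/
lemma tendsto_symmetric_quotient {D : ℝ → ℂ} {L : ℂ}
    (h : Tendsto (fun s : ℝ => (((s - 1)⁻¹ : ℝ) : ℂ) * D s) (𝓝[≠] 1) (𝓝 L)) :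
    Tendsto (fun s : ℝ => (((2 * (s - 1))⁻¹ : ℝ) : ℂ) * (D s - D s⁻¹)) (𝓝[≠] 1) (𝓝 L) := by
  have h3 : Tendsto (fun s : ℝ => ((s⁻¹ : ℝ) : ℂ)) (𝓝[≠] 1) (𝓝 1) := by
    have := (continuous_ofReal.tendsto 1).comp ((tendsto_nhdsWithin_iff.1 tendsto_inv_punctured).1)
    rwa [Complex.ofReal_one] at this
  have h5 := (h.const_mul (1 / 2)).add ((h3.mul (h.comp tendsto_inv_punctured)).const_mul (1 / 2))
  have e : (1 / 2 : ℂ) * L + 1 / 2 * (1 * L) = L := by ring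
  rw [e] at h5
  refine h5.congr' ?_
  have hpos : ∀ᶠ s : ℝ in 𝓝[≠] 1, 0 < s := nhdsWithin_le_nhds (eventually_gt_nhds zero_lt_one)
  filter_upwards [hpos, self_mem_nhdsWithin] with s hs hs1
  have hs1' := sub_ne_zero.2 hs1
  have e1 : s⁻¹ * (s⁻¹ - 1)⁻¹ = -(s - 1)⁻¹ := by
    have : s⁻¹ - 1 = -(s - 1) * s⁻¹ := by field_simp; ring
    rw [this, mul_inv, inv_inv, ← neg_inv]; field_simp
  have e2 : (2 * (s - 1))⁻¹ = 1 / 2 * (s - 1)⁻¹ := by rw [mul_inv]; norm_num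
  have e1' := congrArg (fun t : ℝ => (t : ℂ)) e1
  simp at e1'; simp; linear_combination (1 / 2 * D s⁻¹) * e1'

/-- The pairing of `φ g` with the transported dilation of `g`. -/
def gradPair (A : E3 → E3) (g : E3 → C3) (φ : ℝ → ℝ) (s : ℝ) : ℂ :=
  ∫ x, φ ‖x‖ * (s * ∑ j, g x j * conj (expPh A s x * g (s • x) j))

/-- The weight that arises when the pairing is symmetrized. -/
def symW (φ : ℝ → ℝ) (s r : ℝ) : ℝ := (s * φ r - s ^ 2 * φ (s * r)) * (2 * (s - 1))⁻¹

/-- The splitting sφ(r) - s²φ(sr) = s(φ(r) - φ(sr)) + s(1 - s)φ(sr) exhibits the factor s - 1.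
Beyond r = 2|M| both values of φ vanish, because s ≥ 1/2. -/
lemma abs_symW_le (hφ : LipschitzWith L φ) (h0 : ∀ r ∉ Icc m M, φ r = 0) (hC : ∀ r, ‖φ r‖ ≤ C)
    (hs : s ∈ dil) (hs1 : s ≠ 1) {r : ℝ} (hr : 0 ≤ r) : |symW φ s r| ≤ L * (2 * |M|) + C := by
  have hp := abs_pos.2 (sub_ne_zero.2 hs1)
  have hC0 := (norm_nonneg _).trans (hC 0)
  rw [symW, abs_mul, abs_inv, abs_mul, abs_two, ← div_eq_mul_inv, div_le_iff₀ (by positivity)]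
  by_cases hrM : r ≤ 2 * |M|
  · have h1 : s * φ r - s ^ 2 * φ (s * r) = s * (φ r - φ (s * r)) + s * (1 - s) * φ (s * r) := by ring
    rw [h1]
    have h2 : |φ r - φ (s * r)| ≤ L * (|s - 1| * (2 * |M|)) := by
      have := hφ.dist_le_mul r (s * r)
      rw [Real.dist_eq, Real.dist_eq] at this
      refine this.trans (mul_le_mul_of_nonneg_left ?_ L.2)
      have h3 : r - s * r = -((s - 1) * r) := by ring
      rw [h3, abs_neg, abs_mul, abs_of_nonneg hr]
      exact mul_le_mul_of_nonneg_left hrM (abs_nonneg _)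
    refine (abs_add_le _ _).trans ?_
    rw [abs_mul, abs_mul, abs_mul, abs_of_pos (dil_pos hs), abs_sub_comm 1 s]
    have h4 : |φ (s * r)| ≤ C := hC _
    have h6 := mul_le_mul (mul_le_mul_of_nonneg_right hs.2 hp.le) h4 (abs_nonneg _) (by positivity)
    calc _ ≤ _ := add_le_add (mul_le_mul hs.2 h2 (abs_nonneg _) (by norm_num)) h6
      _ = _ := by ring
  · have hM := le_abs_self M
    have hM' := abs_nonneg M
    have h1 := h0 r fun h => by linarith [h.2]
    have h2 : φ (s * r) = 0 := h0 _ fun h => by nlinarith [h.2, hs.1]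
    rw [h1, h2]; simp; positivity

/-- The derivative of sφ(r) - s²φ(sr) at s = 1 is φ - 2φ - rφ', and half of it survives. -/
lemma tendsto_symW {r : ℝ} (h : DifferentiableAt ℝ φ r) :
    Tendsto (fun s => symW φ s r) (𝓝[≠] 1) (𝓝 (-(1 / 2) * (φ r + r * deriv φ r))) := by
  have h1 : HasDerivAt (fun s : ℝ => s * r) r 1 := by
    simpa using (hasDerivAt_id (1 : ℝ)).mul_const r
  have h2 : HasDerivAt (fun s : ℝ => φ (s * r)) (deriv φ r * r) 1 := by
    have h3 : HasDerivAt φ (deriv φ r) (1 * r) := by rw [one_mul]; exact h.hasDerivAt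
    exact h3.comp 1 h1
  have h4 : HasDerivAt (fun s : ℝ => s ^ 2) (2 : ℝ) 1 := by simpa using hasDerivAt_pow 2 (1 : ℝ)
  have h5 : HasDerivAt (fun s : ℝ => s * φ r - s ^ 2 * φ (s * r))
      (1 * φ r - (2 * φ (1 * r) + 1 ^ 2 * (deriv φ r * r))) 1 :=
    ((hasDerivAt_id (1 : ℝ)).mul_const (φ r)).sub (h4.mul h2)
  have h6 := (hasDerivAt_iff_tendsto_slope.1 h5).const_mul (1 / 2 : ℝ)
  have e : (1 / 2 : ℝ) * (1 * φ r - (2 * φ (1 * r) + 1 ^ 2 * (deriv φ r * r))) =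
      -(1 / 2) * (φ r + r * deriv φ r) := by
    simp; ring
  rw [e] at h6
  refine h6.congr fun s => ?_
  rw [slope_def_field, symW, mul_inv]; simp; rw [div_eq_mul_inv]; ring

lemma abs_mul_deriv_le (hφ : LipschitzWith L φ) (h0 : ∀ r ∉ Icc m M, φ r = 0) {r : ℝ} (hr : 0 ≤ r) :
    |r * deriv φ r| ≤ |M| * L := by
  by_cases h : r ∈ Icc m M
  · rw [abs_mul, abs_of_nonneg hr]
    exact mul_le_mul (h.2.trans (le_abs_self M)) (norm_deriv_le_of_lipschitz hφ) (abs_nonneg _)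
      (abs_nonneg _)
  · rw [deriv_zero_of h0 h, mul_zero, abs_zero]; positivity

lemma radial_weight_bounded (hφ : LipschitzWith L φ) (h0 : ∀ r ∉ Icc m M, φ r = 0) :
    ∃ C, ∀ x : E3, |φ ‖x‖ + ‖x‖ * deriv φ ‖x‖| ≤ C := by
  obtain ⟨C, hC⟩ := exists_bound_radial hφ h0
  exact ⟨C + |M| * L, fun x => (abs_add_le _ _).trans
    (add_le_add (hC _) (abs_mul_deriv_le hφ h0 (norm_nonneg x)))⟩

lemma conj_expPh (s : ℝ) (x : E3) : conj (expPh A s x) = Complex.exp (-(I * phase A s x)) := by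
  rw [expPh, ← Complex.exp_conj, map_mul, Complex.conj_I, conj_ofReal, neg_mul]

lemma expPh_inv (hs : 0 < s) (y : E3) : expPh A s⁻¹ (s • y) = conj (expPh A s y) := by
  have := phase_inv (A := A) (inv_pos.2 hs) y
  rw [inv_inv] at this; rw [conj_expPh, expPh, this]; push_cast; ring_nf

lemma memLp_transported (hA : MemL2loc A) {v : E3 → ℂ} (hv : MemLp v 2) (hs : s ∈ dil) :
    MemLp (fun x => conj (expPh A s x * v (s • x))) 2 :=
  memLp_conj (memLp_covDil hA hv hs)

lemma aesm_radial (hφ : Continuous φ) : AESM (fun x : E3 => (φ ‖x‖ : ℂ)) :=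
  (continuous_ofReal.comp (hφ.comp continuous_norm)).aesm

lemma integrable_grad_mul (hA : MemL2loc A) (hg : MemLp g 2) (hs : s ∈ dil) :
    Integrable (fun x => ∑ j, g x j * conj (expPh A s x * g (s • x) j)) :=
  integrable_finsetSum _ fun j _ =>
    int_mul (memLp_comp hg j) (memLp_transported hA (memLp_comp hg j) hs)

lemma integrable_gradPair (hA : MemL2loc A) (hg : MemLp g 2) (hφ : Continuous φ)
    (hC : ∀ r, ‖φ r‖ ≤ C) (hs : s ∈ dil) :
    Integrable (fun x => φ ‖x‖ * (s * ∑ j, g x j * conj (expPh A s x * g (s • x) j))) :=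
  ((integrable_grad_mul hA hg hs).const_mul _).bdd_mul (aesm_radial hφ)
    (ae_of_all _ fun x => by rw [norm_real]; exact hC _)

/-- Substituting x ↦ sx in the pairing at 1/s reverses the transport and exchanges the two copies of
g, hence gives a complex conjugate, with weight s³·s⁻¹φ(s|x|). The real parts can therefore be
subtracted with the same integrand and only the weights differ, so g is never differentiated. -/
lemma gradPair_sub (hA : MemL2loc A) (hg : MemLp g 2) (hφ : Continuous φ) (hC : ∀ r, ‖φ r‖ ≤ C)
    (hs : s ∈ dil) :
    ((((2 * (s - 1))⁻¹ : ℝ) : ℂ) * (gradPair A g φ s - gradPair A g φ s⁻¹)).re =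
      (∑ j, ∫ x, symW φ s ‖x‖ * (g x j * conj (expPh A s x * g (s • x) j))).re := by
  have hs0 := dil_pos hs
  have hi : ∀ j, Integrable (fun x => g x j * conj (expPh A s x * g (s • x) j)) := fun j =>
    int_mul (memLp_comp hg j) (memLp_transported hA (memLp_comp hg j) hs)
  have hφn : Continuous fun x : E3 => φ (s * ‖x‖) := hφ.comp (continuous_const.mul continuous_norm)
  have i2 : Integrable (fun x => ((s ^ 2 * φ (s * ‖x‖) : ℝ) : ℂ) *
      (∑ j, g x j * conj (expPh A s x * g (s • x) j))) := by
    refine (integrable_grad_mul hA hg hs).bdd_mul (c := s ^ 2 * C)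
      (continuous_ofReal.comp (continuous_const.mul hφn)).aesm
      (ae_of_all _ fun x => ?_)
    rw [norm_real, norm_mul, norm_pow, norm_of_nonneg hs0.le]
    exact mul_le_mul_of_nonneg_left (hC _) (by positivity)
  have e2 : (gradPair A g φ s⁻¹).re = (∫ x, ((s ^ 2 * φ (s * ‖x‖) : ℝ) : ℂ) *
      (∑ j, g x j * conj (expPh A s x * g (s • x) j))).re := by
    have h := integral_dil_inv (fun x => φ ‖x‖ *
      (((s⁻¹ : ℝ) : ℂ) * ∑ j, g x j * conj (expPh A s⁻¹ x * g (s⁻¹ • x) j))) (inv_pos.2 hs0)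
    rw [inv_inv] at h
    have h2 : gradPair A g φ s⁻¹ = ((s ^ 3 : ℝ)) • ∫ x, φ ‖s • x‖ *
      (((s⁻¹ : ℝ) : ℂ) * ∑ j, g (s • x) j * conj (expPh A s⁻¹ (s • x) * g (s⁻¹ • s • x) j)) := by
      rw [h, smul_smul, inv_pow, mul_inv_cancel₀ (pow_ne_zero 3 hs0.ne'), one_smul]; rfl
    rw [h2, real_smul, ← integral_const_mul, ← conj_re, ← integral_conj]; congr 1
    refine int_congr fun x => ?_
    have hsc : (s : ℂ) ≠ 0 := by exact_mod_cast hs0.ne'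
    simp only [inv_smul_smul₀ hs0.ne', expPh_inv hs0, norm_smul, norm_of_nonneg hs0.le,
      map_mul, conj_ofReal, Complex.conj_conj, Fin.sum_univ_three, map_add]
    push_cast; field_simp
  rw [re_ofReal_mul, sub_re, e2, ← sub_re, ← re_ofReal_mul,
    gradPair, ← integral_sub (integrable_gradPair hA hg hφ hC hs) i2, ← integral_const_mul,
    ← integral_finsetSum _ fun j _ => ?_]
  · congr 1
    refine int_congr fun x => ?_
    simp only [symW, ← mul_sum]; push_cast; ring
  · have h1 : (fun x => symW φ s ‖x‖ * (g x j * conj (expPh A s x * g (s • x) j))) =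
        fun x => symW φ s ‖x‖ * (g x j * conj (expPh A s x * g (s • x) j)) := rfl
    refine (hi j).bdd_mul (c := (s * C + s ^ 2 * C) * |(2 * (s - 1))⁻¹|) ?_ (ae_of_all _ fun x => ?_)
    · refine (continuous_ofReal.comp ?_).aesm
      exact ((continuous_const.mul (hφ.comp continuous_norm)).sub
        (continuous_const.mul hφn)).mul continuous_const
    · rw [norm_real, symW, norm_mul]
      refine mul_le_mul_of_nonneg_right ((norm_sub_le _ _).trans ?_) (norm_nonneg _)
      rw [norm_mul, norm_mul, norm_pow, norm_of_nonneg hs0.le]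
      exact add_le_add (mul_le_mul_of_nonneg_left (hC _) hs0.le)
        (mul_le_mul_of_nonneg_left (hC _) (by positivity))

/-- The weights are bounded and converge almost everywhere, the phase factor tends to one almost
everywhere, and the dilations of g converge in L². -/
lemma tendsto_gradPair (hA : MemL2loc A) (hg : MemLp g 2) (hφ : LipschitzWith L φ)
    (h0 : ∀ r ∉ Icc m M, φ r = 0) :
    Tendsto (fun s : ℝ => ((((2 * (s - 1))⁻¹ : ℝ) : ℂ) *
      (gradPair A g φ s - gradPair A g φ s⁻¹)).re) (𝓝[≠] 1)
      (𝓝 (-(1 / 2) * ∫ x, (φ ‖x‖ + ‖x‖ * deriv φ ‖x‖) * ‖g x‖ ^ 2)) := by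
  obtain ⟨C, hC⟩ := exists_bound_radial hφ h0
  set C' := L * (2 * |M|) + C with hC'
  have hnb : ∀ᶠ τ : ℝ in 𝓝[≠] 1, τ ∈ dil :=
    nhdsWithin_le_nhds (Icc_mem_nhds (by norm_num) (by norm_num))
  have hwc : ∀ s, Continuous fun x : E3 => (symW φ s ‖x‖ : ℂ) := fun s =>
    continuous_ofReal.comp (((continuous_const.mul (hφ.continuous.comp continuous_norm)).sub
      (continuous_const.mul (hφ.continuous.comp (continuous_const.mul continuous_norm)))).mul
        continuous_const)
  have hwb : ∀ s ∈ dil, s ≠ 1 → ∀ x : E3, ‖(symW φ s ‖x‖ : ℂ)‖ ≤ C' := fun s hs h1 x => by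
      rw [norm_real]; exact abs_symW_le hφ h0 hC hs h1 (norm_nonneg x)
  have key : ∀ j, Tendsto (fun s : ℝ => ∫ x, symW φ s ‖x‖ *
      (g x j * conj (expPh A s x * g (s • x) j))) (𝓝[≠] 1)
      (𝓝 (∫ x, ((-(1 / 2) * (φ ‖x‖ + ‖x‖ * deriv φ ‖x‖) : ℝ) : ℂ) * (g x j * conj (g x j)))) := by
    intro j
    have hgj := memLp_comp hg j
    have hpm : ∀ s ∈ dil, AESM (fun x => conj (expPh A s x)) := fun s hs =>
      Complex.continuous_conj.comp_aestronglyMeasurable (aesm_expPh hA hs)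
    have hk : ∀ s ∈ dil, s ≠ 1 → MemLp (fun x => g x j *
        (symW φ s ‖x‖ * conj (expPh A s x))) 2 := fun s hs h1 =>
      memLp_mul_bdd hgj ((hwc s).aesm.mul (hpm s hs)) fun x => by
        rw [norm_mul, norm_conj, norm_expPh, mul_one]; exact hwb s hs h1 x
    have hd : ∀ s ∈ dil, MemLp (fun x => conj (g (s • x) j - g x j)) 2 :=
      fun s hs => memLp_conj ((memLp_dil hgj (dil_pos hs)).sub hgj)
    have s1 : Tendsto (fun s : ℝ => ∫ x, (g x j * (symW φ s ‖x‖ *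
        conj (expPh A s x))) * conj (g (s • x) j - g x j)) (𝓝[≠] 1) (𝓝 0) := by
      rw [tendsto_zero_iff_enorm_tendsto_zero]
      have l2 := ENNReal.Tendsto.const_mul (a := ofReal C' * eLpNorm (fun x => g x j) 2 volume)
        ((tendsto_dil hgj).mono_left (nhdsWithin_le_nhds (s := {1}ᶜ)))
        (Or.inr (mul_ne_top ofReal_ne_top hgj.2.ne))
      rw [mul_zero] at l2
      refine tendsto_of_tendsto_of_tendsto_of_le_of_le' tendsto_const_nhds l2
        (Eventually.of_forall fun _ => zero_le) ?_
      filter_upwards [hnb, self_mem_nhdsWithin] with s hs h1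
      refine (enorm_int_mul_le (hk s hs h1).1 (hd s hs).1).trans (mul_le_mul' ?_ ?_)
      · refine eLpNorm_le_mul_eLpNorm_of_ae_le_mul (ae_of_all _ fun x => ?_) 2
        rw [norm_mul, norm_mul, norm_conj, norm_expPh, mul_one, mul_comm]
        exact mul_le_mul_of_nonneg_right (hwb s hs h1 x) (norm_nonneg _)
      · refine eLpNorm_mono fun x => ?_
        rw [norm_conj]
    have s2 : Tendsto (fun s : ℝ => ∫ x, (g x j * (symW φ s ‖x‖ *
        conj (expPh A s x))) * conj (g x j)) (𝓝[≠] 1)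
        (𝓝 (∫ x, ((-(1 / 2) * (φ ‖x‖ + ‖x‖ * deriv φ ‖x‖) : ℝ) : ℂ) * (g x j * conj (g x j)))) := by
      refine tendsto_integral_filter_of_dominated_convergence
        (fun x => C' * ‖g x j * conj (g x j)‖) ?_ ?_
        ((int_mul hgj (memLp_conj hgj)).norm.const_mul C') ?_
      · filter_upwards [hnb, self_mem_nhdsWithin] with s hs h1 using
          (hk s hs h1).1.mul (memLp_conj hgj).1
      · filter_upwards [hnb, self_mem_nhdsWithin] with s hs h1
        refine ae_of_all _ fun x => ?_
        have e : (g x j * (symW φ s ‖x‖ * conj (expPh A s x))) * conj (g x j) =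
            (symW φ s ‖x‖ : ℂ) * conj (expPh A s x) * (g x j * conj (g x j)) := by ring
        rw [e, norm_mul, norm_mul, norm_conj, norm_expPh, mul_one]
        exact mul_le_mul_of_nonneg_right (hwb s hs h1 x) (norm_nonneg _)
      · filter_upwards [tendsto_phase_zero hA, ae_diff_norm hφ] with x hx hdx
        have e1 : Tendsto (fun s => conj (expPh A s x)) (𝓝[≠] 1) (𝓝 1) := by
          have hc : Continuous fun t : ℝ => conj (Complex.exp (I * t)) :=
            Complex.continuous_conj.comp (by fun_prop)
          have := (hc.tendsto 0).comp (hx.mono_left (nhdsWithin_le_nhds (s := {1}ᶜ)))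
          simpa [Function.comp_def, expPh] using this
        have e2 := (continuous_ofReal.tendsto _).comp (tendsto_symW hdx)
        have e3 := (e2.mul e1).mul (tendsto_const_nhds (x := g x j * conj (g x j)))
        rw [mul_one] at e3
        refine e3.congr fun s => ?_
        simp; ring
    have s3 := s1.add s2
    rw [zero_add] at s3
    refine s3.congr' ?_
    filter_upwards [hnb, self_mem_nhdsWithin] with s hs h1
    refine (integral_add (int_mul (hk s hs h1) (hd s hs))
      (int_mul (hk s hs h1) (memLp_conj hgj))).symm.trans
      (int_congr (fun x => ?_))
    simp; ring
  have lim := (Complex.continuous_re.tendsto _).comp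
    (tendsto_finsetSum (Finset.univ : Finset (Fin 3)) fun j _ => key j)
  have elim : (∑ j, ∫ x, ((-(1 / 2) * (φ ‖x‖ + ‖x‖ * deriv φ ‖x‖) : ℝ) : ℂ) *
      (g x j * conj (g x j))).re = -(1 / 2) * ∫ x, (φ ‖x‖ + ‖x‖ * deriv φ ‖x‖) * ‖g x‖ ^ 2 := by
    obtain ⟨Cw, hCw⟩ := radial_weight_bounded hφ h0
    have hwm : Measurable fun x : E3 => -(1 / 2) * (φ ‖x‖ + ‖x‖ * deriv φ ‖x‖) :=
      measurable_const.mul ((hφ.continuous.measurable.comp measurable_norm).add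
        (measurable_norm.mul ((measurable_deriv φ).comp measurable_norm)))
    have hij : ∀ j, Integrable (fun x => (-(1 / 2) * (φ ‖x‖ + ‖x‖ * deriv φ ‖x‖)) *
        ‖g x j‖ ^ 2) := fun j =>
      ((memLp_comp hg j).integrable_norm_pow two_ne_zero).bdd_mul (c := 1 / 2 * Cw)
        hwm.aesm (ae_of_all _ fun x => by rw [norm_mul]; norm_num; exact hCw x)
    have e1 : ∀ j, ∫ x, ((-(1 / 2) * (φ ‖x‖ + ‖x‖ * deriv φ ‖x‖) : ℝ) : ℂ) *
        (g x j * conj (g x j)) = ((∫ x, (-(1 / 2) * (φ ‖x‖ + ‖x‖ * deriv φ ‖x‖)) *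
        ‖g x j‖ ^ 2 : ℝ) : ℂ) := by
      intro j; rw [← integral_complex_ofReal]
      refine int_congr fun x => ?_
      simp only [Complex.mul_conj, normSq_eq_norm_sq]; push_cast; ring
    simp only [e1]
    rw [← Complex.ofReal_sum, ofReal_re, ← integral_finsetSum _ fun j _ => hij j,
      ← integral_const_mul]
    refine int_congr fun x => ?_
    simp only [norm_sq_eq, ← mul_sum]; ring
  rw [elim] at lim
  refine lim.congr' ?_
  filter_upwards [hnb] with s hs
  rw [gradPair_sub hA hg hφ.continuous hC hs]; rfl

/-- The pairing of `φ g` with the flux part of the gradient of the transported dilation. -/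
def fluxPair (A β : E3 → E3) (u : E3 → ℂ) (g : E3 → C3) (φ : ℝ → ℝ) (s : ℝ) : ℂ :=
  ∫ x, φ ‖x‖ * ∑ j, g x j * conj (expPh A s x * (I * flux β s x j * u (s • x)))

lemma norm_fluxIntegrand_le (h0 : ∀ r ∉ Icc m M, φ r = 0) (hpos : ∀ r, 0 ≤ φ r) {W : E3 → ℝ}
    (hW : ∀ x ∈ ann m M, ∀ τ ∈ dil, ‖β (τ • x)‖ ≤ W x) (hs : s ∈ dil) (x : E3) :
    ‖(φ ‖x‖ : ℂ) * ∑ j, g x j * conj (expPh A s x * (I * flux β s x j * u (s • x)))‖ ≤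
      |s - 1| * ((3 * φ ‖x‖ * W x * ‖g x‖) * ‖u (s • x)‖) := by
  by_cases hx : x ∈ ann m M
  · have hf : ∀ j, ‖flux β s x j‖ ≤ W x * |s - 1| := fun j =>
      intervalIntegral.norm_integral_le_of_norm_le_const fun τ hτ =>
        (norm_apply_le _ _).trans (hW x hx τ (uIoc_subset_dil one_mem_dil hs hτ))
    rw [norm_mul, norm_real, norm_of_nonneg (hpos _)]
    have h1 : ‖∑ j, g x j * conj (expPh A s x * (I * flux β s x j * u (s • x)))‖ ≤
        ∑ _j : Fin 3, ‖g x‖ * (W x * |s - 1| * ‖u (s • x)‖) := by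
      refine norm_sum_le_of_le _ fun j _ => ?_
      rw [norm_mul, norm_conj, norm_mul, norm_expPh, one_mul, norm_mul, norm_mul,
        norm_I, one_mul, norm_real]
      exact mul_le_mul (norm_apply_le _ _)
        (mul_le_mul_of_nonneg_right (hf j) (norm_nonneg _)) (by positivity) (norm_nonneg _)
    refine (mul_le_mul_of_nonneg_left h1 (hpos _)).trans (le_of_eq ?_)
    simp; ring
  · have : φ ‖x‖ = 0 := h0 _ hx
    simp [this]

/-- The flux over τ between 1 and s is of size |s - 1|, with a factor 3 for its components. Only
this upper bound is used: the flux quotient need not converge, so β need not be continuous, and the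
virial relation becomes an inequality. -/
lemma norm_fluxPair_le (hu : MemLp u 2) (h0 : ∀ r ∉ Icc m M, φ r = 0) (hpos : ∀ r, 0 ≤ φ r)
    {W : E3 → ℝ} (hK : MemLp (fun x => 3 * φ ‖x‖ * W x * ‖g x‖) 2)
    (hW : ∀ x ∈ ann m M, ∀ τ ∈ dil, ‖β (τ • x)‖ ≤ W x) (hs : s ∈ dil) :
    ‖fluxPair A β u g φ s‖ ≤ |s - 1| * ∫ x, (3 * φ ‖x‖ * W x * ‖g x‖) * ‖u (s • x)‖ := by
  rw [← integral_const_mul]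
  exact norm_integral_le_of_norm_le ((int_mul hK (memLp_dil hu (dil_pos hs)).norm).const_mul _)
    (ae_of_all _ (norm_fluxIntegrand_le h0 hpos hW hs))

lemma tendsto_integral_dil_norm {K : E3 → ℝ} (hK : MemLp K 2) (hu : MemLp u 2) :
    Tendsto (fun s : ℝ => ∫ x, K x * ‖u (s • x)‖) (𝓝 1) (𝓝 (∫ x, K x * ‖u x‖)) := by
  rw [tendsto_iff_edist_tendsto_0]
  have h2 : Tendsto (fun s : ℝ => eLpNorm K 2 volume * eLpNorm (fun x => u (s • x) - u x) 2 volume)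
      (𝓝 1) (𝓝 0) := by
    simpa using ENNReal.Tendsto.const_mul (tendsto_dil hu) (Or.inr hK.2.ne)
  refine tendsto_of_tendsto_of_tendsto_of_le_of_le' tendsto_const_nhds h2
    (Eventually.of_forall fun _ => zero_le) ?_
  filter_upwards [eventually_gt_nhds (zero_lt_one (α := ℝ))] with s hs
  have hus := memLp_dil hu hs
  rw [edist_eq_enorm_sub, ← integral_sub (int_mul hK hus.norm) (int_mul hK hu.norm)]
  simp_rw [← mul_sub]
  refine (enorm_int_mul_le hK.1 (hus.norm.1.sub hu.norm.1)).trans ?_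
  gcongr
  exact eLpNorm_mono fun x => abs_norm_sub_norm_le _ _


/-! ### The virial inequality -/

/-- The part of the equation that is of order zero. -/
def zeroOrd (V U : E3 → ℝ) (lam ε : ℝ) (f u : E3 → ℂ) (x : E3) : ℂ :=
  ((V x : ℂ) + U x + lam + I * ε) * u x - f x

lemma memLp_radial_mul (hφ : LipschitzWith L φ) (h0 : ∀ r ∉ Icc m M, φ r = 0) {k : E3 → ℂ}
    (hk : MemLp ((ann m M).indicator k) 2) : MemLp (fun x => φ ‖x‖ * k x) 2 := by
  obtain ⟨C, hC⟩ := exists_bound_radial hφ h0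
  refine (memLp_mul_bdd hk (aesm_radial hφ.continuous) fun x => by
    rw [norm_real]; exact hC _).ae_eq (ae_of_all _ fun x => ?_)
  by_cases hx : x ∈ ann m M
  · simp only [indicator_of_mem hx]; ring
  · have : φ ‖x‖ = 0 := h0 _ hx
    simp [this]

lemma memLp_radial_deriv_euler (hφ : LipschitzWith L φ) (hm : 0 < m) (h0 : ∀ r ∉ Icc m M, φ r = 0)
    (hg : MemLp g 2) : MemLp (fun x => ((deriv φ ‖x‖ / ‖x‖ : ℝ) : ℂ) * euler g x) 2 := by
  have hmeas : Measurable fun x : E3 => ((deriv φ ‖x‖ / ‖x‖ : ℝ) : ℂ) :=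
    measurable_ofReal.comp (((measurable_deriv φ).comp measurable_norm).div measurable_norm)
  refine (memLp_mul_bdd (memLp_euler hg m M) (w := fun x => (ann m M).indicator
    (fun x : E3 => ((deriv φ ‖x‖ / ‖x‖ : ℝ) : ℂ)) x)
    (hmeas.indicator (measSet_ann _ _)).aesm (C := L / m)
    fun x => ?_).ae_eq (ae_of_all _ fun x => ?_)
  · by_cases hx : x ∈ ann m M
    · rw [indicator_of_mem hx, norm_real, norm_div, norm_norm]
      exact div_le_div₀ L.2 (norm_deriv_le_of_lipschitz hφ) hm hx.1
    · rw [indicator_of_notMem hx, norm_zero]; positivity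
  · by_cases hx : x ∈ ann m M
    · simp only [indicator_of_mem hx]; ring
    · have : deriv φ ‖x‖ = 0 := deriv_zero_of h0 hx
      simp [this, indicator_of_notMem hx]

/-- The term in which φ is differentiated is moved to the left, so that the left side pairs the
transported dilation with a fixed L² function, ready for difference quotients in s. -/
lemma SolvesHelmholtz.covDil_test (hA : MemL2loc A) (hβ : RadialFlux A β) (h : IsH1A A u g)
    (hsol : SolvesHelmholtz A V U lam ε f u g) (hφ : LipschitzWith L φ) (hm : 0 < m)
    (h0 : ∀ r ∉ Icc m M, φ r = 0) (hpos : ∀ r, 0 ≤ φ r) {W : E3 → ℝ}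
    (hK : MemLp (fun x => 3 * φ ‖x‖ * W x * ‖g x‖) 2)
    (hW : ∀ x ∈ ann m M, ∀ τ ∈ dil, ‖β (τ • x)‖ ≤ W x)
    (hV : MemLp ((ann (m / 2) (M + 1)).indicator fun x => ((V x : ℂ) + U x + lam + I * ε) * u x) 2)
    (hf : MemLp ((ann (m / 2) (M + 1)).indicator f) 2) (hs : s ∈ dil) :
    ∫ x, (φ ‖x‖ * zeroOrd V U lam ε f u x -
      ((deriv φ ‖x‖ / ‖x‖ : ℝ) : ℂ) * euler g x) * conj (covDil A s u x) =
      gradPair A g φ s + fluxPair A β u g φ s := by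
  have hs0 := dil_pos hs
  obtain ⟨C, hC⟩ := exists_bound_radial hφ h0
  have hU := memLp_conj (memLp_covDil hA h.memLp hs)
  have hvs : SuppAnn m M (fun x => φ ‖x‖ * covDil A s u x) := SuppAnn.of_notMem fun x hx => by
      have e1 := h0 _ hx
      simp [e1]
  have htest := hsol.test hA h hm hV hf (h.covDil hA hβ hs hφ hm h0) hvs
    (SuppAnn.of_notMem fun x hx => by
      have e1 := h0 _ hx
      ext j; simp [e1, deriv_zero_of h0 hx])
  have ig := integrable_gradPair hA h.memLp_grad hφ.continuous hC hs
  have ie := int_mul (memLp_radial_deriv_euler hφ hm h0 h.memLp_grad) hU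
  have if' : Integrable (fun x => φ ‖x‖ * ∑ j, g x j * conj (expPh A s x *
      (I * flux β s x j * u (s • x)))) := by
    refine ((int_mul hK (memLp_dil h.memLp hs0).norm).const_mul |s - 1|).mono' ?_
      (ae_of_all _ (norm_fluxIntegrand_le h0 hpos hW hs))
    refine (aesm_radial hφ.continuous).mul
      (aestronglyMeasurable_fun_sum _ fun j _ => (memLp_comp h.memLp_grad j).1.mul ?_)
    refine Complex.continuous_conj.comp_aestronglyMeasurable
      ((aesm_expPh hA hs).mul (AEStronglyMeasurable.mul ?_ (memLp_dil h.memLp hs0).1))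
    exact ((measurable_ofReal.comp (measurable_flux hβ s j)).const_mul _).aesm
  have lhs : ∫ x, ∑ j, g x j * conj (((deriv φ ‖x‖ * (x j / ‖x‖) : ℝ) : ℂ) * covDil A s u x +
      (φ ‖x‖ : ℂ) * covDilGrad A β s u g x j) =
      (∫ x, ((deriv φ ‖x‖ / ‖x‖ : ℝ) : ℂ) * euler g x * conj (covDil A s u x)) +
      (gradPair A g φ s + fluxPair A β u g φ s) := by
    rw [gradPair, fluxPair, ← integral_add ig if']
    refine Eq.trans (int_congr (fun x => ?_)) (integral_add ie (ig.add if'))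
    simp only [covDilGrad, euler, Fin.sum_univ_three, map_add, map_mul, conj_ofReal]; push_cast
    ring
  have iz : Integrable (fun x => φ ‖x‖ * zeroOrd V U lam ε f u x * conj (covDil A s u x)) := by
    refine int_mul (memLp_radial_mul hφ h0 ?_) hU
    refine ((hV.sub hf).indicator (measSet_ann m M)).ae_eq (ae_of_all _ fun x => ?_)
    by_cases hx : x ∈ ann m M
    · have hx' : x ∈ ann (m / 2) (M + 1) := ⟨by linarith [hx.1], by linarith [hx.2]⟩
      simp only [indicator_of_mem hx, Pi.sub_apply, indicator_of_mem hx', zeroOrd]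
    · simp only [indicator_of_notMem hx]
  have sub_ann : ∀ w : E3 → ℂ, MemLp ((ann (m / 2) (M + 1)).indicator w) 2 →
      Integrable (fun x => w x * conj (φ ‖x‖ * covDil A s u x)) := by
    intro w hw
    refine (int_mul hw (memLp_conj (h.covDil hA hβ hs hφ hm h0).memLp)).congr
      (ae_of_all _ fun x => ?_)
    by_cases hx : x ∈ ann m M
    · have hx' : x ∈ ann (m / 2) (M + 1) := ⟨by linarith [hx.1], by linarith [hx.2]⟩
      simp only [indicator_of_mem hx']
    · have e1 := h0 _ hx
      simp [e1]
  have rhs : (∫ x, ((V x : ℂ) + U x + lam + I * ε) * u x * conj (φ ‖x‖ * covDil A s u x)) -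
      ∫ x, f x * conj (φ ‖x‖ * covDil A s u x) =
      ∫ x, φ ‖x‖ * zeroOrd V U lam ε f u x * conj (covDil A s u x) := by
    rw [← integral_sub (sub_ann _ hV) (sub_ann _ hf)]
    refine int_congr fun x => ?_
    simp only [zeroOrd, map_mul, conj_ofReal]; ring
  rw [rhs] at htest; rw [← sub_eq_iff_eq_add'.2 (lhs.symm.trans htest).symm, ← integral_sub iz ie]
  simp only [sub_mul]

/-- The virial inequality, obtained by testing the equation with difference quotients of
transported dilations. -/
lemma SolvesHelmholtz.virial (hA : MemL2loc A) (hβ : RadialFlux A β) (h : IsH1A A u g)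
    (hsol : SolvesHelmholtz A V U lam ε f u g) (hφ : LipschitzWith L φ) (hm : 0 < m) (hM : 0 < M)
    (h0 : ∀ r ∉ Icc m M, φ r = 0) (hpos : ∀ r, 0 ≤ φ r) {W : E3 → ℝ}
    (hK : MemLp (fun x => 3 * φ ‖x‖ * W x * ‖g x‖) 2)
    (hW : ∀ x ∈ ann m M, ∀ τ ∈ dil, ‖β (τ • x)‖ ≤ W x)
    (hV : MemLp ((ann (m / 2) (M + 1)).indicator fun x => ((V x : ℂ) + U x + lam + I * ε) * u x) 2)
    (hf : MemLp ((ann (m / 2) (M + 1)).indicator f) 2) :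
    -(∫ x, (3 * φ ‖x‖ * W x * ‖g x‖) * ‖u x‖) ≤
      (∫ x, φ ‖x‖ * (zeroOrd V U lam ε f u x * conj (euler g x)).re) -
      (∫ x, deriv φ ‖x‖ / ‖x‖ * ‖euler g x‖ ^ 2) +
      1 / 2 * (∫ x, (φ ‖x‖ + ‖x‖ * deriv φ ‖x‖) * ‖g x‖ ^ 2) := by
  have hz : MemLp ((ann m M).indicator (zeroOrd V U lam ε f u)) 2 := by
    refine (((hV.sub hf).indicator (measSet_ann m M))).ae_eq (ae_of_all _ fun x => ?_)
    by_cases hx : x ∈ ann m M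
    · have hx' : x ∈ ann (m / 2) (M + 1) := ⟨by linarith [hx.1], by linarith [hx.2]⟩
      simp only [indicator_of_mem hx, Pi.sub_apply, indicator_of_mem hx', zeroOrd]
    · simp only [indicator_of_notMem hx]
  have k1 := memLp_radial_mul hφ h0 hz
  have k2 := memLp_radial_deriv_euler hφ hm h0 h.memLp_grad
  -- This is the fixed function paired with the transported dilations. Its symmetric quotient tends
  -- to the pairing of x·∇_A u with `k`, and by the equation it also equals quotients of the
  -- gradient and flux pairings.
  set k : E3 → ℂ := fun x => φ ‖x‖ * zeroOrd V U lam ε f u x -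
      ((deriv φ ‖x‖ / ‖x‖ : ℝ) : ℂ) * euler g x with hk
  have hkm : MemLp k 2 := k1.sub k2
  have hks : SuppAnn m M (fun x => conj (k x)) := SuppAnn.of_notMem fun x hx => by
    have e1 := h0 _ hx
    simp [hk, e1, deriv_zero_of h0 hx]
  have hnb : ∀ᶠ τ : ℝ in 𝓝[≠] 1, τ ∈ dil :=
    nhdsWithin_le_nhds (Icc_mem_nhds (by norm_num) (by norm_num))
  have lim0 := (Complex.continuous_re.tendsto _).comp (tendsto_symmetric_quotient
    (tendsto_covDil_quotient hA hβ h (memLp_conj hkm) hm hM hks))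
  set Y : ℝ → ℝ := fun s => ∫ x, (3 * φ ‖x‖ * W x * ‖g x‖) * ‖u (s • x)‖ with hY
  have limY1 : Tendsto (fun s : ℝ => 1 / 2 * (Y s + s⁻¹ * Y s⁻¹)) (𝓝[≠] 1)
      (𝓝 (∫ x, (3 * φ ‖x‖ * W x * ‖g x‖) * ‖u x‖)) := by
    have a1 := (tendsto_integral_dil_norm hK h.memLp).mono_left (nhdsWithin_le_nhds (s := {1}ᶜ))
    have a4 := (a1.add (((tendsto_nhdsWithin_iff.1 tendsto_inv_punctured).1).mul (a1.comp tendsto_inv_punctured))).const_mul (1 / 2)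
    have e : ∀ t : ℝ, 1 / 2 * (t + 1 * t) = t := fun t => by ring
    rw [e] at a4; exact a4
  -- Comparing both evaluations of the limit: the gradient part converges to -(1/2)∫(φ + rφ')|g|²,
  -- and the flux part can only lower this by its majorant.
  have hle : -(1 / 2) * (∫ x, (φ ‖x‖ + ‖x‖ * deriv φ ‖x‖) * ‖g x‖ ^ 2) -
      (∫ x, (3 * φ ‖x‖ * W x * ‖g x‖) * ‖u x‖) ≤ (∫ x, euler g x * conj (k x)).re := by
    refine le_of_tendsto_of_tendsto ((tendsto_gradPair hA h.memLp_grad hφ h0).sub limY1) lim0 ?_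
    filter_upwards [hnb, self_mem_nhdsWithin] with s hs hs1
    have hs0 := dil_pos hs
    have hp := abs_pos.2 (sub_ne_zero.2 hs1)
    have hD : ∀ t ∈ dil, ∫ x, covDil A t u x * conj (k x) =
        conj (gradPair A g φ t + fluxPair A β u g φ t) := by
      intro t ht; rw [← hsol.covDil_test hA hβ h hφ hm h0 hpos hK hW hV hf ht, ← integral_conj]
      refine int_congr fun x => ?_
      simp only [map_mul, Complex.conj_conj, hk]; ring
    have hsub : ∀ t ∈ dil, ∫ x, (covDil A t u x - u x) * conj (k x) =
        conj (gradPair A g φ t + fluxPair A β u g φ t) - ∫ x, u x * conj (k x) := by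
      intro t ht
      rw [← hD t ht, ← integral_sub (int_mul (memLp_covDil hA h.memLp ht)
        (memLp_conj hkm)) (int_mul h.memLp (memLp_conj hkm))]
      simp only [sub_mul]
    have hb1 := norm_fluxPair_le (A := A) h.memLp h0 hpos hK hW hs
    have hb2 := norm_fluxPair_le (A := A) h.memLp h0 hpos hK hW (inv_mem_dil hs)
    -- This brings the flux bound at 1/s to the same denominator 2|s - 1|.
    have e3 : |s⁻¹ - 1| = s⁻¹ * |s - 1| := by
      rw [← abs_of_pos (inv_pos.2 hs0), ← abs_mul, abs_sub_comm, abs_of_pos (inv_pos.2 hs0)]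
      congr 1; field_simp
    rw [e3] at hb2; simp only [Function.comp]; rw [hsub s hs, hsub _ (inv_mem_dil hs)]
    have e4 : ((((2 * (s - 1))⁻¹ : ℝ) : ℂ) * (conj (gradPair A g φ s + fluxPair A β u g φ s) -
        (∫ x, u x * conj (k x)) - (conj (gradPair A g φ s⁻¹ + fluxPair A β u g φ s⁻¹) -
        ∫ x, u x * conj (k x)))).re = ((((2 * (s - 1))⁻¹ : ℝ) : ℂ) *
        (gradPair A g φ s - gradPair A g φ s⁻¹)).re + (((2 * (s - 1))⁻¹ : ℝ) *
        ((fluxPair A β u g φ s).re - (fluxPair A β u g φ s⁻¹).re)) := by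
      simp only [re_ofReal_mul, sub_re, conj_re, add_re]; ring
    rw [e4]; rw [sub_eq_add_neg]
    refine add_le_add_right (neg_le_of_abs_le ?_) _
    rw [abs_mul, abs_inv, abs_mul, abs_two, inv_mul_le_iff₀ (by positivity)]
    calc |(fluxPair A β u g φ s).re - (fluxPair A β u g φ s⁻¹).re|
        ≤ ‖fluxPair A β u g φ s‖ + ‖fluxPair A β u g φ s⁻¹‖ :=
          (abs_sub _ _).trans (add_le_add (abs_re_le_norm _) (abs_re_le_norm _))
      _ ≤ |s - 1| * Y s + s⁻¹ * |s - 1| * Y s⁻¹ := add_le_add hb1 hb2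
      _ = _ := by ring
  have e5 : (∫ x, euler g x * conj (k x)).re =
      (∫ x, φ ‖x‖ * (zeroOrd V U lam ε f u x * conj (euler g x)).re) -
      ∫ x, deriv φ ‖x‖ / ‖x‖ * ‖euler g x‖ ^ 2 := by
    have hE := memLp_euler h.memLp_grad m M
    have i1 := int_mul hE (memLp_conj k1)
    have i2 := int_mul hE (memLp_conj k2)
    have e1 : ∫ x, euler g x * conj (k x) =
        (∫ x, (ann m M).indicator (euler g) x * conj (φ ‖x‖ * zeroOrd V U lam ε f u x)) -
        ∫ x, (ann m M).indicator (euler g) x *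
          conj (((deriv φ ‖x‖ / ‖x‖ : ℝ) : ℂ) * euler g x) := by
      rw [← integral_sub i1 i2]
      refine int_congr fun x => ?_
      by_cases hx : x ∈ ann m M
      · simp only [hk, indicator_of_mem hx, map_sub]; ring
      · have := hks.eq_zero hx
        simp only [this, indicator_of_notMem hx]; ring
    have r1 := integral_re i1
    have r2 := integral_re i2
    simp only [re_to_complex] at r1 r2; rw [e1, sub_re, ← r1, ← r2]; congr 1
    · refine int_congr fun x => ?_
      by_cases hx : x ∈ ann m M
      · simp only [indicator_of_mem hx, map_mul, conj_ofReal, mul_re,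
          conj_re, conj_im, mul_im, ofReal_re, ofReal_im]
        ring
      · have : φ ‖x‖ = 0 := h0 _ hx
        simp [indicator_of_notMem hx, this]
    · refine int_congr fun x => ?_
      by_cases hx : x ∈ ann m M
      · simp only [indicator_of_mem hx, map_mul, conj_ofReal, ← normSq_eq_norm_sq,
          normSq_apply, mul_re,
          conj_re, conj_im, mul_im, ofReal_re, ofReal_im]
        ring
      · have : deriv φ ‖x‖ = 0 := deriv_zero_of h0 hx
        simp [indicator_of_notMem hx, this]
  rw [e5] at hle; linarith


/-! ### Radial integration by parts -/

/-- The product of a function in `H¹_A` with a smooth function and a radial Lipschitz function. -/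
lemma IsH1A.smooth_radial_mul (hA : MemL2loc A) (h : IsH1A A u g) {ψ : E3 → ℝ}
    (hψ : ContDiff ℝ C∞ ψ) {Cψ Cd : ℝ} (hψC : ∀ x, ‖ψ x‖ ≤ Cψ) (hψd : ∀ j x, ‖partialD j ψ x‖ ≤ Cd)
    (hκ : LipschitzWith L κ) (hC : ∀ r, ‖κ r‖ ≤ C) :
    IsH1A A (fun x => ((ψ x * κ ‖x‖ : ℝ) : ℂ) * u x) (fun x => WithLp.toLp 2 fun j =>
      ((partialD j ψ x * κ ‖x‖ + ψ x * (deriv κ ‖x‖ * (x j / ‖x‖)) : ℝ) : ℂ) * u x +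
        ((ψ x * κ ‖x‖ : ℝ) : ℂ) * g x j) := by
  have hpc : ∀ j, Continuous (partialD j ψ) := fun j =>
    ((hψ.of_le (by exact_mod_cast le_top) : ContDiff ℝ 1 ψ).continuous_fderiv one_ne_zero).clm_apply
      continuous_const
  have hκc : Continuous fun x : E3 => κ ‖x‖ := hκ.continuous.comp continuous_norm
  have hD : ∀ j, Measurable fun x : E3 =>
      ((partialD j ψ x * κ ‖x‖ + ψ x * (deriv κ ‖x‖ * (x j / ‖x‖)) : ℝ) : ℂ) := fun j =>
    measurable_ofReal.comp (((hpc j).mul hκc).measurable.add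
      (hψ.continuous.measurable.mul (measurable_radial_deriv κ j)))
  have hDb : ∀ j x, ‖((partialD j ψ x * κ ‖x‖ + ψ x * (deriv κ ‖x‖ * (x j / ‖x‖)) : ℝ) : ℂ)‖ ≤
      Cd * C + Cψ * L := fun j x => by
    rw [norm_real]
    refine (norm_add_le _ _).trans (add_le_add ?_ ?_)
    · rw [norm_mul]
      exact mul_le_mul (hψd j x) (hC _) (norm_nonneg _) ((norm_nonneg _).trans (hψd j x))
    · rw [norm_mul]
      exact mul_le_mul (hψC x) (norm_radial_deriv_le hκ x j) (norm_nonneg _)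
        ((norm_nonneg _).trans (hψC x))
  have hvb : ∀ x : E3, ‖((ψ x * κ ‖x‖ : ℝ) : ℂ)‖ ≤ Cψ * C := fun x => by
    rw [norm_real, norm_mul]
    exact mul_le_mul (hψC x) (hC _) (norm_nonneg _) ((norm_nonneg _).trans (hψC x))
  have hvc : Continuous fun x : E3 => ((ψ x * κ ‖x‖ : ℝ) : ℂ) :=
    continuous_ofReal.comp (hψ.continuous.mul hκc)
  refine h.mul hA (D := fun j x =>
    ((partialD j ψ x * κ ‖x‖ + ψ x * (deriv κ ‖x‖ * (x j / ‖x‖)) : ℝ) : ℂ)) (fun j => ?_) hvb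
    (fun j => l2loc_of_bounded (hD j).aesm (hDb j)) (memLp_C3 fun j => ?_)
    fun j x => rfl
  · have hψ' : ContDiff ℝ C∞ fun x => (ψ x : ℂ) := ofRealCLM.contDiff.comp hψ
    convert (wderiv_radial hκ j).smooth_mul hψ' using 1
    · funext x; push_cast; ring
    · funext x
      rw [partialD_ofReal (hψ.differentiable (by simp))]; push_cast; ring
  · have h1 := memLp_mul_bdd h.memLp (hD j).aesm (hDb j)
    have h2 := memLp_mul_bdd (memLp_comp h.memLp_grad j) hvc.aesm hvb
    refine (h1.add h2).ae_eq (ae_of_all _ fun x => ?_)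
    simp; ring

lemma int_radial_sq {u : E3 → F} (hu : MemLp u 2) {w : E3 → ℝ} (hw : AESM w) (hC : ∀ x, ‖w x‖ ≤ C) :
    Integrable (fun x => w x * ‖u x‖ ^ 2) :=
  (hu.int_sq).bdd_mul hw (ae_of_all _ hC)

lemma integrable_radial_cross {v : E3 → ℂ} (hu : MemLp u 2) (hv : MemLp v 2) {w : E3 → ℝ}
    (hw : AESM w) (hC : ∀ x, ‖w x‖ ≤ C) : Integrable (fun x => w x * (2 * (v x * conj (u x)).re)) :=
  (((int_mul hv (memLp_conj hu)).re).const_mul 2).bdd_mul hw (ae_of_all _ hC)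

/-- The weak gradient of `κ(|x|) |u|²`. -/
lemma IsH1A.wderiv_radial_normSq (hA : MemL2loc A) (h : IsH1A A u g) (hκ : LipschitzWith L κ)
    (hm : 0 < m) (h0 : ∀ r ∉ Icc m M, κ r = 0) (j : Fin 3) :
    WDeriv (𝕜 := ℝ) j (fun x => κ ‖x‖ * ‖u x‖ ^ 2) (fun x =>
      κ ‖x‖ * (2 * (g x j * conj (u x)).re) + deriv κ ‖x‖ * (x j / ‖x‖) * ‖u x‖ ^ 2) := by
  obtain ⟨C, hC⟩ := exists_bound_radial hκ h0
  have hκm : AESM (fun x : E3 => κ ‖x‖) := (hκ.continuous.comp continuous_norm).aesm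
  have hdm := (measurable_radial_deriv κ j).aesm (μ := volume)
  have hgj := memLp_comp h.memLp_grad j
  have i1 := int_radial_sq h.memLp hκm fun x => hC ‖x‖
  have i2 := integrable_radial_cross h.memLp hgj hκm fun x => hC ‖x‖
  have i3 := int_radial_sq h.memLp hdm (norm_radial_deriv_le hκ · j)
  refine ⟨i1.locallyIntegrable, (i2.add i3).locallyIntegrable, fun ψ hψ => ?_⟩
  obtain ⟨Cψ, hCψ⟩ := hψ.bounded
  choose Cd hCd using fun j => (hψ.partialD j).bounded
  have hCd' : ∀ j x, ‖partialD j ψ x‖ ≤ ∑ i, |Cd i| := fun j x =>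
    (hCd j x).trans ((le_abs_self _).trans
      (Finset.single_le_sum (f := fun i => |Cd i|) (fun i _ => abs_nonneg _) (Finset.mem_univ j)))
  have hv := h.smooth_radial_mul hA hψ.smooth hCψ hCd' hκ hC
  -- Pairing u with the product ψκu gives the weak derivative of κ|u|²: in the real part the
  -- magnetic potential drops out and the two copies of Re(g ū) add up.
  have key := h.integral_mul_conj hA hm hv (SuppAnn.of_notMem fun x hx => by
    have : κ ‖x‖ = 0 := h0 _ hx
    simp [this]) (SuppAnn.of_notMem fun x hx => by
    ext i; simp [h0 _ hx, deriv_zero_of h0 hx]) j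
  have key := congrArg Complex.re key
  have j1 := int_mul hgj (memLp_conj hv.memLp)
  have j2 := int_mul h.memLp (memLp_conj (memLp_comp hv.memLp_grad j))
  have r1 := integral_re j1
  have r2 := integral_re j2
  simp only [re_to_complex] at r1 r2; rw [Complex.neg_re, ← r1, ← r2] at key
  rw [eq_neg_iff_add_eq_zero] at key ⊢
  refine (integral_add ((i2.add i3).locallyIntegrable.int_mul_test hψ) (i1.locallyIntegrable.int_mul_test (hψ.partialD j))).symm.trans
    (Eq.trans (int_congr (fun x => ?_)) ((integral_add j1.re j2.re).trans key))
  simp only [re_to_complex, map_add, map_mul, conj_ofReal, add_re,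
    mul_re, mul_im, ofReal_re, ofReal_im, conj_re,
    conj_im, ← normSq_eq_norm_sq, normSq_apply, Complex.add_im, Pi.add_apply]
  ring

/-- Integration by parts for the radial derivative of `|u|²`. -/
lemma IsH1A.integral_radial_cross (hA : MemL2loc A) (h : IsH1A A u g) (hκ : LipschitzWith L κ)
    (hm : 0 < m) (hM : 0 < M) (h0 : ∀ r ∉ Icc m M, κ r = 0) :
    ∫ x, (κ ‖x‖ * (2 * crossRe g u x) + ‖x‖ * deriv κ ‖x‖ * ‖u x‖ ^ 2) =
      -3 * ∫ x, κ ‖x‖ * ‖u x‖ ^ 2 := by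
  have hχ := isTest_annCut (m := m / 2) (M := 2 * M) (by linarith) (by linarith)
  set χ := annCut (m / 2) (2 * M) with hχdef
  -- The weak derivative is tested with x_jχ, where χ is one near the support of κ. Hence ∂_j(x_jχ)
  -- = 1 there, and the sum over j gives the 3.
  have hcoord : ∀ j, IsTest fun x : E3 => x j * χ x := fun j => hχ.mul (by fun_prop)
  have hw := fun j => h.wderiv_radial_normSq hA hκ hm h0 j
  have h1 : ∀ x ∈ ann m M, χ x = 1 := fun x hx =>
    annCut_eq_one (by linarith) ⟨by linarith [hx.1], by linarith [hx.2]⟩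
  have hd : ∀ j, ∀ x ∈ ann m M, partialD j (fun x : E3 => x j * χ x) x = 1 := fun j x hx => by
    rw [partialD_mul (by fun_prop) (hχ.differentiable x), partialD_annCut hm hx j, h1 x hx]
    have : partialD j (fun x : E3 => x j) x = 1 := by
      have := (EuclideanSpace.proj j : E3 →L[ℝ] ℝ).fderiv (x := x)
      unfold partialD; erw [this]; simp
    rw [this]; ring
  have key : ∀ j, ∫ x, (κ ‖x‖ * (2 * (g x j * conj (u x)).re) +
      deriv κ ‖x‖ * (x j / ‖x‖) * ‖u x‖ ^ 2) * (x j * χ x) = -∫ x, κ ‖x‖ * ‖u x‖ ^ 2 := fun j => by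
    rw [(hw j).weak _ (hcoord j)]; congr 1
    refine int_congr fun x => ?_
    by_cases hx : x ∈ ann m M
    · simp only [hd j x hx, mul_one]
    · have : κ ‖x‖ = 0 := h0 _ hx
      simp [this]
  have hsum := sum_congr rfl fun j (_ : j ∈ (Finset.univ : Finset (Fin 3))) => key j
  rw [← integral_finsetSum _ fun j _ => (hw j).right.int_mul_test (hcoord j)] at hsum
  rw [Finset.sum_const, Finset.card_univ, Fintype.card_fin, nsmul_eq_mul] at hsum; push_cast at hsum
  rw [show -3 * (∫ x, κ ‖x‖ * ‖u x‖ ^ 2) = 3 * -∫ x, κ ‖x‖ * ‖u x‖ ^ 2 by ring, ← hsum]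
  refine int_congr fun x => ?_
  by_cases hx : x ∈ ann m M
  · have hx0 := (hm.trans_le hx.1).ne'
    have hn : x 0 ^ 2 + x 1 ^ 2 + x 2 ^ 2 = ‖x‖ ^ 2 := by rw [norm_sq_eq, Fin.sum_univ_three]; simp
    simp only [h1 x hx, mul_one, euler, Fin.sum_univ_three, add_re, add_mul, mul_re,
      mul_im, ofReal_re, ofReal_im, conj_re, conj_im]
    field_simp; linear_combination (-(deriv κ ‖x‖ * ‖u x‖ ^ 2)) * hn
  · have e1 := h0 _ hx
    simp [e1, deriv_zero_of h0 hx]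


lemma partialD_coord_div_norm {x : E3} (hx : x ≠ 0) (j : Fin 3) :
    DifferentiableAt ℝ (fun y : E3 => y j / ‖y‖) x ∧
    partialD j (fun y : E3 => y j / ‖y‖) x = ‖x‖⁻¹ - x j ^ 2 / ‖x‖ ^ 3 := by
  have h1 : HasFDerivAt (fun y => y j) (EuclideanSpace.proj j : E3 →L[ℝ] ℝ) x :=
    (EuclideanSpace.proj j : E3 →L[ℝ] ℝ).hasFDerivAt
  have h2 : HasFDerivAt (fun y => y j / ‖y‖) _ x :=
    h1.mul ((hasDerivAt_inv (norm_ne_zero_iff.2 hx)).comp_hasFDerivAt x (hasFDerivAt_norm_of_ne hx))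
  refine ⟨h2.differentiableAt, ?_⟩
  rw [partialD, h2.fderiv]; simp [inner_single x j]; field_simp; ring

lemma radialDiv_eq {η : E3 → ℝ} {x : E3} (hη : DifferentiableAt ℝ η x) (hx : x ≠ 0) :
    radialDiv η x = (∑ j, partialD j η x * (x j / ‖x‖)) + η x * (2 / ‖x‖) := by
  have hn := norm_ne_zero_iff.2 hx
  have hs : x 0 ^ 2 + x 1 ^ 2 + x 2 ^ 2 = ‖x‖ ^ 2 := by rw [norm_sq_eq, Fin.sum_univ_three]; simp
  have e : ∀ j, partialD j (fun y => η y * (y j / ‖y‖)) x =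
      η x * (‖x‖⁻¹ - x j ^ 2 / ‖x‖ ^ 3) + partialD j η x * (x j / ‖x‖) := fun j => by
    rw [partialD_mul hη (partialD_coord_div_norm hx j).1, (partialD_coord_div_norm hx j).2]
  rw [radialDiv, sum_congr rfl fun j _ => e j]; simp only [Fin.sum_univ_three]; field_simp
  linear_combination (-η x) * hs

/-- The bound on the negative part of the radial derivative, tested with `κ(|x|) |u|²`. -/
lemma IsH1A.integral_radialDeriv_le (hA : MemL2loc A) (h : IsH1A A u g) (hκ : LipschitzWith L κ)
    (hm : 0 < m) (h0 : ∀ r ∉ Icc m M, κ r = 0) (hpos : ∀ r, 0 ≤ κ r)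
    (hVq : RadialDerivNegPartLE V q) (hVm : AESM V) (hqm : AESM q)
    (hV : ∀ᵐ x, x ∈ ann (m / 2) (M + 1) → |V x| ≤ C)
    (hq : ∀ᵐ x, x ∈ ann (m / 2) (M + 1) → |q x| ≤ C) :
    ∫ x, V x * (κ ‖x‖ / ‖x‖ * (2 * crossRe g u x) +
      (deriv κ ‖x‖ + 2 * (κ ‖x‖ / ‖x‖)) * ‖u x‖ ^ 2) ≤ ∫ x, q x * (κ ‖x‖ * ‖u x‖ ^ 2) := by
  set η : E3 → ℝ := fun x => κ ‖x‖ * ‖u x‖ ^ 2 with hη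
  set D : Fin 3 → E3 → ℝ := fun j x =>
    κ ‖x‖ * (2 * (g x j * conj (u x)).re) + deriv κ ‖x‖ * (x j / ‖x‖) * ‖u x‖ ^ 2 with hD
  have hw : ∀ j, WDeriv j η (D j) := fun j => h.wderiv_radial_normSq hA hκ hm h0 j
  set K := ann (m / 2) (M + 1) with hK
  have hKm : MeasurableSet K := measSet_ann _ _
  have hsub : ann m M ⊆ K := fun x hx => ⟨by linarith [hx.1], by linarith [hx.2]⟩
  have hηs : SuppAnn m M η := SuppAnn.of_notMem fun x hx => by
    have : κ ‖x‖ = 0 := h0 _ hx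
    simp [hη, this]
  have hDs : ∀ j, ∀ x ∉ ann m M, D j x = 0 := fun j x hx => by
    have e1 := h0 _ hx
    simp [hD, e1, deriv_zero_of h0 hx]
  have iη := int_of_compact (hw 0).left (compact_ann m M) fun x hx => hηs.eq_zero hx
  have iD : ∀ j, Integrable (D j) := fun j => int_of_compact (hw j).right (compact_ann m M) (hDs j)
  have hC0 := abs_nonneg C
  have hx0 : ∀ x ∈ K, 0 < ‖x‖ := fun x hx => lt_of_lt_of_le (by linarith) hx.1
  set k : Fin 3 → E3 → ℝ := fun j => K.indicator fun x => V x * (x j / ‖x‖) with hk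
  set k' : E3 → ℝ := K.indicator fun x => V x * (2 / ‖x‖) with hk'
  set k'' : E3 → ℝ := K.indicator q with hk''
  have mk : ∀ j, AESM (k j) := fun j =>
    (hVm.mul ((meas_coord j).div measurable_norm).aesm).indicator hKm
  have mk' : AESM k' := (hVm.mul (measurable_const.div measurable_norm).aesm).indicator hKm
  have bk : ∀ j, ∀ᵐ x, ‖k j x‖ ≤ |C| := fun j => by
    filter_upwards [hV] with x hx
    by_cases hxK : x ∈ K
    · simp only [hk, indicator_of_mem hxK, norm_mul]
      exact (mul_le_of_le_one_right (norm_nonneg _) (norm_coord_div_le x j)).trans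
        ((hx hxK).trans (le_abs_self C))
    · simp only [hk, indicator_of_notMem hxK, norm_zero, hC0]
  have bk' : ∀ᵐ x, ‖k' x‖ ≤ |C| * (2 / (m / 2)) := by
    filter_upwards [hV] with x hx
    by_cases hxK : x ∈ K
    · simp only [hk', indicator_of_mem hxK, norm_mul]
      refine mul_le_mul ((hx hxK).trans (le_abs_self C)) ?_ (norm_nonneg _) hC0
      rw [norm_div, norm_norm, Real.norm_ofNat]
      exact div_le_div_of_nonneg_left (by norm_num) (by linarith) hxK.1
    · simp only [hk', indicator_of_notMem hxK, norm_zero]; positivity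
  have bk'' : ∀ᵐ x, ‖k'' x‖ ≤ |C| := by
    filter_upwards [hq] with x hx
    by_cases hxK : x ∈ K
    · simp only [hk'', indicator_of_mem hxK]; exact (hx hxK).trans (le_abs_self C)
    · simp only [hk'', indicator_of_notMem hxK, norm_zero, hC0]
  -- The density η = κ|u|² is nonnegative but not smooth, so its mollifications serve as test
  -- functions. V and q are bounded on the annulus, and L¹ convergence of η and its gradient
  -- suffices.
  have t1 : ∀ j, Tendsto (fun n => ∫ x, moll n (D j) x * k j x) atTop (𝓝 (∫ x, D j x * k j x)) :=
    fun j => tendsto_int_mul_one (int_moll (iD j)) (iD j) (moll_tendsto_L1 (iD j)) (mk j) (bk j)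
  have t2 := tendsto_int_mul_one (int_moll iη) iη (moll_tendsto_L1 iη) mk' bk'
  have t3 := tendsto_int_mul_one (int_moll iη) iη (moll_tendsto_L1 iη) (hqm.indicator hKm) bk''
  have hle := le_of_tendsto_of_tendsto (((tendsto_finsetSum Finset.univ fun j _ => t1 j).add t2)) t3 ?_
  · refine le_trans (le_of_eq ?_) (hle.trans (le_of_eq ?_))
    · rw [← integral_finsetSum _ fun j _ => (iD j).mul_bdd (mk j) (bk j)]
      refine Eq.trans (int_congr (fun x => ?_)) (integral_add
        (integrable_finsetSum _ fun j _ => (iD j).mul_bdd (mk j) (bk j)) (iη.mul_bdd mk' bk'))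
      by_cases hx : x ∈ ann m M
      · have hn := (hx0 x (hsub hx)).ne'
        have hs : x 0 ^ 2 + x 1 ^ 2 + x 2 ^ 2 = ‖x‖ ^ 2 := by
          rw [norm_sq_eq, Fin.sum_univ_three]; simp
        simp only [hk, hk', indicator_of_mem (hsub hx), hD, hη, euler, Fin.sum_univ_three,
          add_re, add_mul, mul_re, mul_im, ofReal_re,
          ofReal_im, conj_re, conj_im]
        field_simp; linear_combination (-(deriv κ ‖x‖ * V x * ‖u x‖ ^ 2)) * hs
      · have e1 := h0 _ hx
        simp [hD, hη, e1, deriv_zero_of h0 hx]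
    · refine int_congr fun x => ?_
      change η x * k'' x = q x * η x
      by_cases hx : x ∈ K
      · simp only [hk'', indicator_of_mem hx, mul_comm]
      · simp only [hηs.eq_zero fun hc => hx (hsub hc), zero_mul, mul_zero]
  · filter_upwards [suppAnn_moll hm hηs] with n hn
    have hts : tsupport (moll n η) ⊆ K :=
      closure_minimal (fun x hx => by_contra fun hc => hx (hn.eq_zero hc)) (isClosed_ann _ _)
    have hT := isTest_moll n (hw 0).left (compact_ann m M) fun x hx => hηs.eq_zero hx
    have key := hVq _ hT (fun hc => absurd (hx0 _ (hts hc)) (by simp))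
      (moll_nonneg fun x => mul_nonneg (hpos _) (sq_nonneg _))
    rw [← integral_finsetSum _ fun j _ => (int_moll (iD j) n).mul_bdd (mk j) (bk j)]
    refine le_trans (le_of_eq ?_) ((sub_nonneg.1 (by rw [sub_eq_neg_add]; exact key)).trans
      (le_of_eq ?_))
    · refine (integral_add (integrable_finsetSum _ fun j _ =>
        (int_moll (iD j) n).mul_bdd (mk j) (bk j))
        ((int_moll iη n).mul_bdd mk' bk')).symm.trans (integral_congr_ae ?_)
      filter_upwards [ae_ne_zero] with x hx
      rw [radialDiv_eq (hT.differentiable x) hx]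
      by_cases hxK : x ∈ K
      · simp only [hk, hk', indicator_of_mem hxK, (hw _).partialD_moll, Fin.sum_univ_three]; ring
      · simp only [hk, hk', indicator_of_notMem hxK, hn.eq_zero hxK,
          partialD_zero_of _ fun hc => hxK (hts hc)]
        simp
    · refine int_congr fun x => ?_
      by_cases hx : x ∈ K
      · simp only [indicator_of_mem hx, mul_comm]
      · simp only [hn.eq_zero hx, zero_mul, mul_zero]


/-! ### The Morawetz inequality for multipliers supported in an annulus -/

lemma integral_lincomb {n : ℕ} (c : Fin n → ℝ) {F : Fin n → E3 → ℝ} (hF : ∀ i, Integrable (F i)) :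
    Integrable (fun x => ∑ i, c i * F i x) ∧ ∫ x, ∑ i, c i * F i x = ∑ i, c i * ∫ x, F i x := by
  refine ⟨integrable_finsetSum _ fun i _ => (hF i).const_mul _, ?_⟩
  rw [integral_finsetSum _ fun i _ => (hF i).const_mul _]
  exact sum_congr rfl fun i _ => integral_const_mul _ _

lemma _root_.LipschitzWith.exists_mul {f g : ℝ → ℝ} {K : ℝ≥0} (hf : LipschitzWith K f)
    (hg : LipschitzWith L g) {D : ℝ} (hC : ∀ r, |f r| ≤ C) (hD : ∀ r, |g r| ≤ D) :
    ∃ L' : ℝ≥0, LipschitzWith L' fun r => f r * g r := by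
  have hC0 := (abs_nonneg _).trans (hC 0)
  have hD0 := (abs_nonneg _).trans (hD 0)
  refine ⟨⟨C * L + D * K, by positivity⟩, LipschitzWith.of_dist_le_mul fun r s => ?_⟩
  have h1 := hf.dist_le_mul r s
  have h2 := hg.dist_le_mul r s
  rw [Real.dist_eq] at h1 h2 ⊢
  rw [show f r * g r - f s * g s = f r * (g r - g s) + g s * (f r - f s) by ring]
  refine (abs_add_le _ _).trans ?_
  rw [abs_mul, abs_mul]
  have a1 := mul_le_mul (hC r) h2 (abs_nonneg _) hC0
  have a2 := mul_le_mul (hD s) h1 (abs_nonneg _) hD0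
  change _ ≤ (C * L + D * K) * dist r s
  linarith

/-- On the support of φ the factor r may be replaced by its clamp to [-|M|, |M|], which is bounded
and Lipschitz. -/
lemma exists_lip_id_mul (hφ : LipschitzWith L φ) (hm : 0 < m) (h0 : ∀ r ∉ Icc m M, φ r = 0) :
    ∃ L' : ℝ≥0, LipschitzWith L' fun r => r * φ r := by
  obtain ⟨C, hC⟩ := exists_bound_radial hφ h0
  have h1 : LipschitzWith 1 fun r => max (-|M|) (min |M| r) :=
    (LipschitzWith.id.const_min |M|).const_max (-|M|)
  obtain ⟨L', hL'⟩ := h1.exists_mul hφ (fun r => abs_le.2 ⟨le_max_left _ _,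
    max_le (by linarith [abs_nonneg M]) (min_le_left _ _)⟩) hC
  refine ⟨L', ?_⟩
  convert hL' using 2 with r
  by_cases hr : r ∈ Icc m M
  · have hM := hr.2.trans (le_abs_self M)
    rw [min_eq_right hM, max_eq_right (by linarith [hr.1, abs_nonneg M])]
  · rw [h0 r hr, mul_zero, mul_zero]

lemma norm_euler_le (g : E3 → C3) (x : E3) : ‖euler g x‖ ≤ ‖x‖ * ‖g x‖ := by
  have h := norm_inner_le_norm (𝕜 := ℂ) (WithLp.toLp 2 fun j => (x j) : C3) (g x)
  have e : inner ℂ (WithLp.toLp 2 fun j => (x j) : C3) (g x) = euler g x := by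
    simp [PiLp.inner_apply, euler, mul_comm]
  have e2 : ‖(WithLp.toLp 2 fun j => (x j) : C3)‖ = ‖x‖ := by simp [EuclideanSpace.norm_eq]
  rwa [e, e2] at h

lemma int_weight_euler (hu : MemLp u 2) (hg : MemLp g 2) {p : E3 → ℝ} (hp : AESM p)
    (hC : ∀ x, ‖p x‖ ≤ C) (h0 : ∀ x ∉ ann m M, p x = 0) :
    Integrable (fun x => p x * ‖euler g x‖ ^ 2) ∧
      Integrable (fun x => p x * (euler g x * conj (u x))) := by
  have hE := memLp_euler hg m M
  constructor
  · refine (int_radial_sq hE hp hC).congr (ae_of_all _ fun x => ?_)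
    by_cases hx : x ∈ ann m M
    · simp only [indicator_of_mem hx]
    · simp only [h0 x hx, zero_mul]
  · refine ((int_mul hE (memLp_conj hu)).bdd_mul
      (continuous_ofReal.comp_aestronglyMeasurable hp) (ae_of_all _ fun x => by
        rw [norm_real]; exact hC x)).congr (ae_of_all _ fun x => ?_)
    by_cases hx : x ∈ ann m M
    · simp only [indicator_of_mem hx]
    · simp only [h0 x hx, ofReal_zero, zero_mul]

/-- The equation tested with `κ(|x|) u`. -/
lemma SolvesHelmholtz.test_radial (hA : MemL2loc A) (h : IsH1A A u g)
    (hsol : SolvesHelmholtz A V U lam ε f u g) (hκ : LipschitzWith L κ) (hm : 0 < m)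
    (h0 : ∀ r ∉ Icc m M, κ r = 0)
    (hV : MemLp ((ann (m / 2) (M + 1)).indicator fun x => ((V x : ℂ) + U x + lam + I * ε) * u x) 2)
    (hf : MemLp ((ann (m / 2) (M + 1)).indicator f) 2) :
    ∫ x, (((deriv κ ‖x‖ / ‖x‖ : ℝ) : ℂ) * (euler g x * conj (u x)) +
      ((κ ‖x‖ * ‖g x‖ ^ 2 : ℝ) : ℂ)) =
      ∫ x, κ ‖x‖ * (zeroOrd V U lam ε f u x * conj (u x)) := by
  obtain ⟨C, hC⟩ := exists_bound_radial hκ h0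
  have hd1 : ∀ j x, partialD j (fun _ : E3 => (1 : ℝ)) x = 0 := fun j x => by simp [partialD]
  have hv := h.smooth_radial_mul hA (ψ := fun _ => 1) contDiff_const (Cψ := 1) (Cd := 0)
    (fun x => by simp) (fun j x => by rw [hd1]; simp) hκ hC
  simp only [hd1, one_mul, zero_mul, zero_add] at hv
  have hz : ∀ x ∉ ann m M, κ ‖x‖ = 0 := fun x hx => h0 _ hx
  have hsub : ∀ x ∈ ann m M, x ∈ ann (m / 2) (M + 1) := fun x hx =>
    ⟨by linarith [hx.1], by linarith [hx.2]⟩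
  have key := hsol.test hA h hm hV hf hv (SuppAnn.of_notMem fun x hx => by simp [hz x hx])
    (SuppAnn.of_notMem fun x hx => by ext i; simp [hz x hx, deriv_zero_of h0 hx])
  have i1 := int_mul hV (memLp_conj hv.memLp)
  have i2 := int_mul hf (memLp_conj hv.memLp)
  have hloc : ∀ (k : E3 → ℂ) x, (ann (m / 2) (M + 1)).indicator k x *
      conj (κ ‖x‖ * u x) = k x * conj (κ ‖x‖ * u x) := fun k x => by
    by_cases hx : x ∈ ann m M
    · rw [indicator_of_mem (hsub x hx)]
    · simp [hz x hx]
  simp only [hloc] at i1 i2; rw [← integral_sub i1 i2] at key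
  refine Eq.trans (int_congr (fun x => ?_)) (key.trans (int_congr (fun x => ?_)))
  · simp only [euler, Fin.sum_univ_three, map_add, map_mul, conj_ofReal,
      norm_sq_eq, ← normSq_eq_norm_sq]
    push_cast; simp only [← Complex.mul_conj]; ring
  · simp only [zeroOrd, map_mul, conj_ofReal]; ring

/-- Pointwise bounds of the potentials and of the trapping component by a radial majorant `w`. -/
structure PotBounds (A β : E3 → E3) (V U q : E3 → ℝ) (w : ℝ → ℝ) : Prop where
  memL2loc : MemL2loc A
  flux : RadialFlux A β
  aesm_V₁ : AESM V
  aesm_V₂ : AESM U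
  aesm_q : AESM q
  negPart : RadialDerivNegPartLE V q
  w_meas : Measurable w
  w_nonneg : ∀ r, 0 ≤ w r
  w_cont : ContinuousOn w (Ioi 0)
  V₁_le : ∀ᵐ x, |V x| ≤ ‖x‖ * w ‖x‖
  V₂_le : ∀ᵐ x, |U x| ≤ w ‖x‖
  q_le : ∀ᵐ x, |q x| ≤ w ‖x‖
  flux_le : ∀ x ≠ 0, ∀ τ ∈ dil, ‖β (τ • x)‖ ≤ 8 * (‖x‖ * w ‖x‖)

lemma PotBounds.exists_bound (hP : PotBounds A β V U q w) (hm : 0 < m) (M : ℝ) :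
    ∃ C, 0 ≤ C ∧ ∀ x ∈ ann m M, w ‖x‖ ≤ C ∧ ‖x‖ * w ‖x‖ ≤ C := by
  obtain ⟨C, hC⟩ := (isCompact_Icc).exists_bound_of_continuousOn
    (hP.w_cont.mono fun r hr => hm.trans_le hr.1)
  refine ⟨max |C| (|M| * |C|), le_max_of_le_left (abs_nonneg _), fun x hx => ?_⟩
  have h1 := (le_abs_self _).trans ((hC _ hx).trans (le_abs_self C))
  exact ⟨le_max_of_le_left h1, le_max_of_le_right (mul_le_mul (hx.2.trans (le_abs_self M)) h1
    (hP.w_nonneg _) (abs_nonneg _))⟩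

lemma PotBounds.memLp_zeroOrd (hP : PotBounds A β V U q w) (hu : MemLp u 2) (lam ε : ℝ) (hm : 0 < m)
    (M : ℝ) : MemLp ((ann m M).indicator fun x => ((V x : ℂ) + U x + lam + I * ε) * u x) 2 := by
  obtain ⟨C, hC0, hC⟩ := hP.exists_bound hm M
  have hm1 : AESM (fun x =>
      ((V x : ℂ) + U x + lam + I * ε) * u x) :=
    ((((continuous_ofReal.comp_aestronglyMeasurable hP.aesm_V₁).add
      (continuous_ofReal.comp_aestronglyMeasurable hP.aesm_V₂)).add
      aestronglyMeasurable_const).add aestronglyMeasurable_const).mul hu.1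
  refine hu.of_le_mul (c := C + C + |lam| + |ε|) (hm1.indicator (measSet_ann _ _)) ?_
  filter_upwards [hP.V₁_le, hP.V₂_le] with x h1 h2
  by_cases hx : x ∈ ann m M
  · rw [indicator_of_mem hx, norm_mul]
    refine mul_le_mul_of_nonneg_right ?_ (norm_nonneg _)
    have a1 : ‖(V x : ℂ)‖ ≤ C := by rw [norm_real]; exact h1.trans (hC x hx).2
    have a2 : ‖(U x : ℂ)‖ ≤ C := by rw [norm_real]; exact h2.trans (hC x hx).1
    have a3 : ‖(lam : ℂ)‖ ≤ |lam| := by rw [norm_real]; rfl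
    have a4 : ‖I * (ε : ℂ)‖ ≤ |ε| := by rw [norm_mul, norm_I, one_mul, norm_real]; rfl
    exact norm_add_le_of_le (norm_add_le_of_le (norm_add_le_of_le a1 a2) a3) a4
  · rw [indicator_of_notMem hx, norm_zero]; positivity


/-- The density of the Morawetz form, for a multiplier with values `p` and `d = r p'`. -/
def morDens (lam : ℝ) (u : E3 → ℂ) (g : E3 → C3) (p d : ℝ) (x : E3) : ℝ :=
  1 / 2 * (p - d) * ‖g x‖ ^ 2 + d * ((‖euler g x‖ ^ 2 + crossRe g u x) / ‖x‖ ^ 2) +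
    lam / 2 * (p + d) * ‖u x‖ ^ 2

/-- The density of the error terms in the Morawetz estimate, without the weight. -/
def errDens (w : ℝ → ℝ) (ε : ℝ) (f u : E3 → ℂ) (g : E3 → C3) (x : E3) : ℝ :=
  25 * w ‖x‖ * (‖u x‖ ^ 2 + ‖x‖ * (‖u x‖ ^ 2 + ‖u x‖ * ‖g x‖)) + ε * (‖x‖ * (‖u x‖ * ‖g x‖)) +
    ‖f x‖ * (‖u x‖ + ‖x‖ * ‖g x‖)

/-- Exact cancellations: λ disappears altogether, and the radial cross term of V₁ disappears,
leaving V₁ only against (p + d)|u|²/2. The worst remaining coefficient is that of w|x||u||g|, namely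
24 from the flux plus 1 from V₂; hence the 25 in `errDens`. -/
lemma morawetz_pointwise (hε : 0 ≤ ε) {p d P : ℝ} {x : E3} (hw : 0 ≤ w ‖x‖) (hp : 0 ≤ p)
    (hpP : p ≤ P) (hd : |d| ≤ 5 * P) (h1 : |V x| ≤ ‖x‖ * w ‖x‖) (h2 : |U x| ≤ w ‖x‖)
    (h3 : |q x| ≤ w ‖x‖) :
    |p * (zeroOrd V U lam ε f u x * conj (u x)).re +
      p * (zeroOrd V U lam ε f u x * conj (euler g x)).re +
      3 * p * (8 * (‖x‖ * w ‖x‖)) * ‖g x‖ * ‖u x‖ +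
      1 / 2 * (q x * (‖x‖ * p * ‖u x‖ ^ 2)) -
      1 / 2 * (V x * (p * (2 * crossRe g u x) + (3 * p + d) * ‖u x‖ ^ 2)) +
      lam * (1 / 2 * ((p + d) * ‖u x‖ ^ 2) -
        1 / 2 * (p * (2 * crossRe g u x) + (3 * p + d) * ‖u x‖ ^ 2))| ≤
      P * errDens w ε f u g x := by
  have hu := norm_nonneg (u x)
  have hg := norm_nonneg (g x)
  have hx := norm_nonneg x
  have hP := hp.trans hpP
  have hh := norm_euler_le g x
  have e : p * (zeroOrd V U lam ε f u x * conj (u x)).re +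
      p * (zeroOrd V U lam ε f u x * conj (euler g x)).re +
      3 * p * (8 * (‖x‖ * w ‖x‖)) * ‖g x‖ * ‖u x‖ +
      1 / 2 * (q x * (‖x‖ * p * ‖u x‖ ^ 2)) -
      1 / 2 * (V x * (p * (2 * crossRe g u x) + (3 * p + d) * ‖u x‖ ^ 2)) +
      lam * (1 / 2 * ((p + d) * ‖u x‖ ^ 2) -
        1 / 2 * (p * (2 * crossRe g u x) + (3 * p + d) * ‖u x‖ ^ 2)) =
      3 * p * (8 * (‖x‖ * w ‖x‖)) * ‖g x‖ * ‖u x‖ + 1 / 2 * (q x * (‖x‖ * p * ‖u x‖ ^ 2)) -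
      1 / 2 * V x * ((p + d) * ‖u x‖ ^ 2) +
      U x * (p * (‖u x‖ ^ 2 + crossRe g u x)) +
      ε * (p * (I * u x * conj (euler g x)).re) -
      p * (f x * (conj (u x) + conj (euler g x))).re := by
    simp only [zeroOrd, ← normSq_eq_norm_sq, normSq_apply, mul_re,
      mul_im, sub_re, Complex.sub_im, add_re, Complex.add_im,
      ofReal_re, ofReal_im, conj_re, conj_im, Complex.I_re,
      Complex.I_im]
    ring
  have b1 : |3 * p * (8 * (‖x‖ * w ‖x‖)) * ‖g x‖ * ‖u x‖| ≤
      24 * (P * w ‖x‖ * (‖x‖ * (‖u x‖ * ‖g x‖))) := by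
    rw [abs_of_nonneg (by positivity)]
    have := mul_le_mul_of_nonneg_right hpP (by positivity : 0 ≤ w ‖x‖ * (‖x‖ * (‖u x‖ * ‖g x‖)))
    linarith
  have b2 : |1 / 2 * (q x * (‖x‖ * p * ‖u x‖ ^ 2))| ≤ 1 / 2 * (P * w ‖x‖ * (‖x‖ * ‖u x‖ ^ 2)) := by
    rw [abs_mul, abs_mul, abs_of_nonneg (by positivity : 0 ≤ ‖x‖ * p * ‖u x‖ ^ 2),
      abs_of_pos (by norm_num : (0 : ℝ) < 1 / 2)]
    have := mul_le_mul h3 (mul_le_mul_of_nonneg_right hpP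
      (by positivity : 0 ≤ ‖x‖ * ‖u x‖ ^ 2)) (by positivity) hw
    linarith
  have b3 : |1 / 2 * V x * ((p + d) * ‖u x‖ ^ 2)| ≤ 3 * (P * w ‖x‖ * (‖x‖ * ‖u x‖ ^ 2)) := by
    rw [abs_mul, abs_mul, abs_mul, abs_of_nonneg (by positivity : 0 ≤ ‖u x‖ ^ 2),
      abs_of_pos (by norm_num : (0 : ℝ) < 1 / 2)]
    have hpd : |p + d| ≤ 6 * P := by
      have := abs_add_le p d
      rw [abs_of_nonneg hp] at this; linarith
    have := mul_le_mul h1 (mul_le_mul_of_nonneg_right hpd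
      (by positivity : 0 ≤ ‖u x‖ ^ 2)) (by positivity) (by positivity)
    linarith
  have hre : |crossRe g u x| ≤ ‖x‖ * (‖u x‖ * ‖g x‖) := by
    refine (abs_re_le_norm _).trans ?_
    rw [norm_mul, norm_conj]
    have := mul_le_mul_of_nonneg_right hh hu
    linarith
  have b4 : |U x * (p * (‖u x‖ ^ 2 + crossRe g u x))| ≤
      P * w ‖x‖ * (‖u x‖ ^ 2 + ‖x‖ * (‖u x‖ * ‖g x‖)) := by
    rw [abs_mul, abs_mul, abs_of_nonneg hp]
    have h5 : |‖u x‖ ^ 2 + crossRe g u x| ≤ ‖u x‖ ^ 2 + ‖x‖ * (‖u x‖ * ‖g x‖) := by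
      refine (abs_add_le _ _).trans ?_
      rw [abs_of_nonneg (by positivity : 0 ≤ ‖u x‖ ^ 2)]; linarith
    have := mul_le_mul h2 (mul_le_mul hpP h5 (abs_nonneg _) hP) (by positivity) hw
    linarith
  have b5 : |ε * (p * (I * u x * conj (euler g x)).re)| ≤ P * (ε * (‖x‖ * (‖u x‖ * ‖g x‖))) := by
    rw [abs_mul, abs_mul, abs_of_nonneg hp, abs_of_nonneg hε]
    have h5 : |(I * u x * conj (euler g x)).re| ≤ ‖x‖ * (‖u x‖ * ‖g x‖) := by
      refine (abs_re_le_norm _).trans ?_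
      rw [norm_mul, norm_mul, norm_conj, norm_I, one_mul]
      have := mul_le_mul_of_nonneg_left hh hu
      linarith
    have := mul_le_mul_of_nonneg_left (mul_le_mul hpP h5 (abs_nonneg _) hP) hε
    linarith
  have b6 : |p * (f x * (conj (u x) + conj (euler g x))).re| ≤
      P * (‖f x‖ * (‖u x‖ + ‖x‖ * ‖g x‖)) := by
    rw [abs_mul, abs_of_nonneg hp]
    refine mul_le_mul hpP ((abs_re_le_norm _).trans ?_) (abs_nonneg _) hP
    rw [norm_mul]
    refine mul_le_mul_of_nonneg_left ((norm_add_le _ _).trans ?_) (norm_nonneg _)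
    rw [norm_conj, norm_conj]; linarith
  have b7 : 0 ≤ P * w ‖x‖ * ‖u x‖ ^ 2 := by positivity
  have b8 : 0 ≤ P * w ‖x‖ * (‖x‖ * ‖u x‖ ^ 2) := by positivity
  rw [e, errDens]; rw [abs_le] at *
  constructor <;> linarith [b1.1, b1.2, b2.1, b2.2, b3.1, b3.2, b4.1, b4.2, b5.1, b5.2, b6.1, b6.2]

/-- The Morawetz inequality for multipliers supported in an annulus. -/
lemma SolvesHelmholtz.morawetz_compact (hP : PotBounds A β V U q w) (h : IsH1A A u g) (hε : 0 ≤ ε)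
    (hsol : SolvesHelmholtz A V U lam ε f u g) (hφ : LipschitzWith L φ) (hm : 0 < m) (hM : 0 < M)
    (h0 : ∀ r ∉ Icc m M, φ r = 0) (hpos : ∀ r, 0 ≤ φ r)
    (hf : MemLp ((ann (m / 2) (M + 1)).indicator f) 2) {Ψ : ℝ → ℝ} (hΨ : ∀ r, 0 < r → φ r ≤ Ψ r)
    (hΨ' : ∀ᵐ x : E3, |‖x‖ * deriv φ ‖x‖| ≤ 5 * Ψ ‖x‖) :
    ofReal (∫ x, morDens lam u g (φ ‖x‖) (‖x‖ * deriv φ ‖x‖) x) ≤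
      ∫⁻ x, ofReal (Ψ ‖x‖ * errDens w ε f u g x) := by
  obtain ⟨C, hC⟩ := exists_bound_radial hφ h0
  obtain ⟨Cw, hCw0, hCw⟩ := hP.exists_bound (m := m / 2) (by linarith) (M + 1)
  have hA := hP.memL2loc
  have hV := hP.memLp_zeroOrd h.memLp lam ε (m := m / 2) (by linarith) (M + 1)
  have z0 : ∀ x ∉ ann m M, φ ‖x‖ = 0 := fun x hx => h0 _ hx
  have z1 : ∀ x ∉ ann m M, deriv φ ‖x‖ = 0 := fun x hx => deriv_zero_of h0 hx
  have hsub : ∀ x ∈ ann m M, x ∈ ann (m / 2) (M + 1) := fun x hx =>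
    ⟨by linarith [hx.1], by linarith [hx.2]⟩
  have mφ : Measurable fun x : E3 => φ ‖x‖ := (hφ.continuous.comp continuous_norm).measurable
  have md : Measurable fun x : E3 => deriv φ ‖x‖ := (measurable_deriv φ).comp measurable_norm
  have hd : ∀ x : E3, ‖‖x‖ * deriv φ ‖x‖‖ ≤ |M| * L := fun x => abs_mul_deriv_le hφ h0 (norm_nonneg x)
  have hd' : ∀ x : E3, ‖deriv φ ‖x‖ / ‖x‖‖ ≤ L / m := fun x => by
    by_cases hx : x ∈ ann m M
    · rw [norm_div, norm_norm]; exact div_le_div₀ L.2 (norm_deriv_le_of_lipschitz hφ) hm hx.1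
    · rw [z1 x hx, zero_div, norm_zero]; positivity
  obtain ⟨ih, ic⟩ := int_weight_euler h.memLp h.memLp_grad (md.div measurable_norm).aesm
    hd' (fun x hx => by rw [Pi.div_apply, z1 x hx, zero_div])
  obtain ⟨-, icφ⟩ := int_weight_euler h.memLp h.memLp_grad mφ.aesm (fun x => hC ‖x‖) z0
  have md' : Measurable fun x : E3 => ‖x‖ * deriv φ ‖x‖ := measurable_norm.mul md
  have icφ' := icφ.re.congr (ae_of_all _ fun x => re_ofReal_mul _ _)
  have ic' : Integrable (fun x => deriv φ ‖x‖ / ‖x‖ * crossRe g u x) :=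
    ic.re.congr (ae_of_all _ fun x => re_ofReal_mul _ _)
  have ig := int_radial_sq h.memLp_grad mφ.aesm fun x => hC ‖x‖
  have igd := int_radial_sq h.memLp_grad md'.aesm hd
  have iu := int_radial_sq h.memLp mφ.aesm fun x => hC ‖x‖
  have iud := int_radial_sq h.memLp md'.aesm hd
  set T : E3 → ℝ := fun x => φ ‖x‖ * (2 * crossRe g u x) +
    (3 * φ ‖x‖ + ‖x‖ * deriv φ ‖x‖) * ‖u x‖ ^ 2 with hT
  have iT : Integrable T := by
    refine ((icφ'.const_mul 2).add ((iu.const_mul 3).add iud)).congr (ae_of_all _ fun x => ?_)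
    simp only [Pi.add_apply, hT]; ring
  have zT : ∀ x ∉ ann m M, T x = 0 := fun x hx => by simp [hT, z0 x hx, z1 x hx]
  have hbdd : ∀ {v : E3 → ℝ}, AESM v →
      (∀ᵐ x, x ∈ ann m M → |v x| ≤ Cw) → ∀ {k : E3 → ℝ}, Integrable k →
      (∀ x ∉ ann m M, k x = 0) → Integrable (fun x => v x * k x) := by
    intro v hvm hv k hk hk0
    refine (hk.bdd_mul (c := Cw) (hvm.indicator (measSet_ann m M)) ?_).congr
      (ae_of_all _ fun x => ?_)
    · filter_upwards [hv] with x hx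
      by_cases hxa : x ∈ ann m M
      · rw [indicator_of_mem hxa]; exact hx hxa
      · rwa [indicator_of_notMem hxa, norm_zero]
    · by_cases hxa : x ∈ ann m M
      · simp only [indicator_of_mem hxa]
      · simp only [hk0 x hxa, mul_zero]
  have hV1 : ∀ᵐ x, x ∈ ann (m / 2) (M + 1) → |V x| ≤ Cw := by
    filter_upwards [hP.V₁_le] with x h1 hx using h1.trans (hCw x hx).2
  have hq1 : ∀ᵐ x, x ∈ ann (m / 2) (M + 1) → |q x| ≤ Cw := by
    filter_upwards [hP.q_le] with x h1 hx using h1.trans (hCw x hx).1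
  have iVT := hbdd hP.aesm_V₁ (hV1.mono fun x hx hxa => hx (hsub x hxa)) iT zT
  have hκu : Integrable (fun x : E3 => ‖x‖ * φ ‖x‖ * ‖u x‖ ^ 2) := by
    refine int_radial_sq h.memLp (measurable_norm.mul mφ).aesm (C := |M| * C) fun x => ?_
    by_cases hx : x ∈ ann m M
    · rw [norm_mul, norm_norm]
      exact mul_le_mul (hx.2.trans (le_abs_self M)) (hC _) (norm_nonneg _) (abs_nonneg _)
    · rw [z0 x hx, mul_zero, norm_zero]
      exact mul_nonneg (abs_nonneg _) ((norm_nonneg _).trans (hC 0))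
  have iq := hbdd hP.aesm_q (hq1.mono fun x hx hxa => hx (hsub x hxa)) hκu
    fun x hx => by simp [z0 x hx]
  have hz : MemLp ((ann m M).indicator (zeroOrd V U lam ε f u)) 2 := by
    refine ((hV.sub hf).indicator (measSet_ann m M)).ae_eq (ae_of_all _ fun x => ?_)
    by_cases hx : x ∈ ann m M
    · simp only [indicator_of_mem hx, Pi.sub_apply, indicator_of_mem (hsub x hx), zeroOrd]
    · simp only [indicator_of_notMem hx]
  have hφz := memLp_radial_mul hφ h0 hz
  have izu := (int_mul hφz (memLp_conj h.memLp)).congr (ae_of_all _ fun x => mul_assoc _ _ _)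
  have izh : Integrable (fun x => φ ‖x‖ * (zeroOrd V U lam ε f u x * conj (euler g x)).re)
      volume := by
    refine (int_mul hφz (memLp_conj (memLp_euler h.memLp_grad m M))).re.congr
      (ae_of_all _ fun x => ?_)
    by_cases hx : x ∈ ann m M
    · simp only [indicator_of_mem hx, re_to_complex, mul_assoc, re_ofReal_mul]
    · simp [z0 x hx]
  have hK : MemLp (fun x => 3 * φ ‖x‖ * (8 * (‖x‖ * w ‖x‖)) * ‖g x‖) 2 := by
    refine h.memLp_grad.norm.of_le_mul (c := 3 * C * (8 * Cw)) (((mφ.const_mul 3).mul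
      ((measurable_norm.mul (hP.w_meas.comp measurable_norm)).const_mul 8)).aesm.mul
      h.memLp_grad.1.norm) (ae_of_all _ fun x => ?_)
    rw [norm_mul]
    refine mul_le_mul_of_nonneg_right ?_ (norm_nonneg _)
    by_cases hx : x ∈ ann m M
    · have h1 := hP.w_nonneg ‖x‖
      rw [norm_of_nonneg (mul_nonneg (mul_nonneg (by norm_num) (hpos _)) (by positivity))]
      have h2 : φ ‖x‖ ≤ C := (le_abs_self _).trans (hC _)
      exact mul_le_mul (by linarith) (by linarith [(hCw x (hsub x hx)).2]) (by positivity)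
        (by linarith [hpos ‖x‖])
    · rw [z0 x hx, mul_zero, zero_mul, norm_zero]
      have := (norm_nonneg _).trans (hC 0)
      positivity
  have iX := int_mul hK h.memLp.norm
  have vir := hsol.virial hA hP.flux h hφ hm hM h0 hpos hK
    (fun x hx τ hτ => hP.flux_le x (norm_pos_iff.1 (hm.trans_le hx.1)) τ hτ) hV hf
  have tst := congrArg Complex.re (hsol.test_radial hA h hφ hm h0 hV hf)
  -- `T` is |x|^(-2) times the divergence of |x|²φ|u|² x. Its integral vanishes, so any multiple may
  -- be added; λ/2 times it makes λ cancel pointwise on the error side.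
  have ibp0 : ∫ x, T x = 0 := by
    have e1 : Integrable (fun x => φ ‖x‖ * (2 * crossRe g u x) +
        ‖x‖ * deriv φ ‖x‖ * ‖u x‖ ^ 2) := by
      refine ((icφ'.const_mul 2).add iud).congr (ae_of_all _ fun x => ?_)
      simp; ring
    have e2 : ∫ x, T x = (∫ x, (φ ‖x‖ * (2 * crossRe g u x) +
        ‖x‖ * deriv φ ‖x‖ * ‖u x‖ ^ 2)) + ∫ x, 3 * (φ ‖x‖ * ‖u x‖ ^ 2) := by
      rw [← integral_add e1 (iu.const_mul 3)]
      refine int_congr fun x => ?_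
      simp only [hT]; ring
    rw [e2, h.integral_radial_cross hA hφ hm hM h0, integral_const_mul]; ring
  -- The same `T` arises from the radial derivative bound with κ(r) = rφ(r): the coefficient κ' +
  -- 2κ/r equals 3φ + rφ'.
  have hV1T : ∫ x, V x * T x ≤ ∫ x, q x * (‖x‖ * φ ‖x‖ * ‖u x‖ ^ 2) := by
    obtain ⟨L', hL'⟩ := exists_lip_id_mul hφ hm h0
    refine le_trans (le_of_eq (integral_congr_ae ?_)) (h.integral_radialDeriv_le hA hL' hm
      (fun r hr => by rw [h0 r hr, mul_zero]) (fun r => ?_) hP.negPart hP.aesm_V₁ hP.aesm_q hV1 hq1)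
    · filter_upwards [ae_diff_norm hφ, ae_ne_zero] with x hx hx0
      have hder : deriv (fun r => r * φ r) ‖x‖ = φ ‖x‖ + ‖x‖ * deriv φ ‖x‖ := by
        rw [deriv_fun_mul differentiableAt_fun_id hx]; simp
      rw [hder, mul_div_cancel_left₀ _ (norm_ne_zero_iff.2 hx0)]; ring
    · by_cases hr : r ∈ Icc m M
      · exact mul_nonneg (hm.le.trans hr.1) (hpos r)
      · rw [h0 r hr, mul_zero]
  have tst' : (∫ x, deriv φ ‖x‖ / ‖x‖ * crossRe g u x) + ∫ x, φ ‖x‖ * ‖g x‖ ^ 2 =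
      ∫ x, φ ‖x‖ * (zeroOrd V U lam ε f u x * conj (u x)).re := by
    have r1 := integral_re (ic.add (Integrable.ofReal (𝕜 := ℂ) ig))
    have r2 := integral_re izu
    simp only [re_to_complex, Pi.add_apply] at r1 r2; rw [← integral_add ic' ig]
    refine Eq.trans (int_congr (fun x => ?_)) (r1.trans (tst.trans
      (r2.symm.trans (int_congr (fun x => ?_)))))
    · simp only [add_re, re_ofReal_mul]; rfl
    · simp only [re_ofReal_mul]
  have izu' := izu.re.congr (ae_of_all _ fun x => re_ofReal_mul _ _)
  have igs := (ig.add igd).congr (ae_of_all _ fun x => (add_mul _ _ _).symm)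
  have ius := (iu.add iud).congr (ae_of_all _ fun x => (add_mul _ _ _).symm)
  -- The Morawetz density is split into terms with known integrals. The list after it holds the
  -- error side: the equation tested with φu, the virial inequality, half of the bound for V₁, and
  -- λ/2 times the radial identity.
  obtain ⟨-, eD⟩ := integral_lincomb ![1, -(1 / 2), 1, 1, lam / 2]
    (F := ![fun x => φ ‖x‖ * ‖g x‖ ^ 2, fun x => (φ ‖x‖ + ‖x‖ * deriv φ ‖x‖) * ‖g x‖ ^ 2,
      fun x => deriv φ ‖x‖ / ‖x‖ * ‖euler g x‖ ^ 2,
      fun x => deriv φ ‖x‖ / ‖x‖ * crossRe g u x,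
      fun x => (φ ‖x‖ + ‖x‖ * deriv φ ‖x‖) * ‖u x‖ ^ 2]) (by
    intro i; fin_cases i <;> assumption)
  obtain ⟨-, eR⟩ := integral_lincomb ![1, 1, 1, 1 / 2, -(1 / 2), lam / 2, -(lam / 2)]
    (F := ![fun x => φ ‖x‖ * (zeroOrd V U lam ε f u x * conj (u x)).re,
      fun x => φ ‖x‖ * (zeroOrd V U lam ε f u x * conj (euler g x)).re,
      fun x => 3 * φ ‖x‖ * (8 * (‖x‖ * w ‖x‖)) * ‖g x‖ * ‖u x‖,
      fun x => q x * (‖x‖ * φ ‖x‖ * ‖u x‖ ^ 2), fun x => V x * T x,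
      fun x => (φ ‖x‖ + ‖x‖ * deriv φ ‖x‖) * ‖u x‖ ^ 2, T]) (by
    intro i; fin_cases i <;> assumption)
  simp only [Fin.sum_univ_succ, Matrix.cons_val_zero, Matrix.cons_val_succ, Fin.sum_univ_zero,
    add_zero] at eD eR
  refine (ofReal_le_ofReal ((le_of_eq (Eq.trans (integral_congr_ae
    (ae_of_all _ fun x => ?_)) eD)).trans (le_trans ?_ (le_of_eq eR.symm)))).trans ?_
  · have e : deriv φ ‖x‖ / ‖x‖ = ‖x‖ * deriv φ ‖x‖ / ‖x‖ ^ 2 := by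
      by_cases hx : ‖x‖ = 0
      · simp [hx]
      · field_simp
    simp only [morDens, e]; ring
  · rw [ibp0]; linarith
  · refine (ofReal_le_ofReal (le_abs_self _)).trans ?_
    rw [← norm_eq_abs, ofReal_norm]
    refine (enorm_integral_le_lintegral_enorm _).trans (lintegral_mono_ae ?_)
    filter_upwards [hP.V₁_le, hP.V₂_le, hP.q_le, ae_ne_zero, hΨ'] with x h1 h2 h3 hx h4
    rw [← ofReal_norm]
    refine ofReal_le_ofReal (le_trans (le_of_eq ?_) (morawetz_pointwise (lam := lam) hε (hP.w_nonneg _)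
      (hpos _) (hΨ _ (norm_pos_iff.2 hx)) h4 h1 h2 h3))
    rw [norm_eq_abs]; congr 1; ring


/-! ### Radial cutoffs exhausting the punctured space -/

lemma abs_clamp_sub_le (y z : ℝ) : |max 0 (min 1 y) - max 0 (min 1 z)| ≤ |y - z| := by
  simpa [Real.dist_eq] using ((LipschitzWith.id.const_min 1).const_max 0).dist_le_mul y z

/-- The slope is 2/a on the rising part, where r ≤ a, and 1/b on the falling part, where r ≤ 2b. The
bound is scale invariant, so multiplying by a cutoff costs only a constant, uniformly as the cutoffs
exhaust the space. -/
lemma abs_mul_deriv_trap_le {a b r : ℝ} (ha : 0 < a) (hab : a < b) (hr : 0 < r) :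
    |r * deriv (trap a b) r| ≤ 2 := by
  have hb := ha.trans hab
  rw [abs_mul, abs_of_pos hr]; rcases le_or_gt r a with h | h
  · have e : ∀ s, s < b → trap a b s = max 0 (min 1 (2 * s / a - 1)) := fun s hs => by
      have : s / b < 1 := (div_lt_one hb).2 hs
      rw [trap, ← min_assoc, min_comm 1, min_assoc, min_eq_left (b := 2 - s / b) (by linarith),
        min_comm]
    have h1 : ‖deriv (trap a b) r‖ ≤ 2 / a := by
      refine norm_deriv_le_of_lip' (by positivity) ?_
      filter_upwards [gt_mem_nhds (h.trans_lt hab)] with s hs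
      rw [e s hs, e r (h.trans_lt hab)]
      refine (abs_clamp_sub_le _ _).trans (le_of_eq ?_)
      rw [show 2 * s / a - 1 - (2 * r / a - 1) = 2 / a * (s - r) by ring, abs_mul,
        abs_of_pos (by positivity)]
      rfl
    calc r * |deriv (trap a b) r| ≤ a * (2 / a) := mul_le_mul h h1 (abs_nonneg _) ha.le
      _ = 2 := by field_simp
  · rcases le_or_gt r (2 * b) with h' | h'
    · have e : ∀ s, a < s → trap a b s = max 0 (min 1 (2 - s / b)) := fun s hs => by
        have : 1 < s / a := (one_lt_div ha).2 hs
        rw [trap, ← min_assoc, min_eq_left (a := 1) (by rw [mul_div_assoc]; linarith)]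
      have h1 : ‖deriv (trap a b) r‖ ≤ 1 / b := by
        refine norm_deriv_le_of_lip' (by positivity) ?_
        filter_upwards [lt_mem_nhds h] with s hs
        rw [e s hs, e r h]
        refine (abs_clamp_sub_le _ _).trans (le_of_eq ?_)
        rw [show 2 - s / b - (2 - r / b) = -(1 / b * (s - r)) by ring, abs_neg, abs_mul,
          abs_of_pos (by positivity)]
        rfl
      calc r * |deriv (trap a b) r| ≤ (2 * b) * (1 / b) := mul_le_mul h' h1 (abs_nonneg _) (by positivity)
        _ = 2 := by field_simp
    · rw [deriv_zero_of (fun s hs => trap_eq_zero ha hb hs) fun hc => h'.not_ge hc.2]; simp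

lemma abs_trap_le (a b r : ℝ) : |trap a b r| ≤ 1 := by
  rw [abs_of_nonneg (trap_nonneg a b r)]; exact trap_le_one a b r

/-- Radial cutoffs exhausting `ℝ³ ∖ {0}`. -/
def cutoff (n : ℕ) : ℝ → ℝ := trap (1 / ((n : ℝ) + 2)) (n + 2)

lemma cutoff_aux (n : ℕ) : 0 < 1 / ((n : ℝ) + 2) ∧ 1 / ((n : ℝ) + 2) < n + 2 := by
  have : 0 ≤ n := Nat.cast_nonneg n
  refine ⟨by positivity, ?_⟩
  rw [div_lt_iff₀ (by positivity)]; nlinarith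

lemma cutoff_mul_eq_zero (κ : ℝ → ℝ) (n : ℕ) {r : ℝ}
    (hr : r ∉ Icc (1 / ((n : ℝ) + 2) / 2) (2 * (n + 2))) : κ r * cutoff n r = 0 := by
  rw [cutoff, trap_eq_zero (cutoff_aux n).1 (by positivity) hr, mul_zero]

lemma cutoff_mul_eventuallyEq (κ : ℝ → ℝ) {r : ℝ} (hr : 0 < r) :
    ∀ᶠ n : ℕ in atTop, (fun s => κ s * cutoff n s) =ᶠ[𝓝 r] κ := by
  have h1 : Tendsto (fun n : ℕ => (n : ℝ) + 2) atTop atTop :=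
    tendsto_atTop_add_const_right _ _ tendsto_natCast_atTop_atTop
  filter_upwards [h1.eventually_gt_atTop r, h1.eventually_gt_atTop r⁻¹] with n hn hn'
  have h2 : 1 / ((n : ℝ) + 2) < r := by rw [one_div]; exact inv_lt_of_inv_lt₀ hr hn'
  filter_upwards [Ioo_mem_nhds h2 hn] with s hs
  rw [cutoff, trap_eq_one (cutoff_aux n).1 ⟨hs.1.le, hs.2.le⟩, mul_one]

lemma exists_lip_cutoff_mul (hκ : LipschitzWith L κ) (hC : ∀ r, |κ r| ≤ C) (n : ℕ) :
    ∃ L' : ℝ≥0, LipschitzWith L' fun r => κ r * cutoff n r := by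
  obtain ⟨K, hK⟩ := lipschitzWith_trap (1 / (n + 2)) (n + 2)
  exact hκ.exists_mul hK hC (abs_trap_le _ _)

lemma abs_mul_deriv_cutoff_mul_le (hκ : LipschitzWith L κ) (n : ℕ) :
    ∀ᵐ x : E3, |‖x‖ * deriv (fun r => κ r * cutoff n r) ‖x‖| ≤
      |‖x‖ * deriv κ ‖x‖| + 2 * |κ ‖x‖| := by
  obtain ⟨K, hK⟩ := lipschitzWith_trap (1 / (n + 2)) (n + 2)
  filter_upwards [ae_diff_norm hκ, ae_diff_norm hK, ae_ne_zero] with x h1 h2 h3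
  have h4 := abs_mul_deriv_trap_le (cutoff_aux n).1 (cutoff_aux n).2 (norm_pos_iff.2 h3)
  change |‖x‖ * deriv (fun r => κ r * trap (1 / (n + 2)) (n + 2) r) ‖x‖| ≤ _
  rw [deriv_fun_mul h1 h2, show ‖x‖ * (deriv κ ‖x‖ * trap (1 / (n + 2)) (n + 2) ‖x‖ + κ ‖x‖ *
    deriv (trap (1 / (n + 2)) (n + 2)) ‖x‖) = (‖x‖ * deriv κ ‖x‖) * trap (1 / (n + 2)) (n + 2) ‖x‖ +
    κ ‖x‖ * (‖x‖ * deriv (trap (1 / (n + 2)) (n + 2)) ‖x‖) by ring]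
  refine (abs_add_le _ _).trans (add_le_add ?_ ?_)
  · rw [abs_mul]; exact mul_le_of_le_one_right (abs_nonneg _) (abs_trap_le _ _ _)
  · rw [abs_mul, mul_comm 2]; exact mul_le_mul_of_nonneg_left h4 (abs_nonneg _)

lemma inv_max_le (hm : 0 < m) (r : ℝ) : |(max r m)⁻¹| ≤ m⁻¹ := by
  rw [abs_of_pos (inv_pos.2 (hm.trans_le (le_max_right r m)))]
  exact inv_anti₀ hm (le_max_right r m)

lemma lipschitzWith_inv_max (hm : 0 < m) : ∃ L : ℝ≥0, LipschitzWith L fun r : ℝ => (max r m)⁻¹ := by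
  refine ⟨⟨m⁻¹ * m⁻¹, by positivity⟩, LipschitzWith.of_dist_le_mul fun r s => ?_⟩
  have hr := hm.trans_le (le_max_right r m)
  have hs := hm.trans_le (le_max_right s m)
  rw [Real.dist_eq, Real.dist_eq, show (max r m)⁻¹ - (max s m)⁻¹ =
    (max r m)⁻¹ * (max s m)⁻¹ * (max s m - max r m) by field_simp, abs_mul, abs_mul]
  have hm' := (inv_pos.2 hm).le
  refine mul_le_mul (mul_le_mul (inv_max_le hm r) (inv_max_le hm s) (abs_nonneg _) hm')
    ?_ (abs_nonneg _) (mul_nonneg hm' hm')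
  rw [abs_sub_comm r s]; exact abs_max_sub_max_le_abs _ _ _


/-! ### Hardy inequalities -/

lemma deriv_trap_nonneg {a b r : ℝ} (ha : 0 < a) (hr : r < b) (hb : 0 < b) :
    0 ≤ deriv (trap a b) r := by
  have h1 : Monotone fun s => max 0 (min 1 (2 * s / a - 1)) := fun s t hst => by dsimp only; gcongr
  have e : trap a b =ᶠ[𝓝 r] fun s => max 0 (min 1 (2 * s / a - 1)) := by
    filter_upwards [gt_mem_nhds hr] with s hs
    have : s / b < 1 := (div_lt_one hb).2 hs
    rw [trap, ← min_assoc, min_comm 1, min_assoc, min_eq_left (b := 2 - s / b) (by linarith),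
      min_comm]
  rw [e.deriv_eq]; exact h1.deriv_nonneg

/-- The quotient `|u| / |x|` in Hardy's inequality. -/
def rquot (u : E3 → ℂ) (x : E3) : ℝ := ‖u x‖ / ‖x‖

lemma aesm_rquot (hu : AESM u) : AESM (rquot u) :=
  (hu.norm.aemeasurable.div measurable_norm.aemeasurable).aesm

lemma setLInt_enorm_sq {S : Set E3} (hv : IntegrableOn (fun x => ‖v x‖ ^ 2) S) :
    ∫⁻ x in S, ‖v x‖ₑ ^ 2 = ofReal (∫ x in S, ‖v x‖ ^ 2) := by
  rw [ofReal_integral_eq_lintegral_ofReal hv (ae_of_all _ fun x => sq_nonneg _)]; simp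

lemma measSet_ball (R : ℝ) : MeasurableSet {x : E3 | ‖x‖ ≤ R} :=
  (isClosed_le continuous_norm continuous_const).measurableSet

lemma integrableOn_rquot (hu : MemLp u 2) (hm : 0 < m) :
    IntegrableOn (fun x => ‖rquot u x‖ ^ 2) (ann m M) := by
  rw [← integrable_indicator_iff (measSet_ann _ _)]
  refine ((hu.int_sq).const_mul (m⁻¹ ^ 2)).mono'
    (((aesm_rquot hu.1).norm.pow 2).indicator (measSet_ann _ _))
    (ae_of_all _ fun x => ?_)
  by_cases hx : x ∈ ann m M
  · rw [indicator_of_mem hx, norm_pow, norm_norm, rquot, norm_div, norm_norm, norm_norm,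
      div_eq_inv_mul, mul_pow]
    gcongr
    exact hx.1
  · rw [indicator_of_notMem hx, norm_zero]; positivity

/-- After bounding the cross term by Cauchy–Schwarz, the difference of the two sides is at least
(t/2)(2G - N/R)². -/
lemma hardy_pointwise {E N G R X t : ℝ} (hR : 0 < R) (hE : |E| ≤ R * G * N) (hX : X = (N / R) ^ 2)
    (ht : 0 ≤ t) :
    1 / 2 * (t * X) + s * X ≤ (t * (2 * E) / R ^ 2 + (t + s) * X) + 2 * (t * G ^ 2) := by
  have h1 : t * (2 * E) / R ^ 2 ≥ -(t * (2 * (G * (N / R)))) := by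
    have : -(R * G * N) ≤ E := (abs_le.1 hE).1
    rw [ge_iff_le, le_div_iff₀ (by positivity)]
    have e : -(t * (2 * (G * (N / R)))) * R ^ 2 = t * (2 * -(R * G * N)) := by field_simp
    rw [e]; gcongr
  have h2 := mul_nonneg ht (sq_nonneg (2 * G - N / R))
  nlinarith

/-- Radial integration by parts with weight `trap a ρ`(r)/r². In three dimensions r∂_r + 3 maps
r^(-2) to itself, which leaves |u|²/|x|² with coefficient one plus the derivative of the trapezoid.
On the rising part this derivative has the good sign, so nothing is lost at the inner radius; the
falling part gives the shell term. -/
lemma IsH1A.hardy_annulus (hA : MemL2loc A) (h : IsH1A A u g) {a ρ : ℝ} (ha : 0 < a) (hρ : a < ρ) :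
    ∫⁻ x in ann a ρ, ‖rquot u x‖ₑ ^ 2 ≤ 4 * (∫⁻ x in {x | ‖x‖ ≤ 2 * ρ}, ‖g x‖ₑ ^ 2) +
      4 * ∫⁻ x in ann ρ (2 * ρ), ‖rquot u x‖ₑ ^ 2 := by
  have hρ0 := ha.trans hρ
  have ha4 : 0 < a / 4 := by positivity
  obtain ⟨L1, hL1⟩ := lipschitzWith_inv_max ha4
  obtain ⟨L2, hL2⟩ := hL1.exists_mul hL1 (inv_max_le ha4) (inv_max_le ha4)
  obtain ⟨L3, hL3⟩ := lipschitzWith_trap a ρ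
  obtain ⟨L, hL⟩ := hL2.exists_mul hL3 (fun r => by
    rw [abs_mul]
    exact mul_le_mul (inv_max_le ha4 r) (inv_max_le ha4 r) (abs_nonneg _) (by positivity))
    (abs_trap_le a ρ)
  -- The trapezoid vanishes below a/2, so replacing r by max(r, a/4) is harmless and only makes the
  -- weight Lipschitz on the whole line.
  set κ : ℝ → ℝ := fun r => (max r (a / 4))⁻¹ * (max r (a / 4))⁻¹ * trap a ρ r with hκ
  have h0 : ∀ r, r ∉ Icc (a / 2) (2 * ρ) → κ r = 0 := fun r hr => by
    rw [hκ]; dsimp only; rw [trap_eq_zero ha hρ0 hr, mul_zero]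
  have hm : 0 < a / 2 := by positivity
  obtain ⟨C, hC⟩ := exists_bound_radial hL h0
  have mκ : Measurable fun x : E3 => κ ‖x‖ := (hL.continuous.comp continuous_norm).measurable
  have md : Measurable fun x : E3 => ‖x‖ * deriv κ ‖x‖ :=
    measurable_norm.mul ((measurable_deriv κ).comp measurable_norm)
  obtain ⟨-, ic⟩ := int_weight_euler h.memLp h.memLp_grad mκ.aesm
    (fun x => hC ‖x‖) (fun x hx => h0 _ hx)
  have ic' : Integrable (fun x => κ ‖x‖ * (2 * crossRe g u x)) :=
    (ic.re.const_mul 2).congr (ae_of_all _ fun x => by simp; ring)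
  have iu := int_radial_sq h.memLp mκ.aesm fun x => hC ‖x‖
  have iud := int_radial_sq h.memLp md.aesm fun x => abs_mul_deriv_le hL h0 (norm_nonneg x)
  set I : E3 → ℝ := fun x => (κ ‖x‖ * (2 * crossRe g u x) +
    ‖x‖ * deriv κ ‖x‖ * ‖u x‖ ^ 2) + 3 * (κ ‖x‖ * ‖u x‖ ^ 2) with hI
  have iI := (ic'.add iud).add (iu.const_mul 3)
  have hI0 : ∫ x, I x = 0 := by
    refine (integral_add (ic'.add iud) (iu.const_mul 3)).trans ?_
    rw [integral_const_mul]
    change (∫ x, (κ ‖x‖ * (2 * crossRe g u x) + ‖x‖ * deriv κ ‖x‖ * ‖u x‖ ^ 2)) + _ = _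
    rw [h.integral_radial_cross hA hL hm (by positivity) h0]; ring
  have igS : IntegrableOn (fun x => ‖g x‖ ^ 2) {x : E3 | ‖x‖ ≤ 2 * ρ} volume :=
    (h.memLp_grad.int_sq).integrableOn
  have iq1 := integrableOn_rquot h.memLp ha (M := ρ)
  have iq2 := integrableOn_rquot h.memLp hρ0 (M := 2 * ρ)
  have m1 := measSet_ann a ρ
  have m2 := measSet_ann ρ (2 * ρ)
  have m3 := measSet_ball (2 * ρ)
  have key : 1 / 2 * (∫ x in ann a ρ, ‖rquot u x‖ ^ 2) ≤
      2 * (∫ x in {x : E3 | ‖x‖ ≤ 2 * ρ}, ‖g x‖ ^ 2) +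
        2 * ∫ x in ann ρ (2 * ρ), ‖rquot u x‖ ^ 2 := by
    rw [← integral_indicator m1, ← integral_indicator m2, ← integral_indicator m3]
    have j2 := (integrable_indicator_iff m2).2 iq2
    have j3 := (integrable_indicator_iff m3).2 igS
    rw [← integral_const_mul, ← integral_const_mul, ← integral_const_mul,
      ← zero_add ((∫ x, _) + ∫ x, _), ← hI0, ← integral_add (j3.const_mul 2) (j2.const_mul 2)]
    refine le_trans (integral_mono_ae (((integrable_indicator_iff m1).2 iq1).const_mul _)
      (iI.add ((j3.const_mul 2).add (j2.const_mul 2))) ?_)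
      (le_of_eq (integral_add iI ((j3.const_mul 2).add (j2.const_mul 2))))
    filter_upwards [ae_diff_norm hL3] with x hd
    simp only [Pi.add_apply]
    by_cases hx : x ∈ ann (a / 2) (2 * ρ)
    swap
    · have e1 := h0 _ hx
      have e3 : x ∉ ann a ρ := fun hc => hx ⟨by linarith [hc.1], by linarith [hc.2]⟩
      rw [indicator_of_notMem e3]
      simp only [e1, deriv_zero_of h0 hx, mul_zero, zero_mul, add_zero, zero_add]
      have t1 : 0 ≤ ({x : E3 | ‖x‖ ≤ 2 * ρ}).indicator (fun x => ‖g x‖ ^ 2) x :=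
        indicator_nonneg (fun _ _ => sq_nonneg _) _
      have t2 : 0 ≤ (ann ρ (2 * ρ)).indicator (fun x => ‖rquot u x‖ ^ 2) x :=
        indicator_nonneg (fun _ _ => sq_nonneg _) _
      linarith
    have hr := hm.trans_le hx.1
    have hκd : HasDerivAt κ ((-(‖x‖ ^ 2)⁻¹ * ‖x‖⁻¹ + ‖x‖⁻¹ * -(‖x‖ ^ 2)⁻¹) * trap a ρ ‖x‖ +
        ‖x‖⁻¹ * ‖x‖⁻¹ * deriv (trap a ρ) ‖x‖) ‖x‖ := by
      have h1 := hasDerivAt_inv hr.ne'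
      refine ((h1.mul h1).mul hd.hasDerivAt).congr_of_eventuallyEq ?_
      filter_upwards [lt_mem_nhds (show a / 4 < ‖x‖ by linarith [hx.1])] with s hs
      simp only [hκ, max_eq_left hs.le, Pi.mul_apply]
    have hκx : κ ‖x‖ = ‖x‖⁻¹ * ‖x‖⁻¹ * trap a ρ ‖x‖ := by
      simp only [hκ, max_eq_left (show a / 4 ≤ ‖x‖ by linarith [hx.1])]
    have hX : ‖rquot u x‖ ^ 2 = (‖u x‖ / ‖x‖) ^ 2 := by rw [rquot, norm_div, norm_norm, norm_norm]
    have hE : |crossRe g u x| ≤ ‖x‖ * ‖g x‖ * ‖u x‖ := by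
      refine (abs_re_le_norm _).trans ?_
      rw [norm_mul, norm_conj]; exact mul_le_mul_of_nonneg_right (norm_euler_le g x) (norm_nonneg _)
    have hp := hardy_pointwise (s := ‖x‖ * deriv (trap a ρ) ‖x‖) hr hE hX (trap_nonneg a ρ ‖x‖)
    have hIx : I x = trap a ρ ‖x‖ * (2 * crossRe g u x) / ‖x‖ ^ 2 +
        (trap a ρ ‖x‖ + ‖x‖ * deriv (trap a ρ) ‖x‖) * ‖rquot u x‖ ^ 2 := by
      simp only [hI, hκd.deriv, hκx, hX]; field_simp; ring
    rw [← hIx] at hp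
    have hX0 : 0 ≤ ‖rquot u x‖ ^ 2 := sq_nonneg _
    have t1 := mul_le_mul_of_nonneg_right (trap_le_one a ρ ‖x‖) (sq_nonneg ‖g x‖)
    rw [indicator_of_mem (show x ∈ {x : E3 | ‖x‖ ≤ 2 * ρ} from hx.2)]
    have t2 : 1 / 2 * (ann a ρ).indicator (fun x => ‖rquot u x‖ ^ 2) x ≤
        1 / 2 * (trap a ρ ‖x‖ * ‖rquot u x‖ ^ 2) := by
      by_cases hxa : x ∈ ann a ρ
      · rw [indicator_of_mem hxa, trap_eq_one ha hxa, one_mul]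
      · rw [indicator_of_notMem hxa]
        have := mul_nonneg (trap_nonneg a ρ ‖x‖) hX0
        linarith
    -- Below ρ the trapezoid is nondecreasing; above ρ its logarithmic derivative is at least -2.
    have t3 : -(2 * (ann ρ (2 * ρ)).indicator (fun x => ‖rquot u x‖ ^ 2) x) ≤
        ‖x‖ * deriv (trap a ρ) ‖x‖ * ‖rquot u x‖ ^ 2 := by
      rcases lt_or_ge ‖x‖ ρ with hlt | hge
      · have t4 : 0 ≤ (ann ρ (2 * ρ)).indicator (fun x => ‖rquot u x‖ ^ 2) x :=
          indicator_nonneg (fun _ _ => sq_nonneg _) _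
        have := mul_nonneg (mul_nonneg hr.le (deriv_trap_nonneg ha hlt hρ0)) hX0
        linarith
      · rw [indicator_of_mem (show x ∈ ann ρ (2 * ρ) from ⟨hge, hx.2⟩)]
        have := mul_le_mul_of_nonneg_right (abs_le.1 (abs_mul_deriv_trap_le ha hρ hr)).1 hX0
        linarith
    linarith
  rw [setLInt_enorm_sq iq1, setLInt_enorm_sq iq2, setLInt_enorm_sq igS]
  have n1 : 0 ≤ ∫ x in {x : E3 | ‖x‖ ≤ 2 * ρ}, ‖g x‖ ^ 2 := integral_nonneg fun x => sq_nonneg _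
  have n2 : 0 ≤ ∫ x in ann ρ (2 * ρ), ‖rquot u x‖ ^ 2 := integral_nonneg fun x => sq_nonneg _
  rw [show (4 : ℝ≥0∞) = ofReal 4 by norm_num, ← ofReal_mul (by norm_num),
    ← ofReal_mul (by norm_num), ← ofReal_add (by positivity) (by positivity)]
  exact ofReal_le_ofReal (by linarith)

/-- A local Hardy inequality. -/
lemma IsH1A.hardy_local (hA : MemL2loc A) (h : IsH1A A u g) {ρ : ℝ} (hρ : 0 < ρ) :
    ∫⁻ x in {x | ‖x‖ ≤ ρ}, ‖rquot u x‖ₑ ^ 2 ≤ 4 * (∫⁻ x in {x | ‖x‖ ≤ 2 * ρ}, ‖g x‖ₑ ^ 2) +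
      4 * ∫⁻ x in ann ρ (2 * ρ), ‖rquot u x‖ₑ ^ 2 := by
  have hsub : ({x : E3 | ‖x‖ ≤ ρ} : Set E3) ≤ᵐ[volume] ⋃ n : ℕ, ann (ρ / (n + 2)) ρ := by
    filter_upwards [ae_ne_zero] with x hx0 hx
    obtain ⟨n, hn⟩ := exists_nat_gt (ρ / ‖x‖)
    refine mem_iUnion.2 ⟨n, ?_, hx⟩
    rw [div_lt_iff₀ (norm_pos_iff.2 hx0)] at hn; rw [div_le_iff₀ (by positivity)]; nlinarith
  refine (lintegral_mono' (Measure.restrict_mono' hsub le_rfl) le_rfl).trans ?_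
  have hmono : Monotone fun n : ℕ => ann (ρ / ((n : ℝ) + 2)) ρ := fun m n hmn x hx => by
    have h1 : (m : ℝ) ≤ n := by exact_mod_cast hmn
    exact ⟨le_trans (by gcongr) hx.1, hx.2⟩
  rw [setLIntegral_iUnion_of_directed _ hmono.directed_le]
  refine iSup_le fun n => h.hardy_annulus hA (by positivity) ?_
  rw [div_lt_iff₀ (by positivity)]; nlinarith [(Nat.cast_nonneg n : (0 : ℝ) ≤ n)]


/-- A global Hardy inequality. -/
lemma IsH1A.hardy (hA : MemL2loc A) (h : IsH1A A u g) :
    ∫⁻ x, ‖rquot u x‖ₑ ^ 2 ≤ 4 * (∫⁻ x, ‖g x‖ₑ ^ 2) + 5 * ∫⁻ x, ‖u x‖ₑ ^ 2 := by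
  have hle : ∀ x, 1 ≤ ‖x‖ → ‖rquot u x‖ₑ ^ 2 ≤ ‖u x‖ₑ ^ 2 := fun x hx => by
    rw [← ofReal_norm (rquot u x), ← ofReal_norm (u x)]; gcongr
    rw [rquot, norm_div, norm_norm, norm_norm]; exact div_le_self (norm_nonneg _) hx
  have h1 := h.hardy_local hA one_pos
  have h2 : ∫⁻ x in ann 1 (2 * 1), ‖rquot u x‖ₑ ^ 2 ≤ ∫⁻ x, ‖u x‖ₑ ^ 2 :=
    (setLIntegral_mono' (measSet_ann _ _) fun x hx => hle x hx.1).trans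
      (setLIntegral_le_lintegral _ _)
  have h3 : ∫⁻ x in {x : E3 | ‖x‖ ≤ 1}ᶜ, ‖rquot u x‖ₑ ^ 2 ≤ ∫⁻ x, ‖u x‖ₑ ^ 2 :=
    (setLIntegral_mono' (measSet_ball 1).compl fun x hx =>
      hle x (not_le.1 (show ¬‖x‖ ≤ 1 from hx)).le).trans (setLIntegral_le_lintegral _ _)
  rw [← lintegral_add_compl _ (measSet_ball 1)]
  -- The constant 5 is 4 from the shell 1 ≤ |x| ≤ 2 in the local inequality plus 1 from the
  -- complement of the unit ball; on both, |u|/|x| ≤ |u|.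
  refine (add_le_add (h1.trans (add_le_add (mul_le_mul_right (setLIntegral_le_lintegral _ _) 4)
    (mul_le_mul_right h2 4))) h3).trans (le_of_eq ?_)
  ring

lemma lintegral_enorm_sq_lt_top (hv : MemLp v 2) : ∫⁻ x, ‖v x‖ₑ ^ 2 < ∞ := by
  simpa [HasFiniteIntegral, enorm_pow] using (hv.int_sq).2

/-- This finiteness supplies the majorants with which all cutoffs near the origin are later removed.
-/
lemma IsH1A.memLp_rquot (hA : MemL2loc A) (h : IsH1A A u g) : MemLp (rquot u) 2 := by
  have hm := aesm_rquot h.memLp.1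
  rw [memLp_two_iff_integrable_sq_norm hm]
  refine ⟨hm.norm.pow 2, ?_⟩
  have h1 := (h.hardy hA).trans_lt (ENNReal.add_lt_top.2
    ⟨mul_lt_top (by simp) (lintegral_enorm_sq_lt_top h.memLp_grad),
      mul_lt_top (by simp) (lintegral_enorm_sq_lt_top h.memLp)⟩)
  simpa [HasFiniteIntegral, enorm_pow] using h1

/-! ### From compactly supported to bounded multipliers -/

lemma abs_re_euler_le (u : E3 → ℂ) (g : E3 → C3) {x : E3} (hx : x ≠ 0) :
    |crossRe g u x| ≤ ‖x‖ ^ 2 * (‖g x‖ * rquot u x) := by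
  have hn := norm_ne_zero_iff.2 hx
  refine (abs_re_le_norm _).trans ?_
  rw [norm_mul, norm_conj]
  refine (mul_le_mul_of_nonneg_right (norm_euler_le g x) (norm_nonneg _)).trans (le_of_eq ?_)
  rw [rquot]; field_simp

lemma normSq_eq_rquot (u : E3 → ℂ) {x : E3} (hx : x ≠ 0) :
    ‖u x‖ ^ 2 = ‖x‖ ^ 2 * ‖rquot u x‖ ^ 2 := by
  have hn := norm_ne_zero_iff.2 hx
  rw [rquot, norm_div, norm_norm, norm_norm]; field_simp

lemma aesm_euler (hg : MemLp g 2) : AESM (euler g) := aestronglyMeasurable_fun_sum _ fun j _ =>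
    (measurable_ofReal.comp (meas_coord j)).aesm.mul (memLp_comp hg j).1

lemma aesm_re_euler (hu : MemLp u 2) (hg : MemLp g 2) : AESM (fun x => crossRe g u x) :=
  Complex.continuous_re.comp_aestronglyMeasurable ((aesm_euler hg).mul (memLp_conj hu).1)

/-- Integration by parts for the radial derivative of `|u|²` against weights of order `|x|⁻²`. -/
lemma IsH1A.integral_radial_cross_global (hA : MemL2loc A) (h : IsH1A A u g)
    (hκ : LipschitzWith L κ) {C C' : ℝ} (hC : ∀ r, |κ r| ≤ C) (hC' : ∀ r, r ^ 2 * |κ r| ≤ C')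
    (hd : ∀ᵐ x : E3, ‖x‖ ^ 2 * |‖x‖ * deriv κ ‖x‖| ≤ C') :
    Integrable (fun x => κ ‖x‖ * (2 * crossRe g u x)) ∧
    Integrable (fun x => (‖x‖ * deriv κ ‖x‖ + 3 * κ ‖x‖) * ‖u x‖ ^ 2) ∧
    ∫ x, (κ ‖x‖ * (2 * crossRe g u x)) = -∫ x, (‖x‖ * deriv κ ‖x‖ + 3 * κ ‖x‖) * ‖u x‖ ^ 2 := by
  have hq := h.memLp_rquot hA
  have ib1 := int_mul h.memLp_grad.norm hq
  have ib2 := hq.int_sq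
  have mu2 := h.memLp.1.norm.pow 2
  have hb1 : ∀ {c D : ℝ} {x : E3}, x ≠ 0 → ‖x‖ ^ 2 * |c| ≤ D →
      ‖c * (2 * crossRe g u x)‖ ≤ 2 * D * (‖g x‖ * rquot u x) := by
    intro c D x hx hc; rw [norm_mul, norm_mul, Real.norm_ofNat, norm_eq_abs, norm_eq_abs]
    have h1 := mul_le_mul_of_nonneg_left (abs_re_euler_le u g hx) (abs_nonneg c)
    have h2 := mul_le_mul_of_nonneg_right hc
      (mul_nonneg (norm_nonneg (g x)) (div_nonneg (norm_nonneg (u x)) (norm_nonneg x)))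
    change _ ≤ D * (‖g x‖ * rquot u x) at h2
    change ‖x‖ ^ 2 * |c| * (‖g x‖ * rquot u x) ≤ _ at h2
    linarith
  have hb2 : ∀ {c D : ℝ} {x : E3}, x ≠ 0 → ‖x‖ ^ 2 * |c| ≤ D →
      ‖c * ‖u x‖ ^ 2‖ ≤ D * ‖rquot u x‖ ^ 2 := by
    intro c D x hx hc; rw [norm_mul, norm_pow, norm_norm, norm_eq_abs, normSq_eq_rquot u hx]
    have h2 := mul_le_mul_of_nonneg_right hc (sq_nonneg ‖rquot u x‖)
    linarith
  have hsum : ∀ {a b r D D' : ℝ}, r ^ 2 * |a| ≤ D → r ^ 2 * |b| ≤ D' →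
      r ^ 2 * |a + 3 * b| ≤ D + 3 * D' := by
    intro a b r D D' h1 h2
    have h3 : |a + 3 * b| ≤ |a| + 3 * |b| := (abs_add_le _ _).trans (by simp [abs_mul])
    have := mul_le_mul_of_nonneg_left h3 (sq_nonneg r)
    linarith
  have mκ : ∀ {κ : ℝ → ℝ}, Continuous κ → Measurable fun x : E3 => κ ‖x‖ := fun hc =>
    (hc.comp continuous_norm).measurable
  have md : ∀ κ : ℝ → ℝ, Measurable fun x : E3 => ‖x‖ * deriv κ ‖x‖ := fun κ =>
    measurable_norm.mul ((measurable_deriv κ).comp measurable_norm)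
  have m1 : ∀ {κ : ℝ → ℝ}, Continuous κ → AEStronglyMeasurable
      (fun x => κ ‖x‖ * (2 * crossRe g u x)) volume := fun hc =>
    (mκ hc).aesm.mul ((aesm_re_euler h.memLp h.memLp_grad).const_mul 2)
  have m2 : ∀ {κ : ℝ → ℝ}, Continuous κ → AEStronglyMeasurable
      (fun x => (‖x‖ * deriv κ ‖x‖ + 3 * κ ‖x‖) * ‖u x‖ ^ 2) volume := fun hc =>
    ((md _).add ((mκ hc).const_mul 3)).aesm.mul mu2
  refine ⟨(ib1.const_mul (2 * C')).mono' (m1 hκ.continuous) (ae_ne_zero.mono fun x hx =>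
    hb1 hx (hC' _)), (ib2.const_mul (C' + 3 * C')).mono' (m2 hκ.continuous)
    ((ae_ne_zero.and hd).mono fun x hx => hb2 hx.1 (hsum hx.2 (hC' _))), ?_⟩
  -- The identity holds for κ times each cutoff. The weights are O(|x|^(-2)) uniformly in n, so
  -- |g||u|/|x| and |u|²/|x|² dominate, and the cutoffs become locally equal to one.
  choose Ln hLn using fun n => exists_lip_cutoff_mul hκ hC n
  have hCn : ∀ n r, r ^ 2 * |κ r * cutoff n r| ≤ C' := fun n r => by
    refine le_trans (mul_le_mul_of_nonneg_left ?_ (sq_nonneg r)) (hC' r)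
    rw [abs_mul]; exact mul_le_of_le_one_right (abs_nonneg _) (abs_trap_le _ _ _)
  have hdn : ∀ n, ∀ᵐ x : E3, ‖x‖ ^ 2 * |‖x‖ * deriv (fun r => κ r * cutoff n r) ‖x‖| ≤
      C' + 2 * C' := fun n => by
    filter_upwards [abs_mul_deriv_cutoff_mul_le hκ n, hd] with x hx hx'
    have := mul_le_mul_of_nonneg_left hx (sq_nonneg ‖x‖)
    linarith [hC' ‖x‖]
  have t1 := tendsto_integral_of_dominated_convergence (F := fun n x =>
      κ ‖x‖ * cutoff n ‖x‖ * (2 * crossRe g u x))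
      (f := fun x => κ ‖x‖ * (2 * crossRe g u x))
      (fun x => 2 * C' * (‖g x‖ * rquot u x))
      (fun n => m1 (hLn n).continuous) (ib1.const_mul _)
      (fun n => ae_ne_zero.mono fun x hx => hb1 hx (hCn n _)) (by
        filter_upwards [ae_ne_zero] with x hx
        refine tendsto_const_nhds.congr' ?_
        filter_upwards [cutoff_mul_eventuallyEq κ (norm_pos_iff.2 hx)] with n hn
        have e : κ ‖x‖ * cutoff n ‖x‖ = κ ‖x‖ := hn.self_of_nhds
        rw [e])
  have t2 := tendsto_integral_of_dominated_convergence (F := fun n x =>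
      (‖x‖ * deriv (fun r => κ r * cutoff n r) ‖x‖ + 3 * (κ ‖x‖ * cutoff n ‖x‖)) * ‖u x‖ ^ 2)
     
      (fun x => (C' + 2 * C' + 3 * C') * ‖rquot u x‖ ^ 2)
      (fun n => m2 (hLn n).continuous) (ib2.const_mul _)
      (fun n => by
        filter_upwards [ae_ne_zero, hdn n] with x hx hx'
        exact hb2 hx (hsum hx' (hCn n _))) (by
        filter_upwards [ae_ne_zero] with x hx
        refine tendsto_const_nhds.congr' ?_
        filter_upwards [cutoff_mul_eventuallyEq κ (norm_pos_iff.2 hx)] with n hn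
        have e : κ ‖x‖ * cutoff n ‖x‖ = κ ‖x‖ := hn.self_of_nhds
        rw [hn.deriv_eq, e])
  refine tendsto_nhds_unique t1 (t2.neg.congr fun n => ?_)
  have h0 : ∀ r, r ∉ Icc (1 / ((n : ℝ) + 2) / 2) (2 * (n + 2)) → κ r * cutoff n r = 0 :=
    fun r hr => cutoff_mul_eq_zero κ n hr
  have ibp := h.integral_radial_cross hA (hLn n) (half_pos ((cutoff_aux n).1)) (by positivity) h0
  have j1 := (ib1.const_mul (2 * C')).mono' (m1 (hLn n).continuous)
        (ae_ne_zero.mono fun x hx => hb1 hx (hCn n _))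
  have j2 : Integrable (fun x => κ ‖x‖ * cutoff n ‖x‖ * ‖u x‖ ^ 2) :=
    (ib2.const_mul C').mono' ((mκ (hLn n).continuous).aesm.mul mu2)
      (ae_ne_zero.mono fun x hx => hb2 hx (hCn n _))
  have j3 : Integrable (fun x => ‖x‖ * deriv (fun r => κ r * cutoff n r) ‖x‖ * ‖u x‖ ^ 2) :=
    (ib2.const_mul (C' + 2 * C')).mono' ((md _).aesm.mul mu2) (by
      filter_upwards [ae_ne_zero, hdn n] with x hx hx'
      exact hb2 hx hx')
  have e1 := integral_add j1 j3
  have e2 := integral_add j3 (j2.const_mul 3)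
  rw [ibp] at e1; rw [integral_const_mul] at e2
  have e3 : ∫ x, (‖x‖ * deriv (fun r => κ r * cutoff n r) ‖x‖ + 3 * (κ ‖x‖ * cutoff n ‖x‖)) *
      ‖u x‖ ^ 2 = _ := Eq.trans (int_congr (fun x => by ring)) e2
  rw [e3]; linarith

/-- The cross term over |x|² is at most |g||u|/|x|, which is integrable by Hardy. So no vanishing of
the multiplier at the origin is needed, only boundedness. -/
lemma morawetz_bound {p d : ℝ} (hlam : 0 ≤ lam) {x : E3} (hx : x ≠ 0) (hp : |p| ≤ C)
    (hd : |d| ≤ 3 * C) :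
    |morDens lam u g p d x| ≤ 2 * C * ‖g x‖ ^ 2 + 3 * C * (‖g x‖ ^ 2 + ‖g x‖ * rquot u x) +
        2 * lam * C * ‖u x‖ ^ 2 := by
  have hn := norm_pos_iff.2 hx
  have h1 : |(‖euler g x‖ ^ 2 + crossRe g u x) / ‖x‖ ^ 2| ≤ ‖g x‖ ^ 2 + ‖g x‖ * rquot u x := by
    rw [abs_div, abs_of_pos (by positivity : 0 < ‖x‖ ^ 2), div_le_iff₀ (by positivity)]
    refine (abs_add_le _ _).trans ?_
    rw [abs_of_nonneg (sq_nonneg _)]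
    have h2 := abs_re_euler_le u g hx
    have h3 := pow_le_pow_left₀ (norm_nonneg _) (norm_euler_le g x) 2
    rw [mul_pow] at h3; linarith
  rw [abs_le] at hp hd
  have a1 : |1 / 2 * (p - d) * ‖g x‖ ^ 2| ≤ 2 * C * ‖g x‖ ^ 2 := by
    rw [abs_mul, abs_of_nonneg (sq_nonneg ‖g x‖)]
    refine mul_le_mul_of_nonneg_right (abs_le.2 ⟨?_, ?_⟩) (sq_nonneg _) <;> linarith
  have a2 : |lam / 2 * (p + d) * ‖u x‖ ^ 2| ≤ 2 * lam * C * ‖u x‖ ^ 2 := by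
    rw [abs_mul, abs_of_nonneg (sq_nonneg ‖u x‖), abs_mul, abs_of_nonneg (by positivity)]
    have : |p + d| ≤ 4 * C := abs_le.2 ⟨by linarith, by linarith⟩
    have := mul_le_mul_of_nonneg_left this hlam
    refine mul_le_mul_of_nonneg_right ?_ (sq_nonneg _)
    linarith
  have a3 := mul_le_mul (abs_le.2 hd) h1 (abs_nonneg _) (by linarith)
  rw [← abs_mul] at a3; rw [morDens]
  exact (abs_add_le _ _).trans (add_le_add ((abs_add_le _ _).trans (add_le_add a1 a3)) a2)

/-- The Morawetz inequality for bounded multipliers. -/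
lemma SolvesHelmholtz.morawetz (hP : PotBounds A β V U q w) (h : IsH1A A u g) (hlam : 0 ≤ lam)
    (hε : 0 ≤ ε) (hsol : SolvesHelmholtz A V U lam ε f u g) (hφ : LipschitzWith L φ)
    (hC : ∀ r, φ r ≤ C) (hpos : ∀ r, 0 ≤ φ r) (hd : ∀ r, 0 < r → |r * deriv φ r| ≤ φ r)
    (hf : ∀ m M : ℝ, 0 < m → MemLp ((ann m M).indicator f) 2) :
    Integrable (fun x => morDens lam u g (φ ‖x‖) (‖x‖ * deriv φ ‖x‖) x) ∧
    ofReal (∫ x, morDens lam u g (φ ‖x‖) (‖x‖ * deriv φ ‖x‖) x) ≤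
      ∫⁻ x, ofReal (φ ‖x‖ * errDens w ε f u g x) := by
  have hC' : ∀ r, |φ r| ≤ C := fun r => by rw [abs_of_nonneg (hpos r)]; exact hC r
  have hq := h.memLp_rquot hP.memL2loc
  have ig := h.memLp_grad.int_sq
  have iu := h.memLp.int_sq
  have ib := ((ig.const_mul (2 * C)).add ((ig.add (int_mul h.memLp_grad.norm
    hq)).const_mul (3 * C))).add (iu.const_mul (2 * lam * C))
  have mD : ∀ {κ : ℝ → ℝ}, Continuous κ → AEStronglyMeasurable
      (fun x => morDens lam u g (κ ‖x‖) (‖x‖ * deriv κ ‖x‖) x) volume := fun {κ} hc => by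
    have mp : Measurable fun x : E3 => κ ‖x‖ := (hc.comp continuous_norm).measurable
    have md : Measurable fun x : E3 => ‖x‖ * deriv κ ‖x‖ :=
      measurable_norm.mul ((measurable_deriv κ).comp measurable_norm)
    exact (((((mp.sub md).const_mul (1 / 2)).aesm.mul ig.1).add
      (md.aesm.mul ((((aesm_euler h.memLp_grad).norm.pow 2).add (aesm_re_euler h.memLp h.memLp_grad)).aemeasurable.div
        (measurable_norm.pow_const 2).aemeasurable).aesm)).add
      (((mp.add md).const_mul (lam / 2)).aesm.mul iu.1))
  have hb : ∀ x : E3, x ≠ 0 → |‖x‖ * deriv φ ‖x‖| ≤ C := fun x hx =>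
    (hd _ (norm_pos_iff.2 hx)).trans (hC _)
  have hC0 := (hpos 0).trans (hC 0)
  refine ⟨ib.mono' (mD hφ.continuous) (ae_ne_zero.mono fun x hx =>
    morawetz_bound hlam hx (hC' _) ((hb x hx).trans (by linarith))), ?_⟩
  choose Ln hLn using fun n => exists_lip_cutoff_mul hφ hC' n
  have hcut : ∀ n r, |φ r * cutoff n r| ≤ φ r := fun n r => by
    rw [abs_mul, abs_of_nonneg (hpos r)]; exact mul_le_of_le_one_right (hpos r) (abs_trap_le _ _ _)
  -- The 3 is 1 from the hypothesis on φ plus 2 from the derivative of the cutoff.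
  have hdn : ∀ n, ∀ᵐ x : E3, |‖x‖ * deriv (fun r => φ r * cutoff n r) ‖x‖| ≤ 3 * φ ‖x‖ :=
    fun n => by
      filter_upwards [abs_mul_deriv_cutoff_mul_le hφ n, ae_ne_zero] with x hx hx0
      rw [abs_of_nonneg (hpos _)] at hx; linarith [hd _ (norm_pos_iff.2 hx0)]
  have lim := tendsto_integral_of_dominated_convergence (F := fun n x =>
      morDens lam u g (φ ‖x‖ * cutoff n ‖x‖) (‖x‖ * deriv (fun r => φ r * cutoff n r) ‖x‖) x)
      _
      (fun n => mD (hLn n).continuous) ib (fun n => by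
        filter_upwards [ae_ne_zero, hdn n] with x hx hx'
        exact morawetz_bound hlam hx ((hcut n _).trans (hC _)) (hx'.trans (by
          have := hC ‖x‖; linarith))) (by
        filter_upwards [ae_ne_zero] with x hx
        refine tendsto_const_nhds.congr' ?_
        filter_upwards [cutoff_mul_eventuallyEq φ (norm_pos_iff.2 hx)] with n hn
        have e : φ ‖x‖ * cutoff n ‖x‖ = φ ‖x‖ := hn.self_of_nhds
        rw [hn.deriv_eq, e])
  refine le_of_tendsto ((ENNReal.continuous_ofReal.tendsto _).comp lim)
    (Eventually.of_forall fun n => ?_)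
  have hm := (cutoff_aux n).1
  exact hsol.morawetz_compact hP h hε (hLn n) (half_pos hm) (by positivity)
    (fun r hr => cutoff_mul_eq_zero φ n hr) (fun r => mul_nonneg (hpos r) (trap_nonneg _ _ _))
    (hf _ _ (half_pos (half_pos hm))) (fun r _ => (le_abs_self _).trans (hcut n r)) (by
      filter_upwards [hdn n] with x hx
      linarith [hpos ‖x‖])


/-! ### The averaged Morawetz multiplier -/

section Multiplier

/-- The ramp that rises linearly from `0` at `b` to `1` at `c`. -/
def ramp (b c s : ℝ) : ℝ := max 0 (min 1 ((s - b) / (c - b)))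

/-- Minus the derivative of `mult`. -/
def multSl (b c s : ℝ) : ℝ := ramp b c s * ((max s b)⁻¹ * (max s b)⁻¹)

/-- The average over `R ∈ (b, c)` of `min (1 / R) (1 / r)`. -/
def mult (b c r : ℝ) : ℝ := c⁻¹ + ∫ s in r..c, multSl b c s

variable {b c : ℝ}
lemma ramp_nonneg (b c s : ℝ) : 0 ≤ ramp b c s := le_max_left _ _

lemma ramp_le_one (b c s : ℝ) : ramp b c s ≤ 1 := max_le zero_le_one (min_le_left _ _)

lemma ramp_of_le (hbc : b < c) (hs : s ≤ b) : ramp b c s = 0 :=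
  max_eq_left ((min_le_right _ _).trans (div_nonpos_of_nonpos_of_nonneg (by linarith) (by linarith)))

lemma ramp_of_ge (hbc : b < c) (hs : c ≤ s) : ramp b c s = 1 := by
  have : 1 ≤ (s - b) / (c - b) := by rw [le_div_iff₀ (by linarith)]; linarith
  rw [ramp, min_eq_left this, max_eq_right zero_le_one]

lemma ramp_of_mem (hbc : b < c) (hs : s ∈ Icc b c) : ramp b c s = (s - b) / (c - b) := by
  have h1 : (s - b) / (c - b) ≤ 1 := by rw [div_le_one (by linarith)]; linarith [hs.2]
  rw [ramp, min_eq_right h1, max_eq_right (div_nonneg (by linarith [hs.1]) (by linarith))]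

lemma ramp_mono (hbc : b < c) : Monotone (ramp b c) := fun s t hst => by
  have : 0 ≤ c - b := by linarith
  unfold ramp; gcongr

lemma exists_lip_ramp (b c : ℝ) : ∃ L : ℝ≥0, LipschitzWith L (ramp b c) := by
  refine ⟨‖(c - b)⁻¹‖₊, ?_⟩
  convert (((lipschitzWith_affine (c - b)⁻¹ (-(b * (c - b)⁻¹))).const_min 1).const_max 0) using 2 with s
  rw [ramp, div_eq_inv_mul, mul_sub]; ring_nf

lemma abs_ramp_le (b c s : ℝ) : |ramp b c s| ≤ 1 := by
  rw [abs_of_nonneg (ramp_nonneg b c s)]; exact ramp_le_one b c s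

lemma inv_max_sq_le (hb : 0 < b) (r : ℝ) : |(max r b)⁻¹ * (max r b)⁻¹| ≤ b⁻¹ * b⁻¹ := by
  rw [abs_mul]
  exact mul_le_mul (inv_max_le hb r) (inv_max_le hb r) (abs_nonneg _) (inv_pos.2 hb).le

lemma multSl_nonneg (b c s : ℝ) : 0 ≤ multSl b c s :=
  mul_nonneg (ramp_nonneg _ _ _) (mul_self_nonneg _)

lemma abs_multSl_le (hb : 0 < b) (s : ℝ) : |multSl b c s| ≤ b⁻¹ * b⁻¹ := by
  rw [multSl, abs_mul]
  exact (mul_le_of_le_one_left (abs_nonneg _) (abs_ramp_le _ _ _)).trans (inv_max_sq_le hb s)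

lemma multSl_of_le (hbc : b < c) (hs : s ≤ b) : multSl b c s = 0 := by
  rw [multSl, ramp_of_le hbc hs, zero_mul]

lemma multSl_of_ge (hs : b ≤ s) : multSl b c s = ramp b c s * (s ^ 2)⁻¹ := by
  rw [multSl, max_eq_left hs, ← mul_inv, ← sq]

lemma multSl_le (hbc : b < c) (s : ℝ) : multSl b c s ≤ (s ^ 2)⁻¹ := by
  rcases le_total s b with h | h
  · rw [multSl_of_le hbc h]; positivity
  · rw [multSl_of_ge h]; exact mul_le_of_le_one_left (by positivity) (ramp_le_one _ _ _)

lemma exists_lip_multSl (hb : 0 < b) (c : ℝ) : ∃ L : ℝ≥0, LipschitzWith L (multSl b c) := by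
  obtain ⟨L1, h1⟩ := lipschitzWith_inv_max hb
  obtain ⟨L2, h2⟩ := h1.exists_mul h1 (inv_max_le hb) (inv_max_le hb)
  obtain ⟨L3, h3⟩ := exists_lip_ramp b c
  exact h3.exists_mul h2 (abs_ramp_le b c) (inv_max_sq_le hb)

lemma continuous_multSl (hb : 0 < b) (c : ℝ) : Continuous (multSl b c) :=
  (exists_lip_multSl hb c).choose_spec.continuous

lemma hasDerivAt_mult (hb : 0 < b) (c r : ℝ) : HasDerivAt (mult b c) (-multSl b c r) r := by
  have hf := continuous_multSl hb c
  exact (intervalIntegral.integral_hasDerivAt_left (hf.intervalIntegrable _ _)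
    hf.aesm.stronglyMeasurableAtFilter hf.continuousAt).const_add _

lemma exists_lip_mult (hb : 0 < b) (c : ℝ) : ∃ L : ℝ≥0, LipschitzWith L (mult b c) := by
  refine ⟨⟨b⁻¹ * b⁻¹, by positivity⟩, lipschitzWith_of_nnnorm_deriv_le
    (fun r => (hasDerivAt_mult hb c r).differentiableAt) fun r => NNReal.coe_le_coe.1 ?_⟩
  rw [(hasDerivAt_mult hb c r).deriv, nnnorm_neg, coe_nnnorm]; exact abs_multSl_le hb r

lemma integral_inv_sq {p q : ℝ} (hp : 0 < p) (hq : 0 < q) : ∫ s in p..q, (s ^ 2)⁻¹ = p⁻¹ - q⁻¹ := by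
  have hpos : ∀ s ∈ [[p, q]], s ≠ 0 := fun s hs => by exact ((lt_min hp hq).trans_le hs.1).ne'
  rw [integral_eq_sub_of_hasDerivAt
    (fun s hs => by simpa using (hasDerivAt_inv (hpos s hs)).fun_neg)]
  · ring
  · refine ContinuousOn.intervalIntegrable fun s hs => ContinuousAt.continuousWithinAt ?_
    exact ((continuous_pow 2).continuousAt).inv₀ (pow_ne_zero 2 (hpos s hs))

lemma intervalIntegrable_inv_sq {p q : ℝ} (hp : 0 < p) (hq : 0 < q) :
    IntervalIntegrable (fun s : ℝ => (s ^ 2)⁻¹) volume p q := by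
  refine ContinuousOn.intervalIntegrable fun s hs => ContinuousAt.continuousWithinAt ?_
  exact ((continuous_pow 2).continuousAt).inv₀ (pow_ne_zero 2 ((lt_min hp hq).trans_le hs.1).ne')

lemma mult_of_ge (hb : 0 < b) (hbc : b < c) {r : ℝ} (hr : c ≤ r) : mult b c r = r⁻¹ := by
  have hc := hb.trans hbc
  have : ∫ s in r..c, multSl b c s = ∫ s in r..c, (s ^ 2)⁻¹ := by
    refine integral_congr fun s hs => ?_
    rw [uIcc_of_ge hr] at hs; rw [multSl_of_ge (hbc.le.trans hs.1), ramp_of_ge hbc hs.1, one_mul]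
  rw [mult, this, integral_inv_sq (hc.trans_le hr) hc]; ring

lemma inv_le_mult {r : ℝ} (hr : r ≤ c) : c⁻¹ ≤ mult b c r :=
  le_add_of_nonneg_right (intervalIntegral.integral_nonneg hr fun s _ => multSl_nonneg b c s)

lemma mult_nonneg (hb : 0 < b) (hbc : b < c) (r : ℝ) : 0 ≤ mult b c r := by
  have hc := hb.trans hbc
  rcases le_total r c with h | h
  · exact (inv_pos.2 hc).le.trans (inv_le_mult h)
  · rw [mult_of_ge hb hbc h]; exact inv_nonneg.2 (hc.le.trans h)

lemma mult_le_inv (hb : 0 < b) (hbc : b < c) {r : ℝ} (hr : 0 < r) : mult b c r ≤ r⁻¹ := by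
  have hc := hb.trans hbc
  rcases le_total r c with h | h
  · have := integral_mono_on h ((continuous_multSl hb c).intervalIntegrable _ _)
      (intervalIntegrable_inv_sq hr hc) fun s _ => multSl_le hbc s
    rw [integral_inv_sq hr hc] at this; rw [mult]; linarith
  · rw [mult_of_ge hb hbc h]

lemma mult_le (hb : 0 < b) (hbc : b < c) (r : ℝ) : mult b c r ≤ b⁻¹ := by
  rcases le_total r b with h | h
  · have e : mult b c r = mult b c b := by
      have hi := fun p q => (continuous_multSl hb c).intervalIntegrable (μ := volume) p q
      have h0 : ∫ s in r..b, multSl b c s = 0 := by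
        rw [← intervalIntegral.integral_zero]
        refine integral_congr fun s hs => ?_
        rw [uIcc_of_le h] at hs; exact multSl_of_le hbc hs.2
      rw [mult, mult, ← integral_add_adjacent_intervals (hi r b) (hi b c), h0, zero_add]
    rw [e]; exact mult_le_inv hb hbc hb
  · exact (mult_le_inv hb hbc (hb.trans_le h)).trans (inv_anti₀ hb h)

/-- Equivalently, rφ(r) is nondecreasing. Since the ramp increases, φ(r) ≥ 1/c + ramp(r)(1/r - 1/c)
≥ ramp(r)/r for r between b and c. This gives the coefficient φ + rφ' of the Morawetz form its sign.
-/
lemma mul_multSl_le (hb : 0 < b) (hbc : b < c) {r : ℝ} (hr : 0 < r) :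
    r * multSl b c r ≤ mult b c r := by
  have hc := hb.trans hbc
  rcases le_total r b with h | h
  · rw [multSl_of_le hbc h, mul_zero]; exact mult_nonneg hb hbc r
  have e : r * multSl b c r = ramp b c r * r⁻¹ := by rw [multSl_of_ge h]; field_simp
  rcases le_total r c with h' | h'
  · have := integral_mono_on h' ((intervalIntegrable_inv_sq hr hc).const_mul (ramp b c r))
      ((continuous_multSl hb c).intervalIntegrable _ _) fun s hs => by
        rw [multSl_of_ge (h.trans hs.1)]
        exact mul_le_mul_of_nonneg_right (ramp_mono hbc hs.1) (by positivity)
    rw [intervalIntegral.integral_const_mul, integral_inv_sq hr hc] at this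
    have h1 := mul_le_of_le_one_left (inv_pos.2 hc).le (ramp_le_one b c r)
    rw [e, mult]; linarith
  · rw [e, mult_of_ge hb hbc h']
    exact mul_le_of_le_one_left (inv_pos.2 hr).le (ramp_le_one b c r)

/-- The weight `multSl b c r / r`, regularized at the origin. -/
def multW (b c r : ℝ) : ℝ := multSl b c r * (max r b)⁻¹

lemma multWeight_eq (hbc : b < c) (r : ℝ) : multW b c r = multSl b c r / r := by
  rcases le_total r b with h | h
  · rw [multW, multSl_of_le hbc h, zero_mul, zero_div]
  · rw [multW, max_eq_left h, div_eq_mul_inv]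

lemma ae_norm_ne (t : ℝ) : ∀ᵐ x : E3, ‖x‖ ≠ t := by
  have := Measure.addHaar_sphere (volume : Measure E3) 0 t
  rw [measure_eq_zero_iff_ae_notMem] at this; filter_upwards [this] with x hx; simpa using hx

/-- The operator r∂_r + 3 annihilates r^(-3), so only the slope 1/(c - b) of the ramp survives.
Averaging the multiplier has replaced a surface measure by the uniform density on a shell. -/
lemma deriv_multW (hb : 0 < b) (hbc : b < c) {r : ℝ} (hr : 0 < r) (h1 : r ≠ b) (h2 : r ≠ c) :
    r * deriv (multW b c) r + 3 * multW b c r =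
      (Icc b c).indicator (fun r => (c - b)⁻¹ * (r ^ 2)⁻¹) r := by
  have hc := hb.trans hbc
  have hcb := (sub_pos.2 hbc).ne'
  rcases lt_or_gt_of_ne h1 with h | h
  · have e : multW b c =ᶠ[𝓝 r] fun _ => 0 := by
      filter_upwards [gt_mem_nhds h] with s hs
      rw [multW, multSl_of_le hbc hs.le, zero_mul]
    rw [e.deriv_eq, e.self_of_nhds, indicator_of_notMem fun hm => hm.1.not_gt h]; simp
  have hi := hasDerivAt_inv hr.ne'
  rcases lt_or_gt_of_ne h2 with h' | h'
  · have e : multW b c =ᶠ[𝓝 r] fun s => (s - b) / (c - b) * (s⁻¹ * (s⁻¹ * s⁻¹)) := by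
      filter_upwards [lt_mem_nhds h, gt_mem_nhds h'] with s hs hs'
      rw [multW, multSl, ramp_of_mem hbc ⟨hs.le, hs'.le⟩, max_eq_left hs.le]; ring
    have hd : HasDerivAt (fun s => (s - b) / (c - b) * (s⁻¹ * (s⁻¹ * s⁻¹))) _ r :=
      (((hasDerivAt_id r).sub_const b).div_const (c - b)).mul (hi.mul (hi.mul hi))
    rw [e.deriv_eq, hd.deriv, e.self_of_nhds, indicator_of_mem (show r ∈ Icc b c from ⟨h.le, h'.le⟩)]
    simp; field_simp; ring
  · have e : multW b c =ᶠ[𝓝 r] fun s => s⁻¹ * (s⁻¹ * s⁻¹) := by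
      filter_upwards [lt_mem_nhds h, lt_mem_nhds h'] with s hs hs'
      rw [multW, multSl, ramp_of_ge hbc hs'.le, max_eq_left hs.le]; ring
    have hd : HasDerivAt (fun s => s⁻¹ * (s⁻¹ * s⁻¹)) _ r := hi.mul (hi.mul hi)
    rw [e.deriv_eq, hd.deriv, e.self_of_nhds, indicator_of_notMem fun hm => hm.2.not_gt h']
    field_simp; ring

lemma sq_mul_multWeight_le (hb : 0 < b) (hbc : b < c) (r : ℝ) : r ^ 2 * |multW b c r| ≤ b⁻¹ := by
  rcases le_total r b with h | h
  · rw [multW, multSl_of_le hbc h, zero_mul, abs_zero, mul_zero]; exact (inv_pos.2 hb).le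
  · have hr := hb.trans_le h
    rw [multWeight_eq hbc r, multSl_of_ge h, abs_of_nonneg (by
      have := ramp_nonneg b c r
      positivity), show r ^ 2 * (ramp b c r * (r ^ 2)⁻¹ / r) = ramp b c r * r⁻¹ by field_simp]
    exact (mul_le_of_le_one_left (inv_pos.2 hr).le (ramp_le_one b c r)).trans (inv_anti₀ hb h)

/-- This converts the cross term of the Morawetz density, which has no sign, into a positive shell
mean of |u|²/|x|². -/
lemma IsH1A.integral_multW (hA : MemL2loc A) (h : IsH1A A u g) (hb : 0 < b) (hbc : b < c) :
    Integrable (fun x => multW b c ‖x‖ * (2 * crossRe g u x)) ∧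
    ∫ x, multW b c ‖x‖ * (2 * crossRe g u x) = -((c - b)⁻¹ * ∫ x in ann b c, ‖rquot u x‖ ^ 2) := by
  obtain ⟨L1, hL1⟩ := exists_lip_multSl hb c
  obtain ⟨L2, hL2⟩ := lipschitzWith_inv_max hb
  obtain ⟨L, hL⟩ := hL1.exists_mul hL2 (abs_multSl_le hb) (inv_max_le hb)
  have hform : ∀ᵐ x : E3, ‖x‖ * deriv (multW b c) ‖x‖ + 3 * multW b c ‖x‖ =
      (Icc b c).indicator (fun r => (c - b)⁻¹ * (r ^ 2)⁻¹) ‖x‖ := by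
    filter_upwards [ae_ne_zero, ae_norm_ne b, ae_norm_ne c] with x h0 h1 h2 using
      deriv_multW hb hbc (norm_pos_iff.2 h0) h1 h2
  obtain ⟨i1, -, e⟩ := h.integral_radial_cross_global hA (κ := multW b c) hL
    (C' := (c - b)⁻¹ + 3 * b⁻¹) (fun r => by
      rw [multW, abs_mul]
      exact mul_le_mul (abs_multSl_le hb r) (inv_max_le hb r) (abs_nonneg _) (by positivity))
    (fun r => (sq_mul_multWeight_le hb hbc r).trans (by
      have := inv_pos.2 (sub_pos.2 hbc)
      have := inv_pos.2 hb
      linarith)) (by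
      filter_upwards [hform] with x hx
      have h1 := sq_mul_multWeight_le hb hbc ‖x‖
      have h2 : ‖x‖ ^ 2 * (Icc b c).indicator (fun r => (c - b)⁻¹ * (r ^ 2)⁻¹) ‖x‖ ≤ (c - b)⁻¹ := by
        by_cases hm : ‖x‖ ∈ Icc b c
        · have : ‖x‖ ≠ 0 := (hb.trans_le hm.1).ne'
          rw [indicator_of_mem hm]; exact le_of_eq (by field_simp)
        · rw [indicator_of_notMem hm, mul_zero]; positivity
      rw [show ‖x‖ * deriv (multW b c) ‖x‖ =
        (Icc b c).indicator (fun r => (c - b)⁻¹ * (r ^ 2)⁻¹) ‖x‖ - 3 * multW b c ‖x‖ by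
          rw [← hx]; ring]
      refine (mul_le_mul_of_nonneg_left (abs_sub _ _) (sq_nonneg _)).trans ?_
      rw [abs_of_nonneg (indicator_nonneg (fun r _ => by positivity) _), abs_mul, Nat.abs_ofNat]
      linarith)
  refine ⟨i1, e.trans ?_⟩
  rw [← integral_indicator (measSet_ann b c), ← integral_const_mul]; congr 1
  refine integral_congr_ae ?_
  filter_upwards [hform, ae_ne_zero] with x hx hx0
  have hn := norm_ne_zero_iff.2 hx0
  rw [hx, normSq_eq_rquot u hx0]
  by_cases hm : x ∈ ann b c
  · rw [indicator_of_mem hm, indicator_of_mem (show ‖x‖ ∈ Icc b c from hm)]; field_simp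
  · rw [indicator_of_notMem hm, indicator_of_notMem (show ‖x‖ ∉ Icc b c from hm)]; ring

end Multiplier

/-! ### Lower bounds for the Morawetz form -/

lemma tangentialSq_eq (g : E3 → C3) (x : E3) :
    tangentialSq g x = ‖g x‖ ^ 2 - ‖euler g x‖ ^ 2 / ‖x‖ ^ 2 := by
  have e : ∑ j, ((x j / ‖x‖ : ℝ) : ℂ) * g x j = ((‖x‖⁻¹ : ℝ) : ℂ) * euler g x := by
    rw [euler, mul_sum]
    refine sum_congr rfl fun j _ => ?_
    push_cast; ring
  rw [tangentialSq, e, norm_mul, norm_real, norm_inv, norm_norm, mul_pow, inv_pow]; ring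

lemma tangentialSq_nonneg (g : E3 → C3) (x : E3) : 0 ≤ tangentialSq g x := by
  rw [tangentialSq_eq, sub_nonneg]
  refine div_le_of_le_mul₀ (sq_nonneg _) (sq_nonneg _) ?_
  rw [← mul_pow, mul_comm]; exact pow_le_pow_left₀ (norm_nonneg _) (norm_euler_le g x) 2

/-- The error terms of the Morawetz estimate at scale `b`. -/
def errTot (w : ℝ → ℝ) (ε : ℝ) (f u : E3 → ℂ) (g : E3 → C3) (b : ℝ) : ℝ≥0∞ :=
  ∫⁻ x, ofReal (min b⁻¹ ‖x‖⁻¹ * errDens w ε f u g x)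

lemma errDens_nonneg (hw : ∀ r, 0 ≤ w r) (hε : 0 ≤ ε) (f u : E3 → ℂ) (g : E3 → C3) (x : E3) :
    0 ≤ errDens w ε f u g x := by
  have := hw ‖x‖
  unfold errDens; positivity

lemma errTot_anti (hw : ∀ r, 0 ≤ w r) (hε : 0 ≤ ε) (f u : E3 → ℂ) (g : E3 → C3) {b b' : ℝ}
    (hb : 0 < b) (h : b ≤ b') : errTot w ε f u g b' ≤ errTot w ε f u g b :=
  lintegral_mono fun x => ofReal_le_ofReal (mul_le_mul_of_nonneg_right
    (min_le_min_right _ (inv_anti₀ hb h)) (errDens_nonneg hw hε f u g x))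

/-- `G` is the Morawetz density plus a function of integral zero, and it is a sum of three
nonnegative terms, each effective in one of the regions |x| < b, |x| > c, b < |x| < c. Stating the
bound for a general F and S allows one proof to serve balls, exteriors and shells. -/
lemma SolvesHelmholtz.lower_bound (hP : PotBounds A β V U q w) (h : IsH1A A u g) (hlam : 0 ≤ lam)
    (hε : 0 ≤ ε) (hsol : SolvesHelmholtz A V U lam ε f u g)
    (hf : ∀ m M : ℝ, 0 < m → MemLp ((ann m M).indicator f) 2) {b c : ℝ} (hb : 0 < b) (hbc : b < c)
    {F : E3 → ℝ} {S : Set E3} (hS : MeasurableSet S) {k : ℝ} (hk : 0 < k)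
    (h1 : ∀ x ∈ S, ‖x‖ < b → F x ≤ k * (1 / (2 * c) * (‖g x‖ ^ 2 + lam * ‖u x‖ ^ 2)))
    (h2 : ∀ x ∈ S, c < ‖x‖ → F x ≤ k * (tangentialSq g x / ‖x‖))
    (h3 : ∀ x ∈ S, ‖x‖ ∈ Ioo b c → F x ≤ k * (1 / 2 * ((c - b)⁻¹ * ‖rquot u x‖ ^ 2))) :
    ∫⁻ x in S, ofReal (F x) ≤ ofReal k * errTot w ε f u g b := by
  have hc := hb.trans hbc
  have hcb := sub_pos.2 hbc
  obtain ⟨L, hL⟩ := exists_lip_mult hb c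
  have hder : ∀ r, r * deriv (mult b c) r = -(r * multSl b c r) := fun r => by
    rw [(hasDerivAt_mult hb c r).deriv, mul_neg]
  obtain ⟨iD, hD⟩ := hsol.morawetz hP h hlam hε hL (mult_le hb hbc)
    (mult_nonneg hb hbc) (fun r hr => by
      rw [hder, abs_neg, abs_of_nonneg (mul_nonneg hr.le (multSl_nonneg _ _ _))]
      exact mul_multSl_le hb hbc hr) hf
  obtain ⟨iw, hw⟩ := h.integral_multW hP.memL2loc hb hbc
  have iq := (integrable_indicator_iff (measSet_ann b c)).2 (integrableOn_rquot h.memLp hb)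
  set D : E3 → ℝ := fun x => morDens lam u g (mult b c ‖x‖)
    (‖x‖ * deriv (mult b c) ‖x‖) x with hDdef
  set I : E3 → ℝ := (ann b c).indicator fun x => ‖rquot u x‖ ^ 2 with hI
  set G : E3 → ℝ := fun x => D x + (1 / 2 * (multW b c ‖x‖ * (2 * crossRe g u x))
    + 1 / 2 * (c - b)⁻¹ * I x) with hG
  have iG0 := (iw.const_mul (1 / 2)).add (iq.const_mul (1 / 2 * (c - b)⁻¹))
  have iG : Integrable G := iD.add iG0
  have eG : ∫ x, G x = ∫ x, D x := by
    refine (integral_add iD iG0).trans ?_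
    rw [integral_add' (iw.const_mul (1 / 2)) (iq.const_mul (1 / 2 * (c - b)⁻¹)),
      integral_const_mul, integral_const_mul, hw, integral_indicator (measSet_ann b c)]
    ring
  have lG : ∀ᵐ x, 0 ≤ G x ∧ (x ∈ S → F x ≤ k * G x) := by
    filter_upwards [ae_ne_zero, ae_norm_ne b, ae_norm_ne c] with x hx hxb hxc
    have k0 := multSl_nonneg b c ‖x‖
    have k1 := mul_multSl_le hb hbc (norm_pos_iff.2 hx)
    have t0 := tangentialSq_nonneg g x
    have I0 : 0 ≤ I x := indicator_nonneg (fun _ _ => sq_nonneg _) x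
    -- Writing p for the multiplier and k for |x| times `multSl`, the gradient part (p + k)|g|²/2 -
    -- k|x·g|²/|x|² equals (p - k)|g|²/2 plus k times the squared tangential gradient.
    have e : G x = 1 / 2 * (mult b c ‖x‖ - ‖x‖ * multSl b c ‖x‖) *
        (‖g x‖ ^ 2 + lam * ‖u x‖ ^ 2) + ‖x‖ * multSl b c ‖x‖ * tangentialSq g x +
        1 / 2 * ((c - b)⁻¹ * I x) := by
      simp only [hG, hDdef, morDens, hder, multWeight_eq hbc, tangentialSq_eq]; field_simp; ring
    have a0 : 0 ≤ 1 / 2 * ((c - b)⁻¹ * I x) := by positivity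
    have a1 : 0 ≤ ‖x‖ * multSl b c ‖x‖ * tangentialSq g x := by positivity
    have a2 : 0 ≤ ‖g x‖ ^ 2 + lam * ‖u x‖ ^ 2 := by positivity
    have a3 : 0 ≤ 1 / 2 * (mult b c ‖x‖ - ‖x‖ * multSl b c ‖x‖) * (‖g x‖ ^ 2 + lam * ‖u x‖ ^ 2) :=
      mul_nonneg (mul_nonneg (by norm_num) (sub_nonneg.2 k1)) a2
    refine ⟨by rw [e]; positivity, fun hxS => ?_⟩
    rcases lt_or_gt_of_ne hxb with hxb | hxb
    · refine (h1 x hxS hxb).trans (mul_le_mul_of_nonneg_left ?_ hk.le)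
      have := mul_le_mul_of_nonneg_right (inv_le_mult (b := b) (hxb.le.trans hbc.le)) a2
      rw [multSl_of_le hbc hxb.le] at a1 e; rw [e, one_div, mul_inv]; linarith
    rcases lt_or_gt_of_ne hxc with hxc | hxc
    · refine (h3 x hxS ⟨hxb, hxc⟩).trans (mul_le_mul_of_nonneg_left ?_ hk.le)
      have : I x = ‖rquot u x‖ ^ 2 := indicator_of_mem (show x ∈ ann b c from ⟨hxb.le, hxc.le⟩) _
      rw [e, ← this]; linarith
    · refine (h2 x hxS hxc).trans (mul_le_mul_of_nonneg_left ?_ hk.le)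
      have : ‖x‖ * multSl b c ‖x‖ * tangentialSq g x = tangentialSq g x / ‖x‖ := by
        rw [multSl_of_ge hxb.le, ramp_of_ge hbc hxc.le]; field_simp
      rw [e]; linarith
  calc ∫⁻ x in S, ofReal (F x)
      ≤ ∫⁻ x in S, ofReal k * ofReal (G x) := by
        refine lintegral_mono_ae ?_
        filter_upwards [ae_restrict_mem hS, ae_restrict_of_ae lG] with x hx hG using
          (ofReal_le_ofReal (hG.2 hx)).trans_eq (ofReal_mul hk.le)
    _ ≤ ofReal k * ofReal (∫ x, D x) := by
        rw [lintegral_const_mul' _ _ ofReal_ne_top]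
        refine mul_le_mul_right ((setLIntegral_le_lintegral _ _).trans_eq ?_) _
        rw [← eG, ofReal_integral_eq_lintegral_ofReal iG (lG.mono fun x hx => hx.1)]
    _ ≤ _ := mul_le_mul_right (hD.trans <| lintegral_mono_ae <| ae_ne_zero.mono fun x hx => by
        exact ofReal_le_ofReal (mul_le_mul_of_nonneg_right (le_min (mult_le hb hbc _)
          (mult_le_inv hb hbc (norm_pos_iff.2 hx))) (errDens_nonneg hP.w_nonneg hε f u g x))) _

/-- The energy density that is controlled at every scale. -/
def locEn (lam : ℝ) (u : E3 → ℂ) (g : E3 → C3) (x : E3) : ℝ :=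
  ‖g x‖ ^ 2 + lam * ‖u x‖ ^ 2 + rquot u x ^ 2

lemma locEn_nonneg (hlam : 0 ≤ lam) (u : E3 → ℂ) (g : E3 → C3) (x : E3) :
    0 ≤ locEn lam u g x := by unfold locEn; positivity

/-- For gradient and λ|u|² on the ball of radius R the multiplier with b = R, c = 2R gives the
factor 4R. The shell from b to 2b bounds |u|²/|x|² there, and the local Hardy inequality carries
this bound inwards. -/
lemma SolvesHelmholtz.locEn_le (hP : PotBounds A β V U q w) (h : IsH1A A u g) (hlam : 0 ≤ lam)
    (hε : 0 ≤ ε) (hsol : SolvesHelmholtz A V U lam ε f u g)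
    (hf : ∀ m M : ℝ, 0 < m → MemLp ((ann m M).indicator f) 2) {b : ℝ} (hb : 0 < b) :
    ∫⁻ x in {x | ‖x‖ ≤ b}, ofReal (locEn lam u g x) ≤ ofReal (44 * b) * errTot w ε f u g b := by
  set E := errTot w ε f u g b with hE
  have key : ∀ {R : ℝ}, b ≤ R → ∫⁻ x in {x | ‖x‖ ≤ R}, ofReal (‖g x‖ ^ 2 + lam * ‖u x‖ ^ 2) ≤
        ofReal (4 * R) * E := fun {R} hR => by
    have hR0 := hb.trans_le hR
    refine (hsol.lower_bound hP h hlam hε hf hR0 (show R < 2 * R by linarith)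
      (measSet_ball R) (k := 4 * R) (by linarith) (fun x _ _ => le_of_eq (by field_simp; norm_num))
      (fun x hx hc => ?_) (fun x hx hc => (hc.1.not_ge hx).elim)).trans
      (mul_le_mul_right (errTot_anti hP.w_nonneg hε f u g hb hR) _)
    have : ‖x‖ ≤ R := hx
    linarith
  have k1 := key le_rfl
  have k2 : ∫⁻ x in {x | ‖x‖ ≤ 2 * b}, ‖g x‖ₑ ^ 2 ≤ ofReal (8 * b) * E := by
    refine (lintegral_mono fun x => ?_).trans ((key (show b ≤ 2 * b by linarith)).trans_eq (by ring_nf))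
    rw [← ofReal_norm, ← ofReal_pow (norm_nonneg _)]
    exact ofReal_le_ofReal (le_add_of_nonneg_right (by positivity))
  have k3 : ∫⁻ x in ann b (2 * b), ‖rquot u x‖ₑ ^ 2 ≤ ofReal (2 * b) * E := by
    have e : ∀ x, ‖rquot u x‖ₑ ^ 2 = ofReal (‖rquot u x‖ ^ 2) := fun x => by
      rw [← ofReal_norm, ofReal_pow (norm_nonneg _)]
    simp only [e]
    refine hsol.lower_bound hP h hlam hε hf hb (show b < 2 * b by linarith)
      (measSet_ann _ _) (by linarith) (fun x hx hc => (hc.not_ge hx.1).elim)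
      (fun x hx hc => (hc.not_ge hx.2).elim) fun x _ _ => le_of_eq ?_
    rw [show 2 * b - b = b by ring]; field_simp
  have e : ∀ x, ofReal (locEn lam u g x) =
      ofReal (‖g x‖ ^ 2 + lam * ‖u x‖ ^ 2) + ‖rquot u x‖ₑ ^ 2 := fun x => by
    rw [locEn, ofReal_add (by positivity) (sq_nonneg _), ← ofReal_norm,
      ← ofReal_pow (norm_nonneg _), norm_eq_abs, sq_abs]
  simp only [e]
  have mq := ((aesm_rquot h.memLp.1).enorm.pow_const 2).restrict (s := {x : E3 | ‖x‖ ≤ b})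
  rw [lintegral_add_right' _ mq]
  calc _ ≤ ofReal (4 * b) * E + (4 * (ofReal (8 * b) * E) +
        4 * (ofReal (2 * b) * E)) := by
        gcongr
        exact (h.hardy_local hP.memL2loc hb).trans (by gcongr)
    -- 44 = 4 + 4·8 + 4·2: the ball of radius b, Hardy's gradient term on the ball of radius 2b,
    -- Hardy's shell term.
    _ = _ := by simp; ring


/-! ### The energy identity -/

/-- The equation tested with `u` itself. -/
lemma SolvesHelmholtz.energy (hP : PotBounds A β V U q w) (h : IsH1A A u g)
    (hsol : SolvesHelmholtz A V U lam ε f u g)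
    (hf : ∀ m M : ℝ, 0 < m → MemLp ((ann m M).indicator f) 2)
    (hz : Integrable (fun x => zeroOrd V U lam ε f u x * conj (u x))) :
    ((∫ x, ‖g x‖ ^ 2 : ℝ) : ℂ) = ∫ x, zeroOrd V U lam ε f u x * conj (u x) := by
  set κ : ℕ → ℝ → ℝ := fun n r => 1 * cutoff n r
  have hκ1 : LipschitzWith 0 fun _ : ℝ => (1 : ℝ) := LipschitzWith.const _
  choose Ln hLn using fun n => exists_lip_cutoff_mul hκ1 (C := 1) (by simp) n
  have ig := h.memLp_grad.int_sq
  have hκ : ∀ n r, |κ n r| ≤ 1 := fun n r => by simpa [κ, cutoff] using abs_trap_le _ _ r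
  have mκ : ∀ n, Measurable fun x : E3 => κ n ‖x‖ := fun n =>
    ((hLn n).continuous.comp continuous_norm).measurable
  have ev : ∀ x : E3, x ≠ 0 → ∀ᶠ n in atTop, κ n ‖x‖ = 1 ∧ deriv (κ n) ‖x‖ = 0 := fun x hx => by
    filter_upwards [cutoff_mul_eventuallyEq (fun _ => 1) (norm_pos_iff.2 hx)] with n hn
    exact ⟨hn.self_of_nhds, by rw [show deriv (κ n) ‖x‖ = _ from hn.deriv_eq, deriv_const]⟩
  rw [show ((∫ x, ‖g x‖ ^ 2 : ℝ) : ℂ) = ∫ x, ((‖g x‖ ^ 2 : ℝ) : ℂ) from integral_ofReal.symm]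
  -- The term with the derivative of the cutoff is at most 2|g||u|/|x|, integrable by Hardy, and it
  -- vanishes pointwise in the limit. So u itself becomes admissible.
  have t1 := tendsto_integral_of_dominated_convergence (F := fun n x =>
      ((deriv (κ n) ‖x‖ / ‖x‖ : ℝ) : ℂ) * (euler g x * conj (u x)) + ((κ n ‖x‖ * ‖g x‖ ^ 2 : ℝ) : ℂ))
    (f := fun x => ((‖g x‖ ^ 2 : ℝ) : ℂ))
    (fun x => 2 * (‖g x‖ * rquot u x) + ‖g x‖ ^ 2) (fun n => by
      refine AEStronglyMeasurable.add (AEStronglyMeasurable.mul ?_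
        ((aesm_euler h.memLp_grad).mul (memLp_conj h.memLp).1)) ?_
      · exact (measurable_ofReal.comp (((measurable_deriv _).comp measurable_norm).div
          measurable_norm)).aesm
      · exact continuous_ofReal.comp_aestronglyMeasurable ((mκ n).aesm.mul ig.1))
    (((int_mul h.memLp_grad.norm (h.memLp_rquot hP.memL2loc)).const_mul 2).add ig) (fun n => by
      filter_upwards [abs_mul_deriv_cutoff_mul_le hκ1 n, ae_ne_zero] with x hx hx0
      have hn := norm_pos_iff.2 hx0
      simp only [deriv_const, mul_zero, abs_zero, abs_one, zero_add, mul_one] at hx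
      refine norm_add_le_of_le ?_ ?_
      · rw [norm_mul, norm_mul, norm_conj, norm_real, norm_div, norm_norm, norm_eq_abs]
        rw [abs_mul, abs_of_pos hn] at hx
        calc |deriv (κ n) ‖x‖| / ‖x‖ * (‖euler g x‖ * ‖u x‖)
            ≤ |deriv (κ n) ‖x‖| / ‖x‖ * (‖x‖ * ‖g x‖ * ‖u x‖) := by gcongr; exact norm_euler_le g x
          _ = ‖x‖ * |deriv (κ n) ‖x‖| * (‖g x‖ * rquot u x) := by rw [rquot]; field_simp
          _ ≤ _ := mul_le_mul_of_nonneg_right hx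
              (mul_nonneg (norm_nonneg _) (div_nonneg (norm_nonneg _) (norm_nonneg _)))
      · rw [norm_real, norm_mul, norm_pow, norm_norm]
        exact mul_le_of_le_one_left (sq_nonneg _) (hκ n _))
    (ae_ne_zero.mono fun x hx => tendsto_const_nhds.congr' <| (ev x hx).mono fun n hn => by
      simp [hn.1, hn.2])
  have t2 := tendsto_integral_of_dominated_convergence (F := fun n x =>
      (κ n ‖x‖ : ℂ) * (zeroOrd V U lam ε f u x * conj (u x)))
    (f := fun x => zeroOrd V U lam ε f u x * conj (u x)) _
    (fun n => (measurable_ofReal.comp (mκ n)).aesm.mul hz.1) hz.norm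
    (fun n => ae_of_all _ fun x => by
      rw [norm_mul, norm_real]; exact mul_le_of_le_one_left (norm_nonneg _) (hκ n _))
    (ae_ne_zero.mono fun x hx => tendsto_const_nhds.congr' <| (ev x hx).mono fun n hn => by
      simp [hn.1])
  refine tendsto_nhds_unique t1 (t2.congr fun n => ?_)
  have hm := half_pos (cutoff_aux n).1
  exact (hsol.test_radial hP.memL2loc h (hLn n) hm
    (fun r hr => cutoff_mul_eq_zero (fun _ => 1) n hr)
    (hP.memLp_zeroOrd h.memLp lam ε (half_pos hm) _) (hf _ _ (half_pos hm))).symm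

/-! ### Critical weights and dyadic duality -/

/-- A weight of order `r ^ (θ - 1)` at the origin and `r ^ (-θ - 1)` at infinity. -/
def critW (θ r : ℝ) : ℝ := min (r ^ (θ - 1)) (r ^ (-θ - 1))

lemma critW_nonneg {θ r : ℝ} (hr : 0 ≤ r) : 0 ≤ critW θ r :=
  le_min (Real.rpow_nonneg hr _) (Real.rpow_nonneg hr _)

/-- The truncated weight `min (r / ρ) 1`. -/
def damp (ρ r : ℝ) : ℝ := min (r / ρ) 1

lemma damp_nonneg {ρ r : ℝ} (hρ : 0 < ρ) (hr : 0 ≤ r) : 0 ≤ damp ρ r :=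
  le_min (by positivity) zero_le_one

lemma lintegral_critW_lt_top {θ : ℝ} (hθ : 0 < θ) :
    ∫⁻ R in Ioi (0 : ℝ), ofReal (critW θ R) < ∞ := by
  rw [← Ioc_union_Ioi_eq_Ioi zero_le_one]
  refine (lintegral_union_le _ _ _).trans_lt (ENNReal.add_lt_top.2 ⟨?_, ?_⟩)
  · have h1 : IntegrableOn (fun R : ℝ => R ^ (θ - 1)) (Ioc 0 1) :=
      (intervalIntegral.intervalIntegrable_rpow' (by linarith)).1
    exact (lintegral_mono fun R => ofReal_le_ofReal (min_le_left _ _)).trans_lt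
      (h1.lintegral_lt_top)
  · have h1 := integrableOn_Ioi_rpow_of_lt (show -θ - 1 < -1 by linarith) one_pos
    exact (lintegral_mono fun R => ofReal_le_ofReal (min_le_right _ _)).trans_lt
      (h1.lintegral_lt_top)

lemma measurable_critW (θ : ℝ) : Measurable (critW θ) := by unfold critW; fun_prop

/-- Both exponents lie in [-2, 0], so doubling the radius costs at most 2² = 4. -/
lemma critW_double {θ r R : ℝ} (hθ : θ ∈ Ioo 0 1) (hr : 0 < r) (hR : R ∈ Ioc r (2 * r)) :
    critW θ r ≤ 4 * critW θ R := by
  have key : ∀ p : ℝ, -2 ≤ p → p ≤ 0 → r ^ p ≤ 4 * R ^ p := fun p h1 h2 => by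
    have e : r ^ p = (2 : ℝ) ^ (-p) * (2 * r) ^ p := by
      rw [Real.mul_rpow zero_le_two hr.le, ← mul_assoc, ← Real.rpow_add two_pos]; simp
    rw [e]
    refine mul_le_mul ((rpow_le_rpow_of_exponent_le one_le_two
      (show -p ≤ (2 : ℕ) by push_cast; linarith)).trans_eq (by
        rw [Real.rpow_natCast]; norm_num)) ?_ (by positivity) (by norm_num)
    exact Real.rpow_le_rpow_of_nonpos (hr.trans hR.1) hR.2 h2
  rw [critW, critW, mul_min_of_nonneg _ _ (by norm_num)]
  exact min_le_min (key _ (by linarith [hθ.1]) (by linarith [hθ.2]))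
    (key _ (by linarith [hθ.2]) (by linarith [hθ.1]))

/-- Below ρ ≤ 1 the product is at most r^θ/ρ, which increases up to the value of the weight at ρ.
The damping thus reduces all radii to those at least ρ, where bounds on balls are available. -/
lemma damp_mul_critW_le {θ ρ r : ℝ} (hθ : θ ∈ Ioo 0 1) (hρ : 0 < ρ) (hρ1 : ρ ≤ 1) (hr : 0 < r) :
    damp ρ r * critW θ r ≤ critW θ (max r ρ) := by
  rcases le_total ρ r with h | h
  · rw [max_eq_left h]; exact mul_le_of_le_one_left (critW_nonneg hr.le) (min_le_right _ _)
  · have h1 : ∀ s, 0 < s → s ≤ 1 → critW θ s = s ^ (θ - 1) := fun s h0 h1 =>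
      min_eq_left (rpow_le_rpow_of_exponent_ge h0 h1 (by linarith [hθ.1]))
    have h2 : ∀ s : ℝ, 0 < s → s ^ (θ - 1) = s ^ θ / s := fun s h0 => by
      rw [Real.rpow_sub h0, Real.rpow_one]
    rw [max_eq_right h, h1 r hr (h.trans hρ1), h1 ρ hρ hρ1, h2 r hr, h2 ρ hρ]
    calc damp ρ r * (r ^ θ / r) ≤ r / ρ * (r ^ θ / r) := by
          gcongr; exact min_le_left _ _
      _ = r ^ θ / ρ := by field_simp
      _ ≤ ρ ^ θ / ρ := by gcongr; exact hθ.1.le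

/-- Integrals against a critical weight are controlled by averages over balls. -/
lemma lintegral_critW_le {θ : ℝ} (hθ : θ ∈ Ioo 0 1) {ρ : ℝ} (hρ : 0 < ρ) (hρ1 : ρ ≤ 1)
    {G : E3 → ℝ≥0∞} (hG : AEMeasurable G) {Q : ℝ≥0∞}
    (hQ : ∀ R, ρ ≤ R → ∫⁻ x in {x | ‖x‖ ≤ R}, G x ≤ ofReal R * Q) :
    ∫⁻ x, ofReal (damp ρ ‖x‖ * critW θ ‖x‖) * G x ≤
      8 * (∫⁻ R in Ioi (0 : ℝ), ofReal (critW θ R)) * Q := by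
  set k : ℝ → ℝ≥0∞ := fun R => ofReal (critW θ R / R) with hk
  have mk : Measurable k := ((measurable_critW θ).div measurable_id).ennreal_ofReal
  -- A layer-cake representation: the weight at x is dominated by an integral of `k` over radii R ≥
  -- |x|, R > ρ, and Tonelli turns the inner integral into one over a ball.
  set J : E3 → ℝ → ℝ≥0∞ := fun x R => (Ici ‖x‖).indicator k R * G x with hJ
  have mJ : AEMeasurable (Function.uncurry J) ((volume : Measure E3).prod (volume.restrict (Ioi ρ))) := by
    have : Measurable fun p : E3 × ℝ => (Ici ‖p.1‖).indicator k p.2 := by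
      have := (mk.comp measurable_snd).indicator (measurableSet_le
        (measurable_norm.comp (measurable_fst (α := E3) (β := ℝ))) measurable_snd)
      exact this
    exact this.aemeasurable.mul hG.comp_fst
  have pt : ∀ x, x ≠ 0 → ofReal (damp ρ ‖x‖ * critW θ ‖x‖) * G x ≤
      8 * ∫⁻ R in Ioi ρ, J x R := fun x hx => by
    have hr := norm_pos_iff.2 hx
    set s := max ‖x‖ ρ with hs
    have hs0 : 0 < s := lt_max_of_lt_left hr
    have hsub : Ioc s (2 * s) ⊆ Ioi ρ := fun R hR => (le_max_right _ _).trans_lt hR.1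
    simp; rw [lintegral_mul_const _ (mk.indicator measurableSet_Ici), ← mul_assoc]
    refine mul_le_mul_left ?_ _
    -- On (s, 2s] one has R ≤ 2s and the weight loses at most 4, so `k` is at least the weight at s
    -- over 8s; the interval has length s.
    calc ofReal (damp ρ ‖x‖ * critW θ ‖x‖)
        ≤ ofReal (8 * (critW θ s / (8 * s) * s)) := by
          refine ofReal_le_ofReal ((damp_mul_critW_le hθ hρ hρ1 hr).trans_eq ?_)
          rw [← hs]; field_simp
      _ = 8 * ∫⁻ R in Ioc s (2 * s), ofReal (critW θ s / (8 * s)) := by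
          rw [setLIntegral_const, Real.volume_Ioc, ofReal_mul (by norm_num),
            ofReal_mul (div_nonneg (critW_nonneg hs0.le) (by positivity)),
            ofReal_ofNat, show 2 * s - s = s by ring]
      _ ≤ 8 * ∫⁻ R in Ioi ρ, (Ici ‖x‖).indicator k R := by
          refine mul_le_mul_right ((setLIntegral_mono' measurableSet_Ioc fun R hR => ?_).trans
            (lintegral_mono_set hsub)) _
          rw [indicator_of_mem (show R ∈ Ici ‖x‖ from (le_max_left _ _).trans hR.1.le)]
          refine ofReal_le_ofReal ?_
          rw [div_le_div_iff₀ (by positivity) (hs0.trans hR.1)]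
          have h2 := critW_nonneg (θ := θ) (hs0.trans hR.1).le
          nlinarith [mul_le_mul (critW_double hθ hs0 hR) hR.2 (hs0.trans hR.1).le (by positivity)]
  calc ∫⁻ x, ofReal (damp ρ ‖x‖ * critW θ ‖x‖) * G x
      ≤ ∫⁻ x, 8 * ∫⁻ R in Ioi ρ, J x R := lintegral_mono_ae (ae_ne_zero.mono pt)
    _ = 8 * ∫⁻ R in Ioi ρ, ∫⁻ x, J x R := by
        rw [lintegral_const_mul' _ _ (by simp), lintegral_lintegral_swap mJ]
    _ ≤ 8 * ∫⁻ R in Ioi ρ, ofReal (critW θ R) * Q := by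
        refine mul_le_mul_right (setLIntegral_mono' measurableSet_Ioi fun R hR => ?_) _
        have hR0 := hρ.trans hR
        have e : ∀ x, J x R = ({x : E3 | ‖x‖ ≤ R}).indicator (fun x => k R * G x) x := fun x => by
          simp only [hJ, indicator_apply, mem_Ici, mem_ofPred_eq]; split_ifs <;> simp
        simp only [e]
        rw [lintegral_indicator (measSet_ball R), lintegral_const_mul' _ _ (by simp [hk])]
        refine (mul_le_mul_right (hQ R hR.le) _).trans_eq ?_
        rw [← mul_assoc, ← ofReal_mul (div_nonneg (critW_nonneg hR0.le) hR0.le),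
          div_mul_cancel₀ _ hR0.ne']
    _ ≤ _ := by rw [lintegral_mul_const _ (measurable_critW θ).ennreal_ofReal, mul_assoc]; gcongr

lemma measurableSet_shell (j : ℤ) : MeasurableSet (shell j) := measSet_ann _ _

lemma iUnion_shell {x : E3} (hx : x ≠ 0) : ∃ j, x ∈ shell j := by
  obtain ⟨n, hn⟩ := exists_mem_Ioc_zpow (norm_pos_iff.2 hx) (one_lt_two (α := ℝ))
  exact ⟨n + 1, by simpa using hn.1.le, hn.2⟩

lemma lintegral_le_tsum_shell (F : E3 → ℝ≥0∞) : ∫⁻ x, F x ≤ ∑' j, ∫⁻ x in shell j, F x := by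
  refine le_trans ?_ (lintegral_iUnion_le shell F)
  rw [← setLIntegral_univ]
  refine lintegral_mono_set' (ae_ne_zero.mono fun x hx _ => mem_iUnion.2 (iUnion_shell hx))

/-- Duality between the dyadic norm and averages over balls. -/
lemma lintegral_mul_le_dualNorm {ρ : ℝ} (hρ : 0 < ρ) (hf : AESM f) {G : E3 → ℝ≥0∞}
    (hG : AEMeasurable G) {Q : ℝ≥0∞} (hQ : ∀ R, ρ ≤ R → ∫⁻ x in {x | ‖x‖ ≤ R}, G x ≤ ofReal R * Q) :
    ∫⁻ x, ‖f x‖ₑ * (ofReal (damp ρ ‖x‖) * G x ^ (1 / 2 : ℝ)) ≤ dualNorm f * Q ^ (1 / 2 : ℝ) := by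
  refine (lintegral_le_tsum_shell _).trans ?_
  rw [dualNorm, ← ENNReal.tsum_mul_right]
  refine ENNReal.tsum_le_tsum fun j => ?_
  set R : ℝ := (2 : ℝ) ^ j with hR
  have hR0 : 0 < R := by positivity
  have mt : Measurable fun x : E3 => ofReal (damp ρ ‖x‖) := by unfold damp; fun_prop
  have h2 : ∫⁻ x in shell j, (ofReal (damp ρ ‖x‖) * G x ^ (1 / 2 : ℝ)) ^ (2 : ℝ) ≤
      ofReal ((2 : ℝ) ^ (j + 1)) * Q := by
    have h3 : ofReal R * Q ≤ ofReal ((2 : ℝ) ^ (j + 1)) * Q := by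
      gcongr
      exact zpow_le_zpow_right₀ one_le_two (by lia)
    refine le_trans ?_ h3
    have e : ∀ x, (ofReal (damp ρ ‖x‖) * G x ^ (1 / 2 : ℝ)) ^ (2 : ℝ) =
        ofReal (damp ρ ‖x‖) ^ (2 : ℝ) * G x := fun x => by
      rw [ENNReal.mul_rpow_of_nonneg _ _ zero_le_two, ← rpow_mul]; norm_num
    simp only [e]; rcases le_total ρ R with h | h
    · refine le_trans ?_ (hQ R h)
      refine le_trans (lintegral_mono fun x => ?_) (lintegral_mono_set fun x hx => hx.2)
      refine mul_le_of_le_one_left zero_le (ENNReal.rpow_le_one ?_ zero_le_two)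
      exact ENNReal.ofReal_le_one.2 (min_le_right _ _)
    -- A shell inside the ball of radius ρ has no bound at its own scale. The damping, at most 2^j/ρ
    -- there, makes the bound at scale ρ as good as one at scale 2^j.
    · calc ∫⁻ x in shell j, ofReal (damp ρ ‖x‖) ^ (2 : ℝ) * G x
          ≤ ∫⁻ x in shell j, ofReal (R / ρ) * G x := by
            refine setLIntegral_mono' (measurableSet_shell j) fun x hx => mul_le_mul_left ?_ _
            have h1 := (div_le_one hρ).2 h
            rw [ENNReal.ofReal_rpow_of_nonneg (damp_nonneg hρ (norm_nonneg _)) zero_le_two]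
            refine ofReal_le_ofReal ?_
            have h2 : damp ρ ‖x‖ ≤ R / ρ := (min_le_left _ _).trans (by gcongr; exact hx.2)
            rw [rpow_two]; nlinarith [damp_nonneg hρ (norm_nonneg x)]
        _ ≤ ofReal (R / ρ) * ∫⁻ x in {x | ‖x‖ ≤ ρ}, G x := by
            rw [lintegral_const_mul' _ _ ofReal_ne_top]
            exact mul_le_mul_right (lintegral_mono_set fun x hx => hx.2.trans h) _
        _ ≤ ofReal (R / ρ) * (ofReal ρ * Q) := mul_le_mul_right (hQ ρ le_rfl) _
        _ = ofReal R * Q := by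
            rw [← mul_assoc, ← ofReal_mul (by positivity), div_mul_cancel₀ _ hρ.ne']
  refine (ENNReal.lintegral_mul_le_Lp_mul_Lq (volume.restrict (shell j)) Real.HolderConjugate.two_two
    hf.enorm.restrict
    (mt.aemeasurable.mul (hG.pow_const _)).restrict).trans ?_
  refine (mul_le_mul_right (rpow_le_rpow h2 (by norm_num)) _).trans_eq ?_
  simp
  rw [ENNReal.mul_rpow_of_nonneg _ _ (by norm_num), ENNReal.mul_rpow_of_nonneg _ _ (by norm_num)]
  ring

/-- Shells that meet |x| ≥ m have 2^(j+1) ≥ m, and the sum of the squares of a nonnegative sequence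
is at most the square of its sum. -/
lemma memLp_ann_of_dualNorm (hf : AESM f) (hN : dualNorm f < ∞) (M : ℝ) (hm : 0 < m) :
    MemLp ((ann m M).indicator f) 2 := by
  have mA := measSet_ann m M
  rw [memLp_indicator_iff_restrict mA, memLp_two_iff_integrable_sq_norm hf.restrict]
  refine ⟨hf.restrict.norm.pow 2, ?_⟩
  set t : ℤ → ℝ≥0∞ := fun j => ofReal ((2 : ℝ) ^ (j + 1)) * ∫⁻ x in shell j, ‖f x‖ₑ ^ 2
  have h1 : ∫⁻ x in ann m M, ‖f x‖ₑ ^ 2 ≤ ofReal m⁻¹ * ∑' j, t j := by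
    rw [← lintegral_indicator mA, ← ENNReal.tsum_mul_left]
    refine (lintegral_le_tsum_shell _).trans (ENNReal.tsum_le_tsum fun j => ?_)
    rw [← mul_assoc, ← lintegral_const_mul' _ _ (by finiteness)]
    refine setLIntegral_mono' (measurableSet_shell j) fun x hx => ?_
    by_cases hxA : x ∈ ann m M
    · rw [indicator_of_mem hxA, ← ofReal_mul (by positivity)]
      refine le_mul_of_one_le_left zero_le (ENNReal.one_le_ofReal.2 ?_)
      rw [inv_mul_eq_div, one_le_div hm]
      have : (2 : ℝ) ^ j ≤ 2 ^ (j + 1) := zpow_le_zpow_right₀ one_le_two (by lia)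
      exact hxA.1.trans (hx.2.trans this)
    · rw [indicator_of_notMem hxA]; exact zero_le
  have h2 : ∑' j, t j ≤ dualNorm f * dualNorm f := by
    rw [dualNorm, ← ENNReal.tsum_mul_right]
    refine ENNReal.tsum_le_tsum fun j => ?_
    have e : t j = t j ^ (1 / 2 : ℝ) * t j ^ (1 / 2 : ℝ) := by
      rw [← ENNReal.rpow_add_of_nonneg _ _ (by norm_num) (by norm_num)]; norm_num
    calc t j = _ := e
      _ ≤ _ := mul_le_mul_right (ENNReal.le_tsum j) _
  have h3 := h1.trans_lt (mul_lt_top ofReal_lt_top (h2.trans_lt (mul_lt_top hN hN)))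
  simpa [HasFiniteIntegral, enorm_pow] using h3


/-! ### The power majorant of the potentials -/

section PowerWeight

/-- The majorant of the potentials. -/
def powW (K θ r : ℝ) : ℝ := K * |r ^ (2 * θ - 2) + r ^ (-1 - 2 * θ)|

variable {K θ r : ℝ}
lemma powW_le_near (hK : 0 ≤ K) (hθ : θ ∈ Ioc 0 (1 / 4)) (hr : 0 < r) (hr1 : r ≤ 1) :
    powW K θ r ≤ 2 * K * r ^ (2 * θ - 2) := by
  have := mul_le_mul_of_nonneg_left (rpow_le_rpow_of_exponent_ge hr hr1
    (show 2 * θ - 2 ≤ -1 - 2 * θ by linarith [hθ.2])) hK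
  rw [powW, abs_of_nonneg (by positivity)]; linarith

lemma powW_le_far (hK : 0 ≤ K) (hθ : θ ∈ Ioc 0 (1 / 4)) (hr1 : 1 ≤ r) :
    powW K θ r ≤ 2 * K * r ^ (-1 - 2 * θ) := by
  have := mul_le_mul_of_nonneg_left (rpow_le_rpow_of_exponent_le hr1
    (show 2 * θ - 2 ≤ -1 - 2 * θ by linarith [hθ.2])) hK
  rw [powW, abs_of_nonneg (by positivity)]; linarith

/-- The source of smallness at high frequency, with l = λ^(-1/2). For r ≤ 1 interpolate min(r, l) ≤
r^(1-θ) l^θ; for r ≥ 1 use l ≤ l^θ. Half of the spare exponent 2θ is spent on l, the other half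
keeps the weight integrable. -/
lemma powW_mul_min_le (hK : 0 ≤ K) (hθ : θ ∈ Ioc 0 (1 / 4)) (hr : 0 < r) {l : ℝ} (hl : 0 < l)
    (hl1 : l ≤ 1) : powW K θ r * min r l ≤ 2 * K * l ^ θ * critW θ r := by
  have hlθ : l ≤ l ^ θ := by
    simpa using rpow_le_rpow_of_exponent_ge hl hl1 (show θ ≤ 1 by linarith [hθ.2])
  have hm := lt_min hr hl
  rcases le_total r 1 with h | h
  · have h1 : min r l ≤ r ^ (1 - θ) * l ^ θ := by
      calc min r l = min r l ^ (1 - θ) * min r l ^ θ := by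
            rw [← Real.rpow_add hm, sub_add_cancel, Real.rpow_one]
        _ ≤ _ := mul_le_mul (Real.rpow_le_rpow hm.le (min_le_left _ _) (by linarith [hθ.2]))
            (Real.rpow_le_rpow hm.le (min_le_right _ _) hθ.1.le) (by positivity) (by positivity)
    rw [critW, min_eq_left (rpow_le_rpow_of_exponent_ge hr h (by linarith [hθ.1]))]
    calc _ ≤ 2 * K * r ^ (2 * θ - 2) * (r ^ (1 - θ) * l ^ θ) :=
          mul_le_mul (powW_le_near hK hθ hr h) h1 hm.le (by positivity)
      _ = 2 * K * l ^ θ * (r ^ (2 * θ - 2) * r ^ (1 - θ)) := by ring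
      _ = _ := by rw [← Real.rpow_add hr]; ring_nf
  · rw [critW, min_eq_right (rpow_le_rpow_of_exponent_le h (by linarith [hθ.1]))]
    calc _ ≤ 2 * K * r ^ (-1 - 2 * θ) * l ^ θ :=
          mul_le_mul (powW_le_far hK hθ h) ((min_le_right _ _).trans hlθ) hm.le (by positivity)
      _ ≤ 2 * K * r ^ (-θ - 1) * l ^ θ := by
          gcongr ?_ * _
          exact mul_le_mul_of_nonneg_left (rpow_le_rpow_of_exponent_le h (by linarith [hθ.1]))
            (by positivity)
      _ = _ := by ring

/-- The weight is subcritical at the origin: for r ≤ s one has r^(2θ) ≤ η, and 4Kη ≤ 1/8. The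
constant 1/8 is chosen against the factor 4 in Hardy's inequality, so that half of the gradient
energy remains. -/
lemma exists_powW_le (hK : 0 ≤ K) (hθ : θ ∈ Ioc 0 (1 / 4)) :
    ∃ C, 0 ≤ C ∧ ∀ r, 0 < r → (1 + r) * powW K θ r ≤ 1 / 8 * (r ^ 2)⁻¹ + C := by
  set η : ℝ := 1 / (32 * (K + 1)) with hη
  have hη0 : 0 < η := by positivity
  set s : ℝ := η ^ (1 / (2 * θ)) with hs
  have hs0 : 0 < s := by positivity
  have hsη : s ^ (2 * θ) = η := by
    rw [hs, ← Real.rpow_mul hη0.le, one_div_mul_cancel (by linarith [hθ.1]), Real.rpow_one]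
  refine ⟨4 * K * (s ^ 2)⁻¹ + 4 * K, by positivity, fun r hr => ?_⟩
  have hsplit : r ^ (2 * θ - 2) = r ^ (2 * θ) * (r ^ 2)⁻¹ := by
    rw [Real.rpow_sub hr, rpow_two, div_eq_mul_inv]
  have h0 : 0 ≤ 1 / 8 * (r ^ 2)⁻¹ := by positivity
  have h0' : 0 ≤ 4 * K * (s ^ 2)⁻¹ := by positivity
  rcases le_total r 1 with h | h
  · have h1 : (1 + r) * powW K θ r ≤ 4 * K * (r ^ (2 * θ) * (r ^ 2)⁻¹) := by
      have := mul_le_mul (show 1 + r ≤ 2 by linarith) (powW_le_near hK hθ hr h)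
        (by unfold powW; positivity) zero_le_two
      rw [hsplit] at this; linarith
    refine h1.trans ?_
    rcases le_total r s with h' | h'
    · have h2 := hsη ▸ Real.rpow_le_rpow hr.le h' (by linarith [hθ.1])
      have h3 : 4 * K * η ≤ 1 / 8 := by
        rw [hη, mul_one_div, div_le_div_iff₀ (by positivity) (by norm_num)]; linarith
      have h4 : 4 * K * (r ^ (2 * θ) * (r ^ 2)⁻¹) ≤ 4 * K * η * (r ^ 2)⁻¹ := by
        rw [← mul_assoc]; gcongr
      have h5 : 4 * K * η * (r ^ 2)⁻¹ ≤ 1 / 8 * (r ^ 2)⁻¹ := by gcongr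
      linarith
    · have h2 : r ^ (2 * θ) ≤ 1 := Real.rpow_le_one hr.le h (by linarith [hθ.1])
      have h4 : 4 * K * (r ^ (2 * θ) * (r ^ 2)⁻¹) ≤ 4 * K * (1 * (s ^ 2)⁻¹) := by gcongr
      linarith
  · have h2 : r ^ (-1 - 2 * θ) ≤ r ^ (-1 : ℝ) := rpow_le_rpow_of_exponent_le h (by linarith [hθ.1])
    rw [Real.rpow_neg_one] at h2
    have h3 : (1 + r) * powW K θ r ≤ 2 * r * (2 * K * r⁻¹) := by
      refine mul_le_mul (by linarith) ((powW_le_far hK hθ h).trans ?_)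
        (by unfold powW; positivity) (by positivity)
      gcongr
    have h4 : 2 * r * (2 * K * r⁻¹) = 4 * K := by field_simp; ring
    linarith

end PowerWeight

/-! ### Absorption of the errors -/

section Absorption

/-- X² is the best constant in the ball bounds, N the dual norm of f, l = λ^(-1/2); U, Γ, W, P stand
for the integrals of |u|², |∇_A u|², |u||∇_A u|, |f||u|. Multiplying W² ≤ UΓ by ε² and using the
energy bounds gives εW ≤ NXT, with λ cancelled by l². Then X² ≤ 44E and 88κ ≤ 1 absorb the quadratic
term. -/
lemma absorption {X N U Γ W P l κ E : ℝ} (hX : 0 ≤ X) (hN : 0 ≤ N) (hε : 0 < ε) (hΓ0 : 0 ≤ Γ)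
    (hP0 : 0 ≤ P) (hC : 0 ≤ C) (hlam : 1 ≤ lam) (hl : l ^ 2 * lam = 1) (hW : W ^ 2 ≤ U * Γ)
    (hU : ε * U ≤ P) (hΓ : Γ ≤ 2 * (lam + C) * U + 2 * P) (hP : P ≤ l * N * X)
    (hE : E ≤ κ * X ^ 2 + ε * W + 2 * (N * X)) (hXE : X ^ 2 ≤ 44 * E) (hκ : 88 * κ ≤ 1) :
    E ≤ 176 * (12 + 4 * C) * (1 + ε) * N ^ 2 := by
  set T := √(2 + 2 * C + 2 * ε) with hT
  have hT0 : 0 ≤ T := sqrt_nonneg _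
  have hT2 : T ^ 2 = 2 + 2 * C + 2 * ε := sq_sqrt (by positivity)
  have h1 : ε * Γ ≤ (2 * (lam + C) + 2 * ε) * P := by
    have := mul_le_mul_of_nonneg_left hΓ hε.le
    have := mul_le_mul_of_nonneg_left hU (show 0 ≤ 2 * (lam + C) by linarith)
    linarith
  have h2 : (ε * W) ^ 2 ≤ (N * X * T) ^ 2 := by
    calc (ε * W) ^ 2 = ε * ε * W ^ 2 := by ring
      _ ≤ ε * ε * (U * Γ) := by gcongr
      _ = (ε * U) * (ε * Γ) := by ring
      _ ≤ P * ((2 * (lam + C) + 2 * ε) * P) := by gcongr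
      _ ≤ P * ((lam * (2 + 2 * C + 2 * ε)) * P) := by
          have : 2 * (lam + C) + 2 * ε ≤ lam * (2 + 2 * C + 2 * ε) := by nlinarith
          gcongr
      _ = P ^ 2 * (lam * (2 + 2 * C + 2 * ε)) := by ring
      _ ≤ (l * N * X) ^ 2 * (lam * (2 + 2 * C + 2 * ε)) := by gcongr
      _ = (l ^ 2 * lam) * (N * X) ^ 2 * (2 + 2 * C + 2 * ε) := by ring
      _ = _ := by rw [hl, ← hT2]; ring
  have h3 := (le_abs_self _).trans (abs_le_of_sq_le_sq h2 (by positivity))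
  have h4 : X * X ≤ 88 * ((T + 2) * N) * X := by nlinarith
  have h5 : X ≤ 88 * ((T + 2) * N) := by
    rcases hX.eq_or_lt with h | h
    · rw [← h]; positivity
    · exact le_of_mul_le_mul_right h4 h
  have h6 : E ≤ 176 * ((T + 2) * N) ^ 2 := by
    have : κ * X ^ 2 ≤ 1 / 88 * X ^ 2 := by gcongr; linarith
    have h7 : X ^ 2 ≤ (88 * ((T + 2) * N)) ^ 2 := by gcongr
    have h8 : (T + 2) * N * X ≤ (T + 2) * N * (88 * ((T + 2) * N)) := by gcongr
    nlinarith
  refine h6.trans ?_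
  -- (T + 2)² ≤ 2T² + 8 = 12 + 4C + 4ε. The ε inside T² is the reason for the factor 1 + ε in the
  -- final estimate.
  have h9 : (T + 2) ^ 2 ≤ (12 + 4 * C) * (1 + ε) := by
    have : 0 ≤ C * ε := by positivity
    nlinarith [sq_nonneg (T - 2)]
  calc 176 * ((T + 2) * N) ^ 2 = 176 * (T + 2) ^ 2 * N ^ 2 := by ring
    _ ≤ 176 * ((12 + 4 * C) * (1 + ε)) * N ^ 2 := by gcongr
    _ = _ := by ring

variable {K θ : ℝ}
lemma norm_le_sqrt_locEn (hlam : 1 ≤ lam) (u : E3 → ℂ) (g : E3 → C3) (x : E3) :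
    ‖g x‖ ≤ √(locEn lam u g x) ∧ rquot u x ≤ √(locEn lam u g x) ∧
      ‖u x‖ ≤ lam ^ (-(1 / 2) : ℝ) * √(locEn lam u g x) := by
  have h0 : 0 < lam := by linarith
  refine ⟨Real.le_sqrt_of_sq_le ?_, Real.le_sqrt_of_sq_le ?_, ?_⟩
  · have : 0 ≤ lam * ‖u x‖ ^ 2 + rquot u x ^ 2 := by positivity
    unfold locEn; linarith
  · have : 0 ≤ ‖g x‖ ^ 2 + lam * ‖u x‖ ^ 2 := by positivity
    unfold locEn; linarith
  · rw [Real.rpow_neg h0.le, ← sqrt_eq_rpow, inv_mul_eq_div, le_div_iff₀ (Real.sqrt_pos.2 h0)]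
    refine Real.le_sqrt_of_sq_le ?_
    rw [mul_pow, sq_sqrt h0.le]
    have : 0 ≤ ‖g x‖ ^ 2 + rquot u x ^ 2 := by positivity
    unfold locEn; linarith

/-- All of |g|, |u|/|x| and √λ|u| are at most the root of the local energy density. The constant 150
is 25·2·3: the coefficient in `errDens`, the factor in `powW_mul_min_le`, and three terms. The
damping is dropped in the ε term, which is treated globally. -/
lemma error_pointwise (hK : 0 ≤ K) (hθ : θ ∈ Ioc 0 (1 / 4)) {ρ : ℝ} (hlam : 1 ≤ lam) (hε : 0 ≤ ε)
    (hρ : 0 < ρ) (f u : E3 → ℂ) (g : E3 → C3) {x : E3} (hx : x ≠ 0) :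
    min ρ⁻¹ ‖x‖⁻¹ * errDens (powW K θ) ε f u g x ≤ 150 * K * (lam ^ (-(1 / 2) : ℝ)) ^ θ *
        (damp ρ ‖x‖ * critW θ ‖x‖ * locEn lam u g x) +
      ε * (‖u x‖ * ‖g x‖) + 2 * (‖f x‖ * (damp ρ ‖x‖ * √(locEn lam u g x))) := by
  obtain ⟨hg, hq, hu⟩ := norm_le_sqrt_locEn hlam u g x
  set s := √(locEn lam u g x) with hs
  set l := lam ^ (-(1 / 2) : ℝ) with hl
  have hl0 : 0 < l := by positivity
  have hl1 : l ≤ 1 := Real.rpow_le_one_of_one_le_of_nonpos hlam (by norm_num)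
  have hs2 : s * s = locEn lam u g x := Real.mul_self_sqrt (locEn_nonneg (by linarith) u g x)
  have hs0 : 0 ≤ s := sqrt_nonneg _
  have hr := norm_pos_iff.2 hx
  have hd0 := damp_nonneg hρ hr.le
  have hd1 : damp ρ ‖x‖ ≤ 1 := min_le_right _ _
  have hw0 : 0 ≤ powW K θ ‖x‖ := by unfold powW; positivity
  have hmin : min ρ⁻¹ ‖x‖⁻¹ = damp ρ ‖x‖ * ‖x‖⁻¹ := by
    rw [damp, min_mul_of_nonneg _ _ (by positivity), one_mul]; congr 1; field_simp
  have hun : ‖u x‖ = ‖x‖ * rquot u x := by rw [rquot]; field_simp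
  have hq0 : 0 ≤ rquot u x := div_nonneg (norm_nonneg _) hr.le
  have hus := hu.trans (mul_le_of_le_one_left hs0 hl1)
  have hum : ‖u x‖ ≤ min ‖x‖ l * s := by
    rw [min_mul_of_nonneg _ _ hs0]; exact le_min (hun ▸ mul_le_mul_of_nonneg_left hq hr.le) hu
  have hwu : powW K θ ‖x‖ * ‖u x‖ ≤ 2 * K * l ^ θ * critW θ ‖x‖ * s :=
    calc _ ≤ powW K θ ‖x‖ * (min ‖x‖ l * s) := by gcongr
      _ = powW K θ ‖x‖ * min ‖x‖ l * s := by ring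
      _ ≤ _ := mul_le_mul_of_nonneg_right (powW_mul_min_le hK hθ hr hl0 hl1) hs0
  have e : min ρ⁻¹ ‖x‖⁻¹ * errDens (powW K θ) ε f u g x =
      25 * damp ρ ‖x‖ * (powW K θ ‖x‖ * ‖u x‖ * (rquot u x + ‖u x‖ + ‖g x‖)) +
      damp ρ ‖x‖ * (ε * (‖u x‖ * ‖g x‖)) +
      ‖f x‖ * (damp ρ ‖x‖ * (rquot u x + ‖g x‖)) := by
    rw [hmin, errDens, rquot]; field_simp; ring
  rw [e, ← hs2]
  have t1 : 25 * damp ρ ‖x‖ * (powW K θ ‖x‖ * ‖u x‖ * (rquot u x + ‖u x‖ + ‖g x‖)) ≤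
      25 * damp ρ ‖x‖ * (2 * K * l ^ θ * critW θ ‖x‖ * s * (s + s + s)) := by
    have := critW_nonneg (θ := θ) hr.le
    gcongr
  have t2 : damp ρ ‖x‖ * (ε * (‖u x‖ * ‖g x‖)) ≤ ε * (‖u x‖ * ‖g x‖) :=
    mul_le_of_le_one_left (by positivity) hd1
  have t3 : ‖f x‖ * (damp ρ ‖x‖ * (rquot u x + ‖g x‖)) ≤ ‖f x‖ * (damp ρ ‖x‖ * (s + s)) := by gcongr
  linarith

/-- The imaginary part of the energy identity gives the first bound. In the real part the potentials
are at most |u|²/(8|x|²) + C|u|², and Hardy's inequality bounds the first term by half of ∫|g|² plus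
5/8 of ∫|u|²; rounding 5/8 up yields C + 1. -/
lemma SolvesHelmholtz.energy_bounds (hP : PotBounds A β V U q w)
    (hC : ∀ r, 0 < r → (1 + r) * w r ≤ 1 / 8 * (r ^ 2)⁻¹ + C) (h : IsH1A A u g)
    (hsol : SolvesHelmholtz A V U lam ε f u g) (hfm : AESM f)
    (hf : ∀ m M : ℝ, 0 < m → MemLp ((ann m M).indicator f) 2)
    (hfu : Integrable (fun x => ‖f x‖ * ‖u x‖)) :
    ε * (∫ x, ‖u x‖ ^ 2) ≤ ∫ x, ‖f x‖ * ‖u x‖ ∧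
    ∫ x, ‖g x‖ ^ 2 ≤ 2 * (lam + (C + 1)) * (∫ x, ‖u x‖ ^ 2) + 2 * ∫ x, ‖f x‖ * ‖u x‖ := by
  have iq := (h.memLp_rquot hP.memL2loc).int_sq
  have iu := h.memLp.int_sq
  have hV : ∀ᵐ x, |(V x + U x) * ‖u x‖ ^ 2| ≤ 1 / 8 * ‖rquot u x‖ ^ 2 + C * ‖u x‖ ^ 2 := by
    filter_upwards [hP.V₁_le, hP.V₂_le, ae_ne_zero] with x h1 h2 hx
    have h3 := (abs_add_le (V x) (U x)).trans (add_le_add h1 h2)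
    have h4 := hC _ (norm_pos_iff.2 hx)
    rw [abs_mul, abs_of_nonneg (sq_nonneg ‖u x‖)]
    refine (mul_le_mul_of_nonneg_right (h3.trans (by linarith : _ ≤ 1 / 8 * (‖x‖ ^ 2)⁻¹ + C))
      (sq_nonneg _)).trans_eq ?_
    rw [add_mul, normSq_eq_rquot u hx]
    have := norm_ne_zero_iff.2 hx
    field_simp
  have iV := ((iq.const_mul (1 / 8)).add (iu.const_mul C)).mono' ((hP.aesm_V₁.add hP.aesm_V₂).mul iu.1) hV
  have ifu : Integrable (fun x => f x * conj (u x)) :=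
    hfu.mono' (hfm.mul (memLp_conj h.memLp).1) (ae_of_all _ fun x => by rw [norm_mul, norm_conj])
  have ez : ∀ x, zeroOrd V U lam ε f u x * conj (u x) =
      (((V x + U x) * ‖u x‖ ^ 2 : ℝ) : ℂ) + ((lam : ℂ) + I * ε) * ((‖u x‖ ^ 2 : ℝ) : ℂ) -
        f x * conj (u x) := fun x => by
    have : u x * conj (u x) = ((‖u x‖ ^ 2 : ℝ) : ℂ) := by rw [Complex.mul_conj, normSq_eq_norm_sq]
    rw [zeroOrd, sub_mul, mul_assoc, this]; push_cast; ring
  have i1 := (iV.ofReal).add ((iu.ofReal).const_mul ((lam : ℂ) + I * ε))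
  have hz : Integrable (fun x => zeroOrd V U lam ε f u x * conj (u x)) := by
    simp only [ez]; exact i1.sub ifu
  have en := hsol.energy hP h hf hz
  simp only [ez] at en
  replace en := (en.trans (integral_sub i1 ifu)).trans (congrArg (· - ∫ x, f x * conj (u x))
    (integral_add (iV.ofReal) ((iu.ofReal).const_mul _)))
  simp only [integral_const_mul] at en
  rw [show ∫ x, (((V x + U x) * ‖u x‖ ^ 2 : ℝ) : ℂ) = ((∫ x, (V x + U x) * ‖u x‖ ^ 2 : ℝ) : ℂ)
      from integral_ofReal, show ∫ x, ((‖u x‖ ^ 2 : ℝ) : ℂ) = ((∫ x, ‖u x‖ ^ 2 : ℝ) : ℂ)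
      from integral_ofReal] at en
  have nf : ‖∫ x, f x * conj (u x)‖ ≤ ∫ x, ‖f x‖ * ‖u x‖ := by
    refine (norm_integral_le_integral_norm _).trans_eq (int_congr (fun x => ?_))
    simp
  have hre := congrArg Complex.re en
  have him := congrArg Complex.im en
  simp at hre him
  have n1 := (le_abs_self _).trans ((Complex.abs_im_le_norm _).trans nf)
  have n2 := (neg_le_abs _).trans ((abs_re_le_norm _).trans nf)
  refine ⟨by linarith, ?_⟩
  have v1 : ∫ x, (V x + U x) * ‖u x‖ ^ 2 ≤ 1 / 8 * (∫ x, ‖rquot u x‖ ^ 2) + C * ∫ x, ‖u x‖ ^ 2 := by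
    rw [← integral_const_mul, ← integral_const_mul,
      ← integral_add (iq.const_mul _) (iu.const_mul _)]
    exact integral_mono_ae iV ((iq.const_mul _).add (iu.const_mul _))
      (hV.mono fun x hx => (le_abs_self _).trans hx)
  have v2 : ∫ x, ‖rquot u x‖ ^ 2 ≤ 4 * (∫ x, ‖g x‖ ^ 2) + 5 * ∫ x, ‖u x‖ ^ 2 := by
    have h1 := h.hardy hP.memL2loc
    rw [← setLIntegral_univ, ← setLIntegral_univ (fun x => ‖g x‖ₑ ^ 2),
      ← setLIntegral_univ (fun x => ‖u x‖ₑ ^ 2), setLInt_enorm_sq iq.integrableOn,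
      setLInt_enorm_sq h.memLp_grad.int_sq.integrableOn, setLInt_enorm_sq iu.integrableOn,
      ← ofReal_ofNat 4, ← ofReal_ofNat 5, ← ofReal_mul (by norm_num),
      ← ofReal_mul (by norm_num), ← ofReal_add (by positivity) (by positivity),
      ENNReal.ofReal_le_ofReal_iff (by positivity)] at h1
    simpa only [setIntegral_univ] using h1
  have : 0 ≤ ∫ x, ‖u x‖ ^ 2 := by positivity
  linarith

/-- The resolvent estimate in terms of the error terms. -/
theorem exists_errTot_le (hK : 0 ≤ K) (hθ : θ ∈ Ioc 0 (1 / 4)) :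
    ∃ lam₁ C : ℝ, 1 ≤ lam₁ ∧ 0 < C ∧ ∀ (A β : E3 → E3) (V U q : E3 → ℝ),
      PotBounds A β V U q (powW K θ) → ∀ (lam ε : ℝ), lam₁ ≤ lam → 0 < ε →
      ∀ f : E3 → ℂ, AESM f → dualNorm f < ∞ →
      ∀ (u : E3 → ℂ) (g : E3 → C3), IsH1A A u g → SolvesHelmholtz A V U lam ε f u g →
      ∀ b, 0 < b → errTot (powW K θ) ε f u g b ≤ ofReal (C * (1 + ε)) * dualNorm f ^ 2 := by
  obtain ⟨C, hC0, hC⟩ := exists_powW_le hK hθ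
  have hθ1 : θ ∈ Ioo 0 1 := ⟨hθ.1, by linarith [hθ.2]⟩
  set S := 8 * ∫⁻ R in Ioi (0 : ℝ), ofReal (critW θ R) with hS
  have hS' : S ≠ ∞ := mul_ne_top (by simp) (lintegral_critW_lt_top hθ.1).ne
  set k := 150 * K * S.toReal with hk
  have hk0 : 0 ≤ k := by positivity
  have hlim : Tendsto (fun lam : ℝ => 88 * (k * (lam ^ (-(1 / 2) : ℝ)) ^ θ)) atTop (𝓝 0) := by
    have h1 : Tendsto (fun lam : ℝ => (lam ^ (-(1 / 2) : ℝ)) ^ θ) atTop (𝓝 0) := by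
      have := (tendsto_rpow_neg_atTop (show (0 : ℝ) < 1 / 2 by norm_num)).rpow_const
        (p := θ) (Or.inr hθ.1.le)
      rwa [Real.zero_rpow hθ.1.ne'] at this
    simpa using (h1.const_mul k).const_mul 88
  -- λ₁ makes 88 times the coefficient of X² at most one, as absorption requires; the coefficient
  -- decays like λ^(-θ/2).
  obtain ⟨lam₁, hl1⟩ := eventually_atTop.1 (hlim.eventually_le_const one_pos)
  refine ⟨max lam₁ 1, 176 * (12 + 4 * (C + 1)), le_max_right _ _, by positivity, ?_⟩
  intro A β V U q hP lam ε hlam hε f hfm hN u g h hsol b hb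
  have hlam1 : 1 ≤ lam := (le_max_right _ _).trans hlam
  have hlam0 : 0 < lam := by linarith
  have hκ := hl1 lam ((le_max_left _ _).trans hlam)
  set l := lam ^ (-(1 / 2) : ℝ) with hl
  have hl0 : 0 < l := by positivity
  have hll : l ≤ 1 := Real.rpow_le_one_of_one_le_of_nonpos hlam1 (by norm_num)
  have hl2 : l ^ 2 * lam = 1 := by
    rw [hl, ← rpow_two, ← Real.rpow_mul hlam0.le]; norm_num [Real.rpow_neg_one]; field_simp
  set ρ := min b l with hρdef
  have hρ : 0 < ρ := lt_min hb hl0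
  refine (errTot_anti hP.w_nonneg hε.le f u g hρ (min_le_left b l)).trans ?_
  have hf : ∀ m M : ℝ, 0 < m → MemLp ((ann m M).indicator f) 2 := fun m M hm =>
    memLp_ann_of_dualNorm hfm hN M hm
  have mq := h.memLp_rquot hP.memL2loc
  have iq := mq.int_sq
  have ig := h.memLp_grad.int_sq
  have iu := h.memLp.int_sq
  set G : E3 → ℝ≥0∞ := fun x => ofReal (locEn lam u g x) with hG
  have iE : Integrable (locEn lam u g) := by
    refine ((ig.add (iu.const_mul lam)).add iq).congr (ae_of_all _ fun x => ?_)
    simp [locEn]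
  have mG : AEMeasurable G := iE.1.aemeasurable.ennreal_ofReal
  set E := errTot (powW K θ) ε f u g ρ with hE
  -- the optimal constant in the scaling bound
  set Q : ℝ≥0∞ := ⨆ (R : ℝ) (_ : ρ ≤ R), (∫⁻ x in {x | ‖x‖ ≤ R}, G x) / ofReal R with hQdef
  have hQ : ∀ R, ρ ≤ R → ∫⁻ x in {x | ‖x‖ ≤ R}, G x ≤ ofReal R * Q := fun R hR => by
    have hR0 : ofReal R ≠ 0 := by simpa using hρ.trans_le hR
    rw [mul_comm, ← ENNReal.div_le_iff_le_mul (Or.inl hR0) (Or.inl ofReal_ne_top)]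
    exact le_iSup₂ (f := fun (R : ℝ) (_ : ρ ≤ R) => (∫⁻ x in {x | ‖x‖ ≤ R}, G x) / ofReal R) R hR
  have hQE : Q ≤ ofReal 44 * E := iSup₂_le fun R hR => by
    have hR0 := hρ.trans_le hR
    refine ENNReal.div_le_of_le_mul ?_
    refine (hsol.locEn_le hP h hlam0.le hε.le hf hR0).trans ?_
    rw [ofReal_mul (by norm_num), mul_right_comm]; gcongr
    exact errTot_anti hP.w_nonneg hε.le f u g hρ hR
  -- Absorption needs a quantity known to be finite beforehand. The energy density is integrable, by
  -- Hardy, and only radii at least ρ enter the supremum.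
  have hQtop : Q ≠ ∞ := by
    have h1 : Q ≤ (∫⁻ x, G x) / ofReal ρ := iSup₂_le fun R hR =>
      ENNReal.div_le_div (setLIntegral_le_lintegral _ _) (ofReal_le_ofReal hR)
    exact (h1.trans_lt (ENNReal.div_lt_top iE.lintegral_lt_top.ne (by simpa using hρ))).ne
  set X := √Q.toReal with hX
  have hX2 : X ^ 2 = Q.toReal := sq_sqrt toReal_nonneg
  set N := (dualNorm f).toReal with hNdef
  have hNX : dualNorm f * Q ^ (1 / 2 : ℝ) = ofReal (N * X) := by
    rw [ofReal_mul toReal_nonneg, ofReal_toReal hN.ne, hX,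
      sqrt_eq_rpow, ← ENNReal.ofReal_rpow_of_nonneg toReal_nonneg (by norm_num),
      ofReal_toReal hQtop]
  have hGs : ∀ x, G x ^ (1 / 2 : ℝ) = ofReal √(locEn lam u g x) := fun x => by
    rw [sqrt_eq_rpow, ← ENNReal.ofReal_rpow_of_nonneg (locEn_nonneg hlam0.le u g x) (by norm_num)]
  have hdual : ∫⁻ x, ofReal (‖f x‖ * (damp ρ ‖x‖ * √(locEn lam u g x))) ≤ ofReal (N * X) := by
    rw [← hNX]
    refine (lintegral_mono fun x => le_of_eq ?_).trans (lintegral_mul_le_dualNorm hρ hfm mG hQ)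
    rw [ofReal_mul (norm_nonneg _), ofReal_mul (damp_nonneg hρ (norm_nonneg _)), ofReal_norm, hGs]
  -- the pairing of `f` with `u`
  have hfu : Integrable (fun x => ‖f x‖ * ‖u x‖) ∧ ∫ x, ‖f x‖ * ‖u x‖ ≤ l * N * X := by
    have h1 : ∫⁻ x, ofReal (‖f x‖ * ‖u x‖) ≤ ofReal (l * N * X) := by
      rw [mul_assoc, ofReal_mul hl0.le]
      refine le_trans ?_ (mul_le_mul_right hdual _)
      rw [← lintegral_const_mul' _ _ ofReal_ne_top]
      refine lintegral_mono_ae (ae_ne_zero.mono fun x hx => ?_)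
      rw [← ofReal_mul hl0.le]
      refine ofReal_le_ofReal ?_
      have hr := norm_pos_iff.2 hx
      obtain ⟨-, h2, h3⟩ := norm_le_sqrt_locEn hlam1 u g x
      set s := √(locEn lam u g x)
      have hs : 0 ≤ s := sqrt_nonneg _
      rw [show l * (‖f x‖ * (damp ρ ‖x‖ * s)) = ‖f x‖ * (damp ρ ‖x‖ * (l * s)) by ring]
      refine mul_le_mul_of_nonneg_left ?_ (norm_nonneg _)
      rw [damp, min_mul_of_nonneg _ _ (by positivity), one_mul]
      refine le_min ?_ h3
      rw [rquot, div_le_iff₀ hr] at h2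
      calc ‖u x‖ ≤ ‖x‖ * s * 1 := by linarith
        _ ≤ ‖x‖ * s * (l / ρ) := by gcongr; exact (one_le_div hρ).2 (min_le_right _ _)
        _ = _ := by ring
    have i1 : Integrable (fun x => ‖f x‖ * ‖u x‖) := by
      refine ⟨hfm.norm.mul h.memLp.1.norm, ?_⟩
      rw [hasFiniteIntegral_iff_ofReal (ae_of_all _ fun x => by positivity)]
      exact h1.trans_lt ofReal_lt_top
    refine ⟨i1, ?_⟩
    rwa [← ofReal_integral_eq_lintegral_ofReal i1 (ae_of_all _ fun x => by positivity),
      ENNReal.ofReal_le_ofReal_iff (by positivity)] at h1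
  obtain ⟨hU, hΓ⟩ := hsol.energy_bounds hP hC h hfm hf hfu.1
  have iug : Integrable (fun x => ‖u x‖ * ‖g x‖) := int_mul h.memLp.norm h.memLp_grad.norm
  have hW : (∫ x, ‖u x‖ * ‖g x‖) ^ 2 ≤ (∫ x, ‖u x‖ ^ 2) * ∫ x, ‖g x‖ ^ 2 := by
    have h1 := integral_mul_le_Lp_mul_Lq_of_nonneg (μ := (volume : Measure E3))
      Real.HolderConjugate.two_two (f := fun x => ‖u x‖) (g := fun x => ‖g x‖)
      (ae_of_all _ fun x => norm_nonneg _) (ae_of_all _ fun x => norm_nonneg _)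
      (by simpa using h.memLp.norm) (by simpa using h.memLp_grad.norm)
    simp only [rpow_two, ← sqrt_eq_rpow] at h1
    have h2 := pow_le_pow_left₀ (by positivity) h1 2
    rwa [mul_pow, sq_sqrt (by positivity), sq_sqrt (by positivity)] at h2
  have hmain : E ≤ ofReal (k * l ^ θ * X ^ 2 + ε * (∫ x, ‖u x‖ * ‖g x‖) + 2 * (N * X)) := by
    have e1 : ∫⁻ x, ofReal (150 * K * l ^ θ * (damp ρ ‖x‖ * critW θ ‖x‖ * locEn lam u g x)) ≤
        ofReal (k * l ^ θ * X ^ 2) := by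
      have hc : 0 ≤ 150 * K * l ^ θ := by positivity
      simp only [ofReal_mul hc]
      rw [lintegral_const_mul' _ _ ofReal_ne_top, hX2, show k * l ^ θ * Q.toReal =
        150 * K * l ^ θ * (S.toReal * Q.toReal) by rw [hk]; ring, ofReal_mul hc,
        ofReal_mul toReal_nonneg, ofReal_toReal hS',
        ofReal_toReal hQtop]
      refine mul_le_mul_right (le_trans (lintegral_mono fun x => le_of_eq ?_)
        (lintegral_critW_le hθ1 hρ ((min_le_right _ _).trans hll) mG hQ)) _
      rw [ofReal_mul (mul_nonneg (damp_nonneg hρ (norm_nonneg _)) (critW_nonneg (norm_nonneg _)))]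
    have e2 : ∫⁻ x, ofReal (ε * (‖u x‖ * ‖g x‖)) = ofReal (ε * ∫ x, ‖u x‖ * ‖g x‖) := by
      rw [← integral_const_mul, ofReal_integral_eq_lintegral_ofReal (iug.const_mul ε)
        (ae_of_all _ fun x => by positivity)]
    have e3 : ∫⁻ x, ofReal (2 * (‖f x‖ * (damp ρ ‖x‖ * √(locEn lam u g x)))) ≤
        ofReal (2 * (N * X)) := by
      simp only [ofReal_mul (zero_le_two (α := ℝ))]; rw [lintegral_const_mul' _ _ ofReal_ne_top]
      exact mul_le_mul_right hdual _
    rw [ofReal_add (by positivity) (by positivity),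
      ofReal_add (by positivity) (by positivity), ← e2]
    refine le_trans ?_ (add_le_add (add_le_add e1 le_rfl) e3)
    have md : Measurable fun x : E3 => damp ρ ‖x‖ := by unfold damp; fun_prop
    have m2 : AEMeasurable (fun x => ofReal (ε * (‖u x‖ * ‖g x‖))) :=
      (iug.const_mul ε).1.aemeasurable.ennreal_ofReal
    have m3 : AEMeasurable (fun x => ofReal
        (2 * (‖f x‖ * (damp ρ ‖x‖ * √(locEn lam u g x))))) volume :=
      ((hfm.norm.aemeasurable.mul (md.aemeasurable.mul
        (Real.continuous_sqrt.measurable.comp_aemeasurable iE.1.aemeasurable))).const_mul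
        2).ennreal_ofReal
    rw [← lintegral_add_right' _ m2, ← lintegral_add_right' _ m3]
    refine lintegral_mono_ae (ae_ne_zero.mono fun x hx => (ofReal_le_ofReal
      (error_pointwise hK hθ hlam1 hε.le hρ f u g hx)).trans ?_)
    exact ENNReal.ofReal_add_le.trans (add_le_add_left ENNReal.ofReal_add_le _)
  have hEtop : E ≠ ∞ := (hmain.trans_lt ofReal_lt_top).ne
  have hXE : X ^ 2 ≤ 44 * E.toReal := by
    have := toReal_mono (mul_ne_top ofReal_ne_top hEtop) hQE
    rwa [ENNReal.toReal_mul, toReal_ofReal (by norm_num), ← hX2] at this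
  have hfin := absorption (sqrt_nonneg _) toReal_nonneg hε
    (integral_nonneg fun x => sq_nonneg _) (integral_nonneg fun x => by positivity)
    (by linarith) hlam1 hl2 hW hU hΓ hfu.2
    (ENNReal.toReal_le_of_le_ofReal (by positivity) hmain) hXE hκ
  rw [← ofReal_toReal hEtop, ← ofReal_toReal hN.ne,
    ← ofReal_pow toReal_nonneg, ← ofReal_mul (by positivity)]
  exact ofReal_le_ofReal hfin

end Absorption

/-! ### From bounds at all scales to the norms -/

lemma morreyNorm_sq_le {B : ℝ≥0∞}
    (h : ∀ R, 0 < R → ∫⁻ x in {x | ‖x‖ ≤ R}, ‖v x‖ₑ ^ 2 ≤ ofReal R * B) : morreyNorm v ^ 2 ≤ B := by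
  have h1 : morreyNorm v ≤ B ^ (1 / 2 : ℝ) := iSup₂_le fun R hR =>
    rpow_le_rpow (ENNReal.div_le_of_le_mul ((h R hR).trans_eq (mul_comm _ _))) (by norm_num)
  calc morreyNorm v ^ 2 ≤ (B ^ (1 / 2 : ℝ)) ^ 2 := by gcongr
    _ = B := by rw [← ENNReal.rpow_two, ← rpow_mul]; norm_num

/-- The mean of a function over the sphere of radius `r`, without normalization. -/
def sphMean (h : E3 → ℝ≥0∞) (r : ℝ) : ℝ≥0∞ :=
  ∫⁻ ω : Metric.sphere (0 : E3) 1, h (r • (ω : E3)) ∂((volume : Measure E3).toSphere)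

lemma lintegral_polar {h : E3 → ℝ≥0∞} (hh : AEMeasurable h) :
    AEMeasurable (sphMean h) (volume.restrict (Ioi 0)) ∧
    ∫⁻ x, h x = ∫⁻ r in Ioi (0 : ℝ), ofReal (r ^ 2) * sphMean h r := by
  set σ := (volume : Measure E3).toSphere with hσ
  have mp := (Measure.measurePreserving_homeomorphUnitSphereProd (volume : Measure E3)).symm
    (homeomorphUnitSphereProd E3).toMeasurableEquiv
  rw [finrank_E3] at mp
  change MeasurePreserving (homeomorphUnitSphereProd E3).symm
    (σ.prod (Measure.volumeIoiPow 2)) _ at mp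
  have m0 : MeasurableSet ({0}ᶜ : Set E3) := (measurableSet_singleton 0).compl
  have hh1 := (hh.restrict).comp_quasiMeasurePreserving (MeasurePreserving.mk
      measurable_subtype_coe (map_comap_subtype_coe m0 volume)).quasiMeasurePreserving
  have hh2 := hh1.comp_quasiMeasurePreserving mp.quasiMeasurePreserving
  -- The density r² vanishes nowhere on the half-line, so Lebesgue measure is absolutely continuous
  -- with respect to r² dr, and measurability of spherical means transfers to it.
  have hpos : ∀ᵐ r : Ioi (0 : ℝ) ∂(Measure.comap Subtype.val volume),
      ofReal ((r : ℝ) ^ 2) ≠ 0 := ae_of_all _ fun r => by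
    have : (0 : ℝ) < r := r.2
    simpa using this.ne'
  have mr : Measurable fun r : Ioi (0 : ℝ) => ofReal ((r : ℝ) ^ 2) := by fun_prop
  have hm' : AEMeasurable (fun r : Ioi (0 : ℝ) => sphMean h r) (Measure.comap Subtype.val volume) :=
    hh2.lintegral_prod_left'.mono_ac (withDensity_absolutelyContinuous' mr.aemeasurable hpos)
  refine ⟨?_, ?_⟩
  · rw [← map_comap_subtype_coe measurableSet_Ioi,
      (MeasurableEmbedding.subtype_coe measurableSet_Ioi).aemeasurable_map_iff]
    exact hm'
  · calc ∫⁻ x, h x = ∫⁻ x in ({0}ᶜ : Set E3), h x := by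
          rw [Measure.restrict_eq_self_of_ae_mem (s := ({0}ᶜ : Set E3)) ae_ne_zero]
      _ = ∫⁻ x : ({0}ᶜ : Set E3), h x ∂(Measure.comap Subtype.val volume) :=
          (lintegral_subtype_comap m0 h).symm
      _ = ∫⁻ p : Metric.sphere (0 : E3) 1 × Ioi (0 : ℝ), h ((p.2 : ℝ) • (p.1 : E3))
            ∂(σ.prod (Measure.volumeIoiPow 2)) :=
          (mp.lintegral_comp_emb (homeomorphUnitSphereProd E3).symm.measurableEmbedding
            (fun x : ({0}ᶜ : Set E3) => h x)).symm
      _ = ∫⁻ r : Ioi (0 : ℝ), sphMean h r ∂(Measure.volumeIoiPow 2) := lintegral_prod_symm _ hh2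
      _ = ∫⁻ r : Ioi (0 : ℝ), ofReal ((r : ℝ) ^ 2) * sphMean h r
            ∂(Measure.comap Subtype.val volume) := by
          rw [Measure.volumeIoiPow, lintegral_withDensity_eq_lintegral_mul₀ mr.aemeasurable hm']
          rfl
      _ = _ := lintegral_subtype_comap measurableSet_Ioi (fun r : ℝ => ofReal (r ^ 2) * sphMean h r)

/-- Lebesgue differentiation on a half-line: bounded averages give an almost everywhere bound. -/
lemma ae_le_of_setLIntegral_Icc_le {S : ℝ → ℝ≥0∞} (hS : AEMeasurable S (volume.restrict (Ioi 0)))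
    (hfin : ∫⁻ r in Ioi (0 : ℝ), S r ≠ ∞) {B : ℝ≥0∞}
    (h : ∀ b c : ℝ, 0 < b → b < c → ∫⁻ r in Icc b c, S r ≤ ofReal (c - b) * B) :
    ∀ᵐ r ∂(volume.restrict (Ioi (0 : ℝ))), S r ≤ B := by
  have m0 : MeasurableSet (Ioi (0 : ℝ)) := measurableSet_Ioi
  rw [ae_restrict_iff' m0]
  have hfin' : ∫⁻ r, (Ioi (0 : ℝ)).indicator S r ≠ ∞ := by rwa [lintegral_indicator m0]
  filter_upwards [(IsUnifLocDoublingMeasure.vitaliFamily (volume : Measure ℝ) 1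
    ).ae_tendsto_lintegral_div ((aemeasurable_indicator_iff m0).2 hS) hfin'] with r hr hr0
  have t1 := hr.comp (IsUnifLocDoublingMeasure.tendsto_closedBall_filterAt (μ := (volume : Measure ℝ))
    (fun _ => r) id tendsto_id (by
      filter_upwards [self_mem_nhdsWithin] with δ hδ
      exact Metric.mem_closedBall_self (by simpa using (show (0 : ℝ) < δ from hδ).le)))
  rw [indicator_of_mem hr0] at t1
  refine le_of_tendsto t1 ?_
  filter_upwards [Ioo_mem_nhdsGT hr0] with δ hδ
  have hδ0 := hδ.1
  refine ENNReal.div_le_of_le_mul ?_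
  simp only [id, Real.closedBall_eq_Icc]; rw [Real.volume_Icc, mul_comm]
  refine le_trans (lintegral_mono fun s => indicator_le_self _ _ s) (h _ _ ?_ ?_)
  · linarith [hδ.2]
  · linarith

/-- 91 = 44 + 44 + 1 + 2. The first two come from the ball bounds, the tangential term from
exhausting |x| > 0 by exteriors of balls. The last comes from the shell bound, whose constant 2(c -
b) is proportional to the width, so that Lebesgue differentiation in the radius gives almost every
sphere. -/
theorem SolvesHelmholtz.norms_le (hP : PotBounds A β V U q w) (h : IsH1A A u g) (hlam : 0 < lam)
    (hε : 0 ≤ ε) (hsol : SolvesHelmholtz A V U lam ε f u g)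
    (hf : ∀ m M : ℝ, 0 < m → MemLp ((ann m M).indicator f) 2) {B : ℝ≥0∞}
    (hB : ∀ b, 0 < b → errTot w ε f u g b ≤ B) :
    ofReal lam * morreyNorm u ^ 2 + morreyNorm g ^ 2 + tangentialEnergy g + sphereSup u ≤
      91 * B := by
  have loc : ∀ R, 0 < R → ∫⁻ x in {x | ‖x‖ ≤ R}, ofReal (locEn lam u g x) ≤
      ofReal R * (44 * B) := fun R hR => by
    refine (hsol.locEn_le hP h hlam.le hε hf hR).trans ?_
    rw [ofReal_mul (by norm_num), ofReal_ofNat, mul_comm 44, mul_assoc]; gcongr; exact hB R hR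
  have hl0 : ofReal lam ≠ 0 := by simpa using hlam
  have e1 : ofReal lam * morreyNorm u ^ 2 ≤ 44 * B := by
    rw [mul_comm, ← ENNReal.le_div_iff_mul_le (Or.inl hl0) (Or.inl ofReal_ne_top)]
    refine morreyNorm_sq_le fun R hR => ?_
    rw [← mul_div_assoc, ENNReal.le_div_iff_mul_le (Or.inl hl0) (Or.inl ofReal_ne_top),
      mul_comm, ← lintegral_const_mul' _ _ ofReal_ne_top]
    refine (lintegral_mono fun x => ?_).trans (loc R hR)
    rw [← ofReal_norm, ← ofReal_pow (norm_nonneg _), ← ofReal_mul hlam.le]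
    refine ofReal_le_ofReal ?_
    have : 0 ≤ ‖g x‖ ^ 2 + rquot u x ^ 2 := by positivity
    unfold locEn; linarith
  have e2 : morreyNorm g ^ 2 ≤ 44 * B := by
    refine morreyNorm_sq_le fun R hR => (lintegral_mono fun x => ?_).trans (loc R hR)
    rw [← ofReal_norm, ← ofReal_pow (norm_nonneg _)]
    refine ofReal_le_ofReal ?_
    have : 0 ≤ lam * ‖u x‖ ^ 2 + rquot u x ^ 2 := by positivity
    unfold locEn; linarith
  have e3 : tangentialEnergy g ≤ B := by
    have hS : ∀ n : ℕ, MeasurableSet {x : E3 | 1 / ((n : ℝ) + 1) < ‖x‖} := fun n =>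
      measurableSet_lt measurable_const measurable_norm
    have hU : ∀ᵐ x : E3, x ∈ ⋃ n : ℕ, {x : E3 | 1 / ((n : ℝ) + 1) < ‖x‖} := by
      filter_upwards [ae_ne_zero] with x hx
      exact mem_iUnion.2 (exists_nat_one_div_lt (norm_pos_iff.2 hx))
    rw [tangentialEnergy, ← Measure.restrict_eq_self_of_ae_mem hU, setLIntegral_iUnion_of_directed]
    · refine iSup_le fun n => ?_
      have hc : 0 < 1 / ((n : ℝ) + 1) := by positivity
      have := hsol.lower_bound hP h hlam.le hε hf (half_pos hc) (half_lt_self hc) (hS n) one_pos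
        (F := fun x => tangentialSq g x / ‖x‖) (fun x hx hc' => ?_)
        (fun x _ _ => (one_mul _).ge) fun x hx hc' => (hc'.2.not_gt hx).elim
      · rw [ENNReal.ofReal_one, one_mul] at this; exact this.trans (hB _ (half_pos hc))
      · have : 1 / ((n : ℝ) + 1) < ‖x‖ := hx
        linarith
    · refine Monotone.directed_le fun n m hnm x hx => ?_
      change 1 / ((n : ℝ) + 1) < ‖x‖ at hx
      change 1 / ((m : ℝ) + 1) < ‖x‖
      exact (Nat.one_div_le_one_div hnm).trans_lt hx
  have e4 : sphereSup u ≤ 2 * B := by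
    have mu2 : AEMeasurable (fun x => ‖u x‖ₑ ^ 2) := h.memLp.1.enorm.pow_const 2
    have mq2 : AEMeasurable (fun x => ‖rquot u x‖ₑ ^ 2) := (aesm_rquot h.memLp.1).enorm.pow_const 2
    have key : ∀ r : ℝ, 0 < r → ofReal (r ^ 2) *
        sphMean (fun x => ‖rquot u x‖ₑ ^ 2) r = sphMean (fun x => ‖u x‖ₑ ^ 2) r :=
      fun r hr => by
        rw [sphMean, sphMean, ← lintegral_const_mul' _ _ ofReal_ne_top]
        refine lintegral_congr fun ω => ?_
        have hn : ‖r • (ω : E3)‖ = r := by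
          rw [norm_smul, norm_of_nonneg hr.le, norm_eq_of_mem_sphere, mul_one]
        rw [← ofReal_norm, ← ofReal_norm, ← ofReal_pow (norm_nonneg _),
          ← ofReal_pow (norm_nonneg _), ← ofReal_mul (sq_nonneg _), rquot, hn,
          norm_div, norm_norm, norm_of_nonneg hr.le]
        congr 1; field_simp
    refine essSup_le_of_ae_le _ ?_
    -- In polar coordinates the factor r² cancels against |x|^(-2), so the integral of |u|²/|x|²
    -- over a shell is the integral in r of the unnormalized spherical means of |u|². Hardy gives
    -- their total finiteness.
    have hS := ae_le_of_setLIntegral_Icc_le (B := 2 * B) (lintegral_polar mu2).1 ?_ ?_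
    · filter_upwards [hS, ae_restrict_mem measurableSet_Ioi] with r hr hr0
      have h1 : ofReal (r ^ 2) ≠ 0 := by
        have : 0 < r := hr0
        simpa using this.ne'
      refine le_trans (le_of_eq ?_) hr
      rw [sphereIntegral, mul_comm, mul_div_assoc, ENNReal.div_self h1 ofReal_ne_top, mul_one]; rfl
    · rw [← setLIntegral_congr_fun measurableSet_Ioi fun r hr => key r hr, ← (lintegral_polar mq2).2]
      exact (lintegral_enorm_sq_lt_top (h.memLp_rquot hP.memL2loc)).ne
    · intro b c hb hbc
      have hcb : 0 < c - b := sub_pos.2 hbc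
      have e : ∀ x, ‖rquot u x‖ₑ ^ 2 = ofReal (‖rquot u x‖ ^ 2) := fun x => by
        rw [← ofReal_norm, ofReal_pow (norm_nonneg _)]
      have h1 : ∫⁻ x in ann b c, ‖rquot u x‖ₑ ^ 2 ≤ ofReal (2 * (c - b)) * B := by
        simp only [e]
        refine (hsol.lower_bound hP h hlam.le hε hf hb hbc (measSet_ann _ _)
          (k := 2 * (c - b)) (by linarith) (fun x hx hc => (hc.not_ge hx.1).elim)
          (fun x hx hc => (hc.not_ge hx.2).elim) fun x _ _ => le_of_eq ?_).trans
          (mul_le_mul_right (hB b hb) _)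
        field_simp
      rw [ofReal_mul zero_le_two, ofReal_ofNat, mul_comm 2, mul_assoc] at h1
      refine le_trans (le_of_eq ?_) h1
      rw [← lintegral_indicator (measSet_ann b c),
        (lintegral_polar (mq2.indicator (measSet_ann b c))).2,
        ← lintegral_indicator measurableSet_Ioi, ← lintegral_indicator measurableSet_Icc]
      refine lintegral_congr fun r => ?_
      by_cases hr : 0 < r
      · have hn : ∀ ω : Metric.sphere (0 : E3) 1, ‖r • (ω : E3)‖ = r := fun ω => by
          rw [norm_smul, norm_of_nonneg hr.le, norm_eq_of_mem_sphere, mul_one]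
        rw [indicator_of_mem (show r ∈ Ioi (0 : ℝ) from hr)]
        by_cases hrc : r ∈ Icc b c
        · rw [indicator_of_mem hrc, ← key r hr]; congr 1
          refine lintegral_congr fun ω => ?_
          rw [indicator_of_mem]; simpa [ann, hn] using hrc
        · rw [indicator_of_notMem hrc, sphMean]; simp [ann, hn, show ¬(b ≤ r ∧ r ≤ c) from hrc]
      · rw [indicator_of_notMem (show r ∉ Ioi (0 : ℝ) from hr),
          indicator_of_notMem fun hc => hr (hb.trans_le hc.1)]
  calc _ ≤ 44 * B + 44 * B + B + 2 * B := by gcongr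
    _ = 91 * B := by ring


/-! ### From the hypotheses of the theorem to the radial majorant -/

section Setup

variable {B : E3 → Matrix (Fin 3) (Fin 3) ℝ}
lemma locInt_mul_test {b φ : E3 → ℝ} (hb : LocallyIntegrableOn b {(0 : E3)}ᶜ volume) (hφ : IsTest φ)
    (h0 : (0 : E3) ∉ tsupport φ) : Integrable (fun x => b x * φ x) := by
  have hK := hb.integrableOn_compact_subset (fun x hx => by rintro rfl; exact h0 hx) hφ.compact
  obtain ⟨C, hC⟩ := hφ.bounded
  have h1 : (fun x => b x * φ x) = (tsupport φ).indicator (fun x => b x * φ x) := by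
    ext x; by_cases hx : x ∈ tsupport φ <;> simp [hx, zero_of_tsupp]
  rw [h1, integrable_indicator_iff (isClosed_tsupport φ).measurableSet]
  exact Integrable.mul_bdd hK hφ.continuous.aesm.restrict (ae_of_all _ hC)

/-- The distributional definition changes sign under exchange of k and j; the fundamental lemma of
the calculus of variations on the punctured space makes this pointwise. It gives x·β = 0. -/
lemma IsMagneticField.antisymm (h : IsMagneticField A B) (k j : Fin 3) :
    ∀ᵐ x, B x k j + B x j k = 0 := by
  have := isOpen_compl_singleton.ae_eq_zero_of_integral_contDiff_smul_eq_zero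
    ((h.locInt k j).add (h.locInt j k)) (fun φ h1 h2 h3 => by
      have hφ : IsTest φ := ⟨h1, h2⟩
      have h0 : 0 ∉ tsupport φ := fun hc => h3 hc rfl
      have e : ∀ x, φ x • (B x k j + B x j k) = B x k j * φ x + B x j k * φ x := fun x => by
        rw [smul_eq_mul]; ring
      refine (integral_congr_ae (ae_of_all _ e)).trans ((integral_add
        (locInt_mul_test (h.locInt k j) hφ h0)
        (locInt_mul_test (h.locInt j k) hφ h0)).trans ?_)
      rw [h.weak k j φ hφ h0, h.weak j k φ hφ h0, ← neg_eq_iff_add_eq_zero, ← integral_neg]; congr 1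
      ext x; ring)
  filter_upwards [this, ae_ne_zero] with x h1 h2 using h1 h2

lemma IsMagneticField.aesm (h : IsMagneticField A B) (k j : Fin 3) : AESM (fun x => B x k j) := by
  have := (h.locInt k j).aestronglyMeasurable
  rwa [Measure.restrict_eq_self_of_ae_mem (s := ({0}ᶜ : Set E3)) ae_ne_zero] at this

/-- The contraction of the magnetic field with the position vector is a radial flux. -/
lemma IsMagneticField.exists_radialFlux (hA : MemL2loc A) (h : IsMagneticField A B)
    (mw : Measurable w) (cw : ContinuousOn w (Ioi 0)) (w0 : ∀ r, 0 ≤ w r)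
    (hw : ∀ᵐ x, ‖tangentialField B x‖ ≤ w ‖x‖) :
    ∃ β, RadialFlux A β ∧ ∀ x, ‖β x‖ ≤ ‖x‖ * w ‖x‖ := by
  set b : E3 → E3 := fun x => WithLp.toLp 2 fun j => ∑ k, x k * B x k j with hb
  have mb : AESM b := by
    refine (PiLp.continuous_toLp 2 _).comp_aestronglyMeasurable
      (aemeasurable_pi_lambda _ fun j => ?_).aesm
    exact (aestronglyMeasurable_fun_sum _ fun k _ =>
      (meas_coord k).aesm.mul (h.aesm k j)).aemeasurable
  set b' := mb.mk b with hb'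
  have mb' := mb.stronglyMeasurable_mk.measurable
  -- β is set to zero off the full-measure set where the bound and the orthogonality hold. Both then
  -- hold at every point, as is needed along individual rays, and the weak relation is unaffected.
  set S : Set E3 := {x | ‖b' x‖ ≤ ‖x‖ * w ‖x‖ ∧ ∑ j, x j * b' x j = 0} with hS
  have mS : MeasurableSet S := by
    refine (measurableSet_le mb'.norm (measurable_norm.mul (mw.comp measurable_norm))).inter
      (measurableSet_eq_fun (Finset.measurable_fun_sum _ fun j _ => ?_) measurable_const)
    exact (meas_coord j).mul ((meas_coord j).comp mb')
  have anti := ae_all_iff.2 fun k => ae_all_iff.2 fun j => h.antisymm k j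
  have ae_b : ∀ᵐ x, S.indicator b' x = b x := by
    filter_upwards [mb.ae_eq_mk, hw, ae_ne_zero, anti] with x h1 h2 h3 h4
    have e : b x = ‖x‖ • tangentialField B x := by
      ext j; simp only [hb, tangentialField, PiLp.smul_apply, smul_eq_mul, mul_sum]
      refine sum_congr rfl fun k _ => ?_
      field_simp
    have hx : x ∈ S := by
      refine ⟨?_, ?_⟩
      · rw [hb', ← h1, e, norm_smul, norm_norm]
        exact mul_le_mul_of_nonneg_left h2 (norm_pos_iff.2 h3).le
      · rw [hb', ← h1]
        have d : ∀ k, B x k k = 0 := fun k => by linarith [h4 k k]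
        simp only [hb, Fin.sum_univ_three, d]
        linear_combination x 0 * x 1 * h4 0 1 + x 0 * x 2 * h4 0 2 + x 1 * x 2 * h4 1 2
    rw [indicator_of_mem hx, hb', ← h1]
  refine ⟨S.indicator b', ⟨mb'.indicator mS, fun m M hm => ?_, fun x => ?_, fun j φ hφ h0 => ?_⟩,
    fun x => ?_⟩
  · obtain ⟨C, hC⟩ := (isCompact_Icc).exists_bound_of_continuousOn
      ((continuousOn_id.mul cw).mono fun r hr => hm.trans_le hr.1)
    refine ⟨max 0 C, fun x hx => ?_⟩
    by_cases hxS : x ∈ S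
    · rw [indicator_of_mem hxS]
      exact (hxS.1.trans ((le_abs_self _).trans (hC _ hx))).trans (le_max_right _ _)
    · rw [indicator_of_notMem hxS, norm_zero]; exact le_max_left _ _
  · by_cases hxS : x ∈ S
    · rw [indicator_of_mem hxS]; exact hxS.2
    · rw [indicator_of_notMem hxS]; simp
  · have hcoord : ∀ k : Fin 3, ContDiff ℝ C∞ (fun x : E3 => x k) := fun k => by fun_prop
    have tφ : ∀ k, IsTest fun x => x k * φ x := fun k => hφ.mul (hcoord k)
    have sφ : ∀ k, (0 : E3) ∉ tsupport fun x => x k * φ x := fun k hc =>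
      h0 (tsupport_mul_subset_right hc)
    have pd : ∀ i k x, partialD i (fun x => x k * φ x) x =
        x k * partialD i φ x + φ x * (if k = i then 1 else 0) := fun i k x => by
      have h1 : HasFDerivAt (fun y : E3 => y k) (EuclideanSpace.proj (𝕜 := ℝ) k) x :=
        (EuclideanSpace.proj k : E3 →L[ℝ] ℝ).hasFDerivAt
      rw [partialD_mul h1.differentiableAt hφ.differentiable.differentiableAt, partialD, partialD,
        h1.fderiv]
      simp
    have lA : ∀ i, LocallyIntegrable (fun x => A x i) := fun i => (hA.comp_real i).locallyIntegrable
    have i1 : ∀ k, Integrable (fun x => A x j * partialD k (fun x => x k * φ x) x -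
        A x k * partialD j (fun x => x k * φ x) x) := fun k =>
      ((lA j).int_mul_test ((tφ k).partialD k)).sub ((lA k).int_mul_test ((tφ k).partialD j))
    calc ∫ x, S.indicator b' x j * φ x = ∫ x, ∑ k, B x k j * (x k * φ x) := by
          refine integral_congr_ae (ae_b.mono fun x hx => ?_)
          simp only [hx, hb, Finset.sum_mul]; exact sum_congr rfl fun k _ => by ring
      _ = ∑ k, ∫ x, B x k j * (x k * φ x) := integral_finsetSum _ fun k _ =>
          locInt_mul_test (h.locInt k j) (tφ k) (sφ k)
      _ = ∑ k, ∫ x, (A x j * partialD k (fun x => x k * φ x) x -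
            A x k * partialD j (fun x => x k * φ x) x) :=
          sum_congr rfl fun k _ => h.weak k j _ (tφ k) (sφ k)
      _ = _ := by
          -- In the product rule A_jφ occurs three times from the divergence of x and once with the
          -- opposite sign from ∂_j x_k; this is the 2 in the weak form of the flux.
          rw [← integral_finsetSum _ fun k _ => i1 k]; congr 1; ext x
          simp only [pd, Fin.sum_univ_three]; fin_cases j <;> simp <;> ring
  · by_cases hxS : x ∈ S
    · rw [indicator_of_mem hxS]; exact hxS.1
    · rw [indicator_of_notMem hxS, norm_zero]; exact mul_nonneg (norm_nonneg _) (w0 _)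

/-- Both exponents lie in [-2, 0] and τ ≥ 1/2, so the loss is at most 2² = 4. With |τx| ≤ 2|x| this
explains the 8 in the flux bound. -/
lemma powW_dil {K θ : ℝ} (hK : 0 ≤ K) (hθ : θ ∈ Ioc 0 (1 / 4)) {r τ : ℝ} (hr : 0 < r)
    (hτ : τ ∈ dil) : powW K θ (τ * r) ≤ 4 * powW K θ r := by
  have h0 : 0 < τ := by linarith [hτ.1]
  have key : ∀ p : ℝ, -2 ≤ p → p ≤ 0 → (τ * r) ^ p ≤ 4 * r ^ p := fun p h1 h2 => by
    rw [Real.mul_rpow h0.le hr.le]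
    refine mul_le_mul_of_nonneg_right ?_ (by positivity)
    calc τ ^ p ≤ (1 / 2 : ℝ) ^ p := Real.rpow_le_rpow_of_nonpos (by norm_num) hτ.1 h2
      _ ≤ (1 / 2 : ℝ) ^ (-2 : ℝ) := rpow_le_rpow_of_exponent_ge (by norm_num) (by norm_num) h1
      _ = 4 := by rw [Real.rpow_neg (by norm_num), rpow_two]; norm_num
  have h1 := key (2 * θ - 2) (by linarith [hθ.1]) (by linarith [hθ.2])
  have h2 := key (-1 - 2 * θ) (by linarith [hθ.2]) (by linarith [hθ.1])
  rw [powW, powW, abs_of_nonneg (by positivity), abs_of_nonneg (by positivity)]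
  have := mul_le_mul_of_nonneg_left (add_le_add h1 h2) hK
  linarith

/-- With 2θ = min(α, μ, 1/2) one power law at the origin and one at infinity cover both regimes. The
assumptions change at r₀ rather than at 1; on 1 < r ≤ r₀ the factor r₀^α in the constant makes up
for the growth of r^(α - 2θ). -/
lemma Admissible.exists_potentialBounds {r₀ μ c α : ℝ} (hr₀ : 1 ≤ r₀) (hμ : 0 < μ) (hc : 0 < c)
    (hα : 0 < α) (h : Admissible r₀ μ c α A B V U q) :
    ∃ β, PotBounds A β V U q (powW (c * r₀ ^ α) (min α (min μ (1 / 2)) / 2)) := by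
  set θ := min α (min μ (1 / 2)) / 2 with hθdef
  set K := c * r₀ ^ α with hK
  have hθ2 : 2 * θ = min α (min μ (1 / 2)) := by rw [hθdef]; ring
  have hθα := hθ2.trans_le (min_le_left _ _)
  have hθμ := hθ2.trans_le ((min_le_right _ _).trans (min_le_left _ _))
  have hθ : θ ∈ Ioc 0 (1 / 4) := by
    have h1 : 0 < min α (min μ (1 / 2)) := by positivity
    have h2 : min α (min μ (1 / 2)) ≤ 1 / 2 := (min_le_right _ _).trans (min_le_right _ _)
    constructor <;> linarith
  have hK0 : 0 ≤ K := by positivity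
  have w0 : ∀ r, 0 ≤ powW K θ r := fun r => mul_nonneg hK0 (abs_nonneg _)
  have far : ∀ r, r₀ ≤ r → c / r ^ (1 + μ) ≤ powW K θ r := fun r hr => by
    have hr1 := hr₀.trans hr
    have hr0 : 0 < r := by linarith
    have h1 : r ^ (-(1 + μ)) ≤ r ^ (-1 - 2 * θ) := rpow_le_rpow_of_exponent_le hr1 (by linarith)
    have h2 : 0 ≤ r ^ (2 * θ - 2) := by positivity
    rw [div_eq_mul_inv, ← Real.rpow_neg hr0.le, powW, abs_of_nonneg (by positivity)]
    exact mul_le_mul (le_mul_of_one_le_right hc.le (Real.one_le_rpow hr₀ hα.le)) (by linarith)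
      (by positivity) hK0
  have near : ∀ r, 0 < r → r ≤ r₀ → c / r ^ (2 - α) ≤ powW K θ r := fun r hr0 hr => by
    have h1 : r ^ (α - 2) ≤ r₀ ^ α * r ^ (2 * θ - 2) := by
      rw [show α - 2 = (α - 2 * θ) + (2 * θ - 2) by ring, Real.rpow_add hr0]; gcongr
      calc r ^ (α - 2 * θ) ≤ r₀ ^ (α - 2 * θ) := Real.rpow_le_rpow hr0.le hr (by linarith)
        _ ≤ r₀ ^ α := rpow_le_rpow_of_exponent_le hr₀ (by linarith [hθ.1])
    have h2 : 0 ≤ K * r ^ (-1 - 2 * θ) := by positivity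
    rw [div_eq_mul_inv, ← Real.rpow_neg hr0.le, neg_sub, powW, abs_of_nonneg (by positivity)]
    have := mul_le_mul_of_nonneg_left h1 hc.le
    rw [← mul_assoc, ← hK] at this; linarith
  have mw : Measurable (powW K θ) := by unfold powW; fun_prop
  have cw : ContinuousOn (powW K θ) (Ioi 0) := fun r hr => by
    have hr0 : r ≠ 0 := ne_of_gt hr
    exact ((((Real.continuousAt_rpow_const r _ (Or.inl hr0)).add
      (Real.continuousAt_rpow_const r _ (Or.inl hr0))).abs).const_mul K).continuousWithinAt
  have all : ∀ᵐ x : E3, |V x| ≤ ‖x‖ * powW K θ ‖x‖ ∧ |U x| ≤ powW K θ ‖x‖ ∧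
      |q x| ≤ powW K θ ‖x‖ ∧ ‖tangentialField B x‖ ≤ powW K θ ‖x‖ := by
    filter_upwards [h.far, h.near_V₁, h.near_V₂, h.near_B, ae_ne_zero] with x h1 h2 h3 h4 hx
    have hn := norm_pos_iff.2 hx
    rcases le_total r₀ ‖x‖ with hr | hr
    · have h5 := (h1 hr).trans (far _ hr)
      have a1 : 0 ≤ |V x| / ‖x‖ := by positivity
      have a2 := h.q_nonneg x
      have a3 := norm_nonneg (tangentialField B x)
      have a4 := abs_nonneg (U x)
      refine ⟨?_, by linarith, by rw [abs_of_nonneg a2]; linarith, by linarith⟩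
      rw [← div_le_iff₀' hn]; linarith
    · have h5 := near _ hn hr
      refine ⟨?_, (h3 hr).trans h5, ?_, (h4 hr).trans h5⟩
      · rw [(h2 hr).1, abs_zero]; exact mul_nonneg hn.le (w0 _)
      · rw [(h2 hr).2, abs_zero]; exact w0 _
  obtain ⟨β, hβ, hβw⟩ := h.field.exists_radialFlux h.memL2loc mw cw w0 (all.mono fun x hx => hx.2.2.2)
  refine ⟨β, h.memL2loc, hβ, h.aesm_V₁, h.aesm_V₂, h.aesm_q, h.negPart, mw, w0, cw,
    all.mono fun x hx => hx.1, all.mono fun x hx => hx.2.1, all.mono fun x hx => hx.2.2.1,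
    fun x hx τ hτ => (hβw _).trans ?_⟩
  have hn := norm_pos_iff.2 hx
  have hτ0 : 0 < τ := by linarith [hτ.1]
  rw [norm_smul, norm_of_nonneg hτ0.le]
  have h1 := mul_le_mul (mul_le_mul_of_nonneg_right hτ.2 hn.le) (powW_dil hK0 hθ hn hτ)
    (w0 _) (by positivity)
  linarith

end Setup

end

end MagneticHelmholtz

/-! ### The resolvent estimate -/

theorem mainTheorem5 (r₀ μ c α : ℝ) (hr₀ : 1 ≤ r₀) (hμ : 0 < μ) (hc : 0 < c) (hα : 0 < α) :
    ∃ lam₁ C : ℝ, 0 < lam₁ ∧ 0 < C ∧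
      ∀ (A : E3 → E3) (B : E3 → Matrix (Fin 3) (Fin 3) ℝ) (V₁ V₂ q : E3 → ℝ),
        Admissible r₀ μ c α A B V₁ V₂ q →
      ∀ (lam ε : ℝ), lam₁ ≤ lam → 0 < ε →
      ∀ f : E3 → ℂ, AEStronglyMeasurable f volume → dualNorm f < ∞ →
      ∀ (u : E3 → ℂ) (g : E3 → C3), IsH1A A u g → SolvesHelmholtz A V₁ V₂ lam ε f u g →
        ENNReal.ofReal lam * morreyNorm u ^ 2 + morreyNorm g ^ 2
            + tangentialEnergy g + sphereSup u
          ≤ ENNReal.ofReal (C * (1 + ε)) * dualNorm f ^ 2 := by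
  obtain ⟨lam₁, C, h1, hC, H⟩ := exists_errTot_le (K := c * r₀ ^ α)
    (θ := min α (min μ (1 / 2)) / 2) (by positivity) (by
      have h1 : 0 < min α (min μ (1 / 2)) := by positivity
      have h2 : min α (min μ (1 / 2)) ≤ 1 / 2 := (min_le_right _ _).trans (min_le_right _ _)
      constructor <;> linarith)
  -- C bounds the error functional uniformly over all scales; 91 is the factor from the error bound
  -- to the sum of the four norms.
  refine ⟨lam₁, 91 * C, by linarith, by positivity, ?_⟩
  intro A B V₁ V₂ q hAd lam ε hlam hε f hf hN u g hu hsol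
  obtain ⟨β, hP⟩ := hAd.exists_potentialBounds hr₀ hμ hc hα
  refine (hsol.norms_le hP hu (by linarith) hε.le
    (fun m M hm => memLp_ann_of_dualNorm hf hN M hm)
    (H A β V₁ V₂ q hP lam ε hlam hε f hf hN u g hu hsol)).trans_eq ?_
  rw [mul_assoc 91 C, ENNReal.ofReal_mul (by norm_num : (0 : ℝ) ≤ 91), ENNReal.ofReal_ofNat, mul_assoc]
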